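/- **Setting.** Let $g,k\ge 1$ and let $\mathbb T^{2g}=\mathbb R^{2g}/\mathbb Z^{2g}$, with coordinates $u=(x,y)$, carry the symplectic form $\omega(u,v)=\sum_j(u_{g+j}v_j-u_jv_{g+j})$. For $j\in\mathbb Z$ let $\Gamma^\infty(L^j)$ be the space of smooth functions $s$ on $\mathbb R^{2g}$ with $$s(u+\lambda)=\alpha(\lambda)^j e^{-\pi i j\omega(u,\lambda)}s(u),\qquad \lambda\in\mathbb Z^{2g},\quad \alpha(\lambda)=(-1)^{\sum_i\lambda_i\lambda_{g+i}},$$ with connection $\nabla s=ds-j\pi i\,s\sum_i(y_i\,dx_i-x_i\,dy_i)$ and hermitian product $\langle s,s'\rangle=\int_{\mathbb T^{2g}}s\overline{s'}\,d^gx\,d^gy$. Let $\Gamma^{-\infty}(L^j)$ be the continuous dual of $\Gamma^\infty(L^{-j})$, in which $\Gamma^\infty(L^j)$ embeds by $s\mapsto(\phi\mapsto\int s\phi)$. For $\tau$ in the closed Siegel disc $\mathbb D_g$ (complex symmetric $g\times g$ matrices with $1-\tau^*\tau\ge 0$), let $\mathcal P_\tau\subset\mathbb C^{2g}$ be the invariant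 polarization spanned by the vectors $\sum_l\big(-i(1-\bar\tau)_{lm}\partial_{x_l}+(1+\bar\tau)_{lm}\partial_{y_l}\big)$, $m=1,\dots,g$. Let $\widetilde{\mathcal Q}_\tau\subset\Gamma^{-\infty}(L^k)$ be the space of solutions of the weak equations $s(\nabla_{\bar\xi}\phi)=0$ for all $\xi\in\mathcal P_\tau$, $\phi\in\Gamma^\infty(L^{-k})$. Put $\mathcal Q_\tau=\widetilde{\mathcal Q}_\tau\otimes\mathbb C\sqrt{d^g(x,y)_\tau}$. The polarization $\mathcal P_\tau$ is real if $\overline{\mathcal P_\tau}=\mathcal P_\tau$; a real polarization is reducible if its leaves in $\mathbb T^{2g}$ (the images of the translates of $\mathcal P_\tau\cap\mathbb R^{2g}$) are compact. Two polarizations are transverse if $\mathcal P_\tau\oplus\mathcal P_{\tau'}=\mathbb C^{2g}$. Let $BS_\tau\subset\mathbb T^{2g}$ be the union of the leaves of $\mathcal P_\tau$ along which the connection of $L^k$ has trivial holonomy. For $\tau,\tau'$ in the open disc ($1-\tau^*\tau>0$) put $\Omega=i(1-\tau)(1+\tau)^{-1}$, $\Omega'=i(1-\tau')(1+\tau')^{-1}$.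 The pairing of half-forms is $$\big\langle\sqrt{d^g(x,y)_\tau},\sqrt{d^g(x,y)_{\tau'}}\big\rangle=\det(1+\tau)^{\frac12}\;\overline{\det(1+\tau')^{\frac12}}\;\det\Big(\tfrac1{2ki}(\Omega-\overline{\Omega'})\Big)^{\frac12},$$ with the branches of $\det(A)^{-1/2}=\int_{\mathbb R^g}e^{-\pi\,{}^tvAv}\,d^gv$. There $\widetilde{\mathcal Q}_\tau$ consists of holomorphic (smooth) sections, and the BKS pairing is $$\big\langle s\otimes\sqrt{d^g(x,y)_\tau},\,s'\otimes\sqrt{d^g(x,y)_{\tau'}}\big\rangle_{BKS}=\langle s,s'\rangle\,\big\langle\sqrt{d^g(x,y)_\tau},\sqrt{d^g(x,y)_{\tau'}}\big\rangle .$$ Over points of the closed disc the pairing of half-forms, respectively the BKS pairing, is the extension by continuity in $(\tau,\tau')$, respectively in $(\tau,s;\tau',s')\in(\mathbb D_g\times\Gamma^{-\infty}(L^k))^2$ with $s\in\widetilde{\mathcal Q}_\tau$, $s'\in\widetilde{\mathcal Q}_{\tau'}$ (weak topology on $\Gamma^{-\infty}(L^k)$). **Proposition.** Let $\tau,\tau'\in\mathbb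 D_g$ be such that $\mathcal P_\tau,\mathcal P_{\tau'}$ are real, reducible and transverse (so that $\tau,\tau'\in\partial\mathbb D_g$), and let $\sigma=s\otimes\sqrt{d^g(x,y)_\tau}\in\mathcal Q_\tau$, $\sigma'=s'\otimes\sqrt{d^g(x,y)_{\tau'}}\in\mathcal Q_{\tau'}$. Then: 1. The product $s\,\overline{s'}$ exists as a distribution on $\mathbb T^{2g}$ in the sense of Hörmander, that is: there are no $u$ and $\xi\neq0$ with $(u,\xi)\in WF(s)$ and $(u,-\xi)\in WF(\overline{s'})$, and there is a distribution $w=s\,\overline{s'}$ on $\mathbb T^{2g}$ such that for each point $u$ some smooth compactly supported function $f$ with $f=1$ near $u$ satisfies $\widehat{f^2w}=\widehat{fs}*\widehat{f\overline{s'}}$, the convolution integral being absolutely convergent. 2. $\operatorname{supp}(s\,\overline{s'})\subseteq BS_\tau\cap BS_{\tau'}$. 3. The pairing of half-forms and the BKS pairing extend by continuity from the open disc to these points, and the BKS pairing is the value at the constant function $1$ of the distribution $\sigma\overline{\sigma'}:=\big\langle\sqrt{d^g(x,y)_\tau},\sqrt{d^g(x,y)_{\tau'}}\big\rangle\, s\,\overline{s'}$: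 $$\langle\sigma,\sigma'\rangle_{BKS}=(\sigma\overline{\sigma'})(1)=\big\langle\sqrt{d^g(x,y)_\tau},\sqrt{d^g(x,y)_{\tau'}}\big\rangle\cdot(s\,\overline{s'})(1).$$ -/

import Mathlib

open Set Filter Topology MeasureTheory Complex Matrix
open scoped ContDiff ComplexConjugate ComplexOrder

noncomputable section

namespace TorusQuantization

/-! ### The torus and its prequantum line bundle -/

/-- The universal cover `ℝ²ᵍ` of the torus, with points `u = (x, y)`. -/
abbrev Cover (g : ℕ) : Type := (Fin g → ℝ) × (Fin g → ℝ)

/-- The complexification `ℂ²ᵍ` of the tangent space. -/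
abbrev CTangent (g : ℕ) : Type := (Fin g → ℂ) × (Fin g → ℂ)

/-- The lattice `ℤ²ᵍ`. -/
abbrev Lattice (g : ℕ) : Type := (Fin g → ℤ) × (Fin g → ℤ)

/-- The torus `𝕋²ᵍ = ℝ²ᵍ / ℤ²ᵍ`. -/
abbrev Torus (g : ℕ) : Type := (Fin g → UnitAddCircle) × (Fin g → UnitAddCircle)

variable {g : ℕ}

/-- The covering map `ℝ²ᵍ → 𝕋²ᵍ`. -/
def proj (u : Cover g) : Torus g :=
  (fun i => (u.1 i : UnitAddCircle), fun i => (u.2 i : UnitAddCircle))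

/-- The inclusion `ℤ²ᵍ ⊂ ℝ²ᵍ`. -/
def latt (l : Lattice g) : Cover g := (fun i => (l.1 i : ℝ), fun i => (l.2 i : ℝ))

/-- The symplectic form `ω(u, v) = ∑ⱼ (u_{g+j} vⱼ - uⱼ v_{g+j})`, i.e. `ω = ∑ dyⱼ ∧ dxⱼ`. -/
def omega (u v : Cover g) : ℝ := ∑ i, (u.2 i * v.1 i - u.1 i * v.2 i)

/-- The same expression with a complex tangent vector in the second slot; as a function of `ξ` it
is the value at `u` of the one-form `∑ⱼ (yⱼ dxⱼ - xⱼ dyⱼ)`. -/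
def omegaC (u : Cover g) (xi : CTangent g) : ℂ :=
  ∑ i, ((u.2 i : ℂ) * xi.1 i - (u.1 i : ℂ) * xi.2 i)

/-- The multiplier `α(λ)ʲ exp (-π i j ω(u, λ))` of `Lʲ`, with `α(λ) = (-1)^(∑ λᵢ λ_{g+i})`. -/
def mult (j : ℤ) (l : Lattice g) (u : Cover g) : ℂ :=
  (-1 : ℂ) ^ (j * ∑ i, l.1 i * l.2 i) * exp (-(Real.pi * I * j * omega u (latt l)))

/-- `Γ^∞(Lʲ)`: smooth functions on `ℝ²ᵍ` with the quasi-periodicity of `Lʲ` (`j ∈ ℤ`; for `j = 0`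
these are the smooth functions on the torus). -/
def Sec (g : ℕ) (j : ℤ) : Submodule ℂ (Cover g → ℂ) where
  carrier := {s | ContDiff ℝ ∞ s ∧ ∀ (l : Lattice g) (u : Cover g),
    s (u + latt l) = mult j l u * s u}
  add_mem' := by
    rintro a b ⟨ha, ha'⟩ ⟨hb, hb'⟩
    exact ⟨ha.add hb, fun l u => by simp [ha' l u, hb' l u, mul_add]⟩
  zero_mem' := ⟨contDiff_const, fun l u => by simp⟩
  smul_mem' := by
    rintro c a ⟨ha, ha'⟩
    exact ⟨contDiff_const.mul ha, fun l u => by simp [ha' l u, mul_left_comm]⟩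

/-- `Γ^{-∞}(Lʲ)`: distributional sections of `Lʲ`, the linear functionals on `Γ^∞(L⁻ʲ)` that are
continuous for the `C^∞` topology (`[0,1]²ᵍ` is a fundamental domain). -/
def DistSec (g : ℕ) (j : ℤ) : Submodule ℂ (Module.Dual ℂ (Sec g (-j))) where
  carrier := {s | ∃ (N : ℕ) (C : ℝ), ∀ (phi : Sec g (-j)) (M : ℝ),
    (∀ n ≤ N, ∀ u ∈ Icc (0 : Cover g) 1, ‖iteratedFDeriv ℝ n (phi : Cover g → ℂ) u‖ ≤ M) →
      ‖s phi‖ ≤ C * M}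
  add_mem' := by
    rintro a b ⟨N, C, h⟩ ⟨N', C', h'⟩
    refine ⟨max N N', C + C', fun phi M hM => ?_⟩
    have h1 := h phi M fun n hn => hM n (hn.trans (le_max_left _ _))
    have h2 := h' phi M fun n hn => hM n (hn.trans (le_max_right _ _))
    calc ‖(a + b) phi‖ ≤ ‖a phi‖ + ‖b phi‖ := norm_add_le _ _
      _ ≤ (C + C') * M := by linarith
  zero_mem' := ⟨0, 0, fun phi M _ => by simp⟩
  smul_mem' := by
    rintro c a ⟨N, C, h⟩
    refine ⟨N, ‖c‖ * C, fun phi M hM => ?_⟩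
    have h1 := h phi M hM
    calc ‖(c • a) phi‖ = ‖c‖ * ‖a phi‖ := by simp
      _ ≤ ‖c‖ * (C * M) := by gcongr
      _ = ‖c‖ * C * M := by ring

instance {j : ℤ} : CoeFun (DistSec g j) (fun _ => Sec g (-j) → ℂ) := ⟨fun s => s.1⟩

/-- The weak topology on `Γ^{-∞}(Lʲ)`: convergence on every test section. -/
instance {j : ℤ} : TopologicalSpace (DistSec g j) :=
  TopologicalSpace.induced (fun s (phi : Sec g (-j)) => s phi) inferInstance

/-! ### Auxiliary facts on multipliers -/

lemma omega_add_left (u v w : Cover g) : omega (u + v) w = omega u w + omega v w := by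
  simp only [omega, ← Finset.sum_add_distrib]
  exact Finset.sum_congr rfl fun i _ => by simp; ring

lemma omega_add_right (u v w : Cover g) : omega u (v + w) = omega u v + omega u w := by
  simp only [omega, ← Finset.sum_add_distrib]
  exact Finset.sum_congr rfl fun i _ => by simp; ring

lemma latt_add (l m : Lattice g) : latt (l + m) = latt l + latt m := by
  ext i <;> simp [latt]

lemma neg_one_zpow_eq_exp (n : ℤ) : (-1 : ℂ) ^ n = exp (Real.pi * I * n) := by
  rw [← exp_pi_mul_I, ← exp_int_mul]
  ring_nf

lemma mult_ne_zero (j : ℤ) (l : Lattice g) (u : Cover g) : mult j l u ≠ 0 :=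
  mul_ne_zero (zpow_ne_zero _ (by norm_num)) (exp_ne_zero _)

lemma mult_add (j : ℤ) (l m : Lattice g) (u : Cover g) :
    mult j (l + m) u = mult j l (u + latt m) * mult j m u := by
  have key : ∃ n : ℤ, omega (latt m) (latt l) = n ∧
      ∑ i, (l + m).1 i * (l + m).2 i =
        ∑ i, l.1 i * l.2 i + ∑ i, m.1 i * m.2 i + n + 2 * ∑ i, m.1 i * l.2 i := by
    refine ⟨∑ i, (m.2 i * l.1 i - m.1 i * l.2 i), ?_, ?_⟩
    · simp [omega, latt]
    · rw [Finset.mul_sum]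
      simp only [← Finset.sum_add_distrib]
      exact Finset.sum_congr rfl fun i _ => by simp; ring
  obtain ⟨n, hn, hs⟩ := key
  simp only [mult, latt_add, omega_add_left, omega_add_right, hn, hs, neg_one_zpow_eq_exp,
    ← exp_add]
  rw [exp_eq_exp_iff_exists_int]
  refine ⟨j * (n + ∑ i, m.1 i * l.2 i), ?_⟩
  push_cast
  ring

lemma conj_mult (j : ℤ) (l : Lattice g) (u : Cover g) : conj (mult j l u) = mult (-j) l u := by
  have h : ∀ n : ℤ, (-1 : ℂ) ^ (-n) = (-1 : ℂ) ^ n := fun n => by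
    rw [_root_.zpow_neg, ← _root_.inv_zpow]; norm_num
  simp only [mult, map_mul, map_zpow₀, map_neg, map_one, ← Complex.exp_conj, conj_ofReal, conj_I,
    neg_mul j, h]
  congr 2
  simp

lemma contDiff_omega_left (v : Cover g) : ContDiff ℝ ∞ (fun u : Cover g => omega u v) := by
  unfold omega
  fun_prop

lemma contDiff_mult (j : ℤ) (l : Lattice g) : ContDiff ℝ ∞ (fun u : Cover g => mult j l u) := by
  unfold mult
  have h := ofRealCLM.contDiff.comp (contDiff_omega_left (latt l))
  have h' : ContDiff ℝ ∞ (fun u : Cover g => ((omega u (latt l) : ℝ) : ℂ)) := h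
  fun_prop

/-! ### Operations on sections and distributional sections -/

/-- The constant function `1` on the torus. -/
def oneSec (g : ℕ) : Sec g (-0) :=
  ⟨fun _ => 1, contDiff_const, fun l u => by simp [mult]⟩

lemma conj_mem {i j : ℤ} (h : -i = j) {s : Cover g → ℂ} (hs : s ∈ Sec g i) :
    (fun u => conj (s u)) ∈ Sec g j := by
  subst h
  refine ⟨conjCLE.contDiff.comp hs.1, fun l u => ?_⟩
  simp [hs.2 l u, conj_mult]

/-- The connection `∇ s = ds - j π i s ∑ (yᵢ dxᵢ - xᵢ dyᵢ)` of `Lʲ`, in the direction of a constant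
complex vector field `ξ`, as a function. -/
def covDerivFun (j : ℤ) (xi : CTangent g) (s : Cover g → ℂ) (u : Cover g) : ℂ :=
  fderiv ℝ s u (fun i => (xi.1 i).re, fun i => (xi.2 i).re)
    + I * fderiv ℝ s u (fun i => (xi.1 i).im, fun i => (xi.2 i).im)
    - j * Real.pi * I * s u * omegaC u xi

lemma omegaC_add_left (u v : Cover g) (xi : CTangent g) :
    omegaC (u + v) xi = omegaC u xi + omegaC v xi := by
  simp only [omegaC, ← Finset.sum_add_distrib]
  exact Finset.sum_congr rfl fun i _ => by simp; ring

lemma omegaC_eq (u : Cover g) (xi : CTangent g) :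
    omegaC u xi = omega u (fun i => (xi.1 i).re, fun i => (xi.2 i).re)
      + I * omega u (fun i => (xi.1 i).im, fun i => (xi.2 i).im) := by
  simp only [omegaC, omega, ofReal_sum, Finset.mul_sum, ← Finset.sum_add_distrib]
  refine Finset.sum_congr rfl fun i _ => ?_
  conv_lhs => rw [← re_add_im (xi.1 i), ← re_add_im (xi.2 i)]
  push_cast
  ring

lemma omega_antisymm (u v : Cover g) : omega u v = -omega v u := by
  simp only [omega, ← Finset.sum_neg_distrib]
  exact Finset.sum_congr rfl fun i _ => by ring

/-- The symplectic form as a linear functional of its first slot. -/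
def omegaCLM (v : Cover g) : Cover g →L[ℝ] ℝ :=
  LinearMap.toContinuousLinearMap
    { toFun := fun u => omega u v
      map_add' := fun u w => omega_add_left u w v
      map_smul' := fun c u => by
        simp only [omega, Finset.smul_sum, RingHom.id_apply]
        exact Finset.sum_congr rfl fun i _ => by simp; ring }

lemma hasFDerivAt_mult (j : ℤ) (l : Lattice g) (u : Cover g) :
    HasFDerivAt (fun u : Cover g => mult j l u)
      ((-(Real.pi * I * j) * mult j l u) • (ofRealCLM.comp (omegaCLM (latt l)))) u := by
  have h1 : HasFDerivAt (fun u : Cover g => ((omega u (latt l) : ℝ) : ℂ))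
      (ofRealCLM.comp (omegaCLM (latt l))) u :=
    (ofRealCLM.comp (omegaCLM (latt l))).hasFDerivAt
  have h2 := ((h1.const_mul (Real.pi * I * j)).fun_neg.cexp).const_mul
    ((-1 : ℂ) ^ (j * ∑ i, l.1 i * l.2 i))
  refine HasFDerivAt.congr_fderiv h2 ?_
  refine ContinuousLinearMap.ext fun v => ?_
  simp only [mult, _root_.smul_apply, _root_.neg_apply, smul_eq_mul]
  ring

lemma fderiv_quasi {j : ℤ} {s : Cover g → ℂ} (hs : s ∈ Sec g j) (l : Lattice g)
    (u v : Cover g) :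
    fderiv ℝ s (u + latt l) v = mult j l u * (fderiv ℝ s u v
      - Real.pi * I * j * s u * omega v (latt l)) := by
  have hd : Differentiable ℝ s := hs.1.differentiable (by simp)
  have h1 : HasFDerivAt (fun u => s (u + latt l)) (fderiv ℝ s (u + latt l)) u := by
    have := (hd (u + latt l)).hasFDerivAt.comp u ((hasFDerivAt_id u).add_const (latt l))
    rwa [ContinuousLinearMap.comp_id] at this
  have h2 := (hasFDerivAt_mult j l u).mul (hd u).hasFDerivAt
  have h3 : (fun u => s (u + latt l)) = fun u => mult j l u * s u := funext fun u => hs.2 l u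
  rw [h3] at h1
  rw [h1.unique h2]
  simp [omegaCLM]
  ring

lemma covDerivFun_mem {j : ℤ} (xi : CTangent g) {s : Cover g → ℂ} (hs : s ∈ Sec g j) :
    covDerivFun j xi s ∈ Sec g j := by
  refine ⟨?_, fun l u => ?_⟩
  · have h0 : ContDiff ℝ ∞ (fun u => fderiv ℝ s u) := hs.1.fderiv_right (by simp)
    have h1 := hs.1
    have h2 : ContDiff ℝ ∞ (fun u : Cover g => omegaC u xi) := by
      have h (v : Cover g) : ContDiff ℝ ∞ (fun u : Cover g => ((omega u v : ℝ) : ℂ)) :=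
        ofRealCLM.contDiff.comp (contDiff_omega_left v)
      simp only [omegaC_eq]
      exact (h _).add (contDiff_const.mul (h _))
    unfold covDerivFun
    exact ((h0.clm_apply contDiff_const).add
      (contDiff_const.mul (h0.clm_apply contDiff_const))).sub
      ((contDiff_const.mul h1).mul h2)
  · simp only [covDerivFun, fderiv_quasi hs, hs.2 l u, omegaC_add_left]
    rw [omegaC_eq (latt l), omega_antisymm (latt l), omega_antisymm (latt l)]
    push_cast
    ring

/-- Covariant derivative `∇_ξ : Γ^∞(Lʲ) → Γ^∞(Lʲ)` along a constant complex vector field. -/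
def covDeriv (j : ℤ) (xi : CTangent g) (s : Sec g j) : Sec g j :=
  ⟨covDerivFun j xi s, covDerivFun_mem xi s.2⟩

/-- The complex conjugate `σ̄ ∈ Γ^{-∞}(L⁻ʲ)` of `σ ∈ Γ^{-∞}(Lʲ)`: `σ̄(φ)` is the conjugate of
`σ(φ̄)`. -/
def distConj {j : ℤ} (s : DistSec g j) : DistSec g (-j) :=
  ⟨{ toFun := fun phi =>
        (starRingEnd ℂ) (s ⟨fun u => (starRingEnd ℂ) (phi.1 u), conj_mem (by simp) phi.2⟩)
     map_add' := fun phi psi => by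
        rw [← map_add, ← map_add]
        congr 2
        ext u
        simp
     map_smul' := fun c phi => by
        have : (⟨fun u => (starRingEnd ℂ) ((c • phi).1 u), conj_mem (by simp) (c • phi).2⟩ :
            Sec g (-j)) = (starRingEnd ℂ) c •
              ⟨fun u => (starRingEnd ℂ) (phi.1 u), conj_mem (by simp) phi.2⟩ := by
          ext u
          simp
        rw [this, map_smul]
        simp }, by
    obtain ⟨N, C, h⟩ := s.2
    refine ⟨N, C, fun phi M hM => ?_⟩
    simp only [LinearMap.coe_mk, AddHom.coe_mk, RCLike.norm_conj]
    refine h _ M fun n hn u hu => ?_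
    refine le_of_eq_of_le ?_ (hM n hn u hu)
    exact conjLIE.norm_iteratedFDeriv_comp_left (phi : Cover g → ℂ) u n⟩

/-- The hermitian product `∫ s s̄'` of two smooth sections, with respect to the Liouville
measure. -/
def sectionInner {j : ℤ} (s s' : Sec g j) : ℂ :=
  ∫ u in Icc (0 : Cover g) 1, s.1 u * conj (s'.1 u)

/-- The injection `ι : Γ^∞(Lʲ) → Γ^{-∞}(Lʲ)`, `ι s (φ) = ∫ s φ`. -/
def smoothDist {j : ℤ} (s : Sec g j) : DistSec g j :=
  ⟨{ toFun := fun phi => ∫ u in Icc (0 : Cover g) 1, s.1 u * phi.1 u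
     map_add' := fun phi psi => by
        have hi (f : Sec g (-j)) : IntegrableOn (fun u => s.1 u * f.1 u) (Icc (0 : Cover g) 1) :=
          (s.2.1.continuous.mul f.2.1.continuous).continuousOn.integrableOn_compact isCompact_Icc
        rw [← integral_add (hi phi) (hi psi)]
        simp [mul_add]
     map_smul' := fun c phi => by
        rw [RingHom.id_apply, smul_eq_mul, ← integral_const_mul]
        simp [mul_left_comm] }, by
    obtain ⟨B, hB⟩ := (isCompact_Icc (a := (0 : Cover g)) (b := 1)).exists_bound_of_continuousOn
      s.2.1.continuous.continuousOn
    refine ⟨0, B * (volume : Measure (Cover g)).real (Icc 0 1), fun phi M hM => ?_⟩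
    have h := norm_setIntegral_le_of_norm_le_const (μ := (volume : Measure (Cover g)))
      (s := Icc (0 : Cover g) 1) (f := fun u => s.1 u * phi.1 u) (C := B * M)
      isCompact_Icc.measure_lt_top (fun u hu => by
        rw [norm_mul]
        have h1 := hM 0 le_rfl u hu
        rw [norm_iteratedFDeriv_zero] at h1
        exact mul_le_mul (hB u hu) h1 (norm_nonneg _) ((norm_nonneg _).trans (hB u hu)))
    refine h.trans (le_of_eq ?_)
    ring⟩

/-! ### Localization, wave front sets, supports, products -/

/-- Smooth compactly supported functions on `ℝ²ᵍ`. -/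
abbrev TestFn (g : ℕ) : Type := {f : Cover g → ℂ // ContDiff ℝ ∞ f ∧ HasCompactSupport f}

/-- The section of `Lʲ` obtained from a test function on `ℝ²ᵍ` by summing over the lattice. -/
def periodizeFun (j : ℤ) (f : Cover g → ℂ) (u : Cover g) : ℂ :=
  ∑ᶠ l : Lattice g, (mult j l u)⁻¹ * f (u + latt l)

lemma finite_latt {K : Set (Cover g)} (hK : IsCompact K) : {l : Lattice g | latt l ∈ K}.Finite := by
  obtain ⟨R, hR⟩ := hK.isBounded.exists_norm_le
  obtain ⟨n, hn⟩ := exists_nat_ge R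
  refine ((Set.finite_Icc (fun _ : Fin g => -(n : ℤ)) (fun _ => (n : ℤ))).prod
    (Set.finite_Icc (fun _ : Fin g => -(n : ℤ)) (fun _ => (n : ℤ)))).subset fun l hl => ?_
  have h := (hR _ hl).trans hn
  have h1 (i) : |(l.1 i : ℝ)| ≤ n :=
    (norm_le_pi_norm (latt l).1 i).trans ((norm_fst_le _).trans h)
  have h2 (i) : |(l.2 i : ℝ)| ≤ n :=
    (norm_le_pi_norm (latt l).2 i).trans ((norm_snd_le _).trans h)
  refine ⟨⟨fun i => ?_, fun i => ?_⟩, ⟨fun i => ?_, fun i => ?_⟩⟩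
  · exact_mod_cast (abs_le.1 (h1 i)).1
  · exact_mod_cast (abs_le.1 (h1 i)).2
  · exact_mod_cast (abs_le.1 (h2 i)).1
  · exact_mod_cast (abs_le.1 (h2 i)).2

lemma periodizeFun_mem (j : ℤ) (f : TestFn g) : periodizeFun j f.1 ∈ Sec g j := by
  refine ⟨?_, fun m u => ?_⟩
  · have hsm (l : Lattice g) : ContDiff ℝ ∞ (fun u => (mult j l u)⁻¹ * f.1 (u + latt l)) :=
      ((contDiff_mult j l).inv fun u => mult_ne_zero j l u).mul
        (f.2.1.comp (contDiff_id.add contDiff_const))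
    refine contDiff_iff_contDiffAt.2 fun u => ?_
    have hK : IsCompact ((fun p : Cover g × Cover g => p.1 - p.2) ''
        (tsupport f.1 ×ˢ Metric.closedBall u 1)) :=
      (f.2.2.isCompact.prod (isCompact_closedBall u 1)).image (by fun_prop)
    have hfin := finite_latt hK
    have hev : periodizeFun j f.1 =ᶠ[𝓝 u]
        fun v => ∑ l ∈ hfin.toFinset, (mult j l v)⁻¹ * f.1 (v + latt l) := by
      filter_upwards [Metric.closedBall_mem_nhds u one_pos] with v hv
      refine finsum_eq_sum_of_support_subset _ fun l hl => ?_
      simp only [Finite.coe_toFinset, mem_ofPred_eq]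
      refine ⟨(v + latt l, v), ⟨subset_tsupport _ ?_, hv⟩, by simp⟩
      exact right_ne_zero_of_mul hl
    exact (ContDiff.sum fun l _ => hsm l).contDiffAt.congr_of_eventuallyEq hev
  · unfold periodizeFun
    rw [← smul_eq_mul (mult j m u), smul_finsum,
      ← finsum_comp_equiv (Equiv.addRight m) (f := fun l => mult j m u •
        ((mult j l u)⁻¹ * f.1 (u + latt l)))]
    refine finsum_congr fun l => ?_
    simp only [Equiv.coe_addRight, mult_add, latt_add, smul_eq_mul]
    have := mult_ne_zero j m u
    have := mult_ne_zero j l (u + latt m)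
    rw [show u + (latt l + latt m) = u + latt m + latt l by abel]
    field_simp

/-- The distribution on `ℝ²ᵍ` that represents `σ ∈ Γ^{-∞}(Lʲ)` in the trivialization of the
pulled-back bundle. -/
def distLift {j : ℤ} (s : DistSec g j) (f : TestFn g) : ℂ :=
  s ⟨periodizeFun (-j) f.1, periodizeFun_mem (-j) f⟩

/-- `f(u) exp (-2π i ⟨u, ξ⟩)`. -/
def modulate (f : TestFn g) (xi : Cover g) : TestFn g :=
  ⟨fun u => f.1 u * exp (-(2 * Real.pi * I * ((u.1 ⬝ᵥ xi.1 + u.2 ⬝ᵥ xi.2 : ℝ) : ℂ))), by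
    have h : ContDiff ℝ ∞ (fun u : Cover g => ((u.1 ⬝ᵥ xi.1 + u.2 ⬝ᵥ xi.2 : ℝ) : ℂ)) := by
      refine ofRealCLM.contDiff.comp ?_
      simp only [dotProduct]
      exact (ContDiff.sum fun i _ => by fun_prop).add (ContDiff.sum fun i _ => by fun_prop)
    have := f.2.1
    exact ⟨by fun_prop, f.2.2.mul_right⟩⟩

/-- `f²`. -/
def testSq (f : TestFn g) : TestFn g :=
  ⟨fun u => f.1 u * f.1 u, f.2.1.mul f.2.1, f.2.2.mul_right⟩

/-- The Fourier transform at `ξ` of the compactly supported distribution `f σ` on `ℝ²ᵍ`. -/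
def distFourier {j : ℤ} (s : DistSec g j) (f : TestFn g) (xi : Cover g) : ℂ :=
  distLift s (modulate f xi)

/-- `WF(σ)`, on the cover: `(u, ξ)`, `ξ ≠ 0`, is *not* in it iff for some test function `f` with
`f(u) ≠ 0` the Fourier transform of `f σ` is rapidly decreasing in a conic neighbourhood of `ξ`. -/
def waveFrontSet {j : ℤ} (s : DistSec g j) : Set (Cover g × Cover g) :=
  {p | p.2 ≠ 0 ∧ ¬ ∃ f : TestFn g, f.1 p.1 ≠ 0 ∧ ∃ U ∈ 𝓝 p.2, ∀ N : ℕ, ∃ C : ℝ,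
    ∀ eta ∈ U, ∀ t : ℝ, 1 ≤ t → t ^ N * ‖distFourier s f (t • eta)‖ ≤ C}

/-- `w` is the product of the distributions `s` and `s'` in the sense of Hörmander:
`(u, ξ) ∈ WF(s)` and `(u, -ξ) ∈ WF(s')` never happens, and locally the Fourier transform of the
product is the (absolutely convergent) convolution of the Fourier transforms. -/
def IsProduct {j : ℤ} (s : DistSec g j) (s' : DistSec g (-j)) (w : DistSec g 0) : Prop :=
  (∀ u xi : Cover g, (u, xi) ∈ waveFrontSet s → (u, -xi) ∉ waveFrontSet s') ∧
  ∀ u : Cover g, ∃ f : TestFn g, f.1 =ᶠ[𝓝 u] 1 ∧ ∀ xi : Cover g,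
    Integrable (fun eta => distFourier s f eta * distFourier s' f (xi - eta)) ∧
    distFourier w (testSq f) xi = ∫ eta, distFourier s f eta * distFourier s' f (xi - eta)

/-- The support of a distributional section, a subset of the torus. -/
def distSupport {j : ℤ} (s : DistSec g j) : Set (Torus g) :=
  {p | ∀ O ∈ 𝓝 p, ∃ phi : Sec g (-j), (∀ u, phi.1 u ≠ 0 → proj u ∈ O) ∧ s phi ≠ 0}

/-! ### Invariant polarizations -/

/-- The open Siegel disc. -/
def siegelDisc (g : ℕ) : Set (Matrix (Fin g) (Fin g) ℂ) :=
  {t | t.IsSymm ∧ (1 - tᴴ * t).PosDef}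

/-- The closed Siegel disc `𝔻_g`. -/
def closedSiegelDisc (g : ℕ) : Set (Matrix (Fin g) (Fin g) ℂ) :=
  {t | t.IsSymm ∧ (1 - tᴴ * t).PosSemidef}

/-- Complex conjugation on the complexified tangent space. -/
def CTangent.conj (xi : CTangent g) : CTangent g :=
  (fun i => (starRingEnd ℂ) (xi.1 i), fun i => (starRingEnd ℂ) (xi.2 i))

/-- The inclusion of the real tangent space. -/
def toCTangent (v : Cover g) : CTangent g := (fun i => (v.1 i : ℂ), fun i => (v.2 i : ℂ))

/-- The invariant polarization `𝒫_τ`, spanned by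
`∑ₗ (-i (1 - τ̄)ₗₖ ∂/∂xₗ + (1 + τ̄)ₗₖ ∂/∂yₗ)`, `k = 1, …, g`. -/
def pol (t : Matrix (Fin g) (Fin g) ℂ) : Submodule ℂ (CTangent g) :=
  Submodule.span ℂ (Set.range fun k : Fin g =>
    ((fun l => -I * (1 - t.map (starRingEnd ℂ)) l k,
      fun l => (1 + t.map (starRingEnd ℂ)) l k) : CTangent g))

/-- The polarization is real: it is invariant under complex conjugation. -/
def IsRealPol (t : Matrix (Fin g) (Fin g) ℂ) : Prop :=
  ∀ xi ∈ pol t, CTangent.conj xi ∈ pol t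

/-- Points of `ℝ²ᵍ` on the affine subspace through `u` whose image is the leaf of `𝒫_τ`. -/
def coverLeaf (t : Matrix (Fin g) (Fin g) ℂ) (u : Cover g) : Set (Cover g) :=
  {v | toCTangent (v - u) ∈ pol t}

/-- The leaf of a real polarization through the point of the torus below `u`. -/
def leaf (t : Matrix (Fin g) (Fin g) ℂ) (u : Cover g) : Set (Torus g) :=
  proj '' coverLeaf t u

/-- A real polarization is reducible if its leaves are compact. -/
def IsReducible (t : Matrix (Fin g) (Fin g) ℂ) : Prop :=
  IsRealPol t ∧ ∀ u, IsCompact (leaf t u)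

/-- The polarizations are transverse. -/
def IsTransverse (t t' : Matrix (Fin g) (Fin g) ℂ) : Prop := IsCompl (pol t) (pol t')

/-- The connection of `Lᵏ` has trivial holonomy along the leaf through `u`: for each loop in the
leaf, lifted to a path `γ` in `ℝ²ᵍ` with `γ(1) = γ(0) + λ`, a parallel `ζ` along `γ` satisfies
`ζ(1) = ζ(0)` after identification of the fibres over `γ(0)` and `γ(0) + λ`. -/
def HasTrivialHolonomy (k : ℕ) (t : Matrix (Fin g) (Fin g) ℂ) (u : Cover g) : Prop :=
  ∀ (gam : ℝ → Cover g) (zeta : ℝ → ℂ) (l : Lattice g),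
    ContDiff ℝ 1 gam → (∀ r, gam r ∈ coverLeaf t u) → gam 1 = gam 0 + latt l →
    (∀ r, HasDerivAt zeta (k * Real.pi * I * omega (gam r) (deriv gam r) * zeta r) r) →
    zeta 1 = mult k l (gam 0) * zeta 0

/-- The union of the Bohr–Sommerfeld leaves of `𝒫_τ`. -/
def bohrSommerfeld (k : ℕ) (t : Matrix (Fin g) (Fin g) ℂ) : Set (Torus g) :=
  {p | ∃ u, HasTrivialHolonomy k t u ∧ p ∈ leaf t u}

/-- The space of distributional sections of `Lᵏ` that solve the weak equations of covariant
constancy along `𝒫_τ`: `(∇'_{ξ̄} σ)(φ) = -σ(∇_{ξ̄} φ) = 0` for `ξ ∈ 𝒫_τ`. Constant fields `ξ` (of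
divergence zero) suffice: they span `Γ^∞(𝒫_τ)` over `C^∞(𝕋²ᵍ)`, and
`div(h ξ̄) φ + ∇_{h ξ̄} φ = ∇_{ξ̄} (h φ)`. -/
def weakQuantumSpace (k : ℕ) (t : Matrix (Fin g) (Fin g) ℂ) : Set (DistSec g k) :=
  {s | ∀ xi ∈ pol t, ∀ phi : Sec g (-(k : ℤ)), s (covDeriv (-(k : ℤ)) (CTangent.conj xi) phi) = 0}

/-- The smooth sections of `Lᵏ` that are covariantly constant along `𝒫_τ`; for `τ` in the open disc
these are the holomorphic sections. -/
def smoothQuantumSpace (k : ℕ) (t : Matrix (Fin g) (Fin g) ℂ) : Set (Sec g k) :=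
  {s | ∀ xi ∈ pol t, covDeriv k (CTangent.conj xi) s = 0}

/-! ### Half-forms and the BKS pairing

The fibre over `τ` of the half-form bundle is the line `ℂ √(dᵍ(x,y)_τ)`; elements of
`𝒬_τ = 𝒬̃_τ ⊗ ℂ √(dᵍ(x,y)_τ)` are written `s ⊗ √(dᵍ(x,y)_τ)` with `s ∈ 𝒬̃_τ`. -/

/-- The branch of `(det A)^(-1/2)` given by the Gaussian integral `∫ exp (-π ᵗv A v) dv`, for a
complex symmetric matrix `A` with positive definite real part. -/
def detInvSqrt (A : Matrix (Fin g) (Fin g) ℂ) : ℂ :=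
  ∫ v : Fin g → ℝ, exp (-(Real.pi * ((fun i => (v i : ℂ)) ⬝ᵥ (A *ᵥ fun i => (v i : ℂ)))))

/-- `Ω(τ) = i (1 - τ) (1 + τ)⁻¹`. -/
def periodMatrix (t : Matrix (Fin g) (Fin g) ℂ) : Matrix (Fin g) (Fin g) ℂ :=
  I • ((1 - t) * (1 + t)⁻¹)

/-- The pairing `⟨√(dᵍ(x,y)_τ), √(dᵍ(x,y)_τ')⟩` for `τ, τ'` in the open disc. It is obtained from
`⟨√(dᵍz_Ω), √(dᵍz_Ω')⟩ = (det ((Ω - Ω̄') / (2 k i)))^(1/2)` and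
`√(dᵍ(x,y)_τ) = (det (1 + τ))^(1/2) √(dᵍz_Ω)`. The Gaussian branch of `(det (1 + τ))^(-1/2)` is the
continuous one that is `1` at `τ = 0`. -/
def interiorHalfFormPairing (k : ℕ) (t t' : Matrix (Fin g) (Fin g) ℂ) : ℂ :=
  (detInvSqrt (1 + t))⁻¹ * conj (detInvSqrt (1 + t'))⁻¹ *
    (detInvSqrt ((2 * k * I)⁻¹ • (periodMatrix t - (periodMatrix t').map (starRingEnd ℂ))))⁻¹

/-- `h` is the pairing `⟨√(dᵍ(x,y)_τ), √(dᵍ(x,y)_τ')⟩` of half-forms over points of the closed disc,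
extended by continuity from the open disc. -/
def HasHalfFormPairing (k : ℕ) (t t' : Matrix (Fin g) (Fin g) ℂ) (h : ℂ) : Prop :=
  (𝓝[siegelDisc g ×ˢ siegelDisc g] (t, t')).NeBot ∧
  Tendsto (fun p => interiorHalfFormPairing k p.1 p.2)
    (𝓝[siegelDisc g ×ˢ siegelDisc g] (t, t')) (𝓝 h)

/-- A pair of points of the quantum bundle over the open disc: two base points, and smooth sections
in the fibres over them. -/
structure InteriorPair (g k : ℕ) where
  t : Matrix (Fin g) (Fin g) ℂ
  t' : Matrix (Fin g) (Fin g) ℂ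
  s : Sec g k
  s' : Sec g k
  t_mem : t ∈ siegelDisc g
  t'_mem : t' ∈ siegelDisc g
  s_mem : s ∈ smoothQuantumSpace k t
  s'_mem : s' ∈ smoothQuantumSpace k t'

/-- The BKS pairing over the open disc: the product of the hermitian product of the sections and of
the pairing of half-forms. -/
def InteriorPair.pairing {k : ℕ} (p : InteriorPair g k) : ℂ :=
  sectionInner p.s p.s' * interiorHalfFormPairing k p.t p.t'

/-- The trace on the interior of the neighbourhood filter of the pair of points
`(τ, s ⊗ √(dᵍ(x,y)_τ))`, `(τ', s' ⊗ √(dᵍ(x,y)_τ'))` of the quantum bundle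
`𝒬 ⊂ 𝔻_g × Γ^{-∞}(Lᵏ)`. -/
def bksFilter (k : ℕ) (t t' : Matrix (Fin g) (Fin g) ℂ) (s s' : DistSec g k) :
    Filter (InteriorPair g k) :=
  comap (fun p => (p.t, p.t', smoothDist p.s, smoothDist p.s')) (𝓝 (t, t', s, s'))

/-- `z` is the BKS pairing of `s ⊗ √(dᵍ(x,y)_τ) ∈ 𝒬_τ` and `s' ⊗ √(dᵍ(x,y)_τ') ∈ 𝒬_τ'`, the
extension by continuity of the pairing over the open disc. -/
def HasBKSPairing (k : ℕ) (t t' : Matrix (Fin g) (Fin g) ℂ) (s s' : DistSec g k) (z : ℂ) : Prop :=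
  (bksFilter k t t' s s').NeBot ∧ Tendsto InteriorPair.pairing (bksFilter k t t' s s') (𝓝 z)

end TorusQuantization

end

open TorusQuantization

/-! Reducibility and transversality provide linear coordinates (q, p) on ℝ²ᵍ in which the two real
polarizations are the coordinate planes, ω is multiplied by an even integer, and the integer lattice
lands in the even lattice (`Frame.exists`). After a change of gauge, the conjugate of a polarization
near 𝒫_τ is the graph of -Z with Z small, symmetric and Im Z ≥ 0. A section parallel along that
graph is a Fourier series in p whose χ-th term is a constant times the Gaussian exp(π i K Z(q +
χ/K)), where K is the level (`Frame.hasSum_coeff`). The constants have period K in χ, so finitely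
many test values control the whole section, as a distribution of order at most 2g. Thus a weak
neighbourhood of a boundary section already carries uniform continuity estimates for the nearby
interior sections (`Frame.exists_uniform_evBound`).

The product is built on the Fourier side. If T is parallel along ξ, integration by parts shows that
the Fourier transform of f T decays to any order in ⟨η, ξ⟩ (`exists_decay`). By transversality each
nonzero covector η is detected by a parallel direction of s or by one of s̄'. Hence the product of
the two localized Fourier transforms, at η and -η, has an integrable majorant that is uniform up to
the boundary (`exists_bound_mul`). This yields the wave front condition and the absolute convergence
of the convolution, and dominated convergence makes the Fourier pairing continuous
(`tendsto_pairing`). Over the open disc Parseval's formula turns this pairing into the integral of f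
f' s s̄'. So the smooth functions s s̄' converge weakly to a distribution w, which is the product
(`exists_product`, `isProduct_of_ev`). Evaluation at the constant function 1 is the hermitian
product in the interior, so the BKS pairing converges once the pairing of half-forms does.

The square of the half-form pairing is k⁻ᵍ det(1 - τ τ̄'), which is continuous everywhere and
nonzero at a transverse pair with 𝒫_τ real. Since the open disc is convex, the pairing agrees near
the boundary point with one continuous branch of the root, up to a constant sign
(`exists_hasHalfFormPairing`). The extension of the BKS pairing is not vacuous: theta functions with
Z = iε approximate any pair of boundary sections (`neBot_bksFilter`).

For the support, let λ be a lattice vector tangent to the leaves. Invariance of s along its leaves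
and quasi-periodicity under λ both describe translation by λ. Comparing them shows that exp(2π i k
ω(u, λ)) minus a sign annihilates s (`Frame.GraphParallel.ev_mul_eq_zero`), hence w. Off the
Bohr–Sommerfeld leaves one of these factors is invertible (`distSupport_subset_bohrSommerfeld`). -/

noncomputable section

namespace TorusQuantization

variable {g : ℕ}

/-! ### Smooth compactly supported functions and their `C^K` bounds -/

section TestFunctions

variable {E : Type*} [NormedAddCommGroup E] [NormedSpace ℝ E]

/-- Smooth functions with compact support. -/
def IsTest (f : E → ℂ) : Prop := ContDiff ℝ ∞ f ∧ HasCompactSupport f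

lemma IsTest.continuous {f : E → ℂ} (h : IsTest f) : Continuous f := h.1.continuous

lemma isTest_zero : IsTest (0 : E → ℂ) := ⟨contDiff_const, HasCompactSupport.zero⟩

lemma IsTest.add {f f' : E → ℂ} (h : IsTest f) (h' : IsTest f') : IsTest (fun u => f u + f' u) :=
  ⟨h.1.add h'.1, h.2.add h'.2⟩

lemma IsTest.mul_left {a f : E → ℂ} (h : IsTest f) (ha : ContDiff ℝ ∞ a) :
    IsTest (fun u => a u * f u) :=
  ⟨ha.mul h.1, h.2.mul_left⟩

lemma IsTest.mul_right {a f : E → ℂ} (h : IsTest f) (ha : ContDiff ℝ ∞ a) :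
    IsTest (fun u => f u * a u) :=
  ⟨h.1.mul ha, h.2.mul_right⟩

lemma IsTest.const_mul {f : E → ℂ} (h : IsTest f) (c : ℂ) : IsTest (fun u => c * f u) :=
  h.mul_left contDiff_const

lemma IsTest.neg {f : E → ℂ} (h : IsTest f) : IsTest (fun u => -f u) :=
  ⟨h.1.neg, h.2.neg⟩

lemma IsTest.sub {f f' : E → ℂ} (h : IsTest f) (h' : IsTest f') : IsTest (fun u => f u - f' u) := by
  simpa [sub_eq_add_neg] using h.add h'.neg

lemma IsTest.sum {ι : Type*} {s : Finset ι} {f : ι → E → ℂ} (h : ∀ i ∈ s, IsTest (f i)) :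
    IsTest (fun u => ∑ i ∈ s, f i u) := by
  classical
  induction s using Finset.induction_on with
  | empty =>
    simp only [Finset.sum_empty]
    exact isTest_zero
  | insert a s ha ih =>
    simp only [Finset.sum_insert ha]
    exact (h a (by simp)).add (ih fun i hi => h i (by simp [hi]))

lemma IsTest.conj {f : E → ℂ} (h : IsTest f) : IsTest (fun u => conj (f u)) :=
  ⟨conjCLE.contDiff.comp h.1, h.2.comp_left (map_zero _)⟩

lemma IsTest.integrable [MeasurableSpace E] [OpensMeasurableSpace E] {μ : Measure E}
    [IsFiniteMeasureOnCompacts μ] {f : E → ℂ} (h : IsTest f) : Integrable f μ :=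
  h.1.continuous.integrable_of_hasCompactSupport h.2

lemma IsTest.fderiv_apply {f : E → ℂ} (h : IsTest f) (v : E) :
    IsTest (fun u => fderiv ℝ f u v) :=
  ⟨(h.1.fderiv_right (m := ∞) (by simp)).clm_apply contDiff_const,
    h.2.fderiv_apply (𝕜 := ℝ) (v := v)⟩

lemma IsTest.comp_homeo {F : Type*} [NormedAddCommGroup F] [NormedSpace ℝ F] {f : E → ℂ}
    (h : IsTest f) (e : F ≃ₜ E) (he : ContDiff ℝ ∞ e) : IsTest (fun v => f (e v)) :=
  ⟨h.1.comp he, h.2.comp_homeomorph e⟩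

lemma IsTest.comp_add {f : E → ℂ} (h : IsTest f) (v : E) : IsTest (fun u => f (u + v)) :=
  h.comp_homeo (Homeomorph.addRight v) (contDiff_id.add contDiff_const)

/-- The derivatives of order at most `K` are bounded by `M`. -/
def CkBound (K : ℕ) (M : ℝ) (f : E → ℂ) : Prop :=
  ∀ n ≤ K, ∀ u, ‖iteratedFDeriv ℝ n f u‖ ≤ M

lemma CkBound.nonneg {K : ℕ} {M : ℝ} {f : E → ℂ} (h : CkBound K M f) : 0 ≤ M :=
  (norm_nonneg _).trans (h 0 (Nat.zero_le _) 0)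

lemma CkBound.mono {K K' : ℕ} {M M' : ℝ} {f : E → ℂ} (h : CkBound K M f) (hK : K' ≤ K)
    (hM : M ≤ M') : CkBound K' M' f := fun n hn u => (h n (hn.trans hK) u).trans hM

lemma CkBound.norm_le {K : ℕ} {M : ℝ} {f : E → ℂ} (h : CkBound K M f) (u : E) : ‖f u‖ ≤ M := by
  simpa using h 0 (Nat.zero_le _) u

lemma CkBound.add {K : ℕ} {M M' : ℝ} {f f' : E → ℂ} (h : CkBound K M f) (h' : CkBound K M' f')
    (hf : ContDiff ℝ ∞ f) (hf' : ContDiff ℝ ∞ f') : CkBound K (M + M') (fun u => f u + f' u) := by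
  intro n hn u
  have : (fun u => f u + f' u) = f + f' := rfl
  rw [this, iteratedFDeriv_add_apply (hf.of_le (by exact_mod_cast le_top)).contDiffAt
    (hf'.of_le (by exact_mod_cast le_top)).contDiffAt]
  exact (norm_add_le _ _).trans (add_le_add (h n hn u) (h' n hn u))

lemma CkBound.const_mul {K : ℕ} {M : ℝ} {f : E → ℂ} (h : CkBound K M f) (hf : ContDiff ℝ ∞ f)
    (c : ℂ) : CkBound K (‖c‖ * M) (fun u => c * f u) := by
  intro n hn u
  have : (fun u => c * f u) = c • f := rfl
  rw [this, iteratedFDeriv_const_smul_apply (hf.of_le (by exact_mod_cast le_top)).contDiffAt,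
    norm_smul]
  exact mul_le_mul_of_nonneg_left (h n hn u) (norm_nonneg _)

lemma CkBound.sum {ι : Type*} {s : Finset ι} {K : ℕ} {M : ι → ℝ} {f : ι → E → ℂ}
    (h : ∀ i ∈ s, CkBound K (M i) (f i)) (hf : ∀ i ∈ s, ContDiff ℝ ∞ (f i)) :
    CkBound K (∑ i ∈ s, M i) (fun u => ∑ i ∈ s, f i u) := by
  classical
  induction s using Finset.induction_on with
  | empty =>
    intro n _ u
    simp only [Finset.sum_empty]
    cases n with
    | zero => simp
    | succ n => simp [iteratedFDeriv_const_of_ne (Nat.succ_ne_zero n)]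
  | insert a s ha ih =>
    simp only [Finset.sum_insert ha]
    exact (h a (by simp)).add (ih (fun i hi => h i (by simp [hi])) fun i hi => hf i (by simp [hi]))
      (hf a (by simp)) (ContDiff.sum fun i hi => hf i (by simp [hi]))

/-- Product with a function whose derivatives are bounded on a neighbourhood of the support. -/
lemma CkBound.mul {K : ℕ} {M M' : ℝ} {f a : E → ℂ} {B : Set E} (h : CkBound K M f)
    (hf : ContDiff ℝ ∞ f) (ha : ContDiff ℝ ∞ a) (hB : tsupport f ⊆ B)
    (haB : ∀ n ≤ K, ∀ u ∈ B, ‖iteratedFDeriv ℝ n a u‖ ≤ M') (hM' : 0 ≤ M') :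
    CkBound K (2 ^ K * M' * M) (fun u => a u * f u) := by
  intro n hn u
  have hM := h.nonneg
  refine (norm_iteratedFDeriv_mul_le ha hf u (n := n) (by exact_mod_cast le_top)).trans ?_
  have : ∀ i ∈ Finset.range (n + 1), (n.choose i : ℝ) * ‖iteratedFDeriv ℝ i a u‖ *
      ‖iteratedFDeriv ℝ (n - i) f u‖ ≤ n.choose i * (M' * M) := by
    intro i hi
    rw [mul_assoc]
    refine mul_le_mul_of_nonneg_left ?_ (Nat.cast_nonneg _)
    -- Outside `B` every derivative of `f` vanishes, so no bound on `a` is needed there.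
    by_cases hu : u ∈ B
    · exact mul_le_mul (haB i (by simp at hi; omega) u hu) (h _ (by omega) u) (norm_nonneg _) hM'
    · have : iteratedFDeriv ℝ (n - i) f u = 0 := by
        by_contra h0
        exact hu (hB (support_iteratedFDeriv_subset (𝕜 := ℝ) (n - i) h0))
      rw [this, norm_zero, mul_zero]
      positivity
  refine (Finset.sum_le_sum this).trans ?_
  rw [← Finset.sum_mul]
  have h2 : (∑ i ∈ Finset.range (n + 1), (n.choose i : ℝ)) = 2 ^ n := by
    exact_mod_cast Nat.sum_range_choose n
  rw [h2, mul_assoc]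
  refine mul_le_mul_of_nonneg_right ?_ (by positivity)
  exact pow_le_pow_right₀ (by norm_num) hn

lemma exists_bound_iteratedFDeriv {a : E → ℂ} (ha : ContDiff ℝ ∞ a) {B : Set E} (hB : IsCompact B)
    (K : ℕ) : ∃ M, 0 ≤ M ∧ ∀ n ≤ K, ∀ u ∈ B, ‖iteratedFDeriv ℝ n a u‖ ≤ M := by
  have h (n : ℕ) : ∃ M, ∀ u ∈ B, ‖iteratedFDeriv ℝ n a u‖ ≤ M :=
    hB.exists_bound_of_continuousOn
      (ha.continuous_iteratedFDeriv (m := n) (by exact_mod_cast le_top)).continuousOn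
  choose M hM using h
  refine ⟨∑ n ∈ Finset.range (K + 1), |M n|, by positivity, fun n hn u hu => ?_⟩
  refine (hM n u hu).trans ((le_abs_self _).trans ?_)
  exact Finset.single_le_sum (f := fun n => |M n|) (fun _ _ => abs_nonneg _)
    (Finset.mem_range.2 (by omega))

/-- A uniform version of `CkBound.mul`, for a fixed smooth factor and supports in a fixed compact
set. -/
lemma exists_ckBound_mul {a : E → ℂ} (ha : ContDiff ℝ ∞ a) {B : Set E} (hB : IsCompact B) (K : ℕ) :
    ∃ C, 0 ≤ C ∧ ∀ (f : E → ℂ) (M : ℝ), ContDiff ℝ ∞ f → tsupport f ⊆ B → CkBound K M f →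
      CkBound K (C * M) (fun u => a u * f u) := by
  obtain ⟨M', h0, hM'⟩ := exists_bound_iteratedFDeriv ha hB K
  exact ⟨2 ^ K * M', by positivity, fun f M hf hfB h => h.mul hf ha hfB hM' h0⟩

lemma IsTest.exists_ckBound {f : E → ℂ} (h : IsTest f) (K : ℕ) : ∃ M, CkBound K M f := by
  obtain ⟨M, h0, hM⟩ := exists_bound_iteratedFDeriv h.1 h.2.isCompact K
  refine ⟨M, fun n hn u => ?_⟩
  by_cases hu : u ∈ tsupport f
  · exact hM n hn u hu
  · have : iteratedFDeriv ℝ n f u = 0 := by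
      by_contra h0
      exact hu (support_iteratedFDeriv_subset (𝕜 := ℝ) n h0)
    rw [this, norm_zero]
    exact h0

lemma CkBound.fderiv_apply {K : ℕ} {M : ℝ} {f : E → ℂ} (h : CkBound (K + 1) M f)
    (hf : ContDiff ℝ ∞ f) (v : E) : CkBound K (‖v‖ * M) (fun u => fderiv ℝ f u v) := by
  intro n hn u
  have h1 := norm_iteratedFDeriv_clm_apply_const (𝕜 := ℝ) (f := fderiv ℝ f) (c := v) (x := u)
    (hf.fderiv_right (m := ∞) (by simp)).contDiffAt (n := n) (by exact_mod_cast le_top)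
  refine h1.trans (mul_le_mul_of_nonneg_left ?_ (norm_nonneg _))
  rw [norm_iteratedFDeriv_fderiv]
  exact h _ (by omega) u

/-- The derivative of the exponential is its image under one fixed linear map `T` with ‖T‖ ≤ ‖L‖, so
each differentiation costs one factor ‖L‖. -/
lemma norm_iteratedFDeriv_cexp_linear (L : E →L[ℝ] ℝ) (n : ℕ) (u : E) :
    ‖iteratedFDeriv ℝ n (fun v => cexp (I * (L v : ℝ))) u‖ ≤ ‖L‖ ^ n := by
  induction n generalizing u with
  | zero =>
    rw [norm_iteratedFDeriv_zero, mul_comm, Complex.norm_exp_ofReal_mul_I, pow_zero]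
  | succ n ih =>
    set F : E → ℂ := fun v => cexp (I * (L v : ℝ)) with hF
    have hsm : ContDiff ℝ ∞ F := by
      have : ContDiff ℝ ∞ fun v => ((L v : ℝ) : ℂ) := ofRealCLM.contDiff.comp L.contDiff
      fun_prop
    let T : ℂ →L[ℝ] (E →L[ℝ] ℂ) :=
      (ContinuousLinearMap.smulRightL ℝ E ℂ) L ∘L (ContinuousLinearMap.mul ℝ ℂ I)
    have hT : ‖T‖ ≤ ‖L‖ := by
      refine ContinuousLinearMap.opNorm_le_bound _ (norm_nonneg _) fun c => ?_
      refine ContinuousLinearMap.opNorm_le_bound _ (by positivity) fun v => ?_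
      have hTv : T c v = (L v : ℂ) * (I * c) := by simp [T]
      rw [hTv, norm_mul, norm_mul, norm_I, one_mul, norm_real]
      exact (mul_le_mul_of_nonneg_right (L.le_opNorm v) (norm_nonneg c)).trans_eq (by ring)
    have hd : fderiv ℝ F = fun v => T (F v) := by
      funext v
      have h1 : HasFDerivAt (fun v => ((L v : ℝ) : ℂ)) (ofRealCLM.comp L) v :=
        (ofRealCLM.comp L).hasFDerivAt
      have h2 := (h1.const_mul I).cexp
      rw [h2.fderiv]
      ext w
      simp [T, hF]
      ring
    rw [← norm_iteratedFDeriv_fderiv, hd]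
    refine (T.norm_iteratedFDeriv_comp_left hsm.contDiffAt (n := n)
      (by exact_mod_cast le_top)).trans ?_
    rw [pow_succ']
    exact mul_le_mul hT (ih u) (norm_nonneg _) (norm_nonneg _)

end TestFunctions

/-! ### Lattices with a fundamental domain, and unfolding of integrals -/

lemma exists_isTest_one {E : Type*} [NormedAddCommGroup E] [NormedSpace ℝ E]
    [FiniteDimensional ℝ E] {K : Set E} (hK : IsCompact K) :
    ∃ b : E → ℝ, IsTest (fun u => (b u : ℂ)) ∧ (∀ u, 0 ≤ b u) ∧ ∀ u ∈ K, b u = 1 := by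
  obtain ⟨R, hR⟩ := hK.isBounded.subset_ball (0 : E)
  -- The absolute value keeps both radii positive when `K` is empty and `R` negative.
  obtain ⟨b, hb⟩ : ∃ b : ContDiffBump (0 : E), R ≤ b.rIn :=
    ⟨⟨|R| + 1, |R| + 2, by positivity, by linarith⟩, (le_abs_self R).trans (by simp)⟩
  have h1 : ContDiff ℝ ∞ fun u => (b u : ℂ) := ofRealCLM.contDiff.comp b.contDiff
  have h2 : HasCompactSupport fun u => (b u : ℂ) :=
    b.hasCompactSupport.comp_left (g := fun x : ℝ => (x : ℂ)) ofReal_zero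
  refine ⟨fun u => b u, ⟨h1, h2⟩, fun u => b.nonneg, fun u hu => b.one_of_mem_closedBall ?_⟩
  have := hR hu
  rw [mem_ball_zero_iff] at this
  rw [mem_closedBall_zero_iff]
  exact this.le.trans hb

section Tiling

variable {E Λ : Type*} [NormedAddCommGroup E] [NormedSpace ℝ E] [AddCommGroup Λ]

/-- A lattice in `E` together with a bounded fundamental domain. -/
structure Tiling (E Λ : Type*) [NormedAddCommGroup E] [NormedSpace ℝ E] [AddCommGroup Λ]
    [MeasurableSpace E] where
  e : Λ →+ E
  D : Set E
  K : Set E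
  measurableSet : MeasurableSet D
  existsUnique : ∀ x, ∃! l, x - e l ∈ D
  subset : D ⊆ K
  isCompact : IsCompact K
  finite : ∀ B : Set E, IsCompact B → {l | e l ∈ B}.Finite

variable [MeasurableSpace E] (t : Tiling E Λ)

lemma Tiling.finite_translates {f : E → ℂ} (hf : HasCompactSupport f) {B : Set E}
    (hB : IsCompact B) : {l | ∃ u ∈ B, u + t.e l ∈ tsupport f}.Finite := by
  have hK : IsCompact ((fun p : E × E => p.1 - p.2) '' (tsupport f ×ˢ B)) :=
    (hf.isCompact.prod hB).image (by fun_prop)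
  refine (t.finite _ hK).subset fun l hl => ?_
  obtain ⟨u, hu, hl⟩ := hl
  exact ⟨(u + t.e l, u), ⟨hl, hu⟩, by simp⟩

lemma Tiling.finsum_eq_sum {f : E → ℂ} {F : Finset Λ} {a : Λ → ℂ} {u : E}
    (hF : ∀ l, u + t.e l ∈ tsupport f → l ∈ F) :
    ∑ᶠ l, a l * f (u + t.e l) = ∑ l ∈ F, a l * f (u + t.e l) := by
  refine finsum_eq_sum_of_support_subset _ fun l hl => ?_
  exact hF l (subset_tsupport _ (right_ne_zero_of_mul hl))

lemma Tiling.contDiff_finsum [ProperSpace E] {f : E → ℂ} (hf : IsTest f) :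
    ContDiff ℝ ∞ (fun u => ∑ᶠ l, f (u + t.e l)) := by
  refine contDiff_iff_contDiffAt.2 fun u => ?_
  have hfin := t.finite_translates hf.2 (isCompact_closedBall u 1)
  have hev : (fun u => ∑ᶠ l, f (u + t.e l)) =ᶠ[𝓝 u]
      fun v => ∑ l ∈ hfin.toFinset, f (v + t.e l) := by
    filter_upwards [Metric.closedBall_mem_nhds u one_pos] with v hv
    have := t.finsum_eq_sum (f := f) (F := hfin.toFinset) (a := fun _ => 1) (u := v)
      fun l hl => by simpa using ⟨v, by simpa using hv, hl⟩
    simpa using this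
  exact (ContDiff.sum fun l _ => hf.1.comp (contDiff_id.add contDiff_const)).contDiffAt
    |>.congr_of_eventuallyEq hev

/-- The translates of the fundamental domain partition the space, and invariance of μ moves each
piece back to `D`. -/
lemma Tiling.hasSum_integral [BorelSpace E] [Countable Λ] (μ : Measure E) [μ.IsAddHaarMeasure] {f : E → ℂ}
    (hf : Integrable f μ) : HasSum (fun l => ∫ x in t.D, f (x + t.e l) ∂μ) (∫ x, f x ∂μ) := by
  have hm (l : Λ) : MeasurableSet ((fun x => x - t.e l) ⁻¹' t.D) :=
    t.measurableSet.preimage (by fun_prop)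
  have h1 : ⋃ l, (fun x => x - t.e l) ⁻¹' t.D = univ := by
    refine eq_univ_of_forall fun x => ?_
    obtain ⟨l, hl, -⟩ := t.existsUnique x
    exact mem_iUnion.2 ⟨l, hl⟩
  have h2 : Pairwise (Function.onFun Disjoint fun l => (fun x => x - t.e l) ⁻¹' t.D) := by
    intro l m hlm
    refine Set.disjoint_left.2 fun x hx hx' => hlm ?_
    exact (t.existsUnique x).unique hx hx'
  have h := hasSum_integral_iUnion hm h2 (f := f) (μ := μ) hf.integrableOn
  rw [h1, setIntegral_univ] at h
  refine h.congr_fun fun l => ?_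
  have hmp := (measurePreserving_add_right μ (t.e l)).setIntegral_preimage_emb
    (measurableEmbedding_addRight (t.e l)) f ((fun x => x - t.e l) ⁻¹' t.D)
  rw [← hmp]
  congr 2
  ext x
  simp

lemma Tiling.integral_finsum [BorelSpace E] [Countable Λ] (μ : Measure E) [μ.IsAddHaarMeasure] {f : E → ℂ}
    (hf : Continuous f) (hf' : HasCompactSupport f) :
    ∫ x in t.D, ∑ᶠ l, f (x + t.e l) ∂μ = ∫ x, f x ∂μ := by
  have hfin := t.finite_translates hf' t.isCompact
  have h1 := t.hasSum_integral μ (hf.integrable_of_hasCompactSupport hf')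
  have h2 : ∀ l ∉ hfin.toFinset, ∫ x in t.D, f (x + t.e l) ∂μ = 0 := by
    intro l hl
    refine setIntegral_eq_zero_of_forall_eq_zero fun x hx => ?_
    by_contra h0
    exact hl (by simpa using ⟨x, t.subset hx, subset_tsupport _ h0⟩)
  have h3 := (hasSum_sum_of_ne_finset_zero h2).unique h1
  rw [← h3, ← integral_finsetSum]
  · refine setIntegral_congr_fun t.measurableSet fun x hx => ?_
    have := t.finsum_eq_sum (f := f) (F := hfin.toFinset) (a := fun _ => 1) (u := x)
      fun l hl => by simpa using ⟨x, t.subset hx, hl⟩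
    simpa using this
  · intro l _
    exact ((hf.comp (continuous_add_const (t.e l))).integrable_of_hasCompactSupport
      (hf'.comp_homeomorph (Homeomorph.addRight (t.e l)))).integrableOn

lemma Tiling.finsum_shift {M : Type*} [AddCommMonoid M] (f : E → M) (u : E) (m : Λ) :
    ∑ᶠ l, f (u + t.e m + t.e l) = ∑ᶠ l, f (u + t.e l) := by
  rw [← finsum_comp_equiv (Equiv.addLeft m) (f := fun l => f (u + t.e l))]
  simp [add_assoc]

/-- A bump equal to 1 on `K` is divided by its lattice sum. That sum is periodic, and it is positive
because every orbit meets `D ⊆ K`. -/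
lemma Tiling.exists_partition [FiniteDimensional ℝ E] :
    ∃ r : E → ℂ, IsTest r ∧ ∀ u, ∑ᶠ l, r (u + t.e l) = 1 := by
  have : ProperSpace E := FiniteDimensional.proper ℝ E
  obtain ⟨b, hf, hb0, hb1⟩ := exists_isTest_one t.isCompact
  set f : E → ℂ := fun u => (b u : ℂ) with hfdef
  obtain ⟨s, hsdef⟩ : ∃ s : E → ℂ, s = fun u => ∑ᶠ l, f (u + t.e l) := ⟨_, rfl⟩
  have hs : ContDiff ℝ ∞ s := hsdef ▸ t.contDiff_finsum hf
  have hfin (u : E) := t.finite_translates hf.2 (isCompact_singleton (x := u))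
  have h1 (u : E) (a : Λ → ℂ) := t.finsum_eq_sum (f := f) (F := (hfin u).toFinset) (a := a) (u := u)
      fun l hl => by simpa using hl
  have hs1 (u : E) : s u = ∑ l ∈ (hfin u).toFinset, f (u + t.e l) := by
    have := h1 u fun _ => 1
    simp only [one_mul] at this
    rw [hsdef]
    exact this
  have hs0 (u : E) : s u ≠ 0 := by
    obtain ⟨m, hm, -⟩ := t.existsUnique u
    have hbm : b (u + t.e (-m)) = 1 := by
      refine hb1 _ ?_
      rw [map_neg, ← sub_eq_add_neg]
      exact t.subset hm
    have h2 : s u = ((∑ l ∈ (hfin u).toFinset, b (u + t.e l) : ℝ) : ℂ) := by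
      rw [hs1]; push_cast; rfl
    rw [h2, ofReal_ne_zero]
    refine (lt_of_lt_of_le one_pos ?_).ne'
    rw [← hbm]
    refine Finset.single_le_sum (f := fun l => b (u + t.e l)) (fun _ _ => hb0 _) ?_
    simp only [Finite.mem_toFinset, mem_ofPred_eq]
    refine ⟨u, rfl, subset_tsupport _ ?_⟩
    simp only [f, Function.mem_support, hbm, ofReal_one, ne_eq, one_ne_zero, not_false_eq_true]
  have hsp (u : E) (m : Λ) : s (u + t.e m) = s u := by
    rw [hsdef]; exact t.finsum_shift f u m
  refine ⟨fun u => (s u)⁻¹ * f u, hf.mul_left (hs.inv hs0), fun u => ?_⟩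
  simp only [hsp]
  rw [h1 u fun _ => (s u)⁻¹, ← Finset.mul_sum, ← hs1]
  exact inv_mul_cancel₀ (hs0 u)

end Tiling

/-- The standard lattice in `ℝᶥ`, with the half-open unit cube. -/
def cubeTiling (ι : Type*) [Fintype ι] : Tiling (ι → ℝ) (ι → ℤ) where
  e := ⟨⟨fun m i => (m i : ℝ), by ext; simp⟩, fun _ _ => by ext; simp⟩
  D := {x | ∀ i, x i ∈ Ioc ((0 : ι → ℝ) i) ((0 : ι → ℝ) i + 1)}
  K := Icc 0 1
  measurableSet := MeasurableSet.univ_pi' fun _ => measurableSet_Ioc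
  existsUnique x := by
    have h (i) := existsUnique_sub_zsmul_mem_Ioc (one_pos (α := ℝ)) (x i) 0
    choose m hm hm' using h
    refine ⟨m, fun i => by simpa using hm i, fun n hn => funext fun i => hm' i _ ?_⟩
    simpa using hn i
  subset x hx := ⟨fun i => (hx i).1.le, fun i => by simpa using (hx i).2⟩
  isCompact := isCompact_Icc
  finite B hB := by
    classical
    obtain ⟨R, hR⟩ := hB.isBounded.exists_norm_le
    obtain ⟨n, hn⟩ := exists_nat_ge R
    refine (Set.finite_Icc (fun _ : ι => -(n : ℤ)) (fun _ => (n : ℤ))).subset fun l hl => ?_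
    have h := (hR _ hl).trans hn
    have h1 (i) : |(l i : ℝ)| ≤ n := (norm_le_pi_norm (fun i => (l i : ℝ)) i).trans h
    exact ⟨fun i => by exact_mod_cast (abs_le.1 (h1 i)).1,
      fun i => by exact_mod_cast (abs_le.1 (h1 i)).2⟩

/-- The lattice `ℤ²ᵍ ⊂ ℝ²ᵍ`. -/
def coverTiling (g : ℕ) : Tiling (Cover g) (Lattice g) where
  e := ⟨⟨latt, by ext <;> simp [latt]⟩, latt_add⟩
  D := (cubeTiling (Fin g)).D ×ˢ (cubeTiling (Fin g)).D
  K := Icc 0 1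
  measurableSet := (cubeTiling (Fin g)).measurableSet.prod (cubeTiling (Fin g)).measurableSet
  existsUnique x := by
    obtain ⟨m, hm, hm'⟩ := (cubeTiling (Fin g)).existsUnique x.1
    obtain ⟨n, hn, hn'⟩ := (cubeTiling (Fin g)).existsUnique x.2
    refine ⟨(m, n), ⟨hm, hn⟩, fun l hl => Prod.ext (hm' _ hl.1) (hn' _ hl.2)⟩
  subset x hx := ⟨⟨fun i => (hx.1 i).1.le, fun i => (hx.2 i).1.le⟩,
    ⟨fun i => by simpa using (hx.1 i).2, fun i => by simpa using (hx.2 i).2⟩⟩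
  isCompact := isCompact_Icc
  finite B hB := finite_latt hB

@[simp] lemma coverTiling_e (l : Lattice g) : (coverTiling g).e l = latt l := rfl

instance : (volume : Measure (Cover g)).IsAddHaarMeasure :=
  Measure.prod.instIsAddHaarMeasure volume volume

lemma coverTiling_D_ae : (coverTiling g).D =ᵐ[volume] Icc (0 : Cover g) 1 := by
  have h : (cubeTiling (Fin g)).D = univ.pi fun i => Ioc ((0 : Fin g → ℝ) i) ((1 : Fin g → ℝ) i) := by
    ext x; simp [cubeTiling]
  have h1 : (cubeTiling (Fin g)).D =ᵐ[volume] Icc (0 : Fin g → ℝ) 1 := by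
    rw [h]; exact Measure.univ_pi_Ioc_ae_eq_Icc
  have h2 : Icc (0 : Cover g) 1 = Icc (0 : Fin g → ℝ) 1 ×ˢ Icc (0 : Fin g → ℝ) 1 :=
    (Icc_prod_eq _ _)
  rw [h2]
  exact Measure.set_prod_ae_eq h1 h1

lemma integral_Icc_finsum {f : Cover g → ℂ} (hf : Continuous f) (hf' : HasCompactSupport f) :
    ∫ u in Icc (0 : Cover g) 1, ∑ᶠ l, f (u + latt l) = ∫ u, f u := by
  rw [← setIntegral_congr_set coverTiling_D_ae]
  exact (coverTiling g).integral_finsum volume hf hf'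

lemma exists_partition (g : ℕ) :
    ∃ r : Cover g → ℂ, IsTest r ∧ ∀ u, ∑ᶠ l, r (u + latt l) = 1 :=
  (coverTiling g).exists_partition

/-! ### Distributional sections as distributions on the cover -/

lemma mult_inv (j : ℤ) (l : Lattice g) (u : Cover g) : (mult j l u)⁻¹ = mult (-j) l u := by
  have h : ∀ n : ℤ, ((-1 : ℂ) ^ n)⁻¹ = (-1 : ℂ) ^ n := fun n => by
    rw [← _root_.inv_zpow]; norm_num
  simp only [mult, mul_inv, h, neg_mul, _root_.zpow_neg, ← Complex.exp_neg]
  congr 2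
  push_cast
  ring

lemma mult_zero (l : Lattice g) (u : Cover g) : mult 0 l u = 1 := by simp [mult]

lemma periodizeFun_eq (j : ℤ) (f : Cover g → ℂ) (u : Cover g) :
    periodizeFun j f u = ∑ᶠ l, mult (-j) l u * f (u + latt l) := by
  simp only [periodizeFun, mult_inv]

lemma periodizeFun_eq_sum (j : ℤ) {f : Cover g → ℂ} {F : Finset (Lattice g)} {u : Cover g}
    (hF : ∀ l, u + latt l ∈ tsupport f → l ∈ F) :
    periodizeFun j f u = ∑ l ∈ F, mult (-j) l u * f (u + latt l) := by
  rw [periodizeFun_eq]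
  exact (coverTiling g).finsum_eq_sum (a := fun l => mult (-j) l u) hF

lemma finite_translates {f : Cover g → ℂ} (hf : HasCompactSupport f) {B : Set (Cover g)}
    (hB : IsCompact B) : {l | ∃ u ∈ B, u + latt l ∈ tsupport f}.Finite :=
  (coverTiling g).finite_translates hf hB

open Classical in
/-- The value of a distributional section on a test function on the cover. -/
def ev {j : ℤ} (T : DistSec g j) (f : Cover g → ℂ) : ℂ :=
  -- The value 0 off the test functions makes `ev` total, so that its arguments carry no proofs.
  if h : IsTest f then distLift T ⟨f, h⟩ else 0

/-- The smooth section obtained by periodizing a test function. -/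
def periodize (j : ℤ) {f : Cover g → ℂ} (hf : IsTest f) : Sec g j :=
  ⟨periodizeFun j f, periodizeFun_mem j ⟨f, hf⟩⟩

lemma ev_eq {j : ℤ} (T : DistSec g j) {f : Cover g → ℂ} (hf : IsTest f) :
    ev T f = T (periodize (-j) hf) := by
  rw [ev, dif_pos hf]; rfl

lemma periodizeFun_add (j : ℤ) {f f' : Cover g → ℂ} (hf : IsTest f) (hf' : IsTest f') :
    periodizeFun j (fun u => f u + f' u) = fun u => periodizeFun j f u + periodizeFun j f' u := by
  classical
  funext u
  have h1 := finite_translates hf.2 (isCompact_singleton (x := u))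
  have h2 := finite_translates hf'.2 (isCompact_singleton (x := u))
  have h3 := finite_translates (hf.add hf').2 (isCompact_singleton (x := u))
  let F := h1.toFinset ∪ h2.toFinset ∪ h3.toFinset
  rw [periodizeFun_eq_sum j (F := F) fun l hl => by
      simp only [F, Finset.mem_union]; right; simpa using hl,
    periodizeFun_eq_sum j (F := F) fun l hl => by
      simp only [F, Finset.mem_union]; left; left; simpa using hl,
    periodizeFun_eq_sum j (F := F) fun l hl => by
      simp only [F, Finset.mem_union]; left; right; simpa using hl, ← Finset.sum_add_distrib]
  exact Finset.sum_congr rfl fun l _ => by ring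

lemma periodizeFun_mul (j : ℤ) {f a : Cover g → ℂ} (ha : ∀ u l, a (u + latt l) = a u) :
    periodizeFun j (fun u => a u * f u) = fun u => a u * periodizeFun j f u := by
  funext u
  rw [periodizeFun_eq, periodizeFun_eq, ← smul_eq_mul, smul_finsum]
  exact finsum_congr fun l => by rw [ha, smul_eq_mul]; ring

/-- Quasi-periodicity of `s` cancels the multipliers and leaves `s` times the lattice sum of `f`.
Hence every section is the periodization of a test function, and identities for distributional
sections can be checked on the cover. -/
lemma periodizeFun_mul_sec {j : ℤ} {f s : Cover g → ℂ} (hs : s ∈ Sec g j)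
    (hf : ∀ u, ∑ᶠ l, f (u + latt l) = 1) :
    periodizeFun j (fun u => f u * s u) = s := by
  funext u
  rw [periodizeFun]
  have : ∀ l, (mult j l u)⁻¹ * (f (u + latt l) * s (u + latt l)) = s u • f (u + latt l) := by
    intro l
    have := mult_ne_zero j l u
    rw [hs.2 l u, smul_eq_mul]
    field_simp
  simp only [this]
  rw [← smul_finsum, hf, smul_eq_mul, mul_one]

lemma periodizeFun_translate (j : ℤ) (f : Cover g → ℂ) (m : Lattice g) :
    periodizeFun j (fun u => (mult j m u)⁻¹ * f (u + latt m)) = periodizeFun j f := by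
  funext u
  simp only [periodizeFun]
  rw [← finsum_comp_equiv (Equiv.addLeft m)
    (f := fun l => (mult j l u)⁻¹ * f (u + latt l))]
  refine finsum_congr fun l => ?_
  simp only [Equiv.coe_addLeft, mult_add, mul_inv, latt_add]
  rw [show u + (latt m + latt l) = u + latt l + latt m by abel]
  ring

section

variable {j : ℤ} (T : DistSec g j)

lemma ev_add {f f' : Cover g → ℂ} (hf : IsTest f) (hf' : IsTest f') :
    ev T (fun u => f u + f' u) = ev T f + ev T f' := by
  rw [ev_eq T hf, ev_eq T hf', ev_eq T (hf.add hf'), ← map_add]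
  congr 1
  exact Subtype.ext (periodizeFun_add _ hf hf')

lemma ev_const_mul {f : Cover g → ℂ} (hf : IsTest f) (c : ℂ) :
    ev T (fun u => c * f u) = c * ev T f := by
  rw [ev_eq T hf, ev_eq T (hf.const_mul c), ← smul_eq_mul, ← map_smul]
  congr 1
  exact Subtype.ext (periodizeFun_mul (-j) (a := fun _ => c) fun _ _ => rfl)

lemma ev_zero : ev T (fun _ => 0) = 0 := by
  simpa using ev_const_mul T (isTest_zero (E := Cover g)) 0

lemma ev_neg {f : Cover g → ℂ} (hf : IsTest f) : ev T (fun u => -f u) = -ev T f := by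
  simpa using ev_const_mul T hf (-1)

lemma ev_sub {f f' : Cover g → ℂ} (hf : IsTest f) (hf' : IsTest f') :
    ev T (fun u => f u - f' u) = ev T f - ev T f' := by
  simp only [sub_eq_add_neg]
  rw [ev_add T hf hf'.neg, ev_neg T hf']

lemma ev_sum {ι : Type*} {s : Finset ι} {f : ι → Cover g → ℂ} (h : ∀ i ∈ s, IsTest (f i)) :
    ev T (fun u => ∑ i ∈ s, f i u) = ∑ i ∈ s, ev T (f i) := by
  classical
  induction s using Finset.induction_on with
  | empty => simpa using ev_zero T
  | insert a s ha ih =>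
    simp only [Finset.sum_insert ha]
    rw [ev_add T (h a (by simp)) (IsTest.sum fun i hi => h i (by simp [hi])),
      ih fun i hi => h i (by simp [hi])]

/-- This is the quasi-periodicity of `T` in dual form: translating a test function with the
multiplier only reindexes its periodization. -/
lemma ev_translate {f : Cover g → ℂ} (hf : IsTest f) (m : Lattice g) :
    ev T (fun u => mult j m u * f (u + latt m)) = ev T f := by
  have h : IsTest (fun u => mult j m u * f (u + latt m)) :=
    (hf.comp_add (latt m)).mul_left (contDiff_mult j m)
  rw [ev_eq T hf, ev_eq T h]
  congr 1
  refine Subtype.ext ?_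
  have := periodizeFun_translate (-j) f m
  simp only [mult_inv, neg_neg] at this
  exact this

lemma apply_eq_ev {r : Cover g → ℂ} (hr : IsTest r) (h1 : ∀ u, ∑ᶠ l, r (u + latt l) = 1)
    (phi : Sec g (-j)) : T phi = ev T (fun u => r u * phi.1 u) := by
  rw [ev_eq T (hr.mul_right phi.2.1)]
  congr 1
  exact Subtype.ext (periodizeFun_mul_sec phi.2 h1).symm

end

lemma continuous_ev {j : ℤ} (f : Cover g → ℂ) : Continuous fun T : DistSec g j => ev T f := by
  by_cases hf : IsTest f
  · simp only [ev_eq _ hf]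
    exact (continuous_apply (periodize (-j) hf)).comp continuous_induced_dom
  · simp only [ev, dif_neg hf]
    exact continuous_const

/-- Unfolding: quasi-periodicity of `s` absorbs the multipliers, and the integrand becomes the plain
lattice sum of `s f`. -/
lemma integral_Icc_periodize {i j : ℤ} (hij : j = -i) {s : Cover g → ℂ} (hs : s ∈ Sec g i)
    {f : Cover g → ℂ} (hf : IsTest f) :
    ∫ u in Icc (0 : Cover g) 1, s u * periodizeFun j f u = ∫ u, s u * f u := by
  subst hij
  have h := hf.mul_left hs.1
  rw [← integral_Icc_finsum h.continuous h.2]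
  congr 1
  funext u
  rw [periodizeFun_eq, ← smul_eq_mul, smul_finsum]
  refine finsum_congr fun l => ?_
  rw [hs.2 l u, neg_neg, smul_eq_mul]
  ring

lemma ev_smoothDist {j : ℤ} (s : Sec g j) {f : Cover g → ℂ} (hf : IsTest f) :
    ev (smoothDist s) f = ∫ u, s.1 u * f u := by
  rw [ev_eq _ hf]
  exact integral_Icc_periodize rfl s.2 hf

lemma conj_periodizeFun (j : ℤ) {f : Cover g → ℂ} (hf : IsTest f) (u : Cover g) :
    conj (periodizeFun j f u) = periodizeFun (-j) (fun u => conj (f u)) u := by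
  have h1 := finite_translates hf.2 (isCompact_singleton (x := u))
  have h2 := finite_translates hf.conj.2 (isCompact_singleton (x := u))
  classical
  rw [periodizeFun_eq_sum j (F := h1.toFinset ∪ h2.toFinset) fun l hl => by
      simp only [Finset.mem_union]; left; simpa using hl,
    periodizeFun_eq_sum (-j) (F := h1.toFinset ∪ h2.toFinset) fun l hl => by
      simp only [Finset.mem_union]; right; simpa using hl]
  simp [conj_mult]

lemma ev_distConj {j : ℤ} (T : DistSec g j) {f : Cover g → ℂ} (hf : IsTest f) :
    ev (distConj T) f = conj (ev T fun u => conj (f u)) := by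
  rw [ev_eq _ hf, ev_eq _ hf.conj]
  change (starRingEnd ℂ) (T _) = _
  congr 2
  refine Subtype.ext (funext fun u => ?_)
  change (starRingEnd ℂ) (periodizeFun _ f u) = _
  rw [conj_periodizeFun _ hf]
  simp [periodize]

/-! ### Covariant derivatives of test functions and of their periodizations -/

/-- The real and imaginary parts of a complex tangent vector. -/
def reT (xi : CTangent g) : Cover g := (fun i => (xi.1 i).re, fun i => (xi.2 i).re)

def imT (xi : CTangent g) : Cover g := (fun i => (xi.1 i).im, fun i => (xi.2 i).im)

lemma norm_reT_le (xi : CTangent g) : ‖reT xi‖ ≤ ‖xi‖ := by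
  refine norm_prod_le_iff.2 ⟨(pi_norm_le_iff_of_nonneg (norm_nonneg _)).2 fun i => ?_,
    (pi_norm_le_iff_of_nonneg (norm_nonneg _)).2 fun i => ?_⟩
  · exact (abs_re_le_norm _).trans ((norm_le_pi_norm xi.1 i).trans (norm_fst_le xi))
  · exact (abs_re_le_norm _).trans ((norm_le_pi_norm xi.2 i).trans (norm_snd_le xi))

lemma norm_imT_le (xi : CTangent g) : ‖imT xi‖ ≤ ‖xi‖ := by
  refine norm_prod_le_iff.2 ⟨(pi_norm_le_iff_of_nonneg (norm_nonneg _)).2 fun i => ?_,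
    (pi_norm_le_iff_of_nonneg (norm_nonneg _)).2 fun i => ?_⟩
  · exact (abs_im_le_norm _).trans ((norm_le_pi_norm xi.1 i).trans (norm_fst_le xi))
  · exact (abs_im_le_norm _).trans ((norm_le_pi_norm xi.2 i).trans (norm_snd_le xi))

lemma covDerivFun_eq (j : ℤ) (xi : CTangent g) (f : Cover g → ℂ) (u : Cover g) :
    covDerivFun j xi f u = fderiv ℝ f u (reT xi) + I * fderiv ℝ f u (imT xi)
      - j * Real.pi * I * f u * (omega u (reT xi) + I * omega u (imT xi)) := by
  rw [covDerivFun, omegaC_eq]; rfl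

lemma contDiff_omega_left' (v : Cover g) :
    ContDiff ℝ ∞ (fun u : Cover g => ((omega u v : ℝ) : ℂ)) :=
  ofRealCLM.contDiff.comp (contDiff_omega_left v)

lemma contDiff_omegaC (xi : CTangent g) : ContDiff ℝ ∞ (fun u : Cover g => omegaC u xi) := by
  simp only [omegaC_eq]
  exact (contDiff_omega_left' _).add (contDiff_const.mul (contDiff_omega_left' _))

lemma IsTest.covDerivFun {f : Cover g → ℂ} (hf : IsTest f) (j : ℤ) (xi : CTangent g) :
    IsTest (covDerivFun j xi f) := by
  have h := ((hf.fderiv_apply (reT xi)).add ((hf.fderiv_apply (imT xi)).const_mul I)).sub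
    ((hf.mul_left (contDiff_omegaC xi)).const_mul (j * Real.pi * I))
  have : TorusQuantization.covDerivFun j xi f = fun u => fderiv ℝ f u (reT xi) + I * fderiv ℝ f u (imT xi)
      - j * Real.pi * I * (omegaC u xi * f u) := by
    funext u
    rw [covDerivFun_eq, omegaC_eq]
    simp only [reT, imT]
    ring
  rw [this]
  exact h

lemma covDerivFun_congr {j : ℤ} {xi : CTangent g} {f f' : Cover g → ℂ} {u : Cover g}
    (h : f =ᶠ[𝓝 u] f') : covDerivFun j xi f u = covDerivFun j xi f' u := by
  simp only [covDerivFun, h.fderiv_eq, h.eq_of_nhds]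

lemma covDerivFun_sum {ι : Type*} {s : Finset ι} {j : ℤ} {xi : CTangent g} {f : ι → Cover g → ℂ}
    {u : Cover g} (h : ∀ i ∈ s, DifferentiableAt ℝ (f i) u) :
    covDerivFun j xi (fun u => ∑ i ∈ s, f i u) u = ∑ i ∈ s, covDerivFun j xi (f i) u := by
  simp only [covDerivFun, fderiv_fun_sum h, Finset.sum_sub_distrib, Finset.sum_add_distrib,
    Finset.mul_sum, Finset.sum_mul, _root_.sum_apply]

/-- The derivative of the multiplier cancels the change of the connection form under u ↦ u + λ. This
is why the connection descends to the torus and commutes with periodization. -/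
lemma covDerivFun_mult_translate (j : ℤ) (xi : CTangent g) {f : Cover g → ℂ}
    (hf : Differentiable ℝ f) (l : Lattice g) (u : Cover g) :
    covDerivFun j xi (fun u => mult (-j) l u * f (u + latt l)) u =
      mult (-j) l u * covDerivFun j xi f (u + latt l) := by
  have h1 : HasFDerivAt (fun u => f (u + latt l)) (fderiv ℝ f (u + latt l)) u := by
    have := (hf (u + latt l)).hasFDerivAt.comp u ((hasFDerivAt_id u).add_const (latt l))
    rwa [ContinuousLinearMap.comp_id] at this
  have h2 := (hasFDerivAt_mult (-j) l u).fun_mul h1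
  simp only [covDerivFun_eq, omega_add_left]
  rw [h2.fderiv]
  simp only [omegaCLM, _root_.add_apply, _root_.smul_apply, ContinuousLinearMap.comp_apply,
    smul_eq_mul, ofRealCLM_apply, LinearMap.coe_toContinuousLinearMap', LinearMap.coe_mk,
    AddHom.coe_mk, omega_antisymm (latt l)]
  push_cast
  ring

lemma covDerivFun_periodizeFun (j : ℤ) (xi : CTangent g) {f : Cover g → ℂ} (hf : IsTest f) :
    covDerivFun j xi (periodizeFun j f) = periodizeFun j (covDerivFun j xi f) := by
  classical
  funext u
  have h1 := finite_translates hf.2 (isCompact_closedBall u 1)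
  have h2 := finite_translates (hf.covDerivFun j xi).2 (isCompact_singleton (x := u))
  have hev : periodizeFun j f =ᶠ[𝓝 u]
      fun v => ∑ l ∈ h1.toFinset ∪ h2.toFinset, mult (-j) l v * f (v + latt l) := by
    filter_upwards [Metric.closedBall_mem_nhds u one_pos] with v hv
    refine periodizeFun_eq_sum j fun l hl => ?_
    simp only [Finset.mem_union, Finite.mem_toFinset]
    exact .inl ⟨v, hv, hl⟩
  have hd : Differentiable ℝ f := hf.1.differentiable (by simp)
  rw [covDerivFun_congr hev, covDerivFun_sum, periodizeFun_eq_sum j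
    (F := h1.toFinset ∪ h2.toFinset) fun l hl => by
      simp only [Finset.mem_union, Finite.mem_toFinset]; exact .inr ⟨u, rfl, hl⟩]
  · exact Finset.sum_congr rfl fun l _ => covDerivFun_mult_translate j xi hd l u
  · intro l _
    exact ((contDiff_mult (-j) l).differentiable (by simp) u).mul
      (hd.comp (differentiable_id.add_const _) u)

/-- `T` is covariantly constant along `xi`. -/
def IsParallel {j : ℤ} (T : DistSec g j) (xi : CTangent g) : Prop :=
  ∀ phi : Sec g (-j), T (covDeriv (-j) xi phi) = 0

lemma IsParallel.ev_covDerivFun {j : ℤ} {T : DistSec g j} {xi : CTangent g}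
    (h : IsParallel T xi) {f : Cover g → ℂ} (hf : IsTest f) :
    ev T (covDerivFun (-j) xi f) = 0 := by
  rw [ev_eq T (hf.covDerivFun _ _), ← h (periodize (-j) hf)]
  congr 1
  exact Subtype.ext (covDerivFun_periodizeFun (-j) xi hf).symm

/-! ### Modulation -/

/-- The standard pairing of `ℝ²ᵍ` with its dual. -/
def dotR (u eta : Cover g) : ℝ := u.1 ⬝ᵥ eta.1 + u.2 ⬝ᵥ eta.2

/-- The pairing of a real covector with a complex vector. -/
def dotC (eta : Cover g) (xi : CTangent g) : ℂ := dotR (reT xi) eta + I * dotR (imT xi) eta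

/-- The character `exp (-2π i ⟨u, η⟩)`. -/
def chr (eta u : Cover g) : ℂ := exp (-(2 * Real.pi * I * (dotR u eta : ℂ)))

lemma dotR_add_left (u v eta : Cover g) : dotR (u + v) eta = dotR u eta + dotR v eta := by
  simp [dotR, add_dotProduct]; ring

lemma dotR_smul_left (c : ℝ) (u eta : Cover g) : dotR (c • u) eta = c * dotR u eta := by
  simp [dotR, smul_dotProduct]; ring

lemma dotR_comm (u eta : Cover g) : dotR u eta = dotR eta u := by
  simp [dotR, dotProduct_comm]

/-- The pairing with a covector as a continuous linear functional. -/
def dotCLM (eta : Cover g) : Cover g →L[ℝ] ℝ :=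
  LinearMap.toContinuousLinearMap
    { toFun := fun u => dotR u eta
      map_add' := fun u v => dotR_add_left u v eta
      map_smul' := fun c u => dotR_smul_left c u eta }

@[simp] lemma dotCLM_apply (eta u : Cover g) : dotCLM eta u = dotR u eta := rfl

lemma abs_dotR_le (u eta : Cover g) : |dotR u eta| ≤ 2 * g * ‖u‖ * ‖eta‖ := by
  have h (a b : Fin g → ℝ) : |a ⬝ᵥ b| ≤ g * ‖a‖ * ‖b‖ := by
    refine (Finset.abs_sum_le_sum_abs _ _).trans ?_
    have : ∀ i ∈ Finset.univ, |a i * b i| ≤ ‖a‖ * ‖b‖ := fun i _ => by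
      rw [abs_mul]
      exact mul_le_mul (norm_le_pi_norm a i) (norm_le_pi_norm b i) (abs_nonneg _) (norm_nonneg _)
    refine (Finset.sum_le_sum this).trans_eq ?_
    simp; ring
  have h1 := h u.1 eta.1
  have h2 := h u.2 eta.2
  have e1 : g * ‖u.1‖ * ‖eta.1‖ ≤ g * ‖u‖ * ‖eta‖ := by
    gcongr
    exacts [norm_fst_le u, norm_fst_le eta]
  have e2 : g * ‖u.2‖ * ‖eta.2‖ ≤ g * ‖u‖ * ‖eta‖ := by
    gcongr
    exacts [norm_snd_le u, norm_snd_le eta]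
  calc |dotR u eta| ≤ |u.1 ⬝ᵥ eta.1| + |u.2 ⬝ᵥ eta.2| := abs_add_le _ _
    _ ≤ 2 * g * ‖u‖ * ‖eta‖ := by linarith

lemma norm_dotCLM_le (eta : Cover g) : ‖dotCLM eta‖ ≤ 2 * g * ‖eta‖ :=
  ContinuousLinearMap.opNorm_le_bound _ (by positivity) fun u => by
    rw [dotCLM_apply, Real.norm_eq_abs]
    exact (abs_dotR_le u eta).trans_eq (by ring)

lemma chr_eq (eta : Cover g) :
    chr eta = fun u => cexp (I * (((-(2 * Real.pi)) • dotCLM eta) u : ℝ)) := by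
  funext u
  simp only [chr, _root_.smul_apply, dotCLM_apply, smul_eq_mul]
  congr 1
  push_cast
  ring

lemma contDiff_chr (eta : Cover g) : ContDiff ℝ ∞ (chr eta) := by
  rw [chr_eq]
  have : ContDiff ℝ ∞ fun u : Cover g => (((-(2 * Real.pi)) • dotCLM eta) u : ℂ) :=
    ofRealCLM.contDiff.comp ((-(2 * Real.pi)) • dotCLM eta).contDiff
  fun_prop

lemma chr_add (eta zeta u : Cover g) : chr (eta + zeta) u = chr eta u * chr zeta u := by
  simp only [chr, ← Complex.exp_add, dotR_comm u, dotR_add_left]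
  congr 1
  push_cast
  ring

lemma IsTest.mul_chr {f : Cover g → ℂ} (hf : IsTest f) (eta : Cover g) :
    IsTest (fun u => f u * chr eta u) :=
  hf.mul_right (contDiff_chr eta)

lemma distFourier_eq {j : ℤ} (T : DistSec g j) (f : TestFn g) (eta : Cover g) :
    distFourier T f eta = ev T (fun u => f.1 u * chr eta u) := by
  rw [ev, dif_pos (IsTest.mul_chr f.2 eta)]
  rfl

/-- Each derivative falling on the character costs a factor linear in 1 + ‖η‖. This polynomial loss
is what the integrations by parts in `exists_decay` have to outweigh. -/
lemma exists_ckBound_mul_chr (g K : ℕ) : ∃ C, 0 ≤ C ∧ ∀ (f : Cover g → ℂ) (M : ℝ) (eta : Cover g),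
    ContDiff ℝ ∞ f → CkBound K M f → CkBound K (C * M * (1 + ‖eta‖) ^ K) (fun u => f u * chr eta u) := by
  let c : ℝ := 1 + 2 * Real.pi * (2 * g)
  have hc : 1 ≤ c := by
    have : 0 ≤ 2 * Real.pi * (2 * g) := by positivity
    linarith
  refine ⟨2 ^ K * c ^ K, by positivity, fun f M eta hf h => ?_⟩
  have h1 : ∀ n ≤ K, ∀ u ∈ univ, ‖iteratedFDeriv ℝ n (chr eta) u‖ ≤ c ^ K * (1 + ‖eta‖) ^ K := by
    intro n hn u _
    rw [chr_eq, ← mul_pow]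
    refine (norm_iteratedFDeriv_cexp_linear _ n u).trans ?_
    have hL : ‖(-(2 * Real.pi)) • dotCLM eta‖ ≤ c * (1 + ‖eta‖) := by
      rw [norm_smul, norm_neg, Real.norm_of_nonneg (by positivity)]
      have := norm_dotCLM_le eta
      have hp := Real.pi_pos
      have h0 := norm_nonneg eta
      calc 2 * Real.pi * ‖dotCLM eta‖ ≤ 2 * Real.pi * (2 * g * ‖eta‖) := by gcongr
        _ = (2 * Real.pi * (2 * g)) * ‖eta‖ := by ring
        _ ≤ c * (1 + ‖eta‖) := by
          gcongr
          · simp [c]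
          · linarith
    have h2 : 1 ≤ c * (1 + ‖eta‖) := by nlinarith [norm_nonneg eta]
    exact (pow_le_pow_left₀ (norm_nonneg _) hL n).trans (pow_le_pow_right₀ h2 hn)
  have := h.mul hf (contDiff_chr eta) (subset_univ _) h1 (by positivity)
  simp only [mul_comm (f _)]
  exact this.mono le_rfl (le_of_eq (by ring))

lemma covDerivFun_mul_chr (j : ℤ) (xi : CTangent g) {f : Cover g → ℂ} (hf : Differentiable ℝ f)
    (eta u : Cover g) :
    covDerivFun j xi (fun u => f u * chr eta u) u =
      covDerivFun j xi f u * chr eta u - 2 * Real.pi * I * dotC eta xi * (f u * chr eta u) := by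
  have h0 : HasFDerivAt (fun u => ((dotR u eta : ℝ) : ℂ)) (ofRealCLM.comp (dotCLM eta)) u :=
    (ofRealCLM.comp (dotCLM eta)).hasFDerivAt
  have h1 : HasFDerivAt (chr eta) _ u := (h0.const_mul (2 * Real.pi * I)).fun_neg.cexp
  have h2 := (hf u).hasFDerivAt.fun_mul h1
  simp only [covDerivFun_eq]
  rw [h2.fderiv]
  simp only [_root_.add_apply, _root_.smul_apply, _root_.neg_apply, ContinuousLinearMap.comp_apply,
    smul_eq_mul, ofRealCLM_apply, dotCLM_apply, dotC, chr]
  ring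

/-- Fourier transforms of localized parallel distributional sections. -/
lemma IsParallel.dotC_mul_ev {j : ℤ} {T : DistSec g j} {xi : CTangent g}
    (h : IsParallel T xi) {f : Cover g → ℂ} (hf : IsTest f) (eta : Cover g) :
    2 * Real.pi * I * dotC eta xi * ev T (fun u => f u * chr eta u) =
      ev T (fun u => covDerivFun (-j) xi f u * chr eta u) := by
  have h1 := h.ev_covDerivFun (hf.mul_chr eta)
  have h2 : covDerivFun (-j) xi (fun u => f u * chr eta u) = fun u =>
      covDerivFun (-j) xi f u * chr eta u - 2 * Real.pi * I * dotC eta xi * (f u * chr eta u) :=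
    funext fun u => covDerivFun_mul_chr _ _ (hf.1.differentiable (by simp)) eta u
  rw [h2, ev_sub T ((hf.covDerivFun _ _).mul_chr eta) ((hf.mul_chr eta).const_mul _),
    ev_const_mul T (hf.mul_chr eta), sub_eq_zero] at h1
  exact h1.symm

lemma tsupport_fderiv_apply_subset {E : Type*} [NormedAddCommGroup E] [NormedSpace ℝ E]
    (f : E → ℂ) (v : E) : tsupport (fun u => fderiv ℝ f u v) ⊆ tsupport f := by
  refine (closure_mono fun u hu => ?_).trans (tsupport_fderiv_subset ℝ (f := f))
  intro h
  exact hu (by simp [h])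

lemma tsupport_covDerivFun_subset (j : ℤ) (xi : CTangent g) (f : Cover g → ℂ) :
    tsupport (covDerivFun j xi f) ⊆ tsupport f := by
  refine closure_minimal (fun u hu => ?_) (isClosed_tsupport f)
  by_contra h
  refine hu ?_
  have h1 : f u = 0 := image_eq_zero_of_notMem_tsupport h
  have h2 : fderiv ℝ f u = 0 := by
    by_contra h0
    exact h (tsupport_fderiv_subset ℝ (subset_tsupport _ h0))
  simp [covDerivFun_eq, h1, h2]

/-- Bounds on the covariant derivatives, uniform in the direction. -/
lemma exists_ckBound_covDerivFun (j : ℤ) {B : Set (Cover g)} (hB : IsCompact B) (K : ℕ) (R : ℝ) :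
    ∃ C, 0 ≤ C ∧ ∀ (f : Cover g → ℂ) (M : ℝ) (xi : CTangent g), IsTest f → tsupport f ⊆ B →
      ‖xi‖ ≤ R → CkBound (K + 1) M f → CkBound K (C * M) (covDerivFun j xi f) := by
  have hc1 (i : Fin g) : ContDiff ℝ ∞ fun u : Cover g => ((u.1 i : ℝ) : ℂ) :=
    ofRealCLM.contDiff.comp (by fun_prop)
  have hc2 (i : Fin g) : ContDiff ℝ ∞ fun u : Cover g => ((u.2 i : ℝ) : ℂ) :=
    ofRealCLM.contDiff.comp (by fun_prop)
  choose C1 hC1 h1 using fun i => exists_ckBound_mul (hc1 i) hB K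
  choose C2 hC2 h2 using fun i => exists_ckBound_mul (hc2 i) hB K
  refine ⟨2 * |R| + ‖(j * Real.pi * I : ℂ)‖ * ∑ i, |R| * (C2 i + C1 i), by
    have : ∀ i, 0 ≤ |R| * (C2 i + C1 i) := fun i =>
      mul_nonneg (abs_nonneg _) (add_nonneg (hC2 i) (hC1 i))
    have := Finset.sum_nonneg fun i (_ : i ∈ Finset.univ) => this i
    positivity, fun f M xi hf hfB hxi h => ?_⟩
  have hM := h.nonneg
  have hxi' := hxi.trans (le_abs_self R)
  have hK : CkBound K M f := h.mono (Nat.le_succ K) le_rfl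
  have e : covDerivFun j xi f = fun u => (fderiv ℝ f u (reT xi) + I * fderiv ℝ f u (imT xi))
      + -(j * Real.pi * I) * ∑ i, (xi.1 i * ((u.2 i : ℂ) * f u) + -xi.2 i * ((u.1 i : ℂ) * f u)) := by
    funext u
    have : ∑ i, (xi.1 i * ((u.2 i : ℂ) * f u) + -xi.2 i * ((u.1 i : ℂ) * f u)) = f u * omegaC u xi := by
      rw [omegaC, Finset.mul_sum]
      exact Finset.sum_congr rfl fun i _ => by ring
    rw [this, covDerivFun]
    simp only [reT, imT]
    ring
  have hd1 := hf.fderiv_apply (reT xi)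
  have hd2 := hf.fderiv_apply (imT xi)
  have b1 := (h.fderiv_apply hf.1 (reT xi)).add ((h.fderiv_apply hf.1 (imT xi)).const_mul hd2.1 I)
    hd1.1 (hd2.const_mul I).1
  have b2 := CkBound.sum (s := Finset.univ) (f := fun i (u : Cover g) =>
      xi.1 i * ((u.2 i : ℂ) * f u) + -xi.2 i * ((u.1 i : ℂ) * f u))
    (fun i _ => ((h2 i f M hf.1 hfB hK).const_mul ((hc2 i).mul hf.1) (xi.1 i)).add
      ((h1 i f M hf.1 hfB hK).const_mul ((hc1 i).mul hf.1) (-xi.2 i))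
      (contDiff_const.mul ((hc2 i).mul hf.1)) (contDiff_const.mul ((hc1 i).mul hf.1)))
    (fun i _ => (contDiff_const.mul ((hc2 i).mul hf.1)).add
      (contDiff_const.mul ((hc1 i).mul hf.1)))
  have c2 : ContDiff ℝ ∞ fun u : Cover g =>
      ∑ i, (xi.1 i * ((u.2 i : ℂ) * f u) + -xi.2 i * ((u.1 i : ℂ) * f u)) :=
    ContDiff.sum fun i _ => (contDiff_const.mul ((hc2 i).mul hf.1)).add
      (contDiff_const.mul ((hc1 i).mul hf.1))
  rw [e]
  refine (b1.add (b2.const_mul c2 _) (hd1.add (hd2.const_mul I)).1 (contDiff_const.mul c2)).mono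
    le_rfl ?_
  rw [add_mul, norm_neg, norm_I, one_mul]
  refine add_le_add ?_ ?_
  · have r1 := (norm_reT_le xi).trans hxi'
    have r2 := (norm_imT_le xi).trans hxi'
    calc _ ≤ |R| * M + |R| * M := by gcongr
      _ = _ := by ring
  · rw [mul_assoc ‖(j * Real.pi * I : ℂ)‖]
    refine mul_le_mul_of_nonneg_left ?_ (norm_nonneg _)
    rw [Finset.sum_mul]
    refine Finset.sum_le_sum fun i _ => ?_
    have r1 : ‖xi.1 i‖ ≤ |R| := ((norm_le_pi_norm xi.1 i).trans (norm_fst_le xi)).trans hxi'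
    have r2 : ‖-xi.2 i‖ ≤ |R| := by
      rw [norm_neg]; exact ((norm_le_pi_norm xi.2 i).trans (norm_snd_le xi)).trans hxi'
    calc _ ≤ |R| * (C2 i * M) + |R| * (C1 i * M) := by
          have := mul_nonneg (hC1 i) hM
          have := mul_nonneg (hC2 i) hM
          gcongr
      _ = _ := by ring

/-- Continuity of a distributional section on functions supported in `B`. -/
def EvBound {j : ℤ} (T : DistSec g j) (B : Set (Cover g)) (N : ℕ) (C : ℝ) : Prop :=
  ∀ (f : Cover g → ℂ) (M : ℝ), IsTest f → tsupport f ⊆ B → CkBound N M f → ‖ev T f‖ ≤ C * M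

/-- Decay of the Fourier transform of a localized parallel section. -/
lemma exists_decay (j : ℤ) {B : Set (Cover g)} (hB : IsCompact B) (N : ℕ) (C R : ℝ) (n : ℕ) :
    ∃ D, 0 ≤ D ∧ ∀ (T : DistSec g j) (xi : CTangent g) (f : Cover g → ℂ) (M : ℝ) (eta : Cover g),
      EvBound T B N C → ‖xi‖ ≤ R → IsParallel T xi → IsTest f → tsupport f ⊆ B →
      CkBound (N + n) M f →
      ‖dotC eta xi‖ ^ n * ‖ev T (fun u => f u * chr eta u)‖ ≤ D * M * (1 + ‖eta‖) ^ N := by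
  induction n with
  | zero =>
    obtain ⟨C', hC', h⟩ := exists_ckBound_mul_chr g N
    refine ⟨|C| * C', by positivity, fun T xi f M eta hT _ _ hf hfB hM => ?_⟩
    rw [pow_zero, one_mul]
    have h1 := h f M eta hf.1 hM
    have hsupp : tsupport (fun u => f u * chr eta u) ⊆ B := by
      refine (closure_mono fun u hu => ?_).trans hfB
      exact left_ne_zero_of_mul hu
    refine (hT _ _ (hf.mul_chr eta) hsupp h1).trans ?_
    calc _ ≤ |C| * (C' * M * (1 + ‖eta‖) ^ N) := by
          refine mul_le_mul_of_nonneg_right (le_abs_self C) h1.nonneg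
      _ = _ := by ring
  -- One integration by parts: since `T` is parallel along `xi`, the factor `dotC eta xi` is traded
  -- for a covariant derivative of `f`, at the price of one more derivative in the bound. The factor
  -- 2π is at least 1 and is dropped.
  | succ n ih =>
    obtain ⟨D, hD, h⟩ := ih
    obtain ⟨C', hC', h'⟩ := exists_ckBound_covDerivFun (-j) hB (N + n) R
    refine ⟨D * C', by positivity, fun T xi f M eta hT hxi hp hf hfB hM => ?_⟩
    have h1 := h T xi (covDerivFun (-j) xi f) (C' * M) eta hT hxi hp (hf.covDerivFun _ _)
      ((tsupport_covDerivFun_subset _ _ _).trans hfB) (h' f M xi hf hfB hxi hM)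
    rw [← hp.dotC_mul_ev hf eta, norm_mul, norm_mul] at h1
    have h2 : (1 : ℝ) ≤ ‖(2 * Real.pi * I : ℂ)‖ := by
      simp only [norm_mul, norm_I, mul_one, norm_real, Real.norm_eq_abs, abs_of_pos Real.pi_pos,
        Complex.norm_ofNat]
      linarith [Real.pi_gt_three]
    calc _ = ‖dotC eta xi‖ ^ n * (1 * ‖dotC eta xi‖ * ‖ev T fun u => f u * chr eta u‖) := by ring
      _ ≤ ‖dotC eta xi‖ ^ n * (‖(2 * Real.pi * I : ℂ)‖ * ‖dotC eta xi‖ *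
          ‖ev T fun u => f u * chr eta u‖) := by gcongr
      _ ≤ D * (C' * M) * (1 + ‖eta‖) ^ N := h1
      _ = _ := by ring

/-! ### Parseval's formula on the cover -/

/-- The cover as a Euclidean space. -/
def euclEquiv (g : ℕ) : EuclideanSpace ℝ (Fin g ⊕ Fin g) ≃L[ℝ] Cover g :=
  (EuclideanSpace.equiv (Fin g ⊕ Fin g) ℝ).trans
    (LinearEquiv.sumArrowLequivProdArrow (Fin g) (Fin g) ℝ ℝ).toContinuousLinearEquiv

lemma measurePreserving_euclEquiv (g : ℕ) : MeasurePreserving (euclEquiv g) volume volume :=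
  (volume_measurePreserving_sumPiEquivProdPi (fun _ : Fin g ⊕ Fin g => ℝ)).comp
    (PiLp.volume_preserving_ofLp (Fin g ⊕ Fin g))

lemma integral_euclEquiv {F : Type*} [NormedAddCommGroup F] [NormedSpace ℝ F] (f : Cover g → F) :
    ∫ x, f (euclEquiv g x) = ∫ u, f u :=
  (measurePreserving_euclEquiv g).integral_comp
    (euclEquiv g).toHomeomorph.measurableEmbedding f

lemma dotR_euclEquiv (x y : EuclideanSpace ℝ (Fin g ⊕ Fin g)) :
    dotR (euclEquiv g x) (euclEquiv g y) = inner ℝ x y := by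
  simp only [PiLp.inner_apply, Fintype.sum_sum_type, dotR, dotProduct]
  congr 1 <;> exact Finset.sum_congr rfl fun i _ => by simp [euclEquiv, mul_comm]

/-- The Fourier transform of a function on the cover. -/
def coverFourier (a : Cover g → ℂ) (eta : Cover g) : ℂ := ∫ u, a u * chr eta u

lemma coverFourier_euclEquiv (a : Cover g → ℂ) (w : EuclideanSpace ℝ (Fin g ⊕ Fin g)) :
    coverFourier a (euclEquiv g w) =
      FourierTransform.fourier (fun x => a (euclEquiv g x)) w := by
  rw [coverFourier, ← integral_euclEquiv, Real.fourier_eq']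
  refine integral_congr_ae (Eventually.of_forall fun x => ?_)
  simp only [chr, dotR_euclEquiv, smul_eq_mul]
  rw [mul_comm]
  congr 2
  push_cast
  ring

/-- Write `a` as the inverse transform of its transform and move the inverse transform onto `b`;
there it is the transform at -η. The argument runs for Schwartz functions on Euclidean space and is
carried to the cover, whose norm is a sup norm. -/
lemma parseval {a b : Cover g → ℂ} (ha : IsTest a) (hb : IsTest b) :
    ∫ u, a u * b u = ∫ eta, coverFourier a eta * coverFourier b (-eta) := by
  have hA : IsTest fun x => a (euclEquiv g x) :=
    ha.comp_homeo (euclEquiv g).toHomeomorph (euclEquiv g).contDiff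
  have hB : IsTest fun x => b (euclEquiv g x) :=
    hb.comp_homeo (euclEquiv g).toHomeomorph (euclEquiv g).contDiff
  set A := hA.2.toSchwartzMap hA.1 with hAdef
  set B := hB.2.toSchwartzMap hB.1 with hBdef
  rw [← integral_euclEquiv, ← integral_euclEquiv]
  have h := SchwartzMap.integral_fourierInv_mul_eq (FourierTransform.fourier A) B
  rw [FourierTransform.fourierInv_fourier_eq] at h
  refine (Eq.trans ?_ h).trans ?_
  · rfl
  · refine integral_congr_ae (Eventually.of_forall fun w => ?_)
    change _ = coverFourier a (euclEquiv g w) * coverFourier b (-(euclEquiv g w))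
    rw [← map_neg, coverFourier_euclEquiv, coverFourier_euclEquiv, ← Real.fourierInv_eq_fourier_neg,
      SchwartzMap.fourier_coe, SchwartzMap.fourierInv_coe]
    rfl

/-! ### Products of Fourier transforms of transverse families -/

/-- On a bounded set 1 - chr d is O(‖d‖) with all its derivatives: order zero uses |e^{ix} - 1| ≤
|x|, and the higher orders carry a power of ‖d‖ that is at most ‖d‖ because ‖d‖ ≤ 1. -/
lemma exists_ckBound_mul_one_sub_chr {B : Set (Cover g)} (hB : IsCompact B) (K : ℕ) :
    ∃ C, 0 ≤ C ∧ ∀ (f : Cover g → ℂ) (M : ℝ) (d : Cover g), ContDiff ℝ ∞ f → tsupport f ⊆ B →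
      CkBound K M f → ‖d‖ ≤ 1 → CkBound K (C * ‖d‖ * M) (fun u => (1 - chr d u) * f u) := by
  obtain ⟨R, hR⟩ := hB.isBounded.exists_norm_le
  let c : ℝ := 1 + 2 * Real.pi * (2 * g)
  have hpos : 0 ≤ 2 * Real.pi * (2 * g) := by positivity
  have hc : 1 ≤ c := by linarith
  have hL (d : Cover g) : ‖(-(2 * Real.pi)) • dotCLM d‖ ≤ c * ‖d‖ := by
    rw [norm_smul, norm_neg, Real.norm_of_nonneg (by positivity)]
    have := norm_dotCLM_le d
    calc 2 * Real.pi * ‖dotCLM d‖ ≤ 2 * Real.pi * (2 * g * ‖d‖) := by gcongr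
      _ = (2 * Real.pi * (2 * g)) * ‖d‖ := by ring
      _ ≤ c * ‖d‖ := by gcongr; simp [c]
  refine ⟨2 ^ K * (c ^ K + c * |R|), by positivity, fun f M d hf hfB h hd => ?_⟩
  have h1 : ContDiff ℝ ∞ fun u => 1 - chr d u := contDiff_const.sub (contDiff_chr d)
  refine (h.mul hf h1 hfB (M' := (c ^ K + c * |R|) * ‖d‖) (fun n hn u hu => ?_)
    (by positivity)).mono le_rfl (le_of_eq (by ring))
  cases n with
  | zero =>
    rw [norm_iteratedFDeriv_zero, chr_eq, norm_sub_rev]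
    change ‖cexp (I * _) - 1‖ ≤ _
    refine (Real.norm_exp_I_mul_ofReal_sub_one_le).trans ?_
    refine (ContinuousLinearMap.le_opNorm _ u).trans ?_
    have hu' : ‖u‖ ≤ |R| := (hR u hu).trans (le_abs_self R)
    calc _ ≤ c * ‖d‖ * |R| := by gcongr; exact hL d
      _ ≤ _ := by nlinarith [mul_nonneg (pow_nonneg (zero_le_one.trans hc) K) (norm_nonneg d)]
  | succ n =>
    have e : iteratedFDeriv ℝ (n + 1) (fun u => 1 - chr d u) u =
        -iteratedFDeriv ℝ (n + 1) (chr d) u := by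
      have : (fun u => 1 - chr d u) = (fun _ => (1 : ℂ)) - chr d := rfl
      rw [this, iteratedFDeriv_sub_apply contDiff_const.contDiffAt
        ((contDiff_chr d).of_le (by exact_mod_cast le_top)).contDiffAt,
        iteratedFDeriv_const_of_ne (Nat.succ_ne_zero n)]
      simp
    rw [e, norm_neg, chr_eq]
    refine (norm_iteratedFDeriv_cexp_linear _ _ u).trans ?_
    calc _ ≤ (c * ‖d‖) ^ (n + 1) := by gcongr; exact hL d
      _ = c ^ (n + 1) * ‖d‖ ^ (n + 1) := mul_pow _ _ _
      _ ≤ c ^ K * ‖d‖ := by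
        gcongr
        exact pow_le_of_le_one (norm_nonneg _) hd (Nat.succ_ne_zero n)
      _ ≤ _ := by
        have : 0 ≤ c * |R| * ‖d‖ := by positivity
        linarith

/-- The constant depends on `T` only through `N` and `C`, so Fourier transforms of a family with a
common `EvBound` are equicontinuous. `tendsto_pairing` uses this to pass from a dense set of
frequencies to all of them. -/
lemma EvBound.norm_sub_le {B : Set (Cover g)} (hB : IsCompact B) (j : ℤ) (N : ℕ) (C : ℝ) :
    ∃ D, 0 ≤ D ∧ ∀ (T : DistSec g j) (f : Cover g → ℂ) (M : ℝ) (eta d : Cover g), EvBound T B N C →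
      IsTest f → tsupport f ⊆ B → CkBound N M f → ‖d‖ ≤ 1 →
      ‖ev T (fun u => f u * chr eta u) - ev T (fun u => f u * chr (eta + d) u)‖ ≤
        D * ‖d‖ * M * (1 + ‖eta‖) ^ N := by
  obtain ⟨C1, hC1, h1⟩ := exists_ckBound_mul_one_sub_chr hB N
  obtain ⟨C2, hC2, h2⟩ := exists_ckBound_mul_chr g N
  refine ⟨|C| * (C2 * C1), by positivity, fun T f M eta d hT hf hfB hM hd => ?_⟩
  have b1 := h1 f M d hf.1 hfB hM hd
  have hf' : IsTest fun u => (1 - chr d u) * f u :=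
    hf.mul_left (contDiff_const.sub (contDiff_chr d))
  have b2 := h2 _ _ eta hf'.1 b1
  have e : (fun u => (1 - chr d u) * f u * chr eta u) =
      fun u => f u * chr eta u - f u * chr (eta + d) u := by
    funext u
    rw [chr_add]
    ring
  rw [e] at b2
  rw [← ev_sub T (hf.mul_chr eta) (hf.mul_chr _)]
  have hsupp : tsupport (fun u => f u * chr eta u - f u * chr (eta + d) u) ⊆ B := by
    refine (closure_mono fun u hu => ?_).trans hfB
    intro h0
    exact hu (by simp [h0])
  refine (hT _ _ ((hf.mul_chr eta).sub (hf.mul_chr _)) hsupp b2).trans ?_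
  calc _ ≤ |C| * (C2 * (C1 * ‖d‖ * M) * (1 + ‖eta‖) ^ N) :=
        mul_le_mul_of_nonneg_right (le_abs_self C) b2.nonneg
    _ = _ := by ring

lemma EvBound.continuous {B : Set (Cover g)} (hB : IsCompact B) {j : ℤ} {N : ℕ} {C : ℝ}
    {T : DistSec g j} (hT : EvBound T B N C) {f : Cover g → ℂ} (hf : IsTest f)
    (hfB : tsupport f ⊆ B) : Continuous fun eta => ev T (fun u => f u * chr eta u) := by
  obtain ⟨D, hD, h⟩ := EvBound.norm_sub_le hB j N C
  obtain ⟨M, hM⟩ := hf.exists_ckBound N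
  refine continuous_iff_continuousAt.2 fun eta => ?_
  rw [ContinuousAt, tendsto_iff_norm_sub_tendsto_zero]
  have h2 : Tendsto (fun z : Cover g => D * ‖z - eta‖ * M * (1 + ‖eta‖) ^ N) (𝓝 eta) (𝓝 0) := by
    have : Continuous fun z : Cover g => D * ‖z - eta‖ * M * (1 + ‖eta‖) ^ N := by fun_prop
    simpa using this.tendsto eta
  refine squeeze_zero' (Eventually.of_forall fun _ => norm_nonneg _) ?_ h2
  filter_upwards [Metric.closedBall_mem_nhds eta one_pos] with z hz
  have := h T f M eta (z - eta) hT hf hfB hM (by rwa [← dist_eq_norm])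
  rwa [add_sub_cancel, norm_sub_rev] at this

/-- A pair of distributional sections that are bounded on functions supported in `B`, and such that
each covector is detected by a direction along which one of them is parallel. -/
structure Transverse {j j' : ℤ} (T : DistSec g j) (T' : DistSec g j') (B : Set (Cover g)) (N : ℕ)
    (C R c : ℝ) : Prop where
  left : EvBound T B N C
  right : EvBound T' B N C
  detect : ∀ eta : Cover g, (∃ xi, ‖xi‖ ≤ R ∧ IsParallel T xi ∧ c * ‖eta‖ ≤ ‖dotC eta xi‖) ∨
    ∃ xi, ‖xi‖ ≤ R ∧ IsParallel T' xi ∧ c * ‖eta‖ ≤ ‖dotC eta xi‖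

lemma dotC_neg (eta : Cover g) (xi : CTangent g) : dotC (-eta) xi = -dotC eta xi := by
  simp [dotC, dotR]; ring

/-- At each covector one of the two factors decays as fast as desired, by `detect` and
`exists_decay`, while the other grows at most like (1 + ‖η‖)^N. The constant is the same for all
pairs with given `N`, `C`, `R`, `c`, which makes the bound usable for limits. -/
lemma exists_bound_mul (j j' : ℤ) {B : Set (Cover g)} (hB : IsCompact B) (N : ℕ) (C R : ℝ) {c : ℝ}
    (hc : 0 < c) : ∃ (K : ℕ) (D : ℝ), 0 ≤ D ∧ ∀ (T : DistSec g j) (T' : DistSec g j')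
      (f f' : Cover g → ℂ) (M M' : ℝ) (eta : Cover g), Transverse T T' B N C R c →
      IsTest f → tsupport f ⊆ B → CkBound K M f → IsTest f' → tsupport f' ⊆ B → CkBound K M' f' →
      ‖ev T (fun u => f u * chr eta u) * ev T' (fun u => f' u * chr (-eta) u)‖ ≤
        D * M * M' * (1 + ‖eta‖) ^ (-(2 * g + 1 : ℝ)) := by
  -- The summand 2N absorbs the growth of both factors, and 2g + 1 exceeds the dimension of the
  -- frequency space.
  set n := 2 * N + (2 * g + 1) with hn
  obtain ⟨D0, hD0, h0⟩ := exists_decay j hB N C R 0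
  obtain ⟨D1, hD1, h1⟩ := exists_decay j hB N C R n
  obtain ⟨E0, hE0, k0⟩ := exists_decay j' hB N C R 0
  obtain ⟨E1, hE1, k1⟩ := exists_decay j' hB N C R n
  refine ⟨N + n, 2 ^ n * (D0 * E0 + (D1 * E0 + D0 * E1) / c ^ n), by positivity,
    fun T T' f f' M M' eta hT hf hfB hM hf' hfB' hM' => ?_⟩
  have hM0 := hM.nonneg
  have hM0' := hM'.nonneg
  set x := ‖ev T fun u => f u * chr eta u‖ with hx
  set y := ‖ev T' fun u => f' u * chr (-eta) u‖ with hy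
  set z := 1 + ‖eta‖ with hz
  have hz1 : 1 ≤ z := by simp [hz]
  have hx0 : 0 ≤ x := norm_nonneg _
  have hy0 : 0 ≤ y := norm_nonneg _
  -- a parallel direction is not needed for the crude bounds
  have hp0 {i : ℤ} (S : DistSec g i) : IsParallel S 0 := fun phi => by
    have : covDeriv (-i) 0 phi = 0 := by
      refine Subtype.ext (funext fun u => ?_)
      change covDerivFun (-i) 0 phi.1 u = 0
      simp only [covDerivFun, omegaC]
      simp
      erw [map_zero]
      simp
    rw [this, map_zero]
  have bx : x ≤ D0 * M * z ^ N := by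
    -- A negative `R` is impossible, since `detect` exhibits a vector of norm at most `R`; for R ≥ 0
    -- the zero vector is an admissible direction.
    rcases lt_or_ge R 0 with hR | hR
    · exfalso
      rcases hT.detect 0 with ⟨xi, h, -⟩ | ⟨xi, h, -⟩ <;>
      exact absurd ((norm_nonneg xi).trans h) (not_le.2 hR)
    · simpa using h0 T 0 f M eta hT.left (by simpa using hR) (hp0 T) hf hfB
        (hM.mono (by omega) le_rfl)
  have by' : y ≤ E0 * M' * z ^ N := by
    rcases lt_or_ge R 0 with hR | hR
    · exfalso
      rcases hT.detect 0 with ⟨xi, h, -⟩ | ⟨xi, h, -⟩ <;>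
      exact absurd ((norm_nonneg xi).trans h) (not_le.2 hR)
    · simpa using k0 T' 0 f' M' (-eta) hT.right (by simpa using hR) (hp0 T') hf' hfB'
        (hM'.mono (by omega) le_rfl)
  have hcn : 0 < c ^ n := pow_pos hc n
  have key : ‖eta‖ ^ n * (x * y) ≤ (D1 * E0 + D0 * E1) / c ^ n * (M * M') * z ^ (2 * N) := by
    have hzz : z ^ (2 * N) = z ^ N * z ^ N := by rw [two_mul, pow_add]
    rw [div_mul_eq_mul_div, div_mul_eq_mul_div, le_div_iff₀ hcn, hzz]
    rcases hT.detect eta with ⟨xi, hxi, hp, hd⟩ | ⟨xi, hxi, hp, hd⟩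
    · have b := h1 T xi f M eta hT.left hxi hp hf hfB hM
      have : (c * ‖eta‖) ^ n * x ≤ D1 * M * z ^ N :=
        (mul_le_mul_of_nonneg_right (pow_le_pow_left₀ (by positivity) hd n) hx0).trans b
      calc ‖eta‖ ^ n * (x * y) * c ^ n = ((c * ‖eta‖) ^ n * x) * y := by rw [mul_pow]; ring
        _ ≤ (D1 * M * z ^ N) * (E0 * M' * z ^ N) := by gcongr
        _ ≤ (D1 * M * z ^ N) * (E0 * M' * z ^ N) + (D0 * M * z ^ N) * (E1 * M' * z ^ N) := by
          have : 0 ≤ (D0 * M * z ^ N) * (E1 * M' * z ^ N) := by positivity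
          linarith
        _ = _ := by ring
    · have b := k1 T' xi f' M' (-eta) hT.right hxi hp hf' hfB' hM'
      rw [dotC_neg, norm_neg, norm_neg] at b
      have : (c * ‖eta‖) ^ n * y ≤ E1 * M' * z ^ N :=
        (mul_le_mul_of_nonneg_right (pow_le_pow_left₀ (by positivity) hd n) hy0).trans b
      calc ‖eta‖ ^ n * (x * y) * c ^ n = x * ((c * ‖eta‖) ^ n * y) := by rw [mul_pow]; ring
        _ ≤ (D0 * M * z ^ N) * (E1 * M' * z ^ N) := by gcongr
        _ ≤ (D1 * M * z ^ N) * (E0 * M' * z ^ N) + (D0 * M * z ^ N) * (E1 * M' * z ^ N) := by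
          have : 0 ≤ (D1 * M * z ^ N) * (E0 * M' * z ^ N) := by positivity
          linarith
        _ = _ := by ring
  have hzn : z ^ n ≤ 2 ^ n * (1 + ‖eta‖ ^ n) := by
    refine (add_pow_le zero_le_one (norm_nonneg eta) n).trans ?_
    rw [one_pow]
    gcongr
    · norm_num
    · omega
  -- The crude bound `b0` takes care of bounded η and `key` of large η. Adding them, through (1 +
  -- x)^n ≤ 2^n (1 + x^n), avoids a case distinction.
  have tot : z ^ n * (x * y) ≤
      2 ^ n * (D0 * E0 + (D1 * E0 + D0 * E1) / c ^ n) * M * M' * z ^ (2 * N) := by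
    have b0 : x * y ≤ D0 * E0 * (M * M') * z ^ (2 * N) := by
      calc x * y ≤ (D0 * M * z ^ N) * (E0 * M' * z ^ N) := by gcongr
        _ = _ := by rw [two_mul, pow_add]; ring
    calc z ^ n * (x * y) ≤ 2 ^ n * (1 + ‖eta‖ ^ n) * (x * y) := by gcongr
      _ = 2 ^ n * (x * y + ‖eta‖ ^ n * (x * y)) := by ring
      _ ≤ 2 ^ n * (D0 * E0 * (M * M') * z ^ (2 * N) +
          (D1 * E0 + D0 * E1) / c ^ n * (M * M') * z ^ (2 * N)) := by gcongr
      _ = _ := by ring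
  have hzp : 0 < z ^ (2 * g + 1) := by positivity
  have hr : z ^ (-(2 * g + 1 : ℝ)) = (z ^ (2 * g + 1))⁻¹ := by
    rw [Real.rpow_neg (by positivity), ← Real.rpow_natCast]
    push_cast
    rfl
  rw [norm_mul, hr, ← div_eq_mul_inv, le_div_iff₀ hzp]
  have hz2 : 0 < z ^ (2 * N) := by positivity
  refine le_of_mul_le_mul_right ?_ hz2
  calc x * y * z ^ (2 * g + 1) * z ^ (2 * N) = z ^ n * (x * y) := by rw [hn, pow_add]; ring
    _ ≤ _ := tot

/-- `∫ F(η) F'(-η) dη` for the Fourier transforms of `f T` and `f' T'`. -/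
def pairing {j j' : ℤ} (T : DistSec g j) (T' : DistSec g j') (f f' : Cover g → ℂ) : ℂ :=
  ∫ eta, ev T (fun u => f u * chr eta u) * ev T' (fun u => f' u * chr (-eta) u)

lemma integrable_rpow_cover (g : ℕ) :
    Integrable fun eta : Cover g => (1 + ‖eta‖) ^ (-(2 * g + 1 : ℝ)) := by
  refine integrable_one_add_norm ?_
  simp
  linarith

lemma Transverse.integrable {j j' : ℤ} {T : DistSec g j} {T' : DistSec g j'} {B : Set (Cover g)}
    (hB : IsCompact B) {N : ℕ} {C R c : ℝ} (hc : 0 < c) (h : Transverse T T' B N C R c)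
    {f f' : Cover g → ℂ} (hf : IsTest f) (hfB : tsupport f ⊆ B) (hf' : IsTest f')
    (hfB' : tsupport f' ⊆ B) :
    Integrable fun eta => ev T (fun u => f u * chr eta u) * ev T' (fun u => f' u * chr (-eta) u) := by
  obtain ⟨K, D, hD, hb⟩ := exists_bound_mul j j' hB N C R hc
  obtain ⟨M, hM⟩ := hf.exists_ckBound K
  obtain ⟨M', hM'⟩ := hf'.exists_ckBound K
  refine ((integrable_rpow_cover g).const_mul (D * M * M')).mono' ?_
    (Eventually.of_forall fun eta => hb T T' f f' M M' eta h hf hfB hM hf' hfB' hM')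
  exact ((h.left.continuous hB hf hfB).mul
    ((h.right.continuous hB hf' hfB').comp continuous_neg)).aestronglyMeasurable

lemma exists_norm_pairing_le (j j' : ℤ) {B : Set (Cover g)} (hB : IsCompact B) (N : ℕ) (C R : ℝ)
    {c : ℝ} (hc : 0 < c) : ∃ (K : ℕ) (D : ℝ), 0 ≤ D ∧ ∀ (T : DistSec g j) (T' : DistSec g j')
      (f f' : Cover g → ℂ) (M M' : ℝ), Transverse T T' B N C R c →
      IsTest f → tsupport f ⊆ B → CkBound K M f → IsTest f' → tsupport f' ⊆ B → CkBound K M' f' →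
      ‖pairing T T' f f'‖ ≤ D * M * M' := by
  obtain ⟨K, D, hD, hb⟩ := exists_bound_mul j j' hB N C R hc
  refine ⟨K, D * ∫ eta : Cover g, (1 + ‖eta‖) ^ (-(2 * g + 1 : ℝ)), by positivity,
    fun T T' f f' M M' h hf hfB hM hf' hfB' hM' => ?_⟩
  refine (norm_integral_le_of_norm_le ((integrable_rpow_cover g).const_mul (D * M * M'))
    (Eventually.of_forall fun eta => hb T T' f f' M M' eta h hf hfB hM hf' hfB' hM')).trans ?_
  rw [integral_const_mul]
  exact le_of_eq (by ring)

lemma EvBound.of_tendsto {ι : Type*} {l : Filter ι} [l.NeBot] {j : ℤ} {T : ι → DistSec g j}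
    {S : DistSec g j} (hT : Tendsto T l (𝓝 S)) {B : Set (Cover g)} {N : ℕ} {C : ℝ}
    (h : ∀ᶠ i in l, EvBound (T i) B N C) : EvBound S B N C := by
  intro f M hf hfB hM
  refine le_of_tendsto (((continuous_ev f).tendsto S).comp hT).norm ?_
  filter_upwards [h] with i hi
  exact hi f M hf hfB hM

/-- Convergence of the pairing along an arbitrary filter. -/
lemma tendsto_pairing {ι : Type*} {l : Filter ι} [l.NeBot] {j j' : ℤ} {T : ι → DistSec g j}
    {T' : ι → DistSec g j'} {S : DistSec g j} {S' : DistSec g j'} (hT : Tendsto T l (𝓝 S))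
    (hT' : Tendsto T' l (𝓝 S')) {B : Set (Cover g)} (hB : IsCompact B) {N : ℕ} {C R c : ℝ}
    (hc : 0 < c) (h : ∀ᶠ i in l, Transverse (T i) (T' i) B N C R c) {f f' : Cover g → ℂ}
    (hf : IsTest f) (hfB : tsupport f ⊆ B) (hf' : IsTest f') (hfB' : tsupport f' ⊆ B) :
    Tendsto (fun i => pairing (T i) (T' i) f f') l (𝓝 (pairing S S' f f')) := by
  -- Dominated convergence is applied along a countably generated filter, whereas `l` is arbitrary.
  -- So `l` is replaced by a coarser filter `G` that remembers only the Fourier transforms at the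
  -- countably many frequencies in `Q` and the transversality bounds.
  obtain ⟨Q, hQc, hQ⟩ := TopologicalSpace.exists_countable_dense (Cover g)
  have : Countable Q := hQc.to_subtype
  let Φ : ι → (Q → ℂ) × (Q → ℂ) := fun i => (fun q => ev (T i) fun u => f u * chr q.1 u,
    fun q => ev (T' i) fun u => f' u * chr q.1 u)
  let a : (Q → ℂ) × (Q → ℂ) := (fun q => ev S fun u => f u * chr q.1 u,
    fun q => ev S' fun u => f' u * chr q.1 u)
  let G : Filter ι := comap Φ (𝓝 a) ⊓ 𝓟 {i | Transverse (T i) (T' i) B N C R c}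
  have hlG : l ≤ G := by
    refine le_inf (map_le_iff_le_comap.1 ?_) (le_principal_iff.2 h)
    refine Tendsto.prodMk_nhds ?_ ?_
    · exact tendsto_pi_nhds.2 fun q => ((continuous_ev _).tendsto S).comp hT
    · exact tendsto_pi_nhds.2 fun q => ((continuous_ev _).tendsto S').comp hT'
  have hG : ∀ᶠ i in G, Transverse (T i) (T' i) B N C R c :=
    mem_inf_of_right (mem_principal_self _)
  refine Tendsto.mono_left ?_ hlG
  have hSl : EvBound S B N C := EvBound.of_tendsto hT (h.mono fun i hi => hi.left)
  have hSr : EvBound S' B N C := EvBound.of_tendsto hT' (h.mono fun i hi => hi.right)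
  -- pointwise convergence follows from equicontinuity
  have point {j : ℤ} {T : ι → DistSec g j} {S : DistSec g j} {f : Cover g → ℂ} (hf : IsTest f)
      (hfB : tsupport f ⊆ B) (hS : EvBound S B N C) (hE : ∀ᶠ i in G, EvBound (T i) B N C)
      (hq : ∀ q : Q, Tendsto (fun i => ev (T i) fun u => f u * chr q.1 u) G
        (𝓝 (ev S fun u => f u * chr q.1 u))) (eta : Cover g) :
      Tendsto (fun i => ev (T i) fun u => f u * chr eta u) G
        (𝓝 (ev S fun u => f u * chr eta u)) := by
    obtain ⟨D, hD, hd⟩ := EvBound.norm_sub_le hB j N C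
    obtain ⟨M, hM⟩ := hf.exists_ckBound N
    rw [Metric.tendsto_nhds]
    intro e he
    -- This is the Lipschitz constant at `eta`; the added 1 makes it positive, so that one may
    -- divide by it.
    set A := D * M * (1 + ‖eta‖) ^ N + 1 with hA
    have hM0 := hM.nonneg
    have hA0 : 0 < A := by positivity
    obtain ⟨q, hqQ, hq1⟩ := hQ.exists_dist_lt eta (ε := min 1 (e / 3 / A)) (by positivity)
    have hq2 : ‖q - eta‖ ≤ 1 := by
      rw [← dist_eq_norm, dist_comm]; exact (hq1.trans_le (min_le_left _ _)).le
    have hq3 : ‖q - eta‖ < e / 3 / A := by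
      rw [← dist_eq_norm, dist_comm]; exact hq1.trans_le (min_le_right _ _)
    have hlip (V : DistSec g j) (hV : EvBound V B N C) :
        dist (ev V fun u => f u * chr eta u) (ev V fun u => f u * chr q u) < e / 3 := by
      have := hd V f M eta (q - eta) hV hf hfB hM hq2
      rw [add_sub_cancel] at this
      rw [dist_eq_norm]
      refine this.trans_lt ?_
      calc D * ‖q - eta‖ * M * (1 + ‖eta‖) ^ N = (A - 1) * ‖q - eta‖ := by rw [hA]; ring
        _ ≤ A * ‖q - eta‖ := by gcongr; linarith
        _ < A * (e / 3 / A) := by gcongr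
        _ = e / 3 := by field_simp
    filter_upwards [hE, Metric.tendsto_nhds.1 (hq ⟨q, hqQ⟩) (e / 3) (by positivity)] with i hi1 hi2
    have t1 := hlip _ hi1
    have t2 := hlip _ hS
    rw [dist_comm] at t2
    calc _ ≤ _ := dist_triangle4 _ (ev (T i) fun u => f u * chr q u) (ev S fun u => f u * chr q u) _
      _ < e / 3 + e / 3 + e / 3 := by gcongr
      _ = e := by ring
  have hΦ : Tendsto Φ G (𝓝 a) := tendsto_comap.mono_left inf_le_left
  have p1 := point hf hfB hSl (hG.mono fun i hi => hi.left)
    fun q => ((continuous_apply q).comp continuous_fst).tendsto a |>.comp hΦ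
  have p2 := point hf' hfB' hSr (hG.mono fun i hi => hi.right)
    fun q => ((continuous_apply q).comp continuous_snd).tendsto a |>.comp hΦ
  obtain ⟨K, D, hD, hb⟩ := exists_bound_mul j j' hB N C R hc
  obtain ⟨M, hM⟩ := hf.exists_ckBound K
  obtain ⟨M', hM'⟩ := hf'.exists_ckBound K
  refine tendsto_integral_filter_of_dominated_convergence
    (fun eta => D * M * M' * (1 + ‖eta‖) ^ (-(2 * g + 1 : ℝ))) ?_ ?_
    ((integrable_rpow_cover g).const_mul _) ?_
  · filter_upwards [hG] with i hi
    exact (hi.integrable hB hc hf hfB hf' hfB').aestronglyMeasurable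
  · filter_upwards [hG] with i hi
    exact Eventually.of_forall fun eta => hb _ _ f f' M M' eta hi hf hfB hM hf' hfB' hM'
  · exact Eventually.of_forall fun eta => (p1 eta).mul (p2 (-eta))

/-- For smooth sections the pairing is an integral. -/
lemma pairing_eq_integral {j j' : ℤ} (s : Sec g j) {T' : DistSec g j'} {b : Cover g → ℂ}
    (hb : ContDiff ℝ ∞ b) (hT' : ∀ f, IsTest f → ev T' f = ∫ u, b u * f u) {f f' : Cover g → ℂ}
    (hf : IsTest f) (hf' : IsTest f') :
    pairing (smoothDist s) T' f f' = ∫ u, (s.1 u * f u) * (b u * f' u) := by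
  rw [parseval (hf.mul_left s.2.1) (hf'.mul_left hb), pairing]
  congr 1
  funext eta
  rw [ev_smoothDist s (hf.mul_chr eta), hT' _ (hf'.mul_chr _)]
  simp only [coverFourier, mul_assoc]

/-! ### Complex Gaussian integrals -/

/-- A real vector as a complex one. -/
def toC (v : Fin g → ℝ) : Fin g → ℂ := fun i => (v i : ℂ)

lemma toC_add (v w : Fin g → ℝ) : toC (v + w) = toC v + toC w := by ext; simp [toC]

lemma toC_smul (c : ℝ) (v : Fin g → ℝ) : toC (c • v) = (c : ℂ) • toC v := by ext; simp [toC]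

/-- The quadratic form `ᵗv A v`. -/
def quad (A : Matrix (Fin g) (Fin g) ℂ) (v : Fin g → ℝ) : ℂ := toC v ⬝ᵥ (A *ᵥ toC v)

lemma detInvSqrt_eq (A : Matrix (Fin g) (Fin g) ℂ) :
    detInvSqrt A = ∫ v : Fin g → ℝ, exp (-(Real.pi * quad A v)) := rfl

/-- The real part of the quadratic form of `A` is positive definite. -/
def RePos (A : Matrix (Fin g) (Fin g) ℂ) : Prop := ∀ v : Fin g → ℝ, v ≠ 0 → 0 < (quad A v).re

lemma quad_smul (A : Matrix (Fin g) (Fin g) ℂ) (c : ℝ) (v : Fin g → ℝ) :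
    quad A (c • v) = c ^ 2 * quad A v := by
  simp only [quad, toC_smul, mulVec_smul, dotProduct_smul, smul_dotProduct, smul_eq_mul]
  ring

lemma continuous_quad : Continuous fun p : Matrix (Fin g) (Fin g) ℂ × (Fin g → ℝ) => quad p.1 p.2 := by
  have h (i : Fin g) : Continuous fun p : Matrix (Fin g) (Fin g) ℂ × (Fin g → ℝ) => (p.2 i : ℂ) :=
    continuous_ofReal.comp ((continuous_apply i).comp continuous_snd)
  have h' (i j : Fin g) : Continuous fun p : Matrix (Fin g) (Fin g) ℂ × (Fin g → ℝ) => p.1 i j :=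
    (continuous_apply j).comp ((continuous_apply i).comp continuous_fst)
  simp only [quad, dotProduct, mulVec, toC]
  exact continuous_finsetSum _ fun i _ => (h i).mul
    (continuous_finsetSum _ fun j _ => (h' i j).mul (h j))

/-- On the compact unit sphere the lower bound persists for nearby matrices, and homogeneity extends
it to all `v`. Stating it with ∑ vᵢ² makes the resulting Gaussian majorant a product of one-variable
functions. -/
lemma RePos.eventually {A : Matrix (Fin g) (Fin g) ℂ} (hA : RePos A) :
    ∃ d > 0, ∀ᶠ A' in 𝓝 A, ∀ v : Fin g → ℝ, d * ∑ i, v i ^ 2 ≤ (quad A' v).re := by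
  rcases Nat.eq_zero_or_pos g with rfl | hg
  · refine ⟨1, one_pos, Eventually.of_forall fun A' v => ?_⟩
    simp [quad, dotProduct]
  have hg' : (0 : ℝ) < g := by exact_mod_cast hg
  have hcont : Continuous fun p : Matrix (Fin g) (Fin g) ℂ × (Fin g → ℝ) => (quad p.1 p.2).re :=
    continuous_re.comp continuous_quad
  have hS : IsCompact (Metric.sphere (0 : Fin g → ℝ) 1) := isCompact_sphere _ _
  have : Nonempty (Fin g) := ⟨⟨0, hg⟩⟩
  have hne : (Metric.sphere (0 : Fin g → ℝ) 1).Nonempty := ⟨fun _ => 1, by simp [pi_norm_const]⟩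
  obtain ⟨v0, hv0, hmin⟩ := hS.exists_isMinOn hne
    (hcont.comp (Continuous.prodMk_right A)).continuousOn
  have hv0' : v0 ≠ 0 := by rintro rfl; simp at hv0
  set m := (quad A v0).re with hm
  have hm0 : 0 < m := hA v0 hv0'
  have hev : ∀ᶠ A' in 𝓝 A, ∀ v ∈ Metric.sphere (0 : Fin g → ℝ) 1, m / 2 < (quad A' v).re := by
    refine hS.eventually_forall_of_forall_eventually fun v hv => ?_
    have h0 : m ≤ (quad A v).re := hmin hv
    have h1 : m / 2 < (quad A v).re := by linarith
    exact hcont.continuousAt.eventually (lt_mem_nhds h1)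
  -- The division by `g` comes from ∑ vᵢ² ≤ g ‖v‖², the norm being the sup norm.
  refine ⟨m / 2 / g, by positivity, hev.mono fun A' h v => ?_⟩
  have hsum : ∑ i, v i ^ 2 ≤ g * ‖v‖ ^ 2 := by
    have : ∀ i ∈ Finset.univ, v i ^ 2 ≤ ‖v‖ ^ 2 := fun i _ => by
      rw [← sq_abs]
      exact pow_le_pow_left₀ (abs_nonneg _) (norm_le_pi_norm v i) 2
    simpa using Finset.sum_le_sum this
  have hle : m / 2 * ‖v‖ ^ 2 ≤ (quad A' v).re := by
    rcases eq_or_ne v 0 with rfl | hv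
    · have h0 : toC (0 : Fin g → ℝ) = 0 := by ext; simp [toC]
      simp [quad, h0]
    · have hn : 0 < ‖v‖ := norm_pos_iff.2 hv
      have h1 := (h (‖v‖⁻¹ • v) (by simp [norm_smul, hn.ne'])).le
      rw [quad_smul] at h1
      have h2 : (((‖v‖⁻¹ : ℝ) : ℂ) ^ 2 * quad A' v).re = (‖v‖ ^ 2)⁻¹ * (quad A' v).re := by
        rw [← ofReal_pow, re_ofReal_mul, inv_pow]
      rw [h2] at h1
      rwa [inv_mul_eq_div, le_div_iff₀ (by positivity)] at h1
  calc m / 2 / g * ∑ i, v i ^ 2 ≤ m / 2 / g * (g * ‖v‖ ^ 2) := by gcongr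
    _ = m / 2 * ‖v‖ ^ 2 := by field_simp
    _ ≤ _ := hle

lemma integrable_exp_neg_sum_sq {d : ℝ} (hd : 0 < d) :
    Integrable fun v : Fin g → ℝ => Real.exp (-(d * ∑ i, v i ^ 2)) := by
  have h : Integrable fun v : Fin g → ℝ => ∏ i, Real.exp (-d * v i ^ 2) :=
    Integrable.fintype_prod fun _ => integrable_exp_neg_mul_sq hd
  refine h.congr (Eventually.of_forall fun v => ?_)
  simp only
  rw [← Real.exp_sum, Finset.mul_sum, ← Finset.sum_neg_distrib]
  simp only [neg_mul]

lemma RePos.continuousAt_detInvSqrt {A : Matrix (Fin g) (Fin g) ℂ} (hA : RePos A) :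
    ContinuousAt detInvSqrt A := by
  obtain ⟨d, hd, h⟩ := hA.eventually
  have : FirstCountableTopology (Matrix (Fin g) (Fin g) ℂ) :=
    inferInstanceAs (FirstCountableTopology (Fin g → Fin g → ℂ))
  have hc (v : Fin g → ℝ) : Continuous fun A' : Matrix (Fin g) (Fin g) ℂ => quad A' v :=
    continuous_quad.comp (Continuous.prodMk_left v)
  refine continuousAt_of_dominated (bound := fun v => Real.exp (-(Real.pi * d * ∑ i, v i ^ 2)))
    (F := fun A' v => exp (-(Real.pi * quad A' v))) ?_ ?_
    (integrable_exp_neg_sum_sq (by positivity)) ?_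
  · refine Eventually.of_forall fun A' => Continuous.aestronglyMeasurable ?_
    have : Continuous fun v => quad A' v := continuous_quad.comp (Continuous.prodMk_right A')
    fun_prop
  · filter_upwards [h] with A' hA'
    refine Eventually.of_forall fun v => ?_
    rw [norm_exp, Real.exp_le_exp, neg_re, re_ofReal_mul, neg_le_neg_iff, mul_assoc]
    exact mul_le_mul_of_nonneg_left (hA' v) Real.pi_pos.le
  · refine Eventually.of_forall fun v => ?_
    have := hc v
    exact Continuous.continuousAt (by fun_prop)

/-- Simultaneous diagonalization of a positive definite and a symmetric real matrix. -/
lemma exists_simultaneous_diagonalization {X Y : Matrix (Fin g) (Fin g) ℝ} (hX : X.PosDef)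
    (hY : Y.IsSymm) : ∃ (P : Matrix (Fin g) (Fin g) ℝ) (d : Fin g → ℝ),
      Pᵀ * X * P = 1 ∧ Pᵀ * Y * P = diagonal d := by
  obtain ⟨U, e, he, hU, hUX⟩ : ∃ (U : Matrix (Fin g) (Fin g) ℝ) (e : Fin g → ℝ), (∀ i, 0 < e i) ∧
      Uᵀ * U = 1 ∧ Uᵀ * X * U = diagonal e := by
    refine ⟨hX.isHermitian.eigenvectorUnitary, hX.isHermitian.eigenvalues,
      hX.eigenvalues_pos, ?_, ?_⟩
    · have := Unitary.coe_star_mul_self hX.isHermitian.eigenvectorUnitary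
      rwa [star_eq_conjTranspose, conjTranspose_eq_transpose_of_trivial] at this
    · have := hX.isHermitian.conjStarAlgAut_star_eigenvectorUnitary
      rw [Unitary.conjStarAlgAut_apply] at this
      simpa [star_eq_conjTranspose, conjTranspose_eq_transpose_of_trivial] using! this
  -- Rescaling the eigenvectors by `S` turns the form of `X` into the identity. An orthogonal change
  -- of basis that diagonalizes the transformed `Y` then leaves the identity alone.
  let S : Matrix (Fin g) (Fin g) ℝ := diagonal fun i => (Real.sqrt (e i))⁻¹
  have hS : Sᵀ = S := diagonal_transpose _
  have h1 : (U * S)ᵀ * X * (U * S) = 1 := by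
    rw [transpose_mul, hS, show S * Uᵀ * X * (U * S) = S * (Uᵀ * X * U) * S by noncomm_ring, hUX,
      diagonal_mul_diagonal, diagonal_mul_diagonal, ← diagonal_one]
    congr 1
    funext i
    have h0 := Real.sqrt_pos.2 (he i)
    have h2 := Real.mul_self_sqrt (he i).le
    field_simp
    rw [sq, h2]
  have hY' : ((U * S)ᵀ * Y * (U * S)).IsHermitian := by
    rw [IsHermitian, conjTranspose_eq_transpose_of_trivial, transpose_mul, transpose_mul _ Y,
      transpose_transpose, hY.eq, Matrix.mul_assoc]
  refine ⟨U * S * hY'.eigenvectorUnitary, hY'.eigenvalues, ?_, ?_⟩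
  · have := Unitary.coe_star_mul_self hY'.eigenvectorUnitary
    rw [star_eq_conjTranspose, conjTranspose_eq_transpose_of_trivial] at this
    rw [transpose_mul, show ∀ V : Matrix (Fin g) (Fin g) ℝ, Vᵀ * (U * S)ᵀ * X * (U * S * V) =
      Vᵀ * ((U * S)ᵀ * X * (U * S)) * V from fun V => by noncomm_ring, h1, mul_one, this]
  · have := hY'.conjStarAlgAut_star_eigenvectorUnitary
    rw [Unitary.conjStarAlgAut_apply] at this
    rw [transpose_mul, show ∀ V : Matrix (Fin g) (Fin g) ℝ, Vᵀ * (U * S)ᵀ * Y * (U * S * V) =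
      Vᵀ * ((U * S)ᵀ * Y * (U * S)) * V from fun V => by noncomm_ring]
    simpa [star_eq_conjTranspose, conjTranspose_eq_transpose_of_trivial] using! this

lemma integral_comp_mulVec {P : Matrix (Fin g) (Fin g) ℝ} (hP : P.det ≠ 0) (f : (Fin g → ℝ) → ℂ) :
    ∫ v, f v = ((|P.det| : ℝ) : ℂ) * ∫ w, f (P *ᵥ w) := by
  have h1 := Real.map_matrix_volume_pi_eq_smul_volume_pi hP
  have hinj : Function.Injective (toLin' P) := by
    refine (injective_iff_map_eq_zero _).2 fun v hv => ?_
    exact eq_zero_of_mulVec_eq_zero hP (by simpa using hv)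
  have hemb : MeasurableEmbedding (toLin' P) :=
    (LinearEquiv.ofInjectiveEndo (toLin' P) hinj).toContinuousLinearEquiv.toHomeomorph.measurableEmbedding
  have h2 := hemb.integral_map (μ := volume) f
  rw [h1, integral_smul_measure] at h2
  have h3 : (ENNReal.ofReal |P.det⁻¹|).toReal = |P.det|⁻¹ := by
    rw [ENNReal.toReal_ofReal (abs_nonneg _), abs_inv]
  rw [h3] at h2
  simp only [toLin'_apply] at h2
  rw [← h2, real_smul]
  have : ((|P.det| : ℝ) : ℂ) ≠ 0 := by exact_mod_cast abs_ne_zero.2 hP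
  push_cast
  field_simp

/-- Simultaneous diagonalization of Re A > 0 and Im A splits the integral into one-dimensional
Gaussians with parameters 1 + i dⱼ. Squaring removes the choice of branch. -/
lemma detInvSqrt_sq {A : Matrix (Fin g) (Fin g) ℂ} (hs : A.IsSymm) (hA : RePos A) :
    detInvSqrt A ^ 2 * A.det = 1 := by
  let X : Matrix (Fin g) (Fin g) ℝ := A.map re
  let Y : Matrix (Fin g) (Fin g) ℝ := A.map im
  have hAXY : A = X.map ofReal + I • Y.map ofReal := by
    ext i j
    simp [X, Y, mul_comm I]
  have hXs : X.IsSymm := by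
    ext i j
    simp [X, hs.apply j i]
  have hYs : Y.IsSymm := by
    ext i j
    simp [Y, hs.apply j i]
  have hX : X.PosDef := by
    refine PosDef.of_dotProduct_mulVec_pos (by
      rw [IsHermitian, conjTranspose_eq_transpose_of_trivial]; exact hXs) fun v hv => ?_
    have h := hA v hv
    have : (quad A v).re = star v ⬝ᵥ X *ᵥ v := by
      simp only [quad, dotProduct, mulVec, toC, re_sum, re_ofReal_mul, X, star_trivial, map_apply]
      refine Finset.sum_congr rfl fun i _ => ?_
      congr 1
      refine Finset.sum_congr rfl fun j _ => ?_
      simp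
    rwa [this] at h
  obtain ⟨P, d, hPX, hPY⟩ := exists_simultaneous_diagonalization hX hYs
  have hPdet : P.det ≠ 0 := by
    intro h
    have := congrArg det hPX
    simp [h] at this
  let Pc : Matrix (Fin g) (Fin g) ℂ := P.map ofReal
  have hmap (M N : Matrix (Fin g) (Fin g) ℝ) :
      (M * N).map ofReal = M.map ofReal * N.map ofReal := Matrix.map_mul (f := ofRealHom)
  have hPA : Pcᵀ * A * Pc = diagonal fun i => 1 + I * d i := by
    have e1 : Pcᵀ * X.map ofReal * Pc = 1 := by
      have := congrArg (fun M => M.map (ofReal : ℝ → ℂ)) hPX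
      simp only [hmap] at this
      simpa [Pc, transpose_map] using this
    have e2 : Pcᵀ * Y.map ofReal * Pc = diagonal fun i => (d i : ℂ) := by
      have := congrArg (fun M => M.map (ofReal : ℝ → ℂ)) hPY
      simp only [hmap] at this
      rw [diagonal_map ofReal_zero] at this
      simpa [Pc, transpose_map] using! this
    rw [hAXY, Matrix.mul_add, Matrix.add_mul, e1, Matrix.mul_smul, Matrix.smul_mul, e2,
      ← diagonal_one, ← diagonal_smul, diagonal_add]
    rfl
  have hquad (w : Fin g → ℝ) : quad A (P *ᵥ w) = ∑ i, (1 + I * d i) * (w i : ℂ) ^ 2 := by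
    have e : toC (P *ᵥ w) = Pc *ᵥ toC w := by
      ext i
      simp [toC, mulVec, dotProduct, Pc]
    have e2 : (Pc *ᵥ toC w) ⬝ᵥ (A *ᵥ (Pc *ᵥ toC w)) = toC w ⬝ᵥ ((Pcᵀ * A * Pc) *ᵥ toC w) := by
      rw [← mulVec_mulVec, ← mulVec_mulVec, dotProduct_mulVec (toC w), vecMul_transpose]
    rw [quad, e, e2, hPA, dotProduct]
    refine Finset.sum_congr rfl fun i _ => ?_
    rw [mulVec_diagonal, toC]
    ring
  have hdetP : Pc.det = P.det := by
    simp only [Pc]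
    exact (RingHom.map_det ofRealHom P).symm
  have hdet : (P.det : ℂ) ^ 2 * A.det = ∏ i, (1 + I * d i) := by
    have := congrArg det hPA
    rw [det_mul, det_mul, det_transpose, det_diagonal, hdetP] at this
    rw [← this]
    ring
  have hint : detInvSqrt A = ((|P.det| : ℝ) : ℂ) * ∏ i, (1 / (1 + I * d i)) ^ (1 / 2 : ℂ) := by
    rw [detInvSqrt_eq, integral_comp_mulVec hPdet]
    congr 1
    have e (w : Fin g → ℝ) : exp (-(Real.pi * quad A (P *ᵥ w))) =
        ∏ i, exp (-(Real.pi * (1 + I * d i)) * (w i : ℂ) ^ 2) := by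
      rw [hquad, ← exp_sum, Finset.mul_sum, ← Finset.sum_neg_distrib]
      congr 1
      exact Finset.sum_congr rfl fun i _ => by ring
    simp only [e]
    rw [integral_fintype_prod_volume_eq_prod (fun i (x : ℝ) =>
      exp (-(Real.pi * (1 + I * d i)) * (x : ℂ) ^ 2))]
    refine Finset.prod_congr rfl fun i _ => ?_
    have hre : 0 < (Real.pi * (1 + I * d i) : ℂ).re := by
      rw [re_ofReal_mul]
      simp [Real.pi_pos]
    rw [integral_gaussian_complex hre]
    congr 1
    have : (Real.pi : ℂ) ≠ 0 := by exact_mod_cast Real.pi_ne_zero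
    have h2 : (1 + I * d i : ℂ) ≠ 0 := by
      intro h
      have := congrArg re h
      simp at this
    field_simp
  have h2 (i : Fin g) : (1 + I * d i : ℂ) ≠ 0 := by
    intro h
    have := congrArg re h
    simp at this
  have hsq : ((|P.det| : ℝ) : ℂ) ^ 2 = (P.det : ℂ) ^ 2 := by
    rw [← ofReal_pow, ← ofReal_pow, sq_abs]
  rw [hint, mul_pow, hsq, ← Finset.prod_pow]
  have e3 (i : Fin g) : ((1 / (1 + I * d i)) ^ (1 / 2 : ℂ) : ℂ) ^ 2 = (1 + I * d i)⁻¹ := by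
    rw [← cpow_nat_mul]
    norm_num
  simp only [e3]
  rw [Finset.prod_inv_distrib, ← hdet]
  have h4 : (P.det : ℂ) ≠ 0 := by exact_mod_cast hPdet
  have h5 : A.det ≠ 0 := by
    intro h
    rw [h, mul_zero] at hdet
    exact Finset.prod_ne_zero_iff.2 (fun i _ => h2 i) hdet.symm
  field_simp

/-! ### The Siegel disc -/

/-- The squared hermitian norm of a complex vector. -/
def nsq (v : Fin g → ℂ) : ℝ := ∑ i, ‖v i‖ ^ 2

lemma nsq_nonneg (v : Fin g → ℂ) : 0 ≤ nsq v := Finset.sum_nonneg fun i _ => by positivity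

lemma nsq_pos {v : Fin g → ℂ} (hv : v ≠ 0) : 0 < nsq v := by
  obtain ⟨i, hi⟩ := Function.ne_iff.1 hv
  refine Finset.sum_pos' (fun i _ => by positivity) ⟨i, Finset.mem_univ _, ?_⟩
  have := norm_pos_iff.2 hi
  positivity

lemma nsq_neg (v : Fin g → ℂ) : nsq (-v) = nsq v := by simp [nsq]

lemma nsq_smul (c : ℂ) (v : Fin g → ℂ) : nsq (c • v) = ‖c‖ ^ 2 * nsq v := by
  simp [nsq, Finset.mul_sum, mul_pow]

lemma star_dotProduct_self (v : Fin g → ℂ) : star v ⬝ᵥ v = (nsq v : ℂ) := by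
  simp [dotProduct, nsq, conj_mul']

lemma star_dotProduct_one_sub_mulVec (t : Matrix (Fin g) (Fin g) ℂ) (v : Fin g → ℂ) :
    star v ⬝ᵥ ((1 - tᴴ * t) *ᵥ v) = ((nsq v - nsq (t *ᵥ v) : ℝ) : ℂ) := by
  rw [sub_mulVec, one_mulVec, dotProduct_sub, star_dotProduct_self, ← mulVec_mulVec,
    dotProduct_mulVec, ← star_mulVec, star_dotProduct_self]
  push_cast
  rfl

lemma isHermitian_one_sub (t : Matrix (Fin g) (Fin g) ℂ) : (1 - tᴴ * t).IsHermitian :=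
  isHermitian_one.sub (isHermitian_conjTranspose_mul_self t)

lemma mem_siegelDisc_iff {t : Matrix (Fin g) (Fin g) ℂ} :
    t ∈ siegelDisc g ↔ t.IsSymm ∧ ∀ v, v ≠ 0 → nsq (t *ᵥ v) < nsq v := by
  refine and_congr_right fun _ => ?_
  rw [posDef_iff_dotProduct_mulVec, and_iff_right (isHermitian_one_sub t)]
  refine forall_congr' fun v => imp_congr_right fun _ => ?_
  rw [star_dotProduct_one_sub_mulVec, ← ofReal_zero, real_lt_real, sub_pos]

lemma mem_closedSiegelDisc_iff {t : Matrix (Fin g) (Fin g) ℂ} :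
    t ∈ closedSiegelDisc g ↔ t.IsSymm ∧ ∀ v, nsq (t *ᵥ v) ≤ nsq v := by
  refine and_congr_right fun _ => ?_
  rw [posSemidef_iff_dotProduct_mulVec, and_iff_right (isHermitian_one_sub t)]
  refine forall_congr' fun v => ?_
  rw [star_dotProduct_one_sub_mulVec, ← ofReal_zero, real_le_real, sub_nonneg]

/-- The disc is cut out by nsq(t v) < nsq v, and t ↦ nsq(t v) is convex. Convexity makes the
interior connected near a boundary pair, which fixes the sign of the half-form pairing in
`exists_hasHalfFormPairing`. -/
lemma convex_siegelDisc : Convex ℝ (siegelDisc g) := by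
  intro t ht t' ht' a b ha hb hab
  rw [mem_siegelDisc_iff] at ht ht' ⊢
  refine ⟨(ht.1.smul a).add (ht'.1.smul b), fun v hv => ?_⟩
  have h1 : nsq ((a • t + b • t') *ᵥ v) ≤ a * nsq (t *ᵥ v) + b * nsq (t' *ᵥ v) := by
    simp only [nsq, Finset.mul_sum, ← Finset.sum_add_distrib, add_mulVec, smul_mulVec]
    refine Finset.sum_le_sum fun i _ => ?_
    have h2 : ‖(a • t *ᵥ v + b • t' *ᵥ v) i‖ ≤ a * ‖(t *ᵥ v) i‖ + b * ‖(t' *ᵥ v) i‖ := by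
      refine (norm_add_le _ _).trans (le_of_eq ?_)
      simp [abs_of_nonneg ha, abs_of_nonneg hb]
    refine (pow_le_pow_left₀ (norm_nonneg _) h2 2).trans ?_
    obtain rfl : b = 1 - a := by linarith
    nlinarith [mul_nonneg (mul_nonneg ha hb) (sq_nonneg (‖(t *ᵥ v) i‖ - ‖(t' *ᵥ v) i‖))]
  refine h1.trans_lt ?_
  have h3 := ht.2 v hv
  have h4 := ht'.2 v hv
  rcases ha.eq_or_lt with rfl | ha'
  · obtain rfl : b = 1 := by linarith
    linarith
  · have : nsq v = a * nsq v + b * nsq v := by rw [← add_mul, hab, one_mul]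
    rw [this]
    exact add_lt_add_of_lt_of_le (mul_lt_mul_of_pos_left h3 ha') (mul_le_mul_of_nonneg_left h4.le hb)

lemma smul_mem_siegelDisc {t : Matrix (Fin g) (Fin g) ℂ} (ht : t ∈ closedSiegelDisc g) {r : ℝ}
    (hr : 0 ≤ r) (hr1 : r < 1) : r • t ∈ siegelDisc g := by
  rw [mem_closedSiegelDisc_iff] at ht
  refine mem_siegelDisc_iff.2 ⟨ht.1.smul r, fun v hv => ?_⟩
  have h : r • t = (r : ℂ) • t := by ext; simp
  rw [h, smul_mulVec, nsq_smul]
  have h1 : ‖(r : ℂ)‖ ^ 2 < 1 := by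
    rw [norm_real, Real.norm_of_nonneg hr]
    nlinarith
  have h2 := nsq_pos hv
  have h3 := ht.2 v
  have h4 := nsq_nonneg (t *ᵥ v)
  nlinarith [sq_nonneg ‖(r : ℂ)‖]

lemma neBot_nhdsWithin_siegelDisc {t t' : Matrix (Fin g) (Fin g) ℂ} (ht : t ∈ closedSiegelDisc g)
    (ht' : t' ∈ closedSiegelDisc g) : (𝓝[siegelDisc g ×ˢ siegelDisc g] (t, t')).NeBot := by
  have h : Tendsto (fun r : ℝ => (r • t, r • t')) (𝓝[Ico 0 1] 1)
      (𝓝[siegelDisc g ×ˢ siegelDisc g] (t, t')) := by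
    refine tendsto_nhdsWithin_iff.2 ⟨?_, ?_⟩
    · have hc : Continuous fun r : ℝ => (r • t, r • t') := by fun_prop
      have := hc.tendsto 1
      simp only [one_smul] at this
      exact this.mono_left nhdsWithin_le_nhds
    · filter_upwards [self_mem_nhdsWithin] with r hr
      exact ⟨smul_mem_siegelDisc ht hr.1 hr.2, smul_mem_siegelDisc ht' hr.1 hr.2⟩
  have : (𝓝[Ico (0 : ℝ) 1] 1).NeBot := by
    rw [← mem_closure_iff_nhdsWithin_neBot, closure_Ico zero_ne_one]
    simp
  exact h.neBot

/-! ### The pairing of half-forms -/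

/-- The Cayley transform `(1 - τ) (1 + τ)⁻¹`. -/
def cayley (t : Matrix (Fin g) (Fin g) ℂ) : Matrix (Fin g) (Fin g) ℂ := (1 - t) * (1 + t)⁻¹

lemma det_one_add_ne_zero {t : Matrix (Fin g) (Fin g) ℂ} (ht : t ∈ siegelDisc g) :
    (1 + t).det ≠ 0 := by
  intro h
  obtain ⟨v, hv, hv'⟩ := exists_mulVec_eq_zero_iff.2 h
  rw [add_mulVec, one_mulVec] at hv'
  have h1 : t *ᵥ v = -v := (neg_eq_of_add_eq_zero_right hv').symm
  have := (mem_siegelDisc_iff.1 ht).2 v hv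
  rw [h1, nsq_neg] at this
  exact lt_irrefl _ this

/-- Sum over coordinates the inequality (x² - |z|²)/2 ≤ x (x + Re z), valid for real x because the
difference of the two sides is |x + z|²/2. -/
lemma rePos_one_add {t : Matrix (Fin g) (Fin g) ℂ} (ht : t ∈ siegelDisc g) : RePos (1 + t) := by
  intro v hv
  have hv' : toC v ≠ 0 := by
    obtain ⟨i, hi⟩ := Function.ne_iff.1 hv
    exact Function.ne_iff.2 ⟨i, by simpa [toC] using hi⟩
  have h := (mem_siegelDisc_iff.1 ht).2 _ hv'
  have h2 : (nsq (toC v) - nsq (t *ᵥ toC v)) / 2 ≤ (quad (1 + t) v).re := by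
    simp only [quad, add_mulVec, one_mulVec, dotProduct, nsq, re_sum, ← Finset.sum_sub_distrib,
      Finset.sum_div, toC, re_ofReal_mul, Pi.add_apply, add_re, ofReal_re, norm_real]
    refine Finset.sum_le_sum fun i _ => ?_
    have := abs_re_le_norm ((t *ᵥ fun i => (v i : ℂ)) i)
    have h3 := sq_le_sq' (neg_le_of_abs_le (this.trans (le_refl _))) (le_of_abs_le this)
    rw [Real.norm_eq_abs, sq_abs]
    change (v i ^ 2 - ‖(t *ᵥ fun i => (v i : ℂ)) i‖ ^ 2) / 2 ≤
      v i * (v i + ((t *ᵥ fun i => (v i : ℂ)) i).re)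
    nlinarith [sq_nonneg (v i + ((t *ᵥ fun i => (v i : ℂ)) i).re)]
  linarith

lemma one_add_mul_inv {t : Matrix (Fin g) (Fin g) ℂ} (ht : t ∈ siegelDisc g) :
    (1 + t) * (1 + t)⁻¹ = 1 :=
  mul_nonsing_inv _ (isUnit_iff_ne_zero.2 (det_one_add_ne_zero ht))

lemma cayley_eq {t : Matrix (Fin g) (Fin g) ℂ} (ht : t ∈ siegelDisc g) :
    cayley t = (2 : ℂ) • (1 + t)⁻¹ - 1 := by
  rw [cayley, show (1 - t) = (2 : ℂ) • (1 : Matrix (Fin g) (Fin g) ℂ) - (1 + t) by rw [two_smul]; abel, Matrix.sub_mul,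
    one_add_mul_inv ht, Matrix.smul_mul, Matrix.one_mul]

lemma isSymm_cayley {t : Matrix (Fin g) (Fin g) ℂ} (ht : t ∈ siegelDisc g) :
    (cayley t).IsSymm := by
  rw [cayley_eq ht, IsSymm, transpose_sub, transpose_smul, transpose_nonsing_inv, transpose_add,
    transpose_one, ht.1.eq]

lemma star_toC (v : Fin g → ℝ) : star (toC v) = toC v := by ext; simp [toC]

/-- With v = (1 + t) w the Cayley transform sends v to (1 - t) w, and Re ⟨(1 + t) w, (1 - t) w⟩ =
|w|² - |t w|². -/
lemma rePos_cayley {t : Matrix (Fin g) (Fin g) ℂ} (ht : t ∈ siegelDisc g) : RePos (cayley t) := by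
  intro v hv
  have hv' : toC v ≠ 0 := by
    obtain ⟨i, hi⟩ := Function.ne_iff.1 hv
    exact Function.ne_iff.2 ⟨i, by simpa [toC] using hi⟩
  set w := (1 + t)⁻¹ *ᵥ toC v with hw
  have e1 : toC v = w + t *ᵥ w := by
    have : (1 + t) *ᵥ w = toC v := by rw [hw, mulVec_mulVec, one_add_mul_inv ht, one_mulVec]
    rw [← this, add_mulVec, one_mulVec]
  have e2 : cayley t *ᵥ toC v = w - t *ᵥ w := by
    rw [cayley, ← mulVec_mulVec, sub_mulVec, one_mulVec]
  have hw0 : w ≠ 0 := by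
    intro h
    rw [h] at e1
    exact hv' (by simpa using e1)
  have h := (mem_siegelDisc_iff.1 ht).2 w hw0
  have e3 : (quad (cayley t) v).re = nsq w - nsq (t *ᵥ w) := by
    rw [quad, e2, ← star_toC, e1]
    simp only [dotProduct, nsq, re_sum, ← Finset.sum_sub_distrib]
    refine Finset.sum_congr rfl fun i _ => ?_
    simp only [Pi.star_apply, Pi.add_apply, Pi.sub_apply, mul_re, ← normSq_eq_norm_sq,
      normSq_apply, RCLike.star_def, conj_re, conj_im, add_re, add_im, sub_re, sub_im]
    ring
  rw [e3]
  linarith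

lemma RePos.add {A B : Matrix (Fin g) (Fin g) ℂ} (hA : RePos A) (hB : RePos B) :
    RePos (A + B) := fun v hv => by
  have : quad (A + B) v = quad A v + quad B v := by simp [quad, add_mulVec]
  rw [this, add_re]
  exact add_pos (hA v hv) (hB v hv)

lemma RePos.smul {A : Matrix (Fin g) (Fin g) ℂ} (hA : RePos A) {c : ℝ} (hc : 0 < c) :
    RePos ((c : ℂ) • A) := fun v hv => by
  have : quad ((c : ℂ) • A) v = c * quad A v := by simp [quad, smul_mulVec]
  rw [this, re_ofReal_mul]
  exact mul_pos hc (hA v hv)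

lemma RePos.map_conj {A : Matrix (Fin g) (Fin g) ℂ} (hA : RePos A) :
    RePos (A.map (starRingEnd ℂ)) := fun v hv => by
  have : quad (A.map (starRingEnd ℂ)) v = conj (quad A v) := by
    simp [quad, dotProduct, mulVec, toC]
  rw [this, conj_re]
  exact hA v hv

/-- The matrix whose determinant enters the pairing of half-forms. -/
def halfFormMatrix (k : ℕ) (t t' : Matrix (Fin g) (Fin g) ℂ) : Matrix (Fin g) (Fin g) ℂ :=
  (((2 * k : ℝ)⁻¹ : ℝ) : ℂ) • (cayley t + (cayley t').map (starRingEnd ℂ))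

lemma halfFormMatrix_eq (k : ℕ) (t t' : Matrix (Fin g) (Fin g) ℂ) :
    (2 * k * I)⁻¹ • (periodMatrix t - (periodMatrix t').map (starRingEnd ℂ)) =
      halfFormMatrix k t t' := by
  have h1 : (periodMatrix t').map (starRingEnd ℂ) = -(I • (cayley t').map (starRingEnd ℂ)) := by
    ext i j
    simp only [periodMatrix, cayley, map_apply, Matrix.smul_apply, smul_eq_mul, map_mul, conj_I,
      Matrix.neg_apply,
      neg_mul]
  rw [h1, sub_neg_eq_add, periodMatrix, ← smul_add, smul_smul, halfFormMatrix, cayley]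
  congr 1
  push_cast
  rw [mul_inv, mul_assoc, inv_mul_cancel₀ I_ne_zero, mul_one]

lemma interiorHalfFormPairing_eq (k : ℕ) (t t' : Matrix (Fin g) (Fin g) ℂ) :
    interiorHalfFormPairing k t t' = (detInvSqrt (1 + t))⁻¹ * conj (detInvSqrt (1 + t'))⁻¹ *
      (detInvSqrt (halfFormMatrix k t t'))⁻¹ := by
  rw [interiorHalfFormPairing, halfFormMatrix_eq]

lemma rePos_halfFormMatrix {k : ℕ} (hk : 0 < k) {t t' : Matrix (Fin g) (Fin g) ℂ}
    (ht : t ∈ siegelDisc g) (ht' : t' ∈ siegelDisc g) : RePos (halfFormMatrix k t t') :=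
  ((rePos_cayley ht).add (rePos_cayley ht').map_conj).smul (by positivity)

lemma isSymm_halfFormMatrix {k : ℕ} {t t' : Matrix (Fin g) (Fin g) ℂ}
    (ht : t ∈ siegelDisc g) (ht' : t' ∈ siegelDisc g) : (halfFormMatrix k t t').IsSymm :=
  ((isSymm_cayley ht).add ((isSymm_cayley ht').map _)).smul _

/-- The identity (1 + t)((1 + t)⁻¹ + (1 + t̄')⁻¹ - 1)(1 + t̄') = 1 - t t̄' cancels every factor that
could blow up where 1 + t or 1 + t' becomes singular. What is left is polynomial in t and t̄', hence
continuous across the boundary. -/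
lemma interiorHalfFormPairing_sq {k : ℕ} (hk : 0 < k) {t t' : Matrix (Fin g) (Fin g) ℂ}
    (ht : t ∈ siegelDisc g) (ht' : t' ∈ siegelDisc g) :
    interiorHalfFormPairing k t t' ^ 2 =
      ((k : ℂ)⁻¹) ^ g * (1 - t * t'.map (starRingEnd ℂ)).det := by
  have key (A : Matrix (Fin g) (Fin g) ℂ) (hs : A.IsSymm) (hA : RePos A) :
      (detInvSqrt A)⁻¹ ^ 2 = A.det := by
    have := detInvSqrt_sq hs hA
    rw [inv_pow]
    exact inv_eq_of_mul_eq_one_right this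
  have hs1 {t : Matrix (Fin g) (Fin g) ℂ} (ht : t ∈ siegelDisc g) : (1 + t).IsSymm :=
    isSymm_one.add ht.1
  have e1 := key _ (hs1 ht) (rePos_one_add ht)
  have e2 := key _ (hs1 ht') (rePos_one_add ht')
  have e3 := key _ (isSymm_halfFormMatrix (k := k) ht ht') (rePos_halfFormMatrix hk ht ht')
  rw [interiorHalfFormPairing_eq, mul_pow, mul_pow, ← map_pow, e1, e2, e3]
  set B := t'.map (starRingEnd ℂ) with hB
  have hdet : conj (1 + t').det = (1 + B).det := by
    rw [RingHom.map_det]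
    congr 1
    ext i j
    simp [hB, Matrix.one_apply]
  have hmap : (1 + t').map (starRingEnd ℂ) = 1 + B := by
    ext i j
    simp [hB, Matrix.one_apply, apply_ite]
  have hinv : ((1 + t')⁻¹).map (starRingEnd ℂ) * (1 + B) = 1 := by
    have h := congrArg (fun M => M.map (starRingEnd ℂ))
      (nonsing_inv_mul (1 + t') (isUnit_iff_ne_zero.2 (det_one_add_ne_zero ht')))
    simp only [Matrix.map_mul, hmap] at h
    rw [h, Matrix.map_one (starRingEnd ℂ) (map_zero _) (map_one _)]
  have hM : halfFormMatrix k t t' =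
      (k : ℂ)⁻¹ • ((1 + t)⁻¹ + ((1 + t')⁻¹).map (starRingEnd ℂ) - 1) := by
    rw [halfFormMatrix, cayley_eq ht, cayley_eq ht']
    have e : ((2 : ℂ) • (1 + t')⁻¹ - 1).map (starRingEnd ℂ) =
        (2 : ℂ) • ((1 + t')⁻¹).map (starRingEnd ℂ) - 1 := by
      rw [Matrix.map_sub _ (map_sub _), Matrix.map_one _ (map_zero _) (map_one _),
        Matrix.map_smul' _ _ _ (map_mul _)]
      rw [map_ofNat]
    rw [e, show ∀ A B : Matrix (Fin g) (Fin g) ℂ, (2 : ℂ) • A - 1 + ((2 : ℂ) • B - 1) =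
      (2 : ℂ) • (A + B - 1) from fun A B => by
        rw [smul_sub, smul_add, two_smul ℂ (1 : Matrix (Fin g) (Fin g) ℂ)]; abel, smul_smul]
    congr 1
    push_cast
    field_simp
  rw [hdet, hM, det_smul, Fintype.card_fin]
  have : (1 + t) * ((1 + t)⁻¹ + ((1 + t')⁻¹).map (starRingEnd ℂ) - 1) * (1 + B) = 1 - t * B := by
    have e : (1 + t) * ((1 + t)⁻¹ + ((1 + t')⁻¹).map (starRingEnd ℂ) - 1) * (1 + B) =
        ((1 + t) * (1 + t)⁻¹) * (1 + B) + (1 + t) * (((1 + t')⁻¹).map (starRingEnd ℂ) * (1 + B))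
          - (1 + t) * (1 + B) := by noncomm_ring
    rw [e, hinv, one_add_mul_inv ht]
    noncomm_ring
  rw [← this, det_mul, det_mul]
  ring

lemma continuousAt_cayley {t : Matrix (Fin g) (Fin g) ℂ} (ht : t ∈ siegelDisc g) :
    ContinuousAt cayley t := by
  have h : ContinuousAt (fun A : Matrix (Fin g) (Fin g) ℂ => A⁻¹) (1 + t) :=
    continuousAt_matrix_inv _ (by
      rw [Ring.inverse_eq_inv']
      exact continuousAt_inv₀ (det_one_add_ne_zero ht))
  have h2 : ContinuousAt (fun t : Matrix (Fin g) (Fin g) ℂ => (1 + t)⁻¹) t :=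
    ContinuousAt.comp (f := fun t => 1 + t) h (by fun_prop)
  exact ContinuousAt.mul (by fun_prop) h2

lemma continuousOn_interiorHalfFormPairing {k : ℕ} (hk : 0 < k) :
    ContinuousOn (fun p : Matrix (Fin g) (Fin g) ℂ × Matrix (Fin g) (Fin g) ℂ =>
      interiorHalfFormPairing k p.1 p.2) (siegelDisc g ×ˢ siegelDisc g) := by
  rintro ⟨t, t'⟩ ⟨ht, ht'⟩
  simp only [interiorHalfFormPairing_eq]
  have ne {A : Matrix (Fin g) (Fin g) ℂ} (hs : A.IsSymm) (hA : RePos A) : detInvSqrt A ≠ 0 := by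
    intro h
    have := detInvSqrt_sq hs hA
    simp [h] at this
  have hs1 {t : Matrix (Fin g) (Fin g) ℂ} (ht : t ∈ siegelDisc g) : (1 + t).IsSymm :=
    isSymm_one.add ht.1
  have c1 : ContinuousAt (fun p : Matrix (Fin g) (Fin g) ℂ × Matrix (Fin g) (Fin g) ℂ =>
      detInvSqrt (1 + p.1)) (t, t') :=
    ContinuousAt.comp (f := fun p : Matrix (Fin g) (Fin g) ℂ × Matrix (Fin g) (Fin g) ℂ =>
      1 + p.1) (rePos_one_add ht).continuousAt_detInvSqrt (by fun_prop)
  have c2 : ContinuousAt (fun p : Matrix (Fin g) (Fin g) ℂ × Matrix (Fin g) (Fin g) ℂ =>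
      detInvSqrt (1 + p.2)) (t, t') :=
    ContinuousAt.comp (f := fun p : Matrix (Fin g) (Fin g) ℂ × Matrix (Fin g) (Fin g) ℂ =>
      1 + p.2) (rePos_one_add ht').continuousAt_detInvSqrt (by fun_prop)
  have d1 : ContinuousAt (fun p : Matrix (Fin g) (Fin g) ℂ × Matrix (Fin g) (Fin g) ℂ =>
      cayley p.1) (t, t') := (continuousAt_cayley ht).comp continuousAt_fst
  have d2 : ContinuousAt (fun p : Matrix (Fin g) (Fin g) ℂ × Matrix (Fin g) (Fin g) ℂ =>
      (cayley p.2).map (starRingEnd ℂ)) (t, t') := by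
    have : Continuous fun A : Matrix (Fin g) (Fin g) ℂ => A.map (starRingEnd ℂ) :=
      continuous_id.matrix_map continuous_conj
    exact this.continuousAt.comp ((continuousAt_cayley ht').comp continuousAt_snd)
  have c3 : ContinuousAt (fun p : Matrix (Fin g) (Fin g) ℂ × Matrix (Fin g) (Fin g) ℂ =>
      detInvSqrt (halfFormMatrix k p.1 p.2)) (t, t') :=
    ContinuousAt.comp (f := fun p : Matrix (Fin g) (Fin g) ℂ × Matrix (Fin g) (Fin g) ℂ =>
      halfFormMatrix k p.1 p.2) (rePos_halfFormMatrix hk ht ht').continuousAt_detInvSqrt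
      ((d1.add d2).const_smul (((2 * k : ℝ)⁻¹ : ℝ) : ℂ))
  refine ContinuousAt.continuousWithinAt ?_
  refine ((c1.inv₀ (ne (hs1 ht) (rePos_one_add ht))).mul ?_).mul
    (c3.inv₀ (ne (isSymm_halfFormMatrix ht ht') (rePos_halfFormMatrix hk ht ht')))
  exact continuous_conj.continuousAt.comp (c2.inv₀ (ne (hs1 ht') (rePos_one_add ht')))

/-! ### Transversality and the continuous extension of the half-form pairing. -/

/-- The element of `𝒫_τ` with coefficients `c`. -/
def polVec (t : Matrix (Fin g) (Fin g) ℂ) (c : Fin g → ℂ) : CTangent g :=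
  (-I • (c - t.map (starRingEnd ℂ) *ᵥ c), c + t.map (starRingEnd ℂ) *ᵥ c)

lemma mem_pol_iff {t : Matrix (Fin g) (Fin g) ℂ} {xi : CTangent g} :
    xi ∈ pol t ↔ ∃ c, polVec t c = xi := by
  rw [pol, Submodule.mem_span_range_iff_exists_fun]
  refine exists_congr fun c => ?_
  have : ∑ i, c i • (((fun l => -I * (1 - t.map (starRingEnd ℂ)) l i,
      fun l => (1 + t.map (starRingEnd ℂ)) l i) : CTangent g)) = polVec t c := by
    rw [Prod.ext_iff, Prod.fst_sum, Prod.snd_sum]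
    have e (l x : Fin g) : c x * (-I * (1 - t.map (starRingEnd ℂ)) l x) =
        -I * ((if l = x then c x else 0) - conj (t l x) * c x) := by
      rw [Matrix.sub_apply, Matrix.one_apply, map_apply]
      split_ifs <;> ring
    constructor <;> ext l
    · simp only [Finset.sum_apply, Pi.smul_apply, Prod.smul_fst, smul_eq_mul, e]
      rw [← Finset.mul_sum, Finset.sum_sub_distrib]
      simp [polVec, mulVec, dotProduct]
    · simp [polVec, mulVec, dotProduct, mul_add, Finset.sum_add_distrib, Matrix.one_apply, mul_ite,
        mul_comm]
  rw [this]

lemma polVec_mem (t : Matrix (Fin g) (Fin g) ℂ) (c : Fin g → ℂ) : polVec t c ∈ pol t :=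
  mem_pol_iff.2 ⟨c, rfl⟩

/-- A null vector v of 1 - t t̄' puts the element of 𝒫_t' with coefficients v into the conjugate of
𝒫_t, which is 𝒫_t. Transversality makes this element zero, and then v = 0. -/
lemma det_one_sub_ne_zero {t t' : Matrix (Fin g) (Fin g) ℂ} (h : IsRealPol t)
    (htr : IsTransverse t t') : (1 - t * t'.map (starRingEnd ℂ)).det ≠ 0 := by
  intro h0
  obtain ⟨v, hv, hv'⟩ := exists_mulVec_eq_zero_iff.2 h0
  rw [sub_mulVec, one_mulVec, sub_eq_zero, ← mulVec_mulVec] at hv'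
  set w := t'.map (starRingEnd ℂ) *ᵥ v with hw
  have h1 : polVec t' v ∈ pol t := by
    have := h _ (polVec_mem t (star w))
    convert this using 1
    have e : star (t.map (starRingEnd ℂ) *ᵥ star w) = v := by
      rw [hv']
      ext i
      simp [mulVec, dotProduct]
    have e' (i) : conj ((t.map (starRingEnd ℂ) *ᵥ star w) i) = v i := congrFun e i
    rw [polVec, polVec, ← hw, CTangent.conj, Prod.ext_iff]
    constructor <;> ext i
    · simp [e']
      ring
    · simp [e', add_comm]
  have h2 : polVec t' v = 0 := by
    simpa using Submodule.disjoint_def.1 htr.disjoint _ h1 (polVec_mem t' v)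
  rw [polVec, ← hw, Prod.mk_eq_zero] at h2
  have h3 : v - w = 0 := by simpa using h2.1
  refine hv ?_
  have h4 : (2 : ℂ) • v = 0 := by
    rw [two_smul]
    calc v + v = (v - w) + (v + w) := by abel
      _ = 0 := by rw [h3, h2.2, add_zero]
  simpa using h4

/-- The pairing of half-forms extends by continuity to transverse pairs. -/
lemma exists_hasHalfFormPairing {k : ℕ} (hk : 0 < k) {t t' : Matrix (Fin g) (Fin g) ℂ}
    (ht : t ∈ closedSiegelDisc g) (ht' : t' ∈ closedSiegelDisc g)
    (h : IsRealPol t) (htr : IsTransverse t t') : ∃ z, HasHalfFormPairing k t t' z := by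
  suffices hs : ∃ z, Tendsto (fun p : Matrix (Fin g) (Fin g) ℂ × Matrix (Fin g) (Fin g) ℂ =>
      interiorHalfFormPairing k p.1 p.2) (𝓝[siegelDisc g ×ˢ siegelDisc g] (t, t')) (𝓝 z) from
    hs.imp fun z hz => ⟨neBot_nhdsWithin_siegelDisc ht ht', hz⟩
  let f : Matrix (Fin g) (Fin g) ℂ × Matrix (Fin g) (Fin g) ℂ → ℂ := fun p =>
    ((k : ℂ)⁻¹) ^ g * (1 - p.1 * p.2.map (starRingEnd ℂ)).det
  have hf : Continuous f := by
    have : Continuous fun A : Matrix (Fin g) (Fin g) ℂ => A.map (starRingEnd ℂ) :=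
      continuous_id.matrix_map continuous_conj
    have h2 := this.comp (continuous_snd (X := Matrix (Fin g) (Fin g) ℂ))
    exact continuous_const.mul (Continuous.matrix_det (continuous_const.sub
      (continuous_fst.mul h2)))
  have hk' : (k : ℂ) ≠ 0 := by exact_mod_cast hk.ne'
  have hL : f (t, t') ≠ 0 :=
    mul_ne_zero (pow_ne_zero _ (inv_ne_zero hk')) (det_one_sub_ne_zero h htr)
  set L := f (t, t') with hLdef
  -- Near the point, f/L is close to 1, where the principal root is continuous; so `r` times the
  -- root of f/L is a continuous square root of `f` across the boundary.
  obtain ⟨r, hr⟩ := IsAlgClosed.exists_pow_nat_eq L two_pos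
  have hslit : ∀ᶠ p in 𝓝 (t, t'), f p / L ∈ slitPlane := by
    have hc : ContinuousAt (fun p => f p / L) (t, t') := (hf.div_const L).continuousAt
    refine hc.eventually_mem (isOpen_slitPlane.mem_nhds ?_)
    rw [← hLdef, div_self hL]
    exact one_mem_slitPlane
  have : LocallyConvexSpace ℝ (Matrix (Fin g) (Fin g) ℂ) :=
    inferInstanceAs (LocallyConvexSpace ℝ (Fin g → Fin g → ℂ))
  obtain ⟨V, ⟨hV, hVc⟩, hVs⟩ := (LocallyConvexSpace.convex_basis (𝕜 := ℝ) (t, t')).mem_iff.1 hslit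
  let q : Matrix (Fin g) (Fin g) ℂ × Matrix (Fin g) (Fin g) ℂ → ℂ :=
    fun p => r * (f p / L) ^ (1 / 2 : ℂ)
  have hq {p} (hp : p ∈ V) : ContinuousAt q p :=
    continuousAt_const.mul (ContinuousAt.cpow (hf.div_const L).continuousAt continuousAt_const
      (hVs hp))
  have hqsq (p) : q p ^ 2 = f p := by
    simp only [q]
    rw [mul_pow, hr, ← cpow_nat_mul]
    norm_num
    field_simp
  -- The half-form pairing and `q` are two continuous square roots of the same nonvanishing function
  -- on this convex set, so they agree up to one global sign.
  have hS : IsPreconnected ((siegelDisc g ×ˢ siegelDisc g) ∩ V) :=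
    ((convex_siegelDisc.prod convex_siegelDisc).inter hVc).isPreconnected
  have hlim : Tendsto q (𝓝[siegelDisc g ×ˢ siegelDisc g] (t, t')) (𝓝 (q (t, t'))) :=
    (hq (mem_of_mem_nhds hV)).tendsto.mono_left nhdsWithin_le_nhds
  have hev : ∀ᶠ p in 𝓝[siegelDisc g ×ˢ siegelDisc g] (t, t'),
      p ∈ (siegelDisc g ×ˢ siegelDisc g) ∩ V :=
    (eventually_mem_nhdsWithin).and (nhdsWithin_le_nhds hV)
  have hor := hS.eq_or_eq_neg_of_sq_eq
    ((continuousOn_interiorHalfFormPairing hk).mono inter_subset_left)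
    (fun p hp => (hq hp.2).continuousWithinAt) (fun p hp => by
      simp only [Pi.pow_apply]
      rw [hqsq, interiorHalfFormPairing_sq hk hp.1.1 hp.1.2]) (fun {p} hp h0 => by
      have h1 := hqsq p
      rw [h0] at h1
      have h2 := hVs hp.2
      rw [mem_ofPred_eq, ← h1] at h2
      simp at h2)
  rcases hor with hor | hor
  · exact ⟨_, hlim.congr' (hev.mono fun p hp => (hor hp).symm)⟩
  · exact ⟨_, hlim.neg.congr' (hev.mono fun p hp => (hor hp).symm)⟩

/-! ### Real polarizations and their lattices -/

/-- The complex bilinear extension of the symplectic form. -/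
def omegaCC (xi eta : CTangent g) : ℂ := xi.2 ⬝ᵥ eta.1 - xi.1 ⬝ᵥ eta.2

lemma omegaCC_toCTangent (u v : Cover g) : omegaCC (toCTangent u) (toCTangent v) = omega u v := by
  simp [omegaCC, toCTangent, omega, dotProduct, Finset.sum_sub_distrib]

lemma toCTangent_add (u v : Cover g) : toCTangent (u + v) = toCTangent u + toCTangent v := by
  ext <;> simp [toCTangent]

lemma toCTangent_smul (c : ℝ) (u : Cover g) : toCTangent (c • u) = (c : ℂ) • toCTangent u := by
  ext <;> simp [toCTangent]

lemma toCTangent_zero : toCTangent (0 : Cover g) = 0 := by ext <;> simp [toCTangent]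

lemma toCTangent_re_add_im (xi : CTangent g) : toCTangent (reT xi) + I • toCTangent (imT xi) = xi := by
  ext i
  · simp [toCTangent, reT, imT, mul_comm I]
  · simp [toCTangent, reT, imT, mul_comm I]

lemma conj_toCTangent (u : Cover g) : CTangent.conj (toCTangent u) = toCTangent u := by
  ext <;> simp [CTangent.conj, toCTangent]

lemma CTangent.conj_conj (xi : CTangent g) : CTangent.conj (CTangent.conj xi) = xi := by
  ext <;> simp [CTangent.conj]

lemma CTangent.conj_add (xi eta : CTangent g) :
    CTangent.conj (xi + eta) = CTangent.conj xi + CTangent.conj eta := by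
  ext <;> simp [CTangent.conj]

lemma toCTangent_reT (xi : CTangent g) :
    toCTangent (reT xi) = (2⁻¹ : ℂ) • (xi + CTangent.conj xi) := by
  have h (z : ℂ) : (z.re : ℂ) = 2⁻¹ * (z + conj z) := by
    rw [add_conj]
    push_cast
    ring
  ext i
  · exact h _
  · exact h _

/-- The real subspace `𝒫_τ ∩ ℝ²ᵍ`. -/
def realPart (t : Matrix (Fin g) (Fin g) ℂ) : Submodule ℝ (Cover g) where
  carrier := {v | toCTangent v ∈ pol t}
  add_mem' := fun {u v} hu hv => by
    simp only [mem_ofPred_eq] at hu hv ⊢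
    rw [toCTangent_add]
    exact add_mem hu hv
  zero_mem' := by
    simp only [mem_ofPred_eq]
    rw [toCTangent_zero]
    exact zero_mem _
  smul_mem' := fun c u hu => by
    simp only [mem_ofPred_eq] at hu ⊢
    rw [toCTangent_smul]
    exact (pol t).smul_mem _ hu

lemma mem_realPart {t : Matrix (Fin g) (Fin g) ℂ} {v : Cover g} :
    v ∈ realPart t ↔ toCTangent v ∈ pol t := Iff.rfl

lemma IsRealPol.reT_mem {t : Matrix (Fin g) (Fin g) ℂ} (h : IsRealPol t) {xi : CTangent g}
    (hxi : xi ∈ pol t) : reT xi ∈ realPart t := by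
  rw [mem_realPart, toCTangent_reT]
  exact (pol t).smul_mem _ (add_mem hxi (h _ hxi))

lemma isCompl_realPart {t t' : Matrix (Fin g) (Fin g) ℂ} (h : IsRealPol t) (h' : IsRealPol t')
    (htr : IsTransverse t t') : IsCompl (realPart t) (realPart t') := by
  constructor
  · rw [Submodule.disjoint_def]
    intro v hv hv'
    have := Submodule.disjoint_def.1 htr.disjoint _ hv hv'
    ext i
    · simpa [toCTangent] using congrFun (congrArg Prod.fst this) i
    · simpa [toCTangent] using congrFun (congrArg Prod.snd this) i
  · rw [codisjoint_iff, eq_top_iff]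
    intro v _
    have : toCTangent v ∈ pol t ⊔ pol t' := by
      rw [htr.sup_eq_top]
      trivial
    obtain ⟨xi, hxi, xi', hxi', he⟩ := Submodule.mem_sup.1 this
    refine Submodule.mem_sup.2 ⟨reT xi, h.reT_mem hxi, reT xi', h'.reT_mem hxi', ?_⟩
    have e1 (i) := congrArg re (congrFun (congrArg Prod.fst he) i)
    have e2 (i) := congrArg re (congrFun (congrArg Prod.snd he) i)
    ext i
    · simpa [reT, toCTangent] using e1 i
    · simpa [reT, toCTangent] using e2 i

lemma isSymm_dotProduct {t : Matrix (Fin g) (Fin g) ℂ} (h : t.IsSymm) (v w : Fin g → ℂ) :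
    (t *ᵥ v) ⬝ᵥ w = v ⬝ᵥ (t *ᵥ w) := by
  rw [dotProduct_mulVec, ← mulVec_transpose, h.eq]

/-- The vector `(i (v - v'), v + v')`. -/
def diffSum (v v' : Fin g → ℂ) : CTangent g := (I • (v - v'), v + v')

lemma omegaCC_diffSum (v v' w w' : Fin g → ℂ) :
    omegaCC (diffSum v v') (diffSum w w') = 2 * I * (v' ⬝ᵥ w - v ⬝ᵥ w') := by
  simp only [omegaCC, diffSum, add_dotProduct, dotProduct_add, dotProduct_smul, smul_dotProduct,
    sub_dotProduct, dotProduct_sub, smul_eq_mul]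
  ring

lemma conj_polVec (t : Matrix (Fin g) (Fin g) ℂ) (c : Fin g → ℂ) :
    CTangent.conj (polVec t c) = diffSum (star c) (t *ᵥ star c) := by
  have e (i) : conj ((t.map (starRingEnd ℂ) *ᵥ c) i) = (t *ᵥ star c) i := by
    simp [mulVec, dotProduct]
  rw [polVec, diffSum, CTangent.conj, Prod.ext_iff]
  constructor <;> ext i
  · simp [e]
  · simp [e]

lemma conj_mem_pol_iff {t : Matrix (Fin g) (Fin g) ℂ} {xi : CTangent g} :
    CTangent.conj xi ∈ pol t ↔ ∃ v, diffSum v (t *ᵥ v) = xi := by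
  rw [mem_pol_iff]
  constructor
  · rintro ⟨c, hc⟩
    exact ⟨star c, by rw [← conj_polVec, hc, CTangent.conj_conj]⟩
  · rintro ⟨v, rfl⟩
    exact ⟨star v, by rw [← CTangent.conj_conj (polVec t (star v)), conj_polVec, star_star]⟩

lemma omegaCC_conj (xi eta : CTangent g) :
    omegaCC (CTangent.conj xi) (CTangent.conj eta) = conj (omegaCC xi eta) := by
  simp [omegaCC, CTangent.conj, dotProduct]

/-- Isotropy comes from the symmetry of τ: the conjugate vectors have the form `diffSum v (τ v)`, on
which ω is 2i (τ v · w - v · τ w). -/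
lemma omegaCC_of_mem_pol {t : Matrix (Fin g) (Fin g) ℂ} (h : t.IsSymm) {xi eta : CTangent g}
    (hxi : xi ∈ pol t) (heta : eta ∈ pol t) : omegaCC xi eta = 0 := by
  rw [← CTangent.conj_conj xi] at hxi
  rw [← CTangent.conj_conj eta] at heta
  obtain ⟨v, hv⟩ := conj_mem_pol_iff.1 hxi
  obtain ⟨w, hw⟩ := conj_mem_pol_iff.1 heta
  rw [← CTangent.conj_conj xi, ← CTangent.conj_conj eta, omegaCC_conj, ← hv, ← hw,
    omegaCC_diffSum, isSymm_dotProduct h, sub_self, mul_zero, map_zero]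

lemma omega_of_mem_realPart {t : Matrix (Fin g) (Fin g) ℂ} (h : t.IsSymm) {u v : Cover g}
    (hu : u ∈ realPart t) (hv : v ∈ realPart t) : omega u v = 0 := by
  have := omegaCC_of_mem_pol h hu hv
  rw [omegaCC_toCTangent] at this
  exact_mod_cast this

lemma omega_smul_left (c : ℝ) (u v : Cover g) : omega (c • u) v = c * omega u v := by
  simp only [omega, Finset.mul_sum]
  exact Finset.sum_congr rfl fun i _ => by simp; ring

lemma omega_smul_right (c : ℝ) (u v : Cover g) : omega u (c • v) = c * omega u v := by
  rw [omega_antisymm, omega_smul_left, omega_antisymm v]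
  ring

/-- The symplectic form as a bilinear map. -/
def omegaBilin (g : ℕ) : Cover g →ₗ[ℝ] Cover g →ₗ[ℝ] ℝ :=
  LinearMap.mk₂ ℝ omega omega_add_left omega_smul_left omega_add_right omega_smul_right

lemma eq_zero_of_omega {u : Cover g} (h : ∀ v, omega u v = 0) : u = 0 := by
  ext i
  · have := h (0, Pi.single i 1)
    simpa [omega, Pi.single_apply] using this
  · have := h (Pi.single i 1, 0)
    simpa [omega, Pi.single_apply] using this

/-- An element of `V` that pairs to zero with `W` pairs to zero with V + W, which is everything; so
ω embeds `V` into the dual of `W`. -/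
lemma finrank_le_of_isCompl_isotropic {V W : Submodule ℝ (Cover g)} (h : IsCompl V W)
    (hV : ∀ u ∈ V, ∀ v ∈ V, omega u v = 0) : Module.finrank ℝ V ≤ Module.finrank ℝ W := by
  let f : V →ₗ[ℝ] Module.Dual ℝ W := ((omegaBilin g).compl₁₂ V.subtype W.subtype)
  have hf : Function.Injective f := by
    refine (injective_iff_map_eq_zero _).2 fun v hv => ?_
    have h0 : (v : Cover g) = 0 := eq_zero_of_omega fun w => by
      have : w ∈ V ⊔ W := by rw [h.sup_eq_top]; trivial
      obtain ⟨a, ha, b, hb, rfl⟩ := Submodule.mem_sup.1 this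
      have h1 := DFunLike.congr_fun hv ⟨b, hb⟩
      have h2 : omega (v : Cover g) b = 0 := h1
      rw [omega_add_right, hV _ v.2 _ ha, h2, add_zero]
    exact Subtype.ext h0
  exact (LinearMap.finrank_le_finrank_of_injective hf).trans_eq Subspace.dual_finrank_eq

lemma finrank_eq_of_isCompl_isotropic {V W : Submodule ℝ (Cover g)} (h : IsCompl V W)
    (hV : ∀ u ∈ V, ∀ v ∈ V, omega u v = 0) (hW : ∀ u ∈ W, ∀ v ∈ W, omega u v = 0) :
    Module.finrank ℝ V = g := by
  have h1 := finrank_le_of_isCompl_isotropic h hV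
  have h2 := finrank_le_of_isCompl_isotropic h.symm hW
  have h3 := Submodule.finrank_add_eq_of_isCompl h
  have h4 : Module.finrank ℝ (Cover g) = g + g := by simp
  omega

/-- The covering map as a homomorphism. -/
def projHom (g : ℕ) : Cover g →+ Torus g where
  toFun := proj
  map_zero' := by ext <;> simp [proj]
  map_add' := fun u v => by ext <;> simp [proj]

lemma continuous_proj : Continuous (proj : Cover g → Torus g) := by
  unfold proj
  refine Continuous.prodMk (continuous_pi fun i => ?_) (continuous_pi fun i => ?_)
  · exact (AddCircle.continuous_mk' _).comp ((continuous_apply i).comp continuous_fst)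
  · exact (AddCircle.continuous_mk' _).comp ((continuous_apply i).comp continuous_snd)

lemma proj_eq_iff {u v : Cover g} : proj u = proj v ↔ ∃ l, v = u + latt l := by
  constructor
  · intro h
    have h1 (i) : ∃ n : ℤ, v.1 i - u.1 i = n := by
      have := congrFun (congrArg Prod.fst h) i
      simp only [proj] at this
      obtain ⟨n, hn⟩ := (QuotientAddGroup.eq_iff_sub_mem.1 this.symm)
      exact ⟨n, by simpa using hn.symm⟩
    have h2 (i) : ∃ n : ℤ, v.2 i - u.2 i = n := by
      have := congrFun (congrArg Prod.snd h) i
      simp only [proj] at this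
      obtain ⟨n, hn⟩ := (QuotientAddGroup.eq_iff_sub_mem.1 this.symm)
      exact ⟨n, by simpa using hn.symm⟩
    choose a ha using h1
    choose b hb using h2
    refine ⟨(a, b), ?_⟩
    ext i
    · simp [latt, ← ha]
    · simp [latt, ← hb]
  · rintro ⟨l, rfl⟩
    have (x : ℝ) (n : ℤ) : ((x + n : ℝ) : UnitAddCircle) = x := by
      rw [AddCircle.coe_add]
      have : ((n : ℝ) : UnitAddCircle) = 0 :=
        (AddCircle.coe_eq_zero_iff _).2 ⟨n, by simp⟩
      rw [this, add_zero]
    ext i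
    · exact (this _ _).symm
    · exact (this _ _).symm

/-- The projection of the σ-compact group `V` onto its compact image is open, so finitely many
balls, and hence one ball of `V`, already cover the image. A vector and a representative of it in
that ball differ by a lattice vector lying in `V`. -/
lemma exists_latt_near {V : Submodule ℝ (Cover g)} (hV : IsCompact (proj '' (V : Set (Cover g)))) :
    ∃ R : ℝ, ∀ v ∈ V, ∃ l, latt l ∈ V ∧ ‖v - latt l‖ ≤ R := by
  let S : AddSubgroup (Torus g) := V.toAddSubgroup.map (projHom g)
  have hS : (S : Set (Torus g)) = proj '' (V : Set (Cover g)) := rfl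
  have : CompactSpace S := isCompact_iff_compactSpace.1 (by rw [hS]; exact hV)
  let f : V →+ S := ((projHom g).comp V.subtype.toAddMonoidHom).codRestrict S
    fun v => ⟨v, v.2, rfl⟩
  have hfc : Continuous f :=
    Continuous.subtype_mk (continuous_proj.comp continuous_subtype_val) _
  have hfs : Function.Surjective f := by
    rintro ⟨_, v, hv, rfl⟩
    exact ⟨⟨v, hv⟩, rfl⟩
  have hopen := AddMonoidHom.isOpenMap_of_sigmaCompact f hfs hfc
  obtain ⟨n, hn⟩ : ∃ n : ℕ, (univ : Set S) ⊆ f '' Metric.ball 0 n := by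
    refine (isCompact_univ (X := S)).elim_directed_cover (fun n : ℕ => f '' Metric.ball 0 n)
      (fun n => hopen _ Metric.isOpen_ball) (fun s _ => ?_) ?_
    · obtain ⟨v, rfl⟩ := hfs s
      obtain ⟨n, hn⟩ := exists_nat_gt ‖v‖
      exact mem_iUnion.2 ⟨n, v, by simpa using hn, rfl⟩
    · refine directed_of_isDirected_le fun a b hab => ?_
      exact image_mono (Metric.ball_subset_ball (by exact_mod_cast hab))
  refine ⟨n, fun v hv => ?_⟩
  obtain ⟨w, hw, hwv⟩ := hn (mem_univ (f ⟨v, hv⟩))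
  have : proj (w : Cover g) = proj v := congrArg Subtype.val hwv
  obtain ⟨l, hl⟩ := proj_eq_iff.1 this
  have e : latt l = v - w := by rw [hl]; abel
  refine ⟨l, by rw [e]; exact V.sub_mem hv w.2, ?_⟩
  rw [e, sub_sub_cancel]
  simpa using (mem_ball_zero_iff.1 hw).le

/-- If lₙ is a lattice vector of `V` at bounded distance from n v, then lₙ/n tends to v, and the
span is closed. -/
lemma span_latt_eq {V : Submodule ℝ (Cover g)} (hV : IsCompact (proj '' (V : Set (Cover g)))) :
    Submodule.span ℝ {v | v ∈ V ∧ ∃ l, latt l = v} = V := by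
  refine le_antisymm (Submodule.span_le.2 fun v hv => hv.1) fun v hv => ?_
  set W := Submodule.span ℝ {v | v ∈ V ∧ ∃ l, latt l = v} with hW
  obtain ⟨R, hR⟩ := exists_latt_near hV
  have hcl : IsClosed (W : Set (Cover g)) := W.closed_of_finiteDimensional
  have h1 (n : ℕ) : ∃ w ∈ W, ‖v - w‖ ≤ R * (n + 1 : ℝ)⁻¹ := by
    obtain ⟨l, hl, hl'⟩ := hR ((n + 1 : ℝ) • v) (V.smul_mem _ hv)
    refine ⟨(n + 1 : ℝ)⁻¹ • latt l, W.smul_mem _ (Submodule.subset_span ⟨hl, l, rfl⟩), ?_⟩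
    have hn : (n + 1 : ℝ) ≠ 0 := by positivity
    have e : v - (n + 1 : ℝ)⁻¹ • latt l = (n + 1 : ℝ)⁻¹ • ((n + 1 : ℝ) • v - latt l) := by
      rw [smul_sub, smul_smul, inv_mul_cancel₀ hn, one_smul]
    rw [e, norm_smul, Real.norm_of_nonneg (by positivity), mul_comm]
    gcongr
  choose w hw hw' using h1
  refine hcl.mem_of_tendsto (b := atTop) (f := w) ?_ (Eventually.of_forall hw)
  rw [tendsto_iff_norm_sub_tendsto_zero]
  refine squeeze_zero (fun _ => norm_nonneg _) (fun n => ?_)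
    (g := fun n : ℕ => R * (n + 1 : ℝ)⁻¹) ?_
  · rw [norm_sub_rev]
    exact hw' n
  · have := (tendsto_one_div_add_atTop_nhds_zero_nat (𝕜 := ℝ)).const_mul R
    simpa using this

lemma exists_integer_basis {V : Submodule ℝ (Cover g)} (hV : IsCompact (proj '' (V : Set (Cover g))))
    (hd : Module.finrank ℝ V = g) : ∃ m : Fin g → Lattice g, (∀ i, latt (m i) ∈ V) ∧
      LinearIndependent ℝ (fun i => latt (m i)) ∧
      Submodule.span ℝ (range fun i => latt (m i)) = V := by
  have key := Submodule.exists_fun_fin_finrank_span_eq ℝ {v | v ∈ V ∧ ∃ l, latt l = v}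
  rw [span_latt_eq hV, hd] at key
  obtain ⟨f, hf, hspan, hli⟩ := key
  choose m hm using fun i => (hf i).2
  have e : (fun i => latt (m i)) = f := funext hm
  exact ⟨m, fun i => by rw [hm]; exact (hf i).1, by rwa [e], by rwa [e]⟩

/-! ### Symplectic frames adapted to a pair of real polarizations -/

/-- A linear map `A` of `ℝ²ᵍ` that multiplies the symplectic form by `κ`, maps the lattice into the
even lattice, and maps the two coordinate Lagrangians to `𝒫_τ ∩ ℝ²ᵍ` and `𝒫_τ' ∩ ℝ²ᵍ`. -/
structure Frame (t t' : Matrix (Fin g) (Fin g) ℂ) where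
  A : Cover g ≃L[ℝ] Cover g
  kap : ℕ
  kap_pos : 0 < kap
  kap_even : Even kap
  omega_A : ∀ u v, omega (A u) (A v) = kap * omega u v
  latt_A : ∀ l, ∃ m, A (latt l) = latt (m + m)
  mem_left : ∀ u : Cover g, u.2 = 0 → A u ∈ realPart t
  mem_right : ∀ u : Cover g, u.1 = 0 → A u ∈ realPart t'

/-- The linear map with the given values on the coordinate vectors. -/
def frameMap (a b : Fin g → Cover g) : Cover g →ₗ[ℝ] Cover g :=
  (Fintype.linearCombination ℝ a).coprod (Fintype.linearCombination ℝ b)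

lemma frameMap_apply (a b : Fin g → Cover g) (u : Cover g) :
    frameMap a b u = ∑ i, u.1 i • a i + ∑ i, u.2 i • b i := by
  simp [frameMap, Fintype.linearCombination_apply]

lemma omega_sum_left {ι : Type*} (s : Finset ι) (c : ι → ℝ) (a : ι → Cover g) (v : Cover g) :
    omega (∑ i ∈ s, c i • a i) v = ∑ i ∈ s, c i * omega (a i) v := by
  exact (map_sum ((omegaBilin g).flip v) (fun i => c i • a i) s).trans
    (Finset.sum_congr rfl fun i _ => omega_smul_left _ _ _)

lemma omega_sum_right {ι : Type*} (s : Finset ι) (c : ι → ℝ) (a : ι → Cover g) (v : Cover g) :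
    omega v (∑ i ∈ s, c i • a i) = ∑ i ∈ s, c i * omega v (a i) := by
  rw [omega_antisymm, omega_sum_left, ← Finset.sum_neg_distrib]
  refine Finset.sum_congr rfl fun i _ => ?_
  rw [omega_antisymm v]
  ring

lemma omega_frameMap {a b : Fin g → Cover g} {c : ℝ} (haa : ∀ i j, omega (a i) (a j) = 0)
    (hbb : ∀ i j, omega (b i) (b j) = 0)
    (hba : ∀ i j, omega (b i) (a j) = if i = j then c else 0) (u v : Cover g) :
    omega (frameMap a b u) (frameMap a b v) = c * omega u v := by
  have hab (i j) : omega (a i) (b j) = if j = i then -c else 0 := by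
    rw [omega_antisymm, hba]
    split_ifs <;> simp
  simp only [frameMap_apply, omega_add_left, omega_add_right, omega_sum_left, omega_sum_right, haa,
    hbb, hba, hab, mul_zero, Finset.sum_const_zero, zero_add, add_zero, mul_ite,
    Finset.sum_ite_eq, Finset.sum_ite_eq', Finset.mem_univ, if_true]
  rw [omega, Finset.mul_sum, ← Finset.sum_add_distrib]
  exact Finset.sum_congr rfl fun i _ => by ring

/-- The value of the symplectic form on lattice vectors. -/
def omegaZ (l m : Lattice g) : ℤ := ∑ i, (l.2 i * m.1 i - l.1 i * m.2 i)

lemma omega_latt (l m : Lattice g) : omega (latt l) (latt m) = omegaZ l m := by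
  simp [omega, omegaZ, latt]

lemma latt_sum {ι : Type*} (s : Finset ι) (c : ι → ℤ) (m : ι → Lattice g) :
    latt (∑ i ∈ s, c i • m i) = ∑ i ∈ s, (c i : ℝ) • latt (m i) := by
  classical
  induction s using Finset.induction_on with
  | empty => ext <;> simp [latt]
  | insert i s hi ih =>
    rw [Finset.sum_insert hi, Finset.sum_insert hi, latt_add, ih]
    congr 1
    ext <;> simp [latt]

lemma latt_add_self (m : Lattice g) : latt (m + m) = (2 : ℝ) • latt m := by
  rw [latt_add, two_smul]

/-- Choose lattice vectors forming bases of the two real Lagrangians. Their pairing matrix `E` is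
integral, and it is nonsingular by transversality and isotropy. Multiplying the second basis by ±
the adjugate of `E` makes the pairing |det E| times the identity, and doubling both bases gives even
lattice vectors with factor 4 |det E|. -/
lemma Frame.exists (t t' : Matrix (Fin g) (Fin g) ℂ)
    (hs : t.IsSymm) (hs' : t'.IsSymm) (hred : IsReducible t) (hred' : IsReducible t')
    (htr : IsTransverse t t') : Nonempty (Frame t t') := by
  have hc := isCompl_realPart hred.1 hred'.1 htr
  have hiso (u) (hu : u ∈ realPart t) (v) (hv : v ∈ realPart t) : omega u v = 0 :=
    omega_of_mem_realPart hs hu hv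
  have hiso' (u) (hu : u ∈ realPart t') (v) (hv : v ∈ realPart t') : omega u v = 0 :=
    omega_of_mem_realPart hs' hu hv
  have hcpt {t : Matrix (Fin g) (Fin g) ℂ} (h : IsReducible t) :
      IsCompact (proj '' (realPart t : Set (Cover g))) := by
    have := h.2 0
    rw [leaf, coverLeaf] at this
    simpa using! this
  obtain ⟨m, hm, hli, hspan⟩ := exists_integer_basis (hcpt hred)
    (finrank_eq_of_isCompl_isotropic hc hiso hiso')
  obtain ⟨m', hm', hli', hspan'⟩ := exists_integer_basis (hcpt hred')
    (finrank_eq_of_isCompl_isotropic hc.symm hiso' hiso)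
  let E : Matrix (Fin g) (Fin g) ℤ := Matrix.of fun l i => omegaZ (m' l) (m i)
  have hE : E.det ≠ 0 := by
    intro h0
    have h1 : (E.map (Int.cast : ℤ → ℝ)).det = 0 := by
      have := (Int.castRingHom ℝ).map_det E
      rw [h0, map_zero] at this
      exact this.symm
    obtain ⟨v, hv, hv'⟩ := exists_mulVec_eq_zero_iff.2 h1
    have h2 : ∑ i, v i • latt (m i) = 0 := by
      refine eq_zero_of_omega fun w => ?_
      have hw : w ∈ realPart t ⊔ realPart t' := by rw [hc.sup_eq_top]; trivial
      obtain ⟨a, ha, b, hb, rfl⟩ := Submodule.mem_sup.1 hw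
      have hv0 : ∑ i, v i • latt (m i) ∈ realPart t :=
        Submodule.sum_mem _ fun i _ => Submodule.smul_mem _ _ (hm i)
      rw [omega_add_right, hiso _ hv0 _ ha, zero_add]
      rw [← hspan', Submodule.mem_span_range_iff_exists_fun] at hb
      obtain ⟨d, rfl⟩ := hb
      rw [omega_sum_right]
      refine Finset.sum_eq_zero fun l _ => ?_
      have h3 := congrFun hv' l
      simp only [mulVec, dotProduct, map_apply, E, of_apply, Pi.zero_apply] at h3
      rw [omega_antisymm, omega_sum_right]
      simp only [omega_latt]
      rw [show ∑ i, v i * (omegaZ (m' l) (m i) : ℝ) = 0 by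
        rw [← h3]; exact Finset.sum_congr rfl fun i _ => mul_comm _ _]
      simp
    exact hv (funext fun i => Fintype.linearIndependent_iff.1 hli v h2 i)
  -- The sign makes the multiple of the identity positive while all entries stay integral.
  let C : Matrix (Fin g) (Fin g) ℤ := E.det.sign • E.adjugate
  have hCE : C * E = (|E.det| : ℤ) • 1 := by
    simp only [C]
    rw [Matrix.smul_mul, adjugate_mul, smul_smul, ← Int.sign_mul_self_eq_abs]
  let a : Fin g → Cover g := fun i => latt (m i + m i)
  let b : Fin g → Cover g := fun j => latt ((∑ l, C j l • m' l) + ∑ l, C j l • m' l)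
  have ha (i) : a i ∈ realPart t := by
    simp only [a, latt_add_self]
    exact Submodule.smul_mem _ _ (hm i)
  have hb (i) : b i ∈ realPart t' := by
    simp only [b, latt_add_self, latt_sum]
    exact Submodule.smul_mem _ _ (Submodule.sum_mem _ fun i _ => Submodule.smul_mem _ _ (hm' i))
  have hba (i j) : omega (b i) (a j) = if i = j then ((4 * |E.det| : ℤ) : ℝ) else 0 := by
    simp only [a, b, latt_add_self, latt_sum, omega_smul_left, omega_smul_right, omega_sum_left,
      omega_latt]
    have := congrFun (congrFun hCE i) j
    simp only [Matrix.mul_apply, Matrix.smul_apply, Matrix.one_apply, E, of_apply] at this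
    have h2 : ∑ l, (C i l : ℝ) * (omegaZ (m' l) (m j) : ℝ) =
        ((|E.det| • if i = j then 1 else 0 : ℤ) : ℝ) := by
      rw [← this]
      push_cast
      rfl
    rw [h2]
    split_ifs
    · rw [smul_eq_mul, mul_one, Int.cast_mul]
      norm_num
      ring
    · simp
  have hom := omega_frameMap (fun i j => hiso _ (ha i) _ (ha j)) (fun i j => hiso' _ (hb i) _ (hb j))
    hba
  have hpos : 0 < E.det.natAbs := Int.natAbs_pos.2 hE
  have hk : ((4 * |E.det| : ℤ) : ℝ) = ((4 * E.det.natAbs : ℕ) : ℝ) := by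
    have : (|E.det| : ℤ) = (E.det.natAbs : ℤ) := Int.abs_eq_natAbs _
    rw [this]
    have e (n : ℕ) : ((4 * (n : ℤ) : ℤ) : ℝ) = ((4 * n : ℕ) : ℝ) := by push_cast; rfl
    exact e _
  rw [hk] at hom
  have hinj : Function.Injective (frameMap a b) := by
    refine (injective_iff_map_eq_zero _).2 fun u hu => eq_zero_of_omega fun v => ?_
    have h1 := hom u v
    rw [hu] at h1
    have h2 : omega (0 : Cover g) (frameMap a b v) = 0 := by simp [omega]
    rw [h2] at h1
    refine (mul_eq_zero.1 h1.symm).resolve_left ?_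
    positivity
  refine ⟨⟨(LinearEquiv.ofInjectiveEndo _ hinj).toContinuousLinearEquiv, 4 * E.det.natAbs,
    by positivity, ⟨2 * E.det.natAbs, by ring⟩, fun u v => hom u v, fun l => ?_, fun u hu => ?_,
    fun u hu => ?_⟩⟩
  · refine ⟨∑ i, l.1 i • m i + ∑ j, l.2 j • ∑ i, C j i • m' i, ?_⟩
    change frameMap a b (latt l) = _
    rw [frameMap_apply, latt_add_self, latt_add, latt_sum, latt_sum, smul_add, Finset.smul_sum,
      Finset.smul_sum]
    simp only [a, b, latt_add_self]
    congr 1 <;> exact Finset.sum_congr rfl fun i _ => smul_comm _ _ _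
  · change frameMap a b u ∈ _
    rw [frameMap_apply, hu]
    simpa using Submodule.sum_mem _ fun i _ => Submodule.smul_mem _ _ (ha i)
  · change frameMap a b u ∈ _
    rw [frameMap_apply, hu]
    simpa using Submodule.sum_mem _ fun i _ => Submodule.smul_mem _ _ (hb i)

namespace Frame

variable {t t' : Matrix (Fin g) (Fin g) ℂ}

/-- The frame for the exchanged pair. -/
def swap (F : Frame t t') : Frame t' t where
  A := ((ContinuousLinearEquiv.prodComm ℝ (Fin g → ℝ) (Fin g → ℝ)).trans
    ((ContinuousLinearEquiv.refl ℝ (Fin g → ℝ)).prodCongr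
      (ContinuousLinearEquiv.neg ℝ (M := Fin g → ℝ)))).trans F.A
  kap := F.kap
  kap_pos := F.kap_pos
  kap_even := F.kap_even
  omega_A u v := by
    simp only [ContinuousLinearEquiv.trans_apply, F.omega_A]
    congr 1
    refine Finset.sum_congr rfl fun i _ => ?_
    simp
    ring
  latt_A l := by
    obtain ⟨m, hm⟩ := F.latt_A (l.2, -l.1)
    refine ⟨m, ?_⟩
    rw [← hm]
    simp only [ContinuousLinearEquiv.trans_apply]
    congr 1
    ext <;> simp [latt]
  mem_left u hu := F.mem_right _ (by simpa using hu)
  mem_right u hu := F.mem_left _ (by simp [hu])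

lemma swap_apply (F : Frame t t') (u : Cover g) : F.swap.A u = F.A (u.2, -u.1) := rfl

/-- The complexification of the frame. -/
def AC (F : Frame t t') : CTangent g →ₗ[ℂ] CTangent g where
  toFun xi := toCTangent (F.A (reT xi)) + I • toCTangent (F.A (imT xi))
  map_add' xi eta := by
    have e1 : reT (xi + eta) = reT xi + reT eta := by ext <;> simp [reT]
    have e2 : imT (xi + eta) = imT xi + imT eta := by ext <;> simp [imT]
    rw [e1, e2, map_add, map_add, toCTangent_add, toCTangent_add, smul_add]
    abel
  map_smul' c xi := by
    have e1 : reT (c • xi) = c.re • reT xi - c.im • imT xi := by ext <;> simp [reT, imT]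
    have e2 : imT (c • xi) = c.re • imT xi + c.im • reT xi := by ext <;> simp [imT, reT]
    rw [e1, e2, sub_eq_add_neg, ← neg_smul, map_add, map_add, map_smul, map_smul, map_smul,
      map_smul, RingHom.id_apply]
    simp only [toCTangent_add, toCTangent_smul]
    have hc := re_add_im c
    ext i
    · simp only [ofReal_neg, Prod.fst_add, Prod.smul_fst, Pi.add_apply, Pi.smul_apply, smul_eq_mul]
      linear_combination ((toCTangent (F.A (reT xi))).1 i + I * (toCTangent (F.A (imT xi))).1 i) * hc
        - ((c.im : ℂ) * (toCTangent (F.A (imT xi))).1 i) * I_mul_I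
    · simp only [ofReal_neg, Prod.snd_add, Prod.smul_snd, Pi.add_apply, Pi.smul_apply, smul_eq_mul]
      linear_combination ((toCTangent (F.A (reT xi))).2 i + I * (toCTangent (F.A (imT xi))).2 i) * hc
        - ((c.im : ℂ) * (toCTangent (F.A (imT xi))).2 i) * I_mul_I

lemma AC_toCTangent (F : Frame t t') (u : Cover g) : F.AC (toCTangent u) = toCTangent (F.A u) := by
  have e1 : reT (toCTangent u) = u := by ext <;> simp [reT, toCTangent]
  have e2 : imT (toCTangent u) = 0 := by ext <;> simp [imT, toCTangent]
  change toCTangent (F.A (reT _)) + I • toCTangent (F.A (imT _)) = _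
  rw [e1, e2, map_zero, toCTangent_zero, smul_zero, add_zero]

lemma reT_AC (F : Frame t t') (xi : CTangent g) : reT (F.AC xi) = F.A (reT xi) := by
  change reT (toCTangent (F.A (reT xi)) + I • toCTangent (F.A (imT xi))) = _
  ext <;> simp [reT, toCTangent]

lemma imT_AC (F : Frame t t') (xi : CTangent g) : imT (F.AC xi) = F.A (imT xi) := by
  change imT (toCTangent (F.A (reT xi)) + I • toCTangent (F.A (imT xi))) = _
  ext <;> simp [imT, toCTangent]

lemma conj_AC (F : Frame t t') (xi : CTangent g) :
    CTangent.conj (F.AC xi) = F.AC (CTangent.conj xi) := by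
  have e1 : reT (CTangent.conj xi) = reT xi := by ext <;> simp [reT, CTangent.conj]
  have e2 : imT (CTangent.conj xi) = -imT xi := by ext <;> simp [imT, CTangent.conj]
  change CTangent.conj (toCTangent (F.A (reT xi)) + I • toCTangent (F.A (imT xi))) =
    toCTangent (F.A (reT _)) + I • toCTangent (F.A (imT _))
  rw [e1, e2, map_neg, CTangent.conj_add, conj_toCTangent]
  congr 1
  ext <;> simp [CTangent.conj, toCTangent]

lemma omegaCC_AC (F : Frame t t') (xi eta : CTangent g) :
    omegaCC (F.AC xi) (F.AC eta) = F.kap * omegaCC xi eta := by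
  have e (u v u' v' : Cover g) : omegaCC (toCTangent u + I • toCTangent v)
      (toCTangent u' + I • toCTangent v') =
      omega u u' - omega v v' + I * (omega u v' + omega v u') := by
    simp only [← omegaCC_toCTangent, omegaCC, Prod.fst_add, Prod.snd_add, Prod.smul_fst,
      Prod.smul_snd, add_dotProduct, dotProduct_add, smul_dotProduct, dotProduct_smul, smul_eq_mul]
    linear_combination ((toCTangent v).2 ⬝ᵥ (toCTangent v').1 -
      (toCTangent v).1 ⬝ᵥ (toCTangent v').2) * I_mul_I
  conv_rhs => rw [← toCTangent_re_add_im xi, ← toCTangent_re_add_im eta]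
  change omegaCC (toCTangent (F.A (reT xi)) + I • toCTangent (F.A (imT xi)))
    (toCTangent (F.A (reT eta)) + I • toCTangent (F.A (imT eta))) = _
  rw [e, e]
  simp only [F.omega_A]
  push_cast
  ring

lemma injective_AC (F : Frame t t') : Function.Injective F.AC := by
  refine (injective_iff_map_eq_zero _).2 fun xi h => ?_
  have h1 : F.A (reT xi) = 0 := by
    rw [← reT_AC, h]
    ext <;> simp [reT]
  have h2 : F.A (imT xi) = 0 := by
    rw [← imT_AC, h]
    ext <;> simp [imT]
  rw [← toCTangent_re_add_im xi, (map_eq_zero_iff _ F.A.injective).1 h1,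
    (map_eq_zero_iff _ F.A.injective).1 h2]
  simp [toCTangent_zero]

/-- The complexification of the frame as an equivalence. -/
def ACe (F : Frame t t') : CTangent g ≃L[ℂ] CTangent g :=
  (LinearEquiv.ofInjectiveEndo F.AC F.injective_AC).toContinuousLinearEquiv

lemma ACe_apply (F : Frame t t') (xi : CTangent g) : F.ACe xi = F.AC xi := rfl

lemma AC_mem_pol (F : Frame t t') (w : Fin g → ℂ) : F.AC (w, 0) ∈ pol t := by
  rw [← toCTangent_re_add_im (w, 0), map_add, map_smul, AC_toCTangent, AC_toCTangent]
  refine add_mem (F.mem_left _ ?_) ((pol t).smul_mem _ (F.mem_left _ ?_))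
  · ext; simp [reT]
  · ext; simp [imT]

lemma exists_AC_eq (F : Frame t t') (w : Fin g → ℂ) : ∃ v, F.AC (w, 0) = diffSum v (t *ᵥ v) := by
  have h : CTangent.conj (F.AC (w, 0)) ∈ pol t := by
    rw [conj_AC]
    have e : CTangent.conj (w, (0 : Fin g → ℂ)) = (star w, 0) := by ext <;> simp [CTangent.conj]
    rw [e]
    exact F.AC_mem_pol (star w)
  obtain ⟨v, hv⟩ := conj_mem_pol_iff.1 h
  exact ⟨v, hv.symm⟩

end Frame

/-! ### Polarizations near a real one as graphs -/

/-- The vector `v` in `(i (v - v'), v + v')`. -/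
def alphaPart (xi : CTangent g) : Fin g → ℂ := (2⁻¹ : ℂ) • (xi.2 - I • xi.1)

/-- The vector `v'` in `(i (v - v'), v + v')`. -/
def betaPart (xi : CTangent g) : Fin g → ℂ := (2⁻¹ : ℂ) • (xi.2 + I • xi.1)

lemma diffSum_alphaPart_betaPart (xi : CTangent g) : diffSum (alphaPart xi) (betaPart xi) = xi := by
  ext i
  · simp [diffSum, alphaPart, betaPart]
    linear_combination (-xi.1 i) * I_mul_I
  · simp [diffSum, alphaPart, betaPart]
    ring

lemma alphaPart_diffSum (v v' : Fin g → ℂ) : alphaPart (diffSum v v') = v := by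
  ext i
  simp [diffSum, alphaPart]
  linear_combination (-2⁻¹ * (v i - v' i)) * I_mul_I

lemma betaPart_diffSum (v v' : Fin g → ℂ) : betaPart (diffSum v v') = v' := by
  ext i
  simp [diffSum, betaPart]
  linear_combination (2⁻¹ * (v i - v' i)) * I_mul_I

lemma alphaPart_add (xi eta : CTangent g) : alphaPart (xi + eta) = alphaPart xi + alphaPart eta := by
  ext i
  simp [alphaPart]
  ring

lemma alphaPart_smul (c : ℂ) (xi : CTangent g) : alphaPart (c • xi) = c • alphaPart xi := by
  ext i
  simp [alphaPart]
  ring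

lemma betaPart_add (xi eta : CTangent g) : betaPart (xi + eta) = betaPart xi + betaPart eta := by
  ext i
  simp [betaPart]
  ring

lemma betaPart_smul (c : ℂ) (xi : CTangent g) : betaPart (c • xi) = c • betaPart xi := by
  ext i
  simp [betaPart]
  ring

lemma continuous_alphaPart : Continuous (alphaPart : CTangent g → Fin g → ℂ) := by
  unfold alphaPart
  fun_prop

lemma continuous_betaPart : Continuous (betaPart : CTangent g → Fin g → ℂ) := by
  unfold betaPart
  fun_prop

lemma diffSum_add (v v' w w' : Fin g → ℂ) :
    diffSum (v + w) (v' + w') = diffSum v v' + diffSum w w' := by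
  ext i
  · simp [diffSum]; ring
  · simp [diffSum]; ring

lemma diffSum_smul (c : ℂ) (v v' : Fin g → ℂ) : diffSum (c • v) (c • v') = c • diffSum v v' := by
  ext i
  · simp [diffSum]; ring
  · simp [diffSum]

lemma conj_diffSum (v v' : Fin g → ℂ) :
    CTangent.conj (diffSum v v') = diffSum (star v') (star v) := by
  ext i
  · simp [diffSum, CTangent.conj]; ring
  · simp [diffSum, CTangent.conj]; ring

/-- This is the hermitian form behind the Siegel disc: for v' = τ v its sign is that of |v|² - |τ
v|². -/
lemma omegaCC_conj_diffSum (v v' : Fin g → ℂ) :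
    omegaCC (CTangent.conj (diffSum v v')) (diffSum v v') = 2 * I * (nsq v - nsq v' : ℝ) := by
  rw [conj_diffSum, omegaCC_diffSum, star_dotProduct_self, star_dotProduct_self]
  push_cast
  ring

/-- A matrix with the given columns. -/
def colMatrix (L : (Fin g → ℂ) → Fin g → ℂ) : Matrix (Fin g) (Fin g) ℂ :=
  Matrix.of fun i j => L (Pi.single j 1) i

lemma colMatrix_mulVec {L : (Fin g → ℂ) → Fin g → ℂ} (ha : ∀ v w, L (v + w) = L v + L w)
    (hs : ∀ (c : ℂ) v, L (c • v) = c • L v) (v : Fin g → ℂ) : colMatrix L *ᵥ v = L v := by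
  let f : (Fin g → ℂ) →ₗ[ℂ] Fin g → ℂ := ⟨⟨L, ha⟩, hs⟩
  have : colMatrix L = LinearMap.toMatrix' f := by
    ext i j
    rw [LinearMap.toMatrix'_apply, colMatrix, of_apply]
    congr 2
  rw [this, LinearMap.toMatrix'_mulVec]
  rfl

lemma det_ne_zero_of_mulVec {M : Matrix (Fin g) (Fin g) ℂ} (h : ∀ v, M *ᵥ v = 0 → v = 0) :
    M.det ≠ 0 := fun h0 => by
  obtain ⟨v, hv, hv'⟩ := exists_mulVec_eq_zero_iff.2 h0
  exact hv (h v hv')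

lemma mulVec_inv_mulVec {M : Matrix (Fin g) (Fin g) ℂ} (h : M.det ≠ 0) (v : Fin g → ℂ) :
    M *ᵥ (M⁻¹ *ᵥ v) = v := by
  rw [mulVec_mulVec, mul_nonsing_inv _ (isUnit_iff_ne_zero.2 h), one_mulVec]

lemma inv_mulVec_mulVec {M : Matrix (Fin g) (Fin g) ℂ} (h : M.det ≠ 0) (v : Fin g → ℂ) :
    M⁻¹ *ᵥ (M *ᵥ v) = v := by
  rw [mulVec_mulVec, nonsing_inv_mul _ (isUnit_iff_ne_zero.2 h), one_mulVec]

lemma continuousAt_mul_inv {X : Type*} [TopologicalSpace X] {a b : X → Matrix (Fin g) (Fin g) ℂ}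
    {x : X} (ha : ContinuousAt a x) (hb : ContinuousAt b x) (h : (a x).det ≠ 0) :
    ContinuousAt (fun y => b y * (a y)⁻¹) x := by
  have h1 : ContinuousAt (fun A : Matrix (Fin g) (Fin g) ℂ => A⁻¹) (a x) :=
    continuousAt_matrix_inv _ (by
      rw [Ring.inverse_eq_inv']
      exact continuousAt_inv₀ h)
  exact hb.mul (h1.comp ha)

lemma isSymm_of_dotProduct {M : Matrix (Fin g) (Fin g) ℂ}
    (h : ∀ v w, (M *ᵥ v) ⬝ᵥ w = v ⬝ᵥ (M *ᵥ w)) : M.IsSymm := by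
  ext i j
  have := h (Pi.single i 1) (Pi.single j 1)
  simpa using this

namespace Frame

variable {t t' : Matrix (Fin g) (Fin g) ℂ}

/-- The vector of the graph of `-Z` over `w`. -/
def graphVec (F : Frame t t') (Z : Matrix (Fin g) (Fin g) ℂ) (w : Fin g → ℂ) : CTangent g :=
  F.AC (w, -(Z *ᵥ w))

lemma graphVec_add (F : Frame t t') (Z : Matrix (Fin g) (Fin g) ℂ) (v w : Fin g → ℂ) :
    F.graphVec Z (v + w) = F.graphVec Z v + F.graphVec Z w := by
  rw [graphVec, graphVec, graphVec, ← map_add, mulVec_add, neg_add]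
  rfl

lemma graphVec_smul (F : Frame t t') (Z : Matrix (Fin g) (Fin g) ℂ) (c : ℂ) (w : Fin g → ℂ) :
    F.graphVec Z (c • w) = c • F.graphVec Z w := by
  rw [graphVec, graphVec, ← map_smul, mulVec_smul, ← smul_neg]
  rfl

lemma omegaCC_graphVec (F : Frame t t') (Z : Matrix (Fin g) (Fin g) ℂ) (v w : Fin g → ℂ) :
    omegaCC (F.graphVec Z v) (F.graphVec Z w) = F.kap * (v ⬝ᵥ (Z *ᵥ w) - (Z *ᵥ v) ⬝ᵥ w) := by
  rw [graphVec, graphVec, omegaCC_AC, omegaCC]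
  simp only [neg_dotProduct, dotProduct_neg]
  ring

/-- The same hermitian form read in the coordinates of the frame. Comparison with
`omegaCC_conj_diffSum` translates the condition that defines the disc into a sign of Im Z. -/
lemma omegaCC_conj_graphVec (F : Frame t t') (Z : Matrix (Fin g) (Fin g) ℂ) (w : Fin g → ℂ) :
    omegaCC (CTangent.conj (F.graphVec Z w)) (F.graphVec Z w) =
      F.kap * (2 * I * (star w ⬝ᵥ (Z *ᵥ w)).im) := by
  have e : CTangent.conj (w, -(Z *ᵥ w)) = (star w, -star (Z *ᵥ w)) := by
    ext i
    · simp [CTangent.conj]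
    · simp [CTangent.conj]
  rw [graphVec, conj_AC, e, omegaCC_AC, omegaCC]
  simp only [neg_dotProduct, dotProduct_neg]
  have e2 : star (Z *ᵥ w) ⬝ᵥ w = conj (star w ⬝ᵥ (Z *ᵥ w)) := by
    simp [dotProduct, mul_comm]
  have e3 := sub_conj (star w ⬝ᵥ (Z *ᵥ w))
  push_cast at e3
  rw [e2]
  linear_combination (F.kap : ℂ) * e3

lemma alphaPart_graphVec_injective (F : Frame t t') {Z : Matrix (Fin g) (Fin g) ℂ}
    (hZ : ∀ w : Fin g → ℂ, w ≠ 0 → 0 < (star w ⬝ᵥ (Z *ᵥ w)).im) {w : Fin g → ℂ} (hw : w ≠ 0) :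
    nsq (betaPart (F.graphVec Z w)) < nsq (alphaPart (F.graphVec Z w)) := by
  have h := F.omegaCC_conj_graphVec Z w
  rw [← diffSum_alphaPart_betaPart (F.graphVec Z w), omegaCC_conj_diffSum] at h
  have h2 := congrArg im h
  have e (a b : ℝ) : (a * (2 * I * b) : ℂ).im = a * (2 * b) := by simp
  have e' (b : ℝ) : (2 * I * b : ℂ).im = 2 * b := by simp
  rw [e', ← ofReal_natCast, e] at h2
  have h3 := hZ w hw
  have h4 : (0 : ℝ) < F.kap := by exact_mod_cast F.kap_pos
  have := mul_pos h4 h3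
  linarith

/-- At Z = 0 the hermitian form degenerates, so positivity gives nothing. Instead the vector lies in
the conjugate of 𝒫_t, where the second part is t times the first and vanishes with it. -/
lemma alpha_zero_injective (F : Frame t t') {w : Fin g → ℂ} (h : alphaPart (F.graphVec 0 w) = 0) :
    w = 0 := by
  obtain ⟨v, hv⟩ := F.exists_AC_eq w
  have e : F.graphVec 0 w = F.AC (w, 0) := by simp [graphVec]
  rw [e, hv, alphaPart_diffSum] at h
  rw [h] at hv
  have : F.AC (w, 0) = 0 := by
    rw [hv]
    simp [diffSum]
  have h2 := (map_eq_zero_iff _ F.injective_AC).1 this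
  exact congrArg Prod.fst h2

/-- The matrix that expresses `v` in `(i (v - v'), v + v')` through the point `w` of the base of
the graph of `-Z`. -/
def alphaMatrix (F : Frame t t') (Z : Matrix (Fin g) (Fin g) ℂ) : Matrix (Fin g) (Fin g) ℂ :=
  colMatrix fun w => alphaPart (F.graphVec Z w)

/-- The matrix that expresses `v'` in `(i (v - v'), v + v')` through the point `w` of the base of
the graph of `-Z`. -/
def betaMatrix (F : Frame t t') (Z : Matrix (Fin g) (Fin g) ℂ) : Matrix (Fin g) (Fin g) ℂ :=
  colMatrix fun w => betaPart (F.graphVec Z w)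

lemma alphaMatrix_mulVec (F : Frame t t') (Z : Matrix (Fin g) (Fin g) ℂ) (w : Fin g → ℂ) :
    F.alphaMatrix Z *ᵥ w = alphaPart (F.graphVec Z w) :=
  colMatrix_mulVec (fun v w => by rw [graphVec_add, alphaPart_add])
    (fun c v => by rw [graphVec_smul, alphaPart_smul]) w

lemma betaMatrix_mulVec (F : Frame t t') (Z : Matrix (Fin g) (Fin g) ℂ) (w : Fin g → ℂ) :
    F.betaMatrix Z *ᵥ w = betaPart (F.graphVec Z w) :=
  colMatrix_mulVec (fun v w => by rw [graphVec_add, betaPart_add])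
    (fun c v => by rw [graphVec_smul, betaPart_smul]) w

lemma graphVec_eq (F : Frame t t') (Z : Matrix (Fin g) (Fin g) ℂ) (w : Fin g → ℂ) :
    F.graphVec Z w = diffSum (F.alphaMatrix Z *ᵥ w) (F.betaMatrix Z *ᵥ w) := by
  rw [alphaMatrix_mulVec, betaMatrix_mulVec, diffSum_alphaPart_betaPart]

lemma continuous_AC (F : Frame t t') : Continuous F.AC := F.ACe.continuous

lemma continuous_graphVec (F : Frame t t') (w : Fin g → ℂ) :
    Continuous fun Z => F.graphVec Z w := by
  have : Continuous fun Z : Matrix (Fin g) (Fin g) ℂ => Z *ᵥ w :=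
    Continuous.matrix_mulVec continuous_id continuous_const
  exact F.continuous_AC.comp (continuous_const.prodMk this.neg)

lemma continuous_alphaMatrix (F : Frame t t') : Continuous F.alphaMatrix :=
  continuous_pi fun i => continuous_pi fun _ => (continuous_apply i).comp
    (continuous_alphaPart.comp (F.continuous_graphVec _))

lemma continuous_betaMatrix (F : Frame t t') : Continuous F.betaMatrix :=
  continuous_pi fun i => continuous_pi fun _ => (continuous_apply i).comp
    (continuous_betaPart.comp (F.continuous_graphVec _))

lemma det_alphaMatrix_zero (F : Frame t t') : (F.alphaMatrix 0).det ≠ 0 :=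
  det_ne_zero_of_mulVec fun w h => F.alpha_zero_injective (by rwa [alphaMatrix_mulVec] at h)

lemma betaMatrix_zero (F : Frame t t') : F.betaMatrix 0 = t * F.alphaMatrix 0 := by
  have h (w : Fin g → ℂ) : F.betaMatrix 0 *ᵥ w = (t * F.alphaMatrix 0) *ᵥ w := by
    obtain ⟨v, hv⟩ := F.exists_AC_eq w
    have e : F.graphVec 0 w = diffSum v (t *ᵥ v) := by rw [← hv]; simp [graphVec]
    rw [← mulVec_mulVec, alphaMatrix_mulVec, betaMatrix_mulVec, e, alphaPart_diffSum,
      betaPart_diffSum]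
  ext i j
  simpa using congrFun (h (Pi.single j 1)) i

/-- The point of the open disc whose polarization is a given graph. -/
def discPoint (F : Frame t t') (Z : Matrix (Fin g) (Fin g) ℂ) : Matrix (Fin g) (Fin g) ℂ :=
  F.betaMatrix Z * (F.alphaMatrix Z)⁻¹

lemma tendsto_discPoint (F : Frame t t') : Tendsto F.discPoint (𝓝 0) (𝓝 t) := by
  have h := continuousAt_mul_inv F.continuous_alphaMatrix.continuousAt
    F.continuous_betaMatrix.continuousAt F.det_alphaMatrix_zero
  have e : F.betaMatrix 0 * (F.alphaMatrix 0)⁻¹ = t := by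
    rw [betaMatrix_zero, Matrix.mul_assoc,
      mul_nonsing_inv _ (isUnit_iff_ne_zero.2 F.det_alphaMatrix_zero), Matrix.mul_one]
  have h2 := h.tendsto
  rw [e] at h2
  exact h2

lemma det_alphaMatrix (F : Frame t t') {Z : Matrix (Fin g) (Fin g) ℂ}
    (hZ : ∀ w : Fin g → ℂ, w ≠ 0 → 0 < (star w ⬝ᵥ (Z *ᵥ w)).im) : (F.alphaMatrix Z).det ≠ 0 :=
  det_ne_zero_of_mulVec fun w h => by
    by_contra hw
    have h1 := F.alphaPart_graphVec_injective hZ hw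
    rw [← alphaMatrix_mulVec, h] at h1
    have h2 := nsq_nonneg (betaPart (F.graphVec Z w))
    simp [nsq] at h1 h2
    linarith

lemma discPoint_mulVec_alphaMatrix (F : Frame t t') {Z : Matrix (Fin g) (Fin g) ℂ}
    (h : (F.alphaMatrix Z).det ≠ 0) (w : Fin g → ℂ) :
    F.discPoint Z *ᵥ (F.alphaMatrix Z *ᵥ w) = F.betaMatrix Z *ᵥ w := by
  rw [discPoint, ← mulVec_mulVec, inv_mulVec_mulVec h]

lemma discPoint_mem (F : Frame t t') {Z : Matrix (Fin g) (Fin g) ℂ} (hs : Z.IsSymm)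
    (hZ : ∀ w : Fin g → ℂ, w ≠ 0 → 0 < (star w ⬝ᵥ (Z *ᵥ w)).im) :
    F.discPoint Z ∈ siegelDisc g := by
  have hdet := F.det_alphaMatrix hZ
  refine mem_siegelDisc_iff.2 ⟨isSymm_of_dotProduct fun v w => ?_, fun v hv => ?_⟩
  · rw [← mulVec_inv_mulVec hdet v, ← mulVec_inv_mulVec hdet w,
      F.discPoint_mulVec_alphaMatrix hdet, F.discPoint_mulVec_alphaMatrix hdet]
    have h := F.omegaCC_graphVec Z ((F.alphaMatrix Z)⁻¹ *ᵥ v) ((F.alphaMatrix Z)⁻¹ *ᵥ w)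
    rw [isSymm_dotProduct hs, sub_self, mul_zero, graphVec_eq, graphVec_eq, omegaCC_diffSum] at h
    have h2 : (2 * I : ℂ) ≠ 0 := by simp
    exact sub_eq_zero.1 ((mul_eq_zero.1 h).resolve_left h2)
  · rw [← mulVec_inv_mulVec hdet v, F.discPoint_mulVec_alphaMatrix hdet, alphaMatrix_mulVec,
      betaMatrix_mulVec]
    refine F.alphaPart_graphVec_injective hZ fun h => hv ?_
    rw [← mulVec_inv_mulVec hdet v, h, mulVec_zero]

/-- The vectors of `𝒫̄_τ` for the point `τ` of the disc given by the graph of `-Z`. -/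
lemma exists_graphVec_of_discPoint (F : Frame t t') {Z : Matrix (Fin g) (Fin g) ℂ}
    (h : (F.alphaMatrix Z).det ≠ 0) {xi : CTangent g} (hxi : CTangent.conj xi ∈ pol (F.discPoint Z)) :
    ∃ w, F.graphVec Z w = xi := by
  obtain ⟨v, rfl⟩ := conj_mem_pol_iff.1 hxi
  refine ⟨(F.alphaMatrix Z)⁻¹ *ᵥ v, ?_⟩
  rw [graphVec_eq, ← F.discPoint_mulVec_alphaMatrix h, mulVec_inv_mulVec h]

/-- Points of the open disc near `τ` have polarizations that are graphs over that of `τ`. -/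
lemma eventually_exists_graph (F : Frame t t') {d : ℝ} (hd : 0 < d) :
    ∀ᶠ s in 𝓝 t, s ∈ siegelDisc g → ∃ Z : Matrix (Fin g) (Fin g) ℂ, Z.IsSymm ∧
      (∀ i j, ‖Z i j‖ ≤ d) ∧ (∀ w : Fin g → ℝ, 0 ≤ (quad Z w).im) ∧
      ∀ w, CTangent.conj (F.graphVec Z w) ∈ pol s := by
  -- `L s` parametrizes the conjugate of 𝒫_s in frame coordinates. Its components are given by
  -- matrices `a s` and `b s` with `b t = 0` and `a t` invertible, so for s near t the space is the
  -- graph of b a⁻¹ = -Z with Z small.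
  let L : Matrix (Fin g) (Fin g) ℂ → (Fin g → ℂ) → CTangent g :=
    fun s v => F.ACe.symm (diffSum v (s *ᵥ v))
  have hLa (s v w) : L s (v + w) = L s v + L s w := by
    simp only [L]
    rw [mulVec_add, diffSum_add, map_add]
  have hLs (s) (c : ℂ) (v) : L s (c • v) = c • L s v := by
    simp only [L]
    rw [mulVec_smul, diffSum_smul, map_smul]
  have hLc (v) : Continuous fun s => L s v := by
    have : Continuous fun s : Matrix (Fin g) (Fin g) ℂ => s *ᵥ v :=
      Continuous.matrix_mulVec continuous_id continuous_const
    refine F.ACe.symm.continuous.comp ?_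
    unfold diffSum
    fun_prop
  let a := fun s => colMatrix fun v => (L s v).1
  let b := fun s => colMatrix fun v => (L s v).2
  have ha (s v) : a s *ᵥ v = (L s v).1 :=
    colMatrix_mulVec (fun v w => by rw [hLa]; rfl) (fun c v => by rw [hLs]; rfl) v
  have hb (s v) : b s *ᵥ v = (L s v).2 :=
    colMatrix_mulVec (fun v w => by rw [hLa]; rfl) (fun c v => by rw [hLs]; rfl) v
  have hac : Continuous a := continuous_pi fun i => continuous_pi fun _ =>
    (continuous_apply i).comp (continuous_fst.comp (hLc _))
  have hbc : Continuous b := continuous_pi fun i => continuous_pi fun _ =>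
    (continuous_apply i).comp (continuous_snd.comp (hLc _))
  have hLt (v) : L t v = ((F.alphaMatrix 0)⁻¹ *ᵥ v, 0) := by
    simp only [L]
    rw [ContinuousLinearEquiv.symm_apply_eq, ACe_apply]
    have e : F.AC ((F.alphaMatrix 0)⁻¹ *ᵥ v, 0) = F.graphVec 0 ((F.alphaMatrix 0)⁻¹ *ᵥ v) := by
      simp [graphVec]
    rw [e, graphVec_eq, betaMatrix_zero, ← mulVec_mulVec, mulVec_inv_mulVec F.det_alphaMatrix_zero]
  have hbt : b t = 0 := by
    ext i j
    simp [b, colMatrix, hLt]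
  have hat : (a t).det ≠ 0 := det_ne_zero_of_mulVec fun v h => by
    rw [ha, hLt] at h
    rw [← mulVec_inv_mulVec F.det_alphaMatrix_zero v]
    simp only at h
    rw [h, mulVec_zero]
  have hZc : ContinuousAt (fun s => -(b s * (a s)⁻¹)) t :=
    (continuousAt_mul_inv hac.continuousAt hbc.continuousAt hat).neg
  have hZ0 : ∀ᶠ s in 𝓝 t, ∀ i j, ‖(-(b s * (a s)⁻¹)) i j‖ < d := by
    simp only [eventually_all]
    intro i j
    have h1 : ContinuousAt (fun s => ‖(-(b s * (a s)⁻¹)) i j‖) t :=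
      (((continuous_apply j).comp (continuous_apply i)).continuousAt.comp hZc).norm
    refine h1.eventually_lt continuousAt_const ?_
    simpa [hbt] using hd
  have hdet : ∀ᶠ s in 𝓝 t, (a s).det ≠ 0 :=
    (Continuous.matrix_det hac).continuousAt.eventually_ne hat
  filter_upwards [hZ0, hdet] with s h1 h2 hs
  rw [mem_siegelDisc_iff] at hs
  have hgr (w) : F.graphVec (-(b s * (a s)⁻¹)) w =
      diffSum ((a s)⁻¹ *ᵥ w) (s *ᵥ ((a s)⁻¹ *ᵥ w)) := by
    have e : L s ((a s)⁻¹ *ᵥ w) = (w, -(-(b s * (a s)⁻¹) *ᵥ w)) := by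
      rw [neg_mulVec, neg_neg, ← mulVec_mulVec, hb, Prod.ext_iff]
      refine ⟨?_, rfl⟩
      rw [← ha, mulVec_inv_mulVec h2]
    rw [graphVec, ← e, ← ACe_apply]
    exact F.ACe.apply_symm_apply _
  have hk : (0 : ℝ) < F.kap := by exact_mod_cast F.kap_pos
  refine ⟨-(b s * (a s)⁻¹), isSymm_of_dotProduct fun v w => ?_, fun i j => (h1 i j).le,
    fun w => ?_, fun w => ?_⟩
  · have h := F.omegaCC_graphVec (-(b s * (a s)⁻¹)) v w
    rw [hgr, hgr, omegaCC_diffSum, isSymm_dotProduct hs.1, sub_self, mul_zero] at h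
    have h3 : (F.kap : ℂ) ≠ 0 := by exact_mod_cast F.kap_pos.ne'
    exact (sub_eq_zero.1 ((mul_eq_zero.1 h.symm).resolve_left h3)).symm
  · have h := F.omegaCC_conj_graphVec (-(b s * (a s)⁻¹)) (toC w)
    rw [hgr, omegaCC_conj_diffSum, star_toC] at h
    have h3 := congrArg im h
    have e (a b : ℝ) : (a * (2 * I * b) : ℂ).im = a * (2 * b) := by simp
    have e' (b : ℝ) : (2 * I * b : ℂ).im = 2 * b := by simp
    rw [e', ← ofReal_natCast, e] at h3
    have h4 : nsq (s *ᵥ ((a s)⁻¹ *ᵥ toC w)) ≤ nsq ((a s)⁻¹ *ᵥ toC w) := by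
      rcases eq_or_ne ((a s)⁻¹ *ᵥ toC w) 0 with h0 | h0
      · rw [h0, mulVec_zero]
      · exact (hs.2 _ h0).le
    have h5 : 0 ≤ (F.kap : ℝ) * (quad (-(b s * (a s)⁻¹)) w).im := by
      rw [quad]
      linarith
    exact nonneg_of_mul_nonneg_right h5 hk
  · exact conj_mem_pol_iff.2 ⟨_, (hgr w).symm⟩

end Frame

/-! ### Functionals on test functions that annihilate derivatives -/

/-- A linear functional on the test functions on `E` that annihilates all derivatives is a multiple
of the integral. -/
def AnnihilatorTrivial (E : Type*) [NormedAddCommGroup E] [NormedSpace ℝ E] [MeasurableSpace E]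
    (μ : Measure E) : Prop :=
  ∀ L : (E → ℂ) → ℂ, (∀ f f', IsTest f → IsTest f' → L (fun u => f u + f' u) = L f + L f') →
    (∀ (c : ℂ) f, IsTest f → L (fun u => c * f u) = c * L f) →
    (∀ f v, IsTest f → L (fun u => fderiv ℝ f u v) = 0) →
    ∃ c, ∀ f, IsTest f → L f = c * ∫ u, f u ∂μ

/-- A convolution in the real variable, with the point of `E` as a parameter. -/
lemma contDiff_integral_translate {E : Type*} [NormedAddCommGroup E] [NormedSpace ℝ E]
    {f : ℝ × E → ℂ} (hf : IsTest f) {w : ℝ → ℂ} (hw : LocallyIntegrable w) :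
    ContDiff ℝ ∞ fun p : ℝ × E => ∫ t, w t * f (p.1 - t, p.2) := by
  have h := contDiffOn_convolution_right_with_param (𝕜 := ℝ) (n := ⊤) (ContinuousLinearMap.mul ℝ ℂ)
    (g := fun (y : E) (x : ℝ) => f (x, y)) (f := w) (μ := volume) (s := univ)
    (k := Prod.fst '' tsupport f) isOpen_univ (hf.2.isCompact.image continuous_fst)
    (fun p x _ hx => by
      by_contra h0
      exact hx ⟨(x, p), subset_tsupport _ h0, rfl⟩) hw
    (by
      have : ContDiff ℝ ∞ (fun q : E × ℝ => f (q.2, q.1)) :=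
        hf.1.comp (contDiff_snd.prodMk contDiff_fst)
      exact this.contDiffOn)
  rw [univ_prod_univ, contDiffOn_univ] at h
  exact h.comp (contDiff_snd.prodMk contDiff_fst)

/-- Fix a one-variable test function r of integral 1. The difference of f and r(x) ∫ f(s, y) ds has
zero integral in x, so it is the x-derivative of a test function and `L` kills it. Thus `L` depends
only on the integral over x, to which the hypothesis on `E` applies. -/
lemma annihilatorTrivial_prod {E : Type*} [NormedAddCommGroup E] [NormedSpace ℝ E]
    [FiniteDimensional ℝ E] [MeasurableSpace E] [BorelSpace E] {μ : Measure E} [SFinite μ]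
    [IsFiniteMeasureOnCompacts μ]
    (h : AnnihilatorTrivial E μ) : AnnihilatorTrivial (ℝ × E) (volume.prod μ) := by
  intro L hadd hmul hd
  obtain ⟨r, hr, hr1⟩ : ∃ r : ℝ → ℂ, IsTest r ∧ ∫ x, r x = 1 := by
    obtain ⟨b, hb, hb0, hb1⟩ := exists_isTest_one (isCompact_Icc (a := (0 : ℝ)) (b := 1))
    have hpos : 0 < ∫ x, b x := by
      have hbi : Integrable b := by
        have := hb.integrable (μ := volume)
        simpa using this.re
      refine (integral_pos_iff_support_of_nonneg hb0 hbi).2 (lt_of_lt_of_le ?_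
        (measure_mono (s := Icc (0 : ℝ) 1) fun x hx => by simp [hb1 x hx]))
      simp
    refine ⟨fun x => ((∫ x, b x : ℝ) : ℂ)⁻¹ * b x, hb.const_mul _, ?_⟩
    rw [integral_const_mul, integral_complex_ofReal, inv_mul_cancel₀]
    exact_mod_cast hpos.ne'
  have htest {φ : E → ℂ} (hφ : IsTest φ) : IsTest fun p : ℝ × E => r p.1 * φ p.2 := by
    refine ⟨(hr.1.comp contDiff_fst).mul (hφ.1.comp contDiff_snd), ?_⟩
    refine HasCompactSupport.intro (hr.2.isCompact.prod hφ.2.isCompact) fun p hp => ?_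
    by_contra h0
    exact hp ⟨subset_tsupport _ (left_ne_zero_of_mul h0), subset_tsupport _ (right_ne_zero_of_mul h0)⟩
  obtain ⟨c, hc⟩ := h (fun φ => L fun p => r p.1 * φ p.2)
    (fun f f' hf hf' => by
      rw [← hadd _ _ (htest hf) (htest hf')]
      simp only [mul_add])
    (fun c f hf => by
      rw [← hmul _ _ (htest hf)]
      congr 1
      funext p
      ring)
    (fun f v hf => by
      rw [← hd _ (0, v) (htest hf)]
      congr 1
      funext p
      have h1 : HasFDerivAt (fun p : ℝ × E => r p.1 * f p.2) _ p :=
        (((hr.1.differentiable (by simp)) p.1).hasFDerivAt.comp p hasFDerivAt_fst).mul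
          (((hf.1.differentiable (by simp)) p.2).hasFDerivAt.comp p hasFDerivAt_snd)
      rw [h1.fderiv]
      simp)
  refine ⟨c, fun f hf => ?_⟩
  have hslice {f : ℝ × E → ℂ} (hf : IsTest f) (y : E) : IsTest fun s : ℝ => f (s, y) := by
    refine ⟨hf.1.comp (contDiff_id.prodMk contDiff_const), ?_⟩
    refine HasCompactSupport.intro (hf.2.isCompact.image continuous_fst) fun s hs => ?_
    by_contra h0
    exact hs ⟨(s, y), subset_tsupport _ h0, rfl⟩
  have hbar : IsTest fun y : E => ∫ s, f (s, y) := by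
    constructor
    · have h1 := (contDiff_integral_translate hf (w := fun _ => 1) (locallyIntegrable_const _)).comp
        ((contDiff_const (c := (0 : ℝ))).prodMk contDiff_id)
      have e : (fun y : E => ∫ s, f (s, y)) =
          (fun p : ℝ × E => ∫ t, 1 * f (p.1 - t, p.2)) ∘ fun y => (0, id y) := by
        funext y
        simp only [Function.comp, one_mul, id]
        rw [integral_sub_left_eq_self (fun s => f (s, y)) volume 0]
      rw [e]
      exact h1
    · refine HasCompactSupport.intro (hf.2.isCompact.image continuous_snd) fun y hy => ?_
      refine integral_eq_zero_of_ae (Eventually.of_forall fun s => ?_)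
      by_contra h0
      exact hy ⟨(s, y), subset_tsupport _ h0, rfl⟩
  set th : ℝ × E → ℂ := fun p => f p - r p.1 * ∫ s, f (s, p.2) with hth
  have hthT : IsTest th := hf.sub (htest hbar)
  have hth0 (y : E) : ∫ s, th (s, y) = 0 := by
    simp only [hth]
    rw [integral_sub ((hslice hf y).integrable) (hr.integrable.mul_const _), integral_mul_const, hr1,
      one_mul, sub_self]
  -- The primitive in the first variable, written as a convolution with the Heaviside function so
  -- that joint smoothness comes from `contDiff_integral_translate`.
  let Ph : ℝ × E → ℂ := fun p => ∫ t, (Ici (0 : ℝ)).indicator (fun _ => (1 : ℂ)) t * th (p.1 - t, p.2)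
  have hPh (p : ℝ × E) : Ph p = ∫ s in Iic p.1, th (s, p.2) := by
    rw [← integral_indicator measurableSet_Iic, ← integral_sub_left_eq_self _ _ p.1]
    refine integral_congr_ae (Eventually.of_forall fun t => ?_)
    by_cases ht : 0 ≤ t
    · simp [ht]
    · simp [ht]
  have hPhT : IsTest Ph := by
    refine ⟨contDiff_integral_translate hthT
      ((locallyIntegrable_const 1).indicator measurableSet_Ici), ?_⟩
    obtain ⟨R, hR⟩ := hthT.2.isCompact.isBounded.exists_norm_le
    have hz (s : ℝ) (y : E) (h : R < |s| ∨ R < ‖y‖) : th (s, y) = 0 := by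
      by_contra h0
      have h1 := hR _ (subset_tsupport _ h0)
      rw [norm_prod_le_iff] at h1
      rcases h with h | h
      · exact absurd h1.1 (not_le.2 h)
      · exact absurd h1.2 (not_le.2 h)
    refine HasCompactSupport.intro ((isCompact_Icc (a := -R) (b := R)).prod
      (isCompact_closedBall (0 : E) R)) fun p hp => ?_
    rw [hPh]
    by_cases hy : R < ‖p.2‖
    · simp [hz _ p.2 (Or.inr hy)]
    by_cases h1 : p.1 < -R
    · refine setIntegral_eq_zero_of_forall_eq_zero fun s hs => hz _ _ (Or.inl ?_)
      rw [mem_Iic] at hs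
      exact lt_of_lt_of_le (by linarith) (neg_le_abs s)
    have h2 : R < p.1 := by
      by_contra h2
      exact hp ⟨⟨not_lt.1 h1, not_lt.1 h2⟩, by simpa using hy⟩
    -- To the right of the support the half-line integral is the full one, which is zero; this gives
    -- `Ph` compact support.
    rw [← hth0 p.2]
    refine setIntegral_eq_integral_of_forall_compl_eq_zero fun s hs => hz _ _ (Or.inl ?_)
    rw [mem_Iic, not_le] at hs
    exact lt_of_lt_of_le (by linarith) (le_abs_self s)
  have hder (p : ℝ × E) : fderiv ℝ Ph p (1, 0) = th p := by
    have h1 : HasDerivAt (fun x => Ph (x, p.2)) (fderiv ℝ Ph p (1, 0)) p.1 := by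
      have := ((hPhT.1.differentiable (by simp)) p).hasFDerivAt.comp_hasDerivAt p.1
        ((hasDerivAt_id p.1).prodMk (hasDerivAt_const p.1 p.2))
      exact this
    have hint := (hslice hthT p.2).integrable (μ := volume)
    have h2 : HasDerivAt (fun x => Ph (x, p.2)) (th p) p.1 := by
      have e : (fun x => Ph (x, p.2)) = fun x =>
          (∫ s in Iic p.1, th (s, p.2)) + ∫ s in p.1..x, th (s, p.2) := by
        funext x
        rw [hPh, ← intervalIntegral.integral_Iic_sub_Iic hint.integrableOn hint.integrableOn]
        ring
      rw [e]
      exact (intervalIntegral.integral_hasDerivAt_right hint.intervalIntegrable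
        ((hslice hthT p.2).continuous.stronglyMeasurableAtFilter _ _)
        (hslice hthT p.2).continuous.continuousAt).const_add _
    exact h1.unique h2
  have hLth : L th = 0 := by
    rw [← hd Ph (1, 0) hPhT]
    congr 1
    funext p
    rw [hder]
  have hf2 : L f = L th + L fun p => r p.1 * ∫ s, f (s, p.2) := by
    rw [← hadd _ _ hthT (htest hbar)]
    congr 1
    funext p
    simp [hth]
  rw [hf2, hLth, zero_add, hc _ hbar, integral_prod_symm]
  exact hf.integrable

lemma annihilatorTrivial_pi (n : ℕ) : AnnihilatorTrivial (Fin n → ℝ) volume := by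
  induction n with
  | zero =>
    intro L hadd hmul hd
    refine ⟨L fun _ => 1, fun f hf => ?_⟩
    have h1 : (fun u : Fin 0 → ℝ => f u) = fun u => f 0 * 1 := by
      funext u
      rw [mul_one, Subsingleton.elim u 0]
    have h2 : IsTest fun _ : Fin 0 → ℝ => (1 : ℂ) :=
      ⟨contDiff_const, HasCompactSupport.intro isCompact_univ fun u hu => absurd (mem_univ u) hu⟩
    have h3 : L f = f 0 * L fun _ => 1 := by
      rw [← hmul _ _ h2]
      exact congrArg L h1
    rw [h3, mul_comm]
    congr 1
    have h4 : (volume : Measure (Fin 0 → ℝ)) = Measure.dirac 0 := by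
      rw [volume_pi]
      exact Measure.pi_of_empty _ _
    rw [h4, integral_dirac]
  | succ n ih =>
    intro L hadd hmul hd
    let e : (ℝ × (Fin n → ℝ)) ≃L[ℝ] (Fin (n + 1) → ℝ) := Fin.consEquivL ℝ fun _ => ℝ
    have hT {f : ℝ × (Fin n → ℝ) → ℂ} (hf : IsTest f) : IsTest fun u => f (e.symm u) :=
      ⟨hf.1.comp e.symm.contDiff, hf.2.comp_homeomorph e.symm.toHomeomorph⟩
    have hT' {f : (Fin (n + 1) → ℝ) → ℂ} (hf : IsTest f) : IsTest fun p => f (e p) :=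
      ⟨hf.1.comp e.contDiff, hf.2.comp_homeomorph e.toHomeomorph⟩
    obtain ⟨c, hc⟩ := annihilatorTrivial_prod ih (fun f => L fun u => f (e.symm u))
      (fun f f' hf hf' => hadd _ _ (hT hf) (hT hf')) (fun c f hf => hmul _ _ (hT hf))
      (fun f v hf => by
        rw [← hd _ (e v) (hT hf)]
        congr 1
        funext u
        have h1 := ((hf.1.differentiable (by simp)) (e.symm u)).hasFDerivAt.comp u
          e.symm.hasFDerivAt
        have h2 : fderiv ℝ (fun u => f (e.symm u)) u = _ := h1.fderiv
        rw [h2]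
        simp)
    refine ⟨c, fun f hf => ?_⟩
    have h1 := hc _ (hT' hf)
    simp only [ContinuousLinearEquiv.apply_symm_apply] at h1
    rw [h1]
    congr 1
    have h2 := (volume_preserving_piFinSuccAbove (fun _ : Fin (n + 1) => ℝ) 0).symm
    rw [← h2.integral_comp (MeasurableEquiv.measurableEmbedding _)]
    refine integral_congr_ae (Eventually.of_forall fun p => ?_)
    simp only [MeasurableEquiv.piFinSuccAbove_symm_apply, Fin.insertNthEquiv_zero]
    rfl

/-! ### Sums over integer vectors of products -/

lemma summable_prod_pi {n : ℕ} {f : Fin n → ℤ → ℂ} (hf : ∀ i, Summable fun m => ‖f i m‖) :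
    (Summable fun m : Fin n → ℤ => ‖∏ i, f i (m i)‖) ∧
      HasSum (fun m : Fin n → ℤ => ∏ i, f i (m i)) (∏ i, ∑' m, f i m) := by
  induction n with
  | zero =>
    have h1 : Summable fun m : Fin 0 → ℤ => ‖∏ i, f i (m i)‖ := Summable.of_finite
    refine ⟨h1, ?_⟩
    simp
  | succ n ih =>
    obtain ⟨h1, h2⟩ := ih (f := fun i => f i.succ) fun i => hf _
    have h3 := summable_mul_of_summable_norm (hf 0) h1
    have h4 := (Fin.consEquiv fun _ : Fin (n + 1) => ℤ)
    have hs := (hf 0).mul_norm h1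
    constructor
    · rw [← (Fin.consEquiv fun _ : Fin (n + 1) => ℤ).summable_iff]
      refine hs.congr fun p => ?_
      simp [Fin.prod_univ_succ]
    · rw [← (Fin.consEquiv fun _ : Fin (n + 1) => ℤ).hasSum_iff, Fin.prod_univ_succ]
      have h5 := (hf 0).of_norm.hasSum.mul h2 h3
      refine h5.congr_fun fun p => ?_
      simp [Fin.prod_univ_succ]

/-- The exponent 2n is generous, but it permits comparison with the product of the one-variable
series of (1 + |mᵢ|)⁻². -/
lemma summable_inv_one_add_norm_pow (n : ℕ) :
    Summable fun m : Fin n → ℤ => ((1 + ‖m‖) ^ (2 * n))⁻¹ := by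
  have h0 : Summable fun m : ℤ => ((1 + |(m : ℝ)|) ^ 2)⁻¹ := by
    refine Summable.of_norm_bounded_eventually
      (Real.summable_one_div_int_pow.2 (one_lt_two)) ?_
    filter_upwards [(Set.finite_singleton (0 : ℤ)).compl_mem_cofinite] with m hm
    have hm' : (m : ℝ) ≠ 0 := by exact_mod_cast hm
    rw [Real.norm_of_nonneg (by positivity), one_div, ← sq_abs (m : ℝ)]
    have : 0 < |(m : ℝ)| := abs_pos.2 hm'
    gcongr
    linarith
  have h2 (m : ℤ) : ‖((((1 + |(m : ℝ)|) ^ 2)⁻¹ : ℝ) : ℂ)‖ = ((1 + |(m : ℝ)|) ^ 2)⁻¹ := by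
    rw [norm_real, Real.norm_of_nonneg (by positivity)]
  have h1 := (summable_prod_pi (n := n) (f := fun _ m => ((((1 + |(m : ℝ)|) ^ 2)⁻¹ : ℝ) : ℂ))
    fun i => by simpa only [h2] using h0).1
  refine Summable.of_nonneg_of_le (fun m => by positivity) (fun m => ?_) h1
  simp only [norm_prod, h2]
  rw [Finset.prod_inv_distrib]
  refine inv_anti₀ (Finset.prod_pos fun i _ => by positivity) ?_
  calc ∏ i, (1 + |(m i : ℝ)|) ^ 2 ≤ ∏ _i : Fin n, (1 + ‖m‖) ^ 2 := by
        refine Finset.prod_le_prod (fun i _ => by positivity) fun i _ => ?_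
        gcongr
        have := norm_le_pi_norm m i
        rwa [Int.norm_eq_abs] at this
    _ = (1 + ‖m‖) ^ (2 * n) := by simp [pow_mul]

/-! ### Parameter integrals -/

/-- Differentiation under the integral sign, by induction on the order. The target space varies in
the induction because the derivative takes values in a space of linear maps. -/
lemma integral_param {E Y : Type} [NormedAddCommGroup E] [NormedSpace ℝ E]
    [NormedAddCommGroup Y] [NormedSpace ℝ Y] [MeasurableSpace Y] [BorelSpace Y]
    [SecondCountableTopology Y] (μ : Measure Y) [IsFiniteMeasureOnCompacts μ] {K : Set Y}
    (hK : IsCompact K) (n : ℕ) : ∀ {V : Type} [NormedAddCommGroup V] [NormedSpace ℝ V]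
    [CompleteSpace V] (F : E × Y → V), ContDiff ℝ ∞ F → HasCompactSupport F →
    (∀ x y, y ∉ K → F (x, y) = 0) →
    ContDiff ℝ n (fun x => ∫ y, F (x, y) ∂μ) ∧
    ∀ M, (∀ x y, ‖iteratedFDeriv ℝ n (fun x => F (x, y)) x‖ ≤ M) →
      ∀ x, ‖iteratedFDeriv ℝ n (fun x => ∫ y, F (x, y) ∂μ) x‖ ≤ M * μ.real K := by
  have hslice {V : Type} [NormedAddCommGroup V] (F : E × Y → V) (hF : Continuous F)
      (h0 : ∀ x y, y ∉ K → F (x, y) = 0) (x : E) : Integrable (fun y => F (x, y)) μ :=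
    (hF.comp (Continuous.prodMk_right x)).integrable_of_hasCompactSupport
      (HasCompactSupport.intro hK fun y hy => h0 x y hy)
  induction n with
  | zero =>
    intro V _ _ _ F hF hc h0
    refine ⟨?_, fun M hM x => ?_⟩
    · rw [Nat.cast_zero, contDiff_zero]
      obtain ⟨C, hC⟩ := hF.continuous.bounded_above_of_compact_support hc
      refine continuous_of_dominated (bound := K.indicator fun _ => C)
        (fun x => (hslice F hF.continuous h0 x).aestronglyMeasurable)
        (fun x => Eventually.of_forall fun y => ?_) ?_ (Eventually.of_forall fun y =>
          hF.continuous.comp (Continuous.prodMk_left y))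
      · by_cases hy : y ∈ K
        · simpa [hy] using hC (x, y)
        · simp [hy, h0 x y hy]
      · exact (integrable_indicator_iff hK.measurableSet).2
          (integrableOn_const hK.measure_lt_top.ne)
    · rw [norm_iteratedFDeriv_zero]
      have h1 : ∫ y, F (x, y) ∂μ = ∫ y in K, F (x, y) ∂μ :=
        (setIntegral_eq_integral_of_forall_compl_eq_zero fun y hy => h0 x y hy).symm
      rw [h1]
      refine norm_setIntegral_le_of_norm_le_const hK.measure_lt_top fun y _ => ?_
      simpa using hM x y
  | succ n ih =>
    intro V _ _ _ F hF hc h0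
    let F' : E × Y → E →L[ℝ] V := fun p => (fderiv ℝ F p).comp (ContinuousLinearMap.inl ℝ E Y)
    have hF' : ContDiff ℝ ∞ F' :=
      (hF.fderiv_right (m := ∞) (by simp)).clm_comp contDiff_const
    have hc' : HasCompactSupport F' :=
      (hc.fderiv ℝ).comp_left (g := fun L : E × Y →L[ℝ] V =>
        L.comp (ContinuousLinearMap.inl ℝ E Y)) (by simp)
    have hder (x : E) (y : Y) : HasFDerivAt (fun x => F (x, y)) (F' (x, y)) x :=
      ((hF.differentiable (by simp)) (x, y)).hasFDerivAt.comp x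
        (hasFDerivAt_prodMk_left x y)
    have h0' (x : E) (y : Y) (hy : y ∉ K) : F' (x, y) = 0 := by
      have h1 : (fun x => F (x, y)) = fun _ => 0 := funext fun x => h0 x y hy
      have h2 := hder x y
      rw [h1] at h2
      exact h2.unique (hasFDerivAt_const 0 x)
    obtain ⟨C, hC⟩ := hF'.continuous.bounded_above_of_compact_support hc'
    have hI (x : E) : HasFDerivAt (fun x => ∫ y, F (x, y) ∂μ) (∫ y, F' (x, y) ∂μ) x := by
      refine hasFDerivAt_integral_of_dominated_of_fderiv_le (bound := K.indicator fun _ => C)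
        (F' := fun x y => F' (x, y)) univ_mem
        (Eventually.of_forall fun x => (hslice F hF.continuous h0 x).aestronglyMeasurable)
        (hslice F hF.continuous h0 x) (hslice F' hF'.continuous h0' x).aestronglyMeasurable
        (Eventually.of_forall fun y x _ => ?_) ?_ (Eventually.of_forall fun y x _ => hder x y)
      · by_cases hy : y ∈ K
        · simpa [hy] using hC (x, y)
        · simp [hy, h0' x y hy]
      · exact (integrable_indicator_iff hK.measurableSet).2
          (integrableOn_const hK.measure_lt_top.ne)
    have hfd : fderiv ℝ (fun x => ∫ y, F (x, y) ∂μ) = fun x => ∫ y, F' (x, y) ∂μ :=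
      funext fun x => (hI x).fderiv
    obtain ⟨ih1, ih2⟩ := ih F' hF' hc' h0'
    refine ⟨?_, fun M hM x => ?_⟩
    · rw [Nat.cast_succ, contDiff_succ_iff_fderiv]
      refine ⟨fun x => (hI x).differentiableAt, by simp, ?_⟩
      rw [hfd]
      exact ih1
    · rw [← norm_iteratedFDeriv_fderiv, hfd]
      refine ih2 M (fun x y => ?_) x
      have h1 : (fun x => F' (x, y)) = fderiv ℝ fun x => F (x, y) :=
        funext fun x => (hder x y).fderiv.symm
      rw [h1, norm_iteratedFDeriv_fderiv]
      exact hM x y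

/-! ### Fourier series in half of the variables -/

/-- The character `exp (2π i χ · p)`. -/
def ech (chi : Fin g → ℤ) (p : Fin g → ℝ) : ℂ := exp (2 * Real.pi * I * ∑ i, (chi i : ℂ) * (p i : ℂ))

lemma norm_ech (chi : Fin g → ℤ) (p : Fin g → ℝ) : ‖ech chi p‖ = 1 := by
  have : ech chi p = exp ((2 * Real.pi * ∑ i, (chi i : ℝ) * p i : ℝ) * I) := by
    rw [ech]
    congr 1
    push_cast
    ring
  rw [this, norm_exp_ofReal_mul_I]

lemma ech_neg (chi : Fin g → ℤ) (p : Fin g → ℝ) : ech (-chi) p * ech chi p = 1 := by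
  rw [ech, ech, ← exp_add, ← mul_add, ← Finset.sum_add_distrib]
  simp

lemma ech_add (chi chi' : Fin g → ℤ) (p : Fin g → ℝ) : ech (chi + chi') p = ech chi p * ech chi' p := by
  rw [ech, ech, ech, ← exp_add, ← mul_add, ← Finset.sum_add_distrib]
  simp [add_mul]

lemma ech_zero (p : Fin g → ℝ) : ech 0 p = 1 := by simp [ech]

/-- Integer vectors as real vectors. -/
def intVec (m : Fin g → ℤ) : Fin g → ℝ := fun i => (m i : ℝ)

lemma ech_add_intVec (chi m : Fin g → ℤ) (p : Fin g → ℝ) : ech chi (p + intVec m) = ech chi p := by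
  rw [ech, ech, exp_eq_exp_iff_exists_int]
  refine ⟨∑ i, chi i * m i, ?_⟩
  push_cast
  simp only [intVec, Pi.add_apply, ofReal_add, mul_add, Finset.sum_add_distrib, ofReal_intCast]
  ring

lemma contDiff_ech (chi : Fin g → ℤ) : ContDiff ℝ ∞ (ech chi) := by
  have h (i : Fin g) : ContDiff ℝ ∞ (fun p : Fin g → ℝ => (p i : ℂ)) :=
    ofRealCLM.contDiff.comp (contDiff_apply ℝ ℝ i)
  have h2 : ContDiff ℝ ∞ fun p : Fin g → ℝ => ∑ i, (chi i : ℂ) * (p i : ℂ) :=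
    ContDiff.sum fun i _ => contDiff_const.mul (h i)
  exact (contDiff_const.mul h2).cexp

lemma hasFDerivAt_ech (chi : Fin g → ℤ) (p v : Fin g → ℝ) :
    fderiv ℝ (ech chi) p v = 2 * Real.pi * I * (∑ i, (chi i : ℂ) * (v i : ℂ)) * ech chi p := by
  have h1 : HasDerivAt (fun r : ℝ => ech chi (p + r • v)) (fderiv ℝ (ech chi) p v) 0 := by
    have h := ((contDiff_ech chi).differentiable (by simp) (p + (0 : ℝ) • v)).hasFDerivAt
    have h2 : HasDerivAt (fun r : ℝ => p + r • v) v 0 := by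
      simpa using ((hasDerivAt_id (0 : ℝ)).smul_const v).const_add p
    have h3 := h.comp_hasDerivAt (0 : ℝ) h2
    simpa using! h3
  have h2 : HasDerivAt (fun r : ℝ => ech chi (p + r • v))
      (2 * Real.pi * I * (∑ i, (chi i : ℂ) * (v i : ℂ)) * ech chi p) 0 := by
    have e : (fun r : ℝ => ech chi (p + r • v)) = fun r : ℝ =>
        exp (2 * Real.pi * I * (∑ i, (chi i : ℂ) * (p i : ℂ)) +
          (r : ℂ) * (2 * Real.pi * I * ∑ i, (chi i : ℂ) * (v i : ℂ))) := by
      funext r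
      rw [ech]
      congr 1
      simp only [Pi.add_apply, Pi.smul_apply, smul_eq_mul, ofReal_add, ofReal_mul, mul_add,
        Finset.sum_add_distrib, Finset.mul_sum]
      congr 1
      exact Finset.sum_congr rfl fun i _ => by ring
    rw [e]
    have h3 : HasDerivAt (fun r : ℝ => (r : ℂ)) 1 0 := ofRealCLM.hasDerivAt
    have h4 := ((h3.mul_const (2 * Real.pi * I * ∑ i, (chi i : ℂ) * (v i : ℂ))).const_add
      (2 * Real.pi * I * (∑ i, (chi i : ℂ) * (p i : ℂ)))).cexp
    convert h4 using 1
    simp only [ofReal_zero, zero_mul, add_zero, one_mul, ech]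
    ring
  exact h1.unique h2

lemma mFourier_coe (chi : Fin g → ℤ) (p : Fin g → ℝ) :
    UnitAddTorus.mFourier chi (fun i => (p i : UnitAddCircle)) = ech chi p := by
  simp only [UnitAddTorus.mFourier, ContinuousMap.coe_mk, fourier_coe_apply, ech, ← exp_sum,
    Finset.mul_sum]
  congr 1
  refine Finset.sum_congr rfl fun i _ => ?_
  push_cast
  ring

/-- Fourier inversion for the periodization of a test function. -/
lemma hasSum_fourier_periodization {f : (Fin g → ℝ) → ℂ} (hf : IsTest f)
    (hs : Summable fun chi : Fin g → ℤ => ∫ y, f y * ech chi y) (p : Fin g → ℝ) :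
    HasSum (fun chi : Fin g → ℤ => (∫ y, f y * ech chi y) * ech (-chi) p)
      (∑ᶠ m : Fin g → ℤ, f (p + intVec m)) := by
  have he : ∀ m, (cubeTiling (Fin g)).e m = intVec m := fun m => rfl
  let F : C(Fin g → ℝ, ℂ) := ⟨fun p => ∑ᶠ m : Fin g → ℤ, f (p + intVec m),
    ((cubeTiling (Fin g)).contDiff_finsum hf).continuous⟩
  let q : C(Fin g → ℝ, UnitAddTorus (Fin g)) := ⟨fun p i => (p i : UnitAddCircle),
    continuous_pi fun i => (AddCircle.continuous_mk' _).comp (continuous_apply i)⟩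
  have hq : IsQuotientMap q :=
    (IsOpenQuotientMap.piMap fun _ : Fin g => QuotientAddGroup.isOpenQuotientMap_mk).isQuotientMap
  have hfac : Function.FactorsThrough F q := by
    intro x y hxy
    have h1 (i) : ∃ n : ℤ, y i - x i = n := by
      have := congrFun hxy i
      obtain ⟨n, hn⟩ := (QuotientAddGroup.eq_iff_sub_mem.1 this.symm)
      exact ⟨n, by simpa using hn.symm⟩
    choose m hm using h1
    have : y = x + intVec m := by
      ext i
      simp [intVec, ← hm]
    rw [this]
    exact ((cubeTiling (Fin g)).finsum_shift f x m).symm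
  let G : C(UnitAddTorus (Fin g), ℂ) := hq.lift F hfac
  have hG (x : Fin g → ℝ) : G (fun i => (x i : UnitAddCircle)) = F x :=
    DFunLike.congr_fun (hq.lift_comp F hfac) x
  have hcoef (n : Fin g → ℤ) : UnitAddTorus.mFourierCoeff G n = ∫ y, f y * ech (-n) y := by
    rw [UnitAddTorus.mFourierCoeff_eq_integral G n 0]
    simp only [hG, mFourier_coe, smul_eq_mul]
    rw [← (cubeTiling (Fin g)).integral_finsum volume (f := fun y => f y * ech (-n) y)
      (hf.continuous.mul (contDiff_ech (-n)).continuous) (hf.2.mul_right)]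
    refine integral_congr_ae (Eventually.of_forall fun x => ?_)
    change ech (-n) x * ∑ᶠ m, f (x + intVec m) = ∑ᶠ m, f (x + intVec m) * ech (-n) (x + intVec m)
    simp only [ech_add_intVec]
    rw [← smul_eq_mul, smul_finsum]
    exact finsum_congr fun m => by rw [smul_eq_mul, mul_comm]
  have hs' : Summable (UnitAddTorus.mFourierCoeff G) := by
    have h1 := (Equiv.neg (Fin g → ℤ)).summable_iff.2 hs
    refine h1.congr fun n => ?_
    rw [hcoef]
    rfl
  have h := UnitAddTorus.hasSum_mFourier_series_apply_of_summable hs' (fun i => (p i : UnitAddCircle))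
  rw [hG, ← (Equiv.neg (Fin g → ℤ)).hasSum_iff] at h
  refine h.congr_fun fun n => ?_
  simp only [Function.comp, Equiv.neg_apply, hcoef, neg_neg, mFourier_coe, smul_eq_mul]

/-! ### Continuity of distributional sections along series of test functions -/

/-- What remains after a finite partial sum has derivatives up to order N bounded by the tail of ∑
M, so the continuity bound of `T` makes the error tend to zero. -/
lemma EvBound.hasSum {j : ℤ} {T : DistSec g j} {B : Set (Cover g)} (hB : IsCompact B) {N : ℕ}
    {C : ℝ} (hT : EvBound T B N C) {ι : Type*} {F : ι → Cover g → ℂ} {f : Cover g → ℂ}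
    (hF : ∀ i, IsTest (F i)) (hFB : ∀ i, tsupport (F i) ⊆ B) (hf : IsTest f)
    (hfB : tsupport f ⊆ B) {M : ι → ℝ} (hM : Summable M) (hFM : ∀ i, CkBound N (M i) (F i))
    (hs : ∀ u, HasSum (fun i => F i u) (f u)) : HasSum (fun i => ev T (F i)) (ev T f) := by
  classical
  have hM0 (i) : 0 ≤ M i := (hFM i).nonneg
  have key (S : Finset ι) : ‖ev T f - ∑ i ∈ S, ev T (F i)‖ ≤ C * (∑' i, M i - ∑ i ∈ S, M i) := by
    have hS : IsTest fun u => ∑ i ∈ S, F i u := IsTest.sum fun i _ => hF i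
    rw [← ev_sum T fun i _ => hF i, ← ev_sub T hf hS]
    have hsum : (∑' i, if i ∈ S then 0 else M i) = ∑' i, M i - ∑ i ∈ S, M i := by
      have h1 := hM.hasSum.sub (hasSum_sum_of_ne_finset_zero (s := S)
        (f := fun i => if i ∈ S then M i else 0) fun i hi => if_neg hi)
      have h2 : ∑ i ∈ S, (if i ∈ S then M i else 0) = ∑ i ∈ S, M i :=
        Finset.sum_congr rfl fun i hi => if_pos hi
      rw [h2] at h1
      rw [← h1.tsum_eq]
      exact tsum_congr fun i => by split_ifs <;> simp
    refine hT _ _ (hf.sub hS) ?_ ?_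
    · refine (tsupport_sub _ _).trans (union_subset hfB ?_)
      refine closure_minimal (fun u hu => ?_) hB.isClosed
      obtain ⟨i, hi, hi'⟩ := Finset.exists_ne_zero_of_sum_ne_zero hu
      exact hFB i (subset_tsupport _ hi')
    · have hsm : Summable fun i => if i ∈ S then 0 else M i :=
        Summable.of_nonneg_of_le (fun i => by split_ifs <;> simp [hM0]) (fun i => by
          split_ifs
          · exact hM0 i
          · exact le_rfl) hM
      have hb (k : ℕ) (i : ι) (x : Cover g) (hk : (k : ℕ∞) ≤ (N : ℕ∞)) :
          ‖iteratedFDeriv ℝ k (fun u => if i ∈ S then 0 else F i u) x‖ ≤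
            if i ∈ S then 0 else M i := by
        by_cases hi : i ∈ S
        · simp only [if_pos hi]
          rw [iteratedFDeriv_fun_zero]
          simp
        · simp only [if_neg hi]
          exact hFM i k (by exact_mod_cast hk) x
      have hcd (i : ι) : ContDiff ℝ N (fun u => if i ∈ S then 0 else F i u) := by
        by_cases hi : i ∈ S
        · simpa only [if_pos hi] using contDiff_const
        · simpa only [if_neg hi] using (hF i).1.of_le (by exact_mod_cast le_top)
      have heq : (fun u => f u - ∑ i ∈ S, F i u) = fun u => ∑' i, if i ∈ S then 0 else F i u := by
        funext u
        have h1 := (hs u).sub (hasSum_sum_of_ne_finset_zero (s := S)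
          (f := fun i => if i ∈ S then F i u else 0) fun i hi => if_neg hi)
        have h2 : ∑ i ∈ S, (if i ∈ S then F i u else 0) = ∑ i ∈ S, F i u :=
          Finset.sum_congr rfl fun i hi => if_pos hi
        rw [h2] at h1
        rw [← h1.tsum_eq]
        exact tsum_congr fun i => by split_ifs <;> simp
      intro k hk x
      rw [heq, ← hsum, iteratedFDeriv_tsum (N := N) hcd (v := fun _ i => if i ∈ S then 0 else M i)
        (fun _ _ => hsm) hb (by exact_mod_cast hk)]
      exact tsum_of_norm_bounded hsm.hasSum fun i => hb k i x (by exact_mod_cast hk)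
  rw [HasSum, tendsto_iff_norm_sub_tendsto_zero]
  refine squeeze_zero (fun _ => norm_nonneg _) (fun S => ?_)
    (g := fun S => C * (∑' i, M i - ∑ i ∈ S, M i)) ?_
  · rw [norm_sub_rev]
    exact key S
  · have h1 : Tendsto (fun S : Finset ι => ∑ i ∈ S, M i) atTop (𝓝 (∑' i, M i)) := hM.hasSum
    have := (tendsto_const_nhds (x := ∑' i, M i)).sub h1
    rw [sub_self] at this
    simpa using this.const_mul C

/-! ### Distributional sections in the coordinates of a frame -/

lemma exists_ckBound_comp {E F : Type*} [NormedAddCommGroup E] [NormedSpace ℝ E]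
    [NormedAddCommGroup F] [NormedSpace ℝ F] (L : E →L[ℝ] F) (K : ℕ) :
    ∃ C, 0 ≤ C ∧ ∀ (f : F → ℂ) (M : ℝ), ContDiff ℝ ∞ f → CkBound K M f →
      CkBound K (C * M) fun u => f (L u) := by
  refine ⟨(max 1 ‖L‖) ^ K, by positivity, fun f M hf hM n hn u => ?_⟩
  have h := L.iteratedFDeriv_comp_right (f := f) hf u (i := n) (by exact_mod_cast le_top)
  change ‖iteratedFDeriv ℝ n (f ∘ L) u‖ ≤ _
  rw [h]
  refine (ContinuousMultilinearMap.norm_compContinuousLinearMap_le _ _).trans ?_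
  rw [Finset.prod_const, Finset.card_univ, Fintype.card_fin, mul_comm]
  refine mul_le_mul ?_ (hM n hn _) (norm_nonneg _) (by positivity)
  calc ‖L‖ ^ n ≤ (max 1 ‖L‖) ^ n := by gcongr; exact le_max_right _ _
    _ ≤ _ := pow_le_pow_right₀ (le_max_left _ _) hn

lemma tsupport_comp_homeo {E F : Type*} [TopologicalSpace E] [TopologicalSpace F] (e : E ≃ₜ F)
    {f : F → ℂ} {B : Set F} (h : tsupport f ⊆ B) : tsupport (fun u => f (e u)) ⊆ e.symm '' B := by
  have h1 := tsupport_comp_subset_preimage f e.continuous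
  intro u hu
  exact ⟨e u, h (h1 hu), by simp⟩

/-- The seminorms bounding `T` look only at the unit cube, and near the cube the periodization of a
function supported in `B` is a sum over a fixed finite set of lattice vectors. -/
lemma exists_evBound {j : ℤ} (T : DistSec g j) {B : Set (Cover g)} (hB : IsCompact B) :
    ∃ N C, EvBound T B N C := by
  obtain ⟨N, C, h⟩ := T.2
  -- The unit cube lies in the ball of radius 1. Radius 2 leaves room for a neighbourhood of each of
  -- its points, as derivatives require.
  have hK : IsCompact (Metric.closedBall (0 : Cover g) 2) := isCompact_closedBall _ _
  have hfin : {l : Lattice g | ∃ u ∈ Metric.closedBall (0 : Cover g) 2, u + latt l ∈ B}.Finite := by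
    have h1 : IsCompact ((fun p : Cover g × Cover g => p.1 - p.2) ''
        (B ×ˢ Metric.closedBall 0 2)) := (hB.prod hK).image (by fun_prop)
    refine (finite_latt h1).subset ?_
    rintro l ⟨u, hu, hl⟩
    exact ⟨(u + latt l, u), ⟨hl, hu⟩, by simp⟩
  have hl (l : Lattice g) : ∃ c, 0 ≤ c ∧ ∀ f M, IsTest f → tsupport f ⊆ B → CkBound N M f →
      CkBound N (c * M) fun u => mult j l u * f (u + latt l) := by
    have hB' : IsCompact ((fun u => u - latt l) '' B) := hB.image (by fun_prop)
    obtain ⟨c, hc, hcf⟩ := exists_ckBound_mul (contDiff_mult j l) hB' N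
    refine ⟨c, hc, fun f M hf hfB hM => hcf _ M (hf.comp_add _).1 ?_ ?_⟩
    · intro u hu
      have h1 := tsupport_comp_subset_preimage f (continuous_add_const (latt l)) hu
      exact ⟨u + latt l, hfB h1, by simp⟩
    · intro n hn u
      rw [iteratedFDeriv_comp_add_right]
      exact hM n hn _
  choose c hc hcf using hl
  refine ⟨N, C * ∑ l ∈ hfin.toFinset, c l, fun f M hf hfB hM => ?_⟩
  rw [ev_eq T hf, mul_assoc]
  refine h _ _ fun n hn u hu => ?_
  have hev : periodizeFun (-j) f =ᶠ[𝓝 u]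
      fun v => ∑ l ∈ hfin.toFinset, mult j l v * f (v + latt l) := by
    have hu1 : ‖u‖ ≤ 1 := by
      refine max_le ?_ ?_ <;> refine (pi_norm_le_iff_of_nonneg zero_le_one).2 fun i => ?_ <;>
        rw [Real.norm_eq_abs, abs_le]
      · exact ⟨by have := hu.1.1 i; simp at this; linarith, hu.2.1 i⟩
      · exact ⟨by have := hu.1.2 i; simp at this; linarith, hu.2.2 i⟩
    filter_upwards [Metric.closedBall_mem_nhds u one_pos] with v hv
    rw [periodizeFun_eq_sum (-j) (F := hfin.toFinset), neg_neg]
    intro l hl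
    refine hfin.mem_toFinset.2 ⟨v, ?_, hfB hl⟩
    rw [mem_closedBall_zero_iff]
    rw [mem_closedBall_iff_norm] at hv
    have := norm_add_le (v - u) u
    rw [sub_add_cancel] at this
    linarith
  have hs := CkBound.sum (s := hfin.toFinset) (fun l _ => hcf l f M hf hfB hM)
    (fun l _ => (contDiff_mult j l).mul (hf.comp_add _).1)
  rw [← Finset.sum_mul] at hs
  change ‖iteratedFDeriv ℝ n (periodizeFun (-j) f) u‖ ≤ _
  rw [(Filter.EventuallyEq.iteratedFDeriv ℝ hev n).eq_of_nhds]
  exact hs n hn u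

/-- `exp (-π i K ⟨q, p⟩)`. -/
def phase (K : ℕ) (w : Cover g) : ℂ := exp (-(Real.pi * I * K * ((w.1 ⬝ᵥ w.2 : ℝ) : ℂ)))

lemma phase_ne_zero (K : ℕ) (w : Cover g) : phase K w ≠ 0 := exp_ne_zero _

lemma contDiff_phase (K : ℕ) : ContDiff ℝ ∞ (phase (g := g) K) := by
  have h : ContDiff ℝ ∞ (fun w : Cover g => ((w.1 ⬝ᵥ w.2 : ℝ) : ℂ)) := by
    have h : ContDiff ℝ ∞ (fun w : Cover g => ∑ i, w.1 i * w.2 i) :=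
      ContDiff.sum fun i _ => by fun_prop
    exact ofRealCLM.contDiff.comp h
  exact (contDiff_const.mul h).neg.cexp

lemma contDiff_inv_phase (K : ℕ) : ContDiff ℝ ∞ fun w : Cover g => (phase K w)⁻¹ :=
  (contDiff_phase K).inv fun w => phase_ne_zero _ w

lemma fderiv_phase (K : ℕ) (w v : Cover g) :
    fderiv ℝ (phase K) w v =
      -(Real.pi * I * K * ((v.1 ⬝ᵥ w.2 + w.1 ⬝ᵥ v.2 : ℝ) : ℂ)) * phase K w := by
  have h1 : HasDerivAt (fun r : ℝ => phase K (w + r • v)) (fderiv ℝ (phase K) w v) 0 := by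
    have h := ((contDiff_phase K).differentiable (by simp) (w + (0 : ℝ) • v)).hasFDerivAt
    have h2 : HasDerivAt (fun r : ℝ => w + r • v) v 0 := by
      simpa using ((hasDerivAt_id (0 : ℝ)).smul_const v).const_add w
    have h3 := h.comp_hasDerivAt (0 : ℝ) h2
    simpa using! h3
  refine h1.unique ?_
  have h4 : HasDerivAt (fun r : ℝ => (w.1 ⬝ᵥ w.2 + r * (v.1 ⬝ᵥ w.2 + w.1 ⬝ᵥ v.2)
      + r * r * (v.1 ⬝ᵥ v.2) : ℝ)) (v.1 ⬝ᵥ w.2 + w.1 ⬝ᵥ v.2) 0 := by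
    have hi := hasDerivAt_id (0 : ℝ)
    have := ((hi.mul_const (v.1 ⬝ᵥ w.2 + w.1 ⬝ᵥ v.2)).const_add (w.1 ⬝ᵥ w.2)).add
      ((hi.mul hi).mul_const (v.1 ⬝ᵥ v.2))
    simpa using! this
  have h5 := ((h4.ofReal_comp.const_mul (Real.pi * I * K : ℂ)).fun_neg).cexp
  refine HasDerivAt.congr_deriv (h5.congr_of_eventuallyEq (Eventually.of_forall fun r => ?_)) ?_
  · simp only [phase, Prod.fst_add, Prod.snd_add, Prod.smul_fst, Prod.smul_snd, add_dotProduct,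
      dotProduct_add, smul_dotProduct, dotProduct_smul, smul_eq_mul]
    congr 4
    ring
  · simp [phase]
    ring

namespace Frame

variable {t t' : Matrix (Fin g) (Fin g) ℂ} (F : Frame t t')

/-- The level of `Lᵏ` in the coordinates of the frame. -/
def lev (k : ℕ) : ℕ := k * F.kap

/-- The function on the cover that is `g(q, p)` in the coordinates of the frame, up to a phase. -/
def pull (k : ℕ) (f : Cover g → ℂ) (u : Cover g) : ℂ :=
  phase (F.lev k) (F.A.symm u) * f (F.A.symm u)

lemma pull_A (k : ℕ) (f : Cover g → ℂ) (w : Cover g) :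
    F.pull k f (F.A w) = phase (F.lev k) w * f w := by simp [pull]

/-- The inverse of `pull`. -/
def unpull (k : ℕ) (f : Cover g → ℂ) (w : Cover g) : ℂ := (phase (F.lev k) w)⁻¹ * f (F.A w)

lemma pull_unpull (k : ℕ) (f : Cover g → ℂ) : F.pull k (F.unpull k f) = f := by
  funext u
  simp [pull, unpull, phase_ne_zero]

lemma isTest_pull (k : ℕ) {f : Cover g → ℂ} (hf : IsTest f) : IsTest (F.pull k f) :=
  (hf.mul_left (contDiff_phase (F.lev k))).comp_homeo F.A.symm.toHomeomorph F.A.symm.contDiff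

lemma isTest_unpull (k : ℕ) {f : Cover g → ℂ} (hf : IsTest f) : IsTest (F.unpull k f) :=
  (hf.comp_homeo F.A.toHomeomorph F.A.contDiff).mul_left
    (contDiff_inv_phase (F.lev k))

lemma tsupport_pull {k : ℕ} {f : Cover g → ℂ} {B : Set (Cover g)} (h : tsupport f ⊆ B) :
    tsupport (F.pull k f) ⊆ F.A '' B :=
  tsupport_comp_homeo F.A.symm.toHomeomorph (f := fun w => phase (F.lev k) w * f w)
    ((tsupport_mul_subset_right (f := phase (F.lev k)) (g := f)).trans h)

lemma tsupport_unpull {k : ℕ} {f : Cover g → ℂ} {B : Set (Cover g)} (h : tsupport f ⊆ B) :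
    tsupport (F.unpull k f) ⊆ F.A.symm '' B := by
  have h1 : tsupport (fun w => f (F.A w)) ⊆ F.A.symm '' B :=
    tsupport_comp_homeo F.A.toHomeomorph h
  have h2 : tsupport (F.unpull k f) ⊆ tsupport (fun w => f (F.A w)) :=
    closure_mono fun w hw => right_ne_zero_of_mul hw
  exact h2.trans h1

lemma exists_ckBound_pull (k : ℕ) {B : Set (Cover g)} (hB : IsCompact B) (K : ℕ) :
    ∃ C, 0 ≤ C ∧ ∀ (f : Cover g → ℂ) (M : ℝ), ContDiff ℝ ∞ f → tsupport f ⊆ B → CkBound K M f →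
      CkBound K (C * M) (F.pull k f) := by
  obtain ⟨C, hC, h⟩ := exists_ckBound_mul (contDiff_phase (F.lev k)) hB K
  obtain ⟨C', hC', h'⟩ := exists_ckBound_comp (F.A.symm : Cover g →L[ℝ] Cover g) K
  refine ⟨C' * C, mul_nonneg hC' hC, fun f M hf hfB hM => ?_⟩
  have h1 : ContDiff ℝ ∞ fun w => phase (F.lev k) w * f w := (contDiff_phase _).mul hf
  have h2 := h' _ _ h1 (h f M hf hfB hM)
  rw [← mul_assoc] at h2
  exact h2

lemma exists_ckBound_unpull (k : ℕ) {B : Set (Cover g)} (hB : IsCompact B) (K : ℕ) :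
    ∃ C, 0 ≤ C ∧ ∀ (f : Cover g → ℂ) (M : ℝ), ContDiff ℝ ∞ f → tsupport f ⊆ B → CkBound K M f →
      CkBound K (C * M) (F.unpull k f) := by
  obtain ⟨C, hC, h⟩ := exists_ckBound_mul
    (contDiff_inv_phase (F.lev k)) (hB.image F.A.symm.continuous) K
  obtain ⟨C', hC', h'⟩ := exists_ckBound_comp (F.A : Cover g →L[ℝ] Cover g) K
  refine ⟨C * C', mul_nonneg hC hC', fun f M hf hfB hM => ?_⟩
  have h1 : ContDiff ℝ ∞ fun w => f (F.A w) := hf.comp F.A.contDiff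
  have h2 : tsupport (fun w => f (F.A w)) ⊆ F.A.symm '' B :=
    tsupport_comp_homeo F.A.toHomeomorph hfB
  have h3 : CkBound K (C' * M) fun w => f (F.A w) := h' f M hf hM
  have h4 := h _ _ h1 h2 h3
  rw [← mul_assoc] at h4
  exact h4

lemma fderiv_pull (k : ℕ) {f : Cover g → ℂ} (hf : Differentiable ℝ f) (w v : Cover g) :
    fderiv ℝ (F.pull k f) (F.A w) (F.A v) = phase (F.lev k) w *
      (fderiv ℝ f w v - Real.pi * I * F.lev k * ((v.1 ⬝ᵥ w.2 + w.1 ⬝ᵥ v.2 : ℝ) : ℂ) * f w) := by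
  have hp := (contDiff_phase (g := g) (F.lev k)).differentiable (by simp)
  have h1 : fderiv ℝ (F.pull k f) (F.A w) =
      (fderiv ℝ (fun w => phase (F.lev k) w * f w) w).comp (F.A.symm : Cover g →L[ℝ] Cover g) := by
    have := F.A.symm.comp_right_fderiv (f := fun w => phase (F.lev k) w * f w) (x := F.A w)
    rw [ContinuousLinearEquiv.symm_apply_apply] at this
    exact this
  rw [h1, ContinuousLinearMap.comp_apply, ContinuousLinearEquiv.coe_coe,
    ContinuousLinearEquiv.symm_apply_apply]
  rw [fderiv_fun_mul (hp w) (hf w)]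
  simp only [_root_.add_apply, _root_.smul_apply, smul_eq_mul, fderiv_phase]
  ring

/-- The derivative along a complex vector. -/
def _root_.TorusQuantization.cderiv (xi : CTangent g) (f : Cover g → ℂ) (w : Cover g) : ℂ :=
  fderiv ℝ f w (reT xi) + I * fderiv ℝ f w (imT xi)

/-- The phase replaces the symmetric gauge by one in which the connection form is a multiple of q ·
dp. Covariant derivatives in the q-directions become plain derivatives. -/
lemma covDerivFun_pull (k : ℕ) {f : Cover g → ℂ} (hf : Differentiable ℝ f) (xi : CTangent g) :
    covDerivFun (-(k : ℤ)) (F.AC xi) (F.pull k f) =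
      F.pull k fun w => cderiv xi f w - 2 * Real.pi * I * F.lev k * (toC w.1 ⬝ᵥ xi.2) * f w := by
  funext u
  obtain ⟨w, rfl⟩ := F.A.surjective u
  rw [covDerivFun_eq, reT_AC, imT_AC, F.fderiv_pull k hf, F.fderiv_pull k hf, F.omega_A, F.omega_A,
    pull_A, pull_A, cderiv]
  have e : toC w.1 ⬝ᵥ xi.2 = ((w.1 ⬝ᵥ (reT xi).2 : ℝ) : ℂ) + I * ((w.1 ⬝ᵥ (imT xi).2 : ℝ) : ℂ) := by
    simp only [dotProduct, toC, reT, imT, ofReal_sum, Finset.mul_sum, ← Finset.sum_add_distrib]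
    refine Finset.sum_congr rfl fun i _ => ?_
    conv_lhs => rw [← re_add_im (xi.2 i)]
    push_cast
    ring
  have ho (a b : Cover g) : omega a b = b.1 ⬝ᵥ a.2 - a.1 ⬝ᵥ b.2 := by
    simp only [omega, dotProduct, ← Finset.sum_sub_distrib]
    exact Finset.sum_congr rfl fun i _ => by ring
  rw [e, ho, ho, lev]
  push_cast
  ring

lemma ev_pull_cderiv {k : ℕ} {T : DistSec g k} {xi : CTangent g} (hT : IsParallel T (F.AC xi))
    {f : Cover g → ℂ} (hf : IsTest f) :
    ev T (F.pull k fun w =>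
      cderiv xi f w - 2 * Real.pi * I * F.lev k * (toC w.1 ⬝ᵥ xi.2) * f w) = 0 := by
  rw [← F.covDerivFun_pull k (hf.1.differentiable (by simp))]
  exact hT.ev_covDerivFun (F.isTest_pull k hf)

lemma even_lev (k : ℕ) : Even (F.lev k) := F.kap_even.mul_left k

/-- All signs disappear because the frame maps the lattice into the even lattice and the level is
even. In this gauge integer translations in p act trivially, and those in q act with a character in
p. -/
lemma ev_pull_translate {k : ℕ} (T : DistSec g k) {f : Cover g → ℂ} (hf : IsTest f)
    (l : Lattice g) :
    ev T (F.pull k fun w => ech (-(F.lev k • l.1)) w.2 * f (w + latt l)) = ev T (F.pull k f) := by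
  obtain ⟨m, hm⟩ := F.latt_A l
  rw [← ev_translate T (F.isTest_pull k hf) (m + m)]
  congr 1
  funext u
  obtain ⟨w, rfl⟩ := F.A.surjective u
  rw [pull_A, ← hm, ← map_add, pull_A, mult, ← hm, F.omega_A]
  have hs : ((-1 : ℂ) ^ ((k : ℤ) * ∑ i, (m + m).1 i * (m + m).2 i)) = 1 := by
    refine Even.neg_one_zpow (Even.mul_left ?_ _)
    refine ⟨2 * ∑ i, m.1 i * m.2 i, ?_⟩
    rw [Finset.mul_sum, ← Finset.sum_add_distrib]
    exact Finset.sum_congr rfl fun i _ => by simp; ring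
  rw [hs, one_mul, ← mul_assoc, ← mul_assoc]
  congr 1
  obtain ⟨r, hr⟩ := F.even_lev k
  rw [phase, phase, ech, ← exp_add, ← exp_add, exp_eq_exp_iff_exists_int]
  have hk : (k : ℂ) * F.kap = F.lev k := by rw [lev]; push_cast; ring
  have hr' : (F.lev k : ℂ) = r + r := by exact_mod_cast hr
  refine ⟨r * ∑ i, l.1 i * l.2 i, ?_⟩
  have e1 : ((omega w (latt l) : ℝ) : ℂ) = ∑ i, (l.1 i : ℂ) * (w.2 i : ℂ) - ∑ i, (w.1 i : ℂ) * l.2 i := by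
    simp only [omega, latt, ofReal_sum, ← Finset.sum_sub_distrib]
    refine Finset.sum_congr rfl fun i _ => ?_
    push_cast
    ring
  have e2 : (((w + latt l).1 ⬝ᵥ (w + latt l).2 : ℝ) : ℂ) = ((w.1 ⬝ᵥ w.2 : ℝ) : ℂ) +
      (∑ i, (l.1 i : ℂ) * (w.2 i : ℂ) + ∑ i, (w.1 i : ℂ) * l.2 i + ∑ i, (l.1 i : ℂ) * l.2 i) := by
    simp only [dotProduct, latt, ofReal_sum, ← Finset.sum_add_distrib]
    refine Finset.sum_congr rfl fun i _ => ?_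
    simp
    ring
  have e3 : ∑ i, (((-(F.lev k • l.1)) i : ℤ) : ℂ) * (w.2 i : ℂ) =
      -(F.lev k * ∑ i, (l.1 i : ℂ) * (w.2 i : ℂ)) := by
    rw [Finset.mul_sum, ← Finset.sum_neg_distrib]
    refine Finset.sum_congr rfl fun i _ => ?_
    simp
    ring
  rw [e2, e3]
  push_cast
  rw [e1]
  linear_combination (Real.pi * I * (∑ i, (l.1 i : ℂ) * (w.2 i : ℂ) - ∑ i, (w.1 i : ℂ) * l.2 i)) * hk
    + (Real.pi * I * ∑ i, (l.1 i : ℂ) * l.2 i) * hr'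

end Frame

/-! ### Partial Fourier coefficients of test functions -/

lemma IsTest.tensor {E E' : Type*} [NormedAddCommGroup E] [NormedSpace ℝ E]
    [NormedAddCommGroup E'] [NormedSpace ℝ E'] {a : E → ℂ} {b : E' → ℂ} (ha : IsTest a)
    (hb : IsTest b) : IsTest fun w : E × E' => a w.1 * b w.2 := by
  refine ⟨(ha.1.comp contDiff_fst).mul (hb.1.comp contDiff_snd),
    HasCompactSupport.intro (ha.2.isCompact.prod hb.2.isCompact) fun w hw => ?_⟩
  by_contra h
  exact hw ⟨subset_tsupport _ (left_ne_zero_of_mul h), subset_tsupport _ (right_ne_zero_of_mul h)⟩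

lemma IsTest.slice {E E' : Type*} [NormedAddCommGroup E] [NormedSpace ℝ E]
    [NormedAddCommGroup E'] [NormedSpace ℝ E'] {f : E × E' → ℂ} (hf : IsTest f) (q : E) :
    IsTest fun p => f (q, p) := by
  refine ⟨hf.1.comp (contDiff_const.prodMk contDiff_id),
    HasCompactSupport.intro (hf.2.isCompact.image continuous_snd) fun p hp => ?_⟩
  by_contra h
  exact hp ⟨(q, p), subset_tsupport _ h, rfl⟩

/-- `∫ f(q, p) exp (2π i ⟨χ, p⟩) dp`. -/
def halfFourier (f : Cover g → ℂ) (chi : Fin g → ℤ) (q : Fin g → ℝ) : ℂ :=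
  ∫ p, f (q, p) * ech chi p

lemma isTest_mul_ech {f : Cover g → ℂ} (hf : IsTest f) (chi : Fin g → ℤ) :
    IsTest fun w => f w * ech chi w.2 :=
  hf.mul_right ((contDiff_ech chi).comp contDiff_snd)

lemma halfFourier_eq_zero {f : Cover g → ℂ} {chi : Fin g → ℤ} {q : Fin g → ℝ}
    (hq : q ∉ Prod.fst '' tsupport f) : halfFourier f chi q = 0 := by
  have h (p) : f (q, p) = 0 := by
    by_contra h
    exact hq ⟨(q, p), subset_tsupport _ h, rfl⟩
  simp [halfFourier, h]

lemma isTest_halfFourier {f : Cover g → ℂ} (hf : IsTest f) (chi : Fin g → ℤ) :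
    IsTest (halfFourier f chi) := by
  refine ⟨contDiff_infty.2 fun n => ?_, HasCompactSupport.intro
    (hf.2.isCompact.image continuous_fst) fun q hq => halfFourier_eq_zero hq⟩
  exact (integral_param volume (hf.2.isCompact.image continuous_snd) n
    (fun w : Cover g => f w * ech chi w.2) (isTest_mul_ech hf chi).1 (isTest_mul_ech hf chi).2
    fun q p hp => by
      have : f (q, p) = 0 := by
        by_contra h
        exact hp ⟨(q, p), subset_tsupport _ h, rfl⟩
      simp [this]).1

lemma ckBound_slice {f : Cover g → ℂ} (hf : ContDiff ℝ ∞ f) {N : ℕ} {M : ℝ} (hM : CkBound N M f)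
    (p : Fin g → ℝ) : CkBound N M fun q => f (q, p) := by
  intro n hn q
  have e : (fun q => f (q, p)) =
      (fun w => f (w + (0, p))) ∘ (ContinuousLinearMap.inl ℝ (Fin g → ℝ) (Fin g → ℝ)) := by
    funext q
    simp
  have hs : ContDiff ℝ ∞ fun w => f (w + (0, p)) := hf.comp (contDiff_id.add contDiff_const)
  rw [e, ContinuousLinearMap.iteratedFDeriv_comp_right _ hs _ (by exact_mod_cast le_top)]
  refine (ContinuousMultilinearMap.norm_compContinuousLinearMap_le _ _).trans ?_
  rw [Finset.prod_const, Finset.card_univ, Fintype.card_fin, iteratedFDeriv_comp_add_right]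
  have h1 : ‖ContinuousLinearMap.inl ℝ (Fin g → ℝ) (Fin g → ℝ)‖ ≤ 1 :=
    ContinuousLinearMap.opNorm_le_bound _ zero_le_one fun x => by simp
  calc _ ≤ M * 1 ^ n := by
        refine mul_le_mul (hM n hn _) (pow_le_pow_left₀ (norm_nonneg _) h1 n) (by positivity)
          hM.nonneg
    _ = M := by simp

lemma ckBound_halfFourier {f : Cover g → ℂ} (hf : IsTest f) {B : Set (Cover g)} (hB : IsCompact B)
    (hfB : tsupport f ⊆ B) {N : ℕ} {M : ℝ} (hM : CkBound N M f) (chi : Fin g → ℤ) :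
    CkBound N (M * volume.real (Prod.snd '' B)) (halfFourier f chi) := by
  intro n hn q
  refine (integral_param volume (hB.image continuous_snd) n
    (fun w : Cover g => f w * ech chi w.2) (isTest_mul_ech hf chi).1 (isTest_mul_ech hf chi).2
    fun q p hp => ?_).2 M (fun q p => ?_) q
  · have : f (q, p) = 0 := by
      by_contra h
      exact hp ⟨(q, p), hfB (subset_tsupport _ h), rfl⟩
    simp [this]
  · have e : (fun q => f (q, p) * ech chi p) = ech chi p • fun q => f (q, p) := by
      funext q
      simp [mul_comm]
    have h1 := (ckBound_slice hf.1 hM p)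
    have hs : ContDiff ℝ ∞ fun q => f (q, p) := hf.1.comp (contDiff_id.prodMk contDiff_const)
    change ‖iteratedFDeriv ℝ n (fun q => f (q, p) * ech chi p) q‖ ≤ M
    rw [e, iteratedFDeriv_const_smul_apply (hs.contDiffAt.of_le (by exact_mod_cast le_top)), norm_smul,
      norm_ech, one_mul]
    exact h1 n hn q

lemma halfFourier_fderiv {f : Cover g → ℂ} (hf : IsTest f) (chi : Fin g → ℤ) (j : Fin g) :
    halfFourier (fun w => fderiv ℝ f w (0, Pi.single j 1)) chi =
      fun q => -(2 * Real.pi * I * chi j) * halfFourier f chi q := by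
  funext q
  have h1 := hf.slice q
  have e1 (p) : fderiv ℝ (fun p => f (q, p)) p (Pi.single j 1) = fderiv ℝ f (q, p) (0, Pi.single j 1) := by
    have h2 := ((hf.1.differentiable (by simp)) (q, p)).hasFDerivAt.comp p
      ((hasFDerivAt_const q p).prodMk (hasFDerivAt_id p))
    have h3 : HasFDerivAt (fun p => f (q, p)) _ p := h2
    rw [h3.fderiv]
    simp
  have he := contDiff_ech chi
  have h2 := integral_mul_fderiv_eq_neg_fderiv_mul_of_integrable (μ := volume)
    (f := ech chi) (g := fun p => f (q, p)) (v := Pi.single j 1)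
    ((h1.mul_left ((he.fderiv_right (m := ∞) (by simp)).clm_apply contDiff_const)).integrable)
    ((h1.fderiv_apply (Pi.single j 1)).mul_left he).integrable (h1.mul_left he).integrable
    (fun p _ => he.differentiable (by simp) p) (fun p _ => h1.1.differentiable (by simp) p)
  simp only [e1, hasFDerivAt_ech] at h2
  have e2 : ∑ i, (chi i : ℂ) * ((Pi.single j (1 : ℝ) : Fin g → ℝ) i : ℂ) = chi j := by
    rw [Finset.sum_eq_single j]
    · simp
    · intro i _ hi
      simp [hi]
    · simp
  rw [e2] at h2
  simp only [halfFourier]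
  rw [← integral_const_mul]
  calc _ = ∫ p, ech chi p * fderiv ℝ f (q, p) (0, Pi.single j 1) := by
        congr 1; funext p; ring
    _ = _ := by
        rw [h2, ← integral_neg]
        congr 1
        funext p
        ring

lemma ckBound_halfFourier_pow {B : Set (Cover g)} (hB : IsCompact B) {N : ℕ} (chi : Fin g → ℤ)
    (j : Fin g) (n : ℕ) {f : Cover g → ℂ} (hf : IsTest f) (hfB : tsupport f ⊆ B) {M : ℝ}
    (hM : CkBound (N + n) M f) :
    CkBound N (M * volume.real (Prod.snd '' B)) fun q => ((2 * Real.pi * I * chi j) ^ n) *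
      halfFourier f chi q := by
  induction n generalizing f M with
  | zero => simpa using ckBound_halfFourier hf hB hfB hM chi
  | succ n ih =>
    have hv : ‖((0, Pi.single j 1) : Cover g)‖ ≤ 1 := by
      rw [Prod.norm_mk]
      simp [Pi.norm_single]
    have h1 : CkBound (N + n) M fun w => fderiv ℝ f w (0, Pi.single j 1) := by
      have := hM.fderiv_apply hf.1 (0, Pi.single j 1)
      exact this.mono le_rfl (mul_le_of_le_one_left hM.nonneg hv)
    have h2 := ih (hf.fderiv_apply _) ((tsupport_fderiv_apply_subset _ _).trans hfB) h1
    rw [halfFourier_fderiv hf] at h2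
    have h3 := h2.const_mul (contDiff_const.mul (contDiff_const.mul (isTest_halfFourier hf chi).1))
      (-1)
    simp only [norm_neg, norm_one, one_mul] at h3
    convert h3 using 2 with q
    ring

/-- For χ ≠ 0, integrate by parts n times in the coordinate where |χⱼ| is largest; there 2π |χⱼ| ≥ 1
+ ‖χ‖. -/
lemma ckBound_halfFourier_decay {B : Set (Cover g)} (hB : IsCompact B) {N : ℕ} (chi : Fin g → ℤ)
    (n : ℕ) {f : Cover g → ℂ} (hf : IsTest f) (hfB : tsupport f ⊆ B) {M : ℝ}
    (hM : CkBound (N + n) M f) :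
    CkBound N (M * volume.real (Prod.snd '' B) * ((1 + ‖chi‖) ^ n)⁻¹) (halfFourier f chi) := by
  by_cases h0 : chi = 0
  · subst h0
    simpa using ckBound_halfFourier hf hB hfB (hM.mono (Nat.le_add_right _ _) le_rfl) 0
  have hne : Nonempty (Fin g) := by
    by_contra h
    rw [not_nonempty_iff] at h
    exact h0 (Subsingleton.elim _ _)
  obtain ⟨j, hj⟩ : ∃ j, ‖chi‖ = ‖chi j‖ := by
    obtain ⟨j, -, hj⟩ := Finset.exists_max_image Finset.univ (fun j => ‖chi j‖) Finset.univ_nonempty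
    refine ⟨j, le_antisymm ?_ (norm_le_pi_norm chi j)⟩
    exact (pi_norm_le_iff_of_nonneg (norm_nonneg _)).2 fun i => hj i (Finset.mem_univ _)
  have hj1 : (1 : ℝ) ≤ ‖chi j‖ := by
    have h1 : chi j ≠ 0 := by
      intro h
      rw [h, norm_zero, norm_eq_zero] at hj
      exact h0 hj
    rw [Int.norm_eq_abs]
    exact_mod_cast Int.one_le_abs h1
  have h1 := (ckBound_halfFourier_pow hB chi j n hf hfB hM).const_mul
    (contDiff_const.mul (isTest_halfFourier hf chi).1) (((2 * Real.pi * I * chi j) ^ n)⁻¹)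
  have hz : (2 * Real.pi * I * chi j : ℂ) ≠ 0 := by
    intro h
    have : ‖(2 * Real.pi * I * chi j : ℂ)‖ = 2 * Real.pi * ‖chi j‖ := by
      simp [Int.norm_eq_abs, abs_of_pos Real.pi_pos]
    rw [h, norm_zero] at this
    have := Real.pi_pos
    nlinarith
  have e : (fun q => ((2 * Real.pi * I * chi j : ℂ) ^ n)⁻¹ * ((2 * Real.pi * I * chi j) ^ n *
      halfFourier f chi q)) = halfFourier f chi := by
    funext q
    rw [← mul_assoc, inv_mul_cancel₀ (pow_ne_zero _ hz), one_mul]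
  rw [e] at h1
  refine h1.mono le_rfl ?_
  rw [mul_comm]
  refine mul_le_mul_of_nonneg_left ?_ (mul_nonneg hM.nonneg measureReal_nonneg)
  rw [norm_inv, norm_pow]
  refine inv_anti₀ (by positivity) (pow_le_pow_left₀ (by positivity) ?_ n)
  have : ‖(2 * Real.pi * I * chi j : ℂ)‖ = 2 * Real.pi * ‖chi j‖ := by
    simp [Int.norm_eq_abs, abs_of_pos Real.pi_pos]
  rw [this, hj]
  nlinarith [Real.pi_gt_three]

lemma hasSum_halfFourier {f : Cover g → ℂ} (hf : IsTest f) (w : Cover g) :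
    HasSum (fun chi : Fin g → ℤ => halfFourier f chi w.1 * ech (-chi) w.2)
      (∑ᶠ m : Fin g → ℤ, f (w.1, w.2 + intVec m)) := by
  refine hasSum_fourier_periodization (hf.slice w.1) ?_ w.2
  obtain ⟨M, hM⟩ := hf.exists_ckBound (0 + 2 * g)
  refine Summable.of_norm_bounded
    ((summable_inv_one_add_norm_pow g).mul_left (M * volume.real (Prod.snd '' tsupport f)))
    fun chi => ?_
  exact (ckBound_halfFourier_decay hf.2.isCompact chi (2 * g) hf subset_rfl hM).norm_le w.1

/-! ### The Fourier expansion of parallel distributional sections -/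

/-- A test function on `ℝᵍ` whose integral translates sum to `1`. -/
def unitPart (g : ℕ) : (Fin g → ℝ) → ℂ := Classical.choose (cubeTiling (Fin g)).exists_partition

lemma isTest_unitPart : IsTest (unitPart g) :=
  (Classical.choose_spec (cubeTiling (Fin g)).exists_partition).1

lemma finsum_unitPart (p : Fin g → ℝ) : ∑ᶠ m : Fin g → ℤ, unitPart g (p + intVec m) = 1 :=
  (Classical.choose_spec (cubeTiling (Fin g)).exists_partition).2 p

/-- `ψ(q) β(p) exp (-2π i ⟨χ, p⟩)`. -/
def partWave (chi : Fin g → ℤ) (psi : (Fin g → ℝ) → ℂ) (w : Cover g) : ℂ :=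
  psi w.1 * (unitPart g w.2 * ech (-chi) w.2)

lemma isTest_partWave (chi : Fin g → ℤ) {psi : (Fin g → ℝ) → ℂ} (h : IsTest psi) :
    IsTest (partWave chi psi) := h.tensor (isTest_unitPart.mul_right (contDiff_ech (-chi)))

/-- `exp (π i K Z(q + χ / K))`. -/
def gaussian (K : ℕ) (Z : Matrix (Fin g) (Fin g) ℂ) (chi : Fin g → ℤ) (q : Fin g → ℝ) : ℂ :=
  exp (Real.pi * I * K * quad Z (q + (K : ℝ)⁻¹ • intVec chi))

lemma gaussian_ne_zero (K : ℕ) (Z : Matrix (Fin g) (Fin g) ℂ) (chi : Fin g → ℤ) (q : Fin g → ℝ) :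
    gaussian K Z chi q ≠ 0 := exp_ne_zero _

lemma contDiff_gaussian (K : ℕ) (Z : Matrix (Fin g) (Fin g) ℂ) (chi : Fin g → ℤ) :
    ContDiff ℝ ∞ (gaussian K Z chi) := by
  have h (i : Fin g) : ContDiff ℝ ∞ fun q : Fin g → ℝ => toC (q + (K : ℝ)⁻¹ • intVec chi) i :=
    ofRealCLM.contDiff.comp ((contDiff_apply ℝ ℝ i).add contDiff_const)
  have h2 : ContDiff ℝ ∞ fun q : Fin g → ℝ => quad Z (q + (K : ℝ)⁻¹ • intVec chi) := by
    unfold quad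
    simp only [dotProduct, mulVec]
    exact ContDiff.sum fun i _ => (h i).mul (ContDiff.sum fun l _ => contDiff_const.mul (h l))
  exact (contDiff_const.mul h2).cexp

lemma norm_gaussian_le {K : ℕ} {Z : Matrix (Fin g) (Fin g) ℂ} (hZ : ∀ v, 0 ≤ (quad Z v).im)
    (chi : Fin g → ℤ) (q : Fin g → ℝ) : ‖gaussian K Z chi q‖ ≤ 1 := by
  rw [gaussian, norm_exp, Real.exp_le_one_iff]
  have h := hZ (q + (K : ℝ)⁻¹ • intVec chi)
  have e (z : ℂ) : (Real.pi * I * K * z : ℂ).re = -(Real.pi * K * z.im) := by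
    simp [mul_re, mul_im]
  rw [e]
  have := Real.pi_pos
  have : 0 ≤ Real.pi * K * (quad Z (q + (K : ℝ)⁻¹ • intVec chi)).im := by positivity
  linarith

lemma quad_add_smul {Z : Matrix (Fin g) (Fin g) ℂ} (hs : Z.IsSymm) (x v : Fin g → ℝ) (r : ℝ) :
    quad Z (x + r • v) = quad Z x + r * (2 * (toC x ⬝ᵥ Z *ᵥ toC v)) + r * r * quad Z v := by
  simp only [quad, toC_add, toC_smul, mulVec_add, mulVec_smul, add_dotProduct, dotProduct_add,
    smul_dotProduct, dotProduct_smul, smul_eq_mul]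
  rw [← isSymm_dotProduct hs (toC v), dotProduct_comm (Z *ᵥ toC v)]
  ring

lemma fderiv_gaussian {K : ℕ} {Z : Matrix (Fin g) (Fin g) ℂ} (hs : Z.IsSymm) (chi : Fin g → ℤ)
    (q v : Fin g → ℝ) : fderiv ℝ (gaussian K Z chi) q v = 2 * Real.pi * I * K *
      (toC (q + (K : ℝ)⁻¹ • intVec chi) ⬝ᵥ Z *ᵥ toC v) * gaussian K Z chi q := by
  have h1 : HasDerivAt (fun r : ℝ => gaussian K Z chi (q + r • v))
      (fderiv ℝ (gaussian K Z chi) q v) 0 := by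
    have h := ((contDiff_gaussian K Z chi).differentiable (by simp) (q + (0 : ℝ) • v)).hasFDerivAt
    have h2 : HasDerivAt (fun r : ℝ => q + r • v) v 0 := by
      simpa using ((hasDerivAt_id (0 : ℝ)).smul_const v).const_add q
    have h3 := h.comp_hasDerivAt (0 : ℝ) h2
    simpa using! h3
  refine h1.unique ?_
  set x := q + (K : ℝ)⁻¹ • intVec chi with hx
  have h4 : HasDerivAt (fun r : ℝ => quad Z x + r * (2 * (toC x ⬝ᵥ Z *ᵥ toC v))
      + r * r * quad Z v) (2 * (toC x ⬝ᵥ Z *ᵥ toC v)) 0 := by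
    have hi : HasDerivAt (fun r : ℝ => (r : ℂ)) 1 0 := by
      simpa using (hasDerivAt_id (0 : ℝ)).ofReal_comp
    have := ((hi.mul_const (2 * (toC x ⬝ᵥ Z *ᵥ toC v))).const_add (quad Z x)).add
      ((hi.mul hi).mul_const (quad Z v))
    simpa using! this
  have h5 := (h4.const_mul (Real.pi * I * K : ℂ)).cexp
  refine HasDerivAt.congr_deriv (h5.congr_of_eventuallyEq (Eventually.of_forall fun r => ?_)) ?_
  · have e : q + r • v + (K : ℝ)⁻¹ • intVec chi = x + r • v := by rw [hx]; abel
    simp only [gaussian]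
    rw [e, quad_add_smul hs]
  · simp [gaussian, ← hx]
    ring

lemma fderiv_tensor {a b : (Fin g → ℝ) → ℂ} (ha : Differentiable ℝ a) (hb : Differentiable ℝ b)
    (w u : Cover g) : fderiv ℝ (fun w : Cover g => a w.1 * b w.2) w u =
      fderiv ℝ a w.1 u.1 * b w.2 + a w.1 * fderiv ℝ b w.2 u.2 := by
  have h1 : HasFDerivAt (fun w : Cover g => a w.1) _ w := (ha w.1).hasFDerivAt.comp w hasFDerivAt_fst
  have h2 : HasFDerivAt (fun w : Cover g => b w.2) _ w := (hb w.2).hasFDerivAt.comp w hasFDerivAt_snd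
  rw [(h1.fun_mul h2).fderiv]
  simp
  ring

lemma finsum_fderiv_unitPart (p v : Fin g → ℝ) :
    ∑ᶠ m : Fin g → ℤ, fderiv ℝ (unitPart g) (p + intVec m) v = 0 := by
  have hfin := (cubeTiling (Fin g)).finite_translates isTest_unitPart.2 (isCompact_closedBall p 1)
  have hev : (fun _ => 1) =ᶠ[𝓝 p]
      fun p' => ∑ m ∈ hfin.toFinset, unitPart g (p' + intVec m) := by
    filter_upwards [Metric.closedBall_mem_nhds p one_pos] with p' hp'
    have := (cubeTiling (Fin g)).finsum_eq_sum (f := unitPart g) (F := hfin.toFinset)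
      (a := fun _ => 1) (u := p') fun l hl => by simpa using ⟨p', by simpa using hp', hl⟩
    simp only [one_mul] at this
    exact (finsum_unitPart p').symm.trans this
  have h1 : ∑ᶠ m : Fin g → ℤ, fderiv ℝ (unitPart g) (p + intVec m) v =
      ∑ m ∈ hfin.toFinset, fderiv ℝ (unitPart g) (p + intVec m) v := by
    refine finsum_eq_sum_of_support_subset _ fun m hm => ?_
    rw [Finset.mem_coe, Finite.mem_toFinset]
    refine ⟨p, Metric.mem_closedBall_self zero_le_one, ?_⟩
    exact tsupport_fderiv_apply_subset _ v (subset_tsupport _ hm)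
  have h2 : HasFDerivAt (fun p' => ∑ m ∈ hfin.toFinset, unitPart g (p' + intVec m))
      (∑ m ∈ hfin.toFinset, fderiv ℝ (unitPart g) (p + intVec m)) p := by
    refine HasFDerivAt.fun_sum fun m _ => ?_
    have := (isTest_unitPart.1.differentiable (by simp) (p + intVec m)).hasFDerivAt.comp p
      ((hasFDerivAt_id p).add_const (intVec m))
    rwa [ContinuousLinearMap.comp_id] at this
  have h3 := h2.unique ((hasFDerivAt_const (1 : ℂ) p).congr_of_eventuallyEq hev.symm)
  rw [h1]
  have := congrArg (fun L => L v) h3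
  simpa using this

/-- One finite set serves both expansions, and their m-th terms are translates of each other by (0,
-m). `ev_pull_periodize` compares them term by term. -/
lemma exists_finset_periodization {f : Cover g → ℂ} (hf : IsTest f) :
    ∃ S : Finset (Fin g → ℤ), (∀ w : Cover g, f w = ∑ m ∈ S, unitPart g (w.2 + intVec m) * f w) ∧
      ∀ w : Cover g, unitPart g w.2 * ∑ᶠ m : Fin g → ℤ, f (w.1, w.2 + intVec m) =
        ∑ m ∈ S, unitPart g w.2 * f (w + latt (0, -m)) := by
  have hfin := (cubeTiling (Fin g)).finite_translates isTest_unitPart.2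
    (hf.2.isCompact.image continuous_snd)
  have hmem (m : Fin g → ℤ) (w : Cover g) (h1 : f w ≠ 0) (h2 : unitPart g (w.2 + intVec m) ≠ 0) :
      m ∈ hfin.toFinset := by
    rw [Finite.mem_toFinset]
    exact ⟨w.2, ⟨w, subset_tsupport _ h1, rfl⟩, subset_tsupport _ h2⟩
  refine ⟨hfin.toFinset, fun w => ?_, fun w => ?_⟩
  · have h1 : ∑ᶠ m : Fin g → ℤ, unitPart g (w.2 + intVec m) * f w = f w := by
      rw [← finsum_mul', finsum_unitPart, one_mul]
      have := (cubeTiling (Fin g)).finite_translates isTest_unitPart.2 (isCompact_singleton (x := w.2))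
      refine this.subset fun m hm => ⟨w.2, rfl, subset_tsupport _ hm⟩
    rw [← finsum_eq_sum_of_support_subset, h1]
    intro m hm
    exact hmem m w (right_ne_zero_of_mul hm) (left_ne_zero_of_mul hm)
  · have e (m : Fin g → ℤ) : w + latt (0, -m) = (w.1, w.2 + intVec (-m)) := by
      ext i <;> simp [latt, intVec]
    have h0 : (Function.support fun m : Fin g → ℤ => f (w.1, w.2 + intVec m)).Finite := by
      have := (cubeTiling (Fin g)).finite_translates (hf.slice w.1).2 (isCompact_singleton (x := w.2))
      refine this.subset fun m hm => ⟨w.2, rfl, subset_tsupport _ hm⟩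
    rw [mul_finsum' _ _ h0, ← finsum_comp_equiv (Equiv.neg (Fin g → ℤ)),
      finsum_eq_sum_of_support_subset]
    · exact Finset.sum_congr rfl fun m _ => by rw [e]; rfl
    · intro m hm
      refine hmem m (w.1, w.2 + intVec (-m)) (right_ne_zero_of_mul hm) ?_
      have : w.2 + intVec (-m) + intVec m = w.2 := by ext i; simp [intVec]
      rw [this]
      exact left_ne_zero_of_mul hm

namespace Frame

variable {t t' : Matrix (Fin g) (Fin g) ℂ} (F : Frame t t')

lemma ev_pull_sum {k : ℕ} (T : DistSec g k) {ι : Type*} {S : Finset ι} {f : ι → Cover g → ℂ}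
    (h : ∀ i ∈ S, IsTest (f i)) :
    ev T (F.pull k fun w => ∑ i ∈ S, f i w) = ∑ i ∈ S, ev T (F.pull k (f i)) := by
  rw [← ev_sum T fun i hi => F.isTest_pull k (h i hi)]
  congr 1
  funext u
  rw [pull, Finset.mul_sum]
  rfl

/-- Since `T` does not see integer translations in p, a test function may be replaced by a cutoff
times its p-periodization. This is where Fourier series in p enter. -/
lemma ev_pull_periodize {k : ℕ} (T : DistSec g k) {f : Cover g → ℂ} (hf : IsTest f) :
    IsTest (fun w : Cover g => unitPart g w.2 * ∑ᶠ m : Fin g → ℤ, f (w.1, w.2 + intVec m)) ∧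
    ev T (F.pull k fun w => unitPart g w.2 * ∑ᶠ m : Fin g → ℤ, f (w.1, w.2 + intVec m)) =
      ev T (F.pull k f) := by
  obtain ⟨S, h1, h2⟩ := exists_finset_periodization hf
  have hb : ContDiff ℝ ∞ (unitPart g) := isTest_unitPart.1
  have ht2 (m : Fin g → ℤ) : IsTest fun w : Cover g => unitPart g w.2 * f (w + latt (0, -m)) :=
    (hf.comp_add _).mul_left (hb.comp contDiff_snd)
  have ht1 (m : Fin g → ℤ) : IsTest fun w : Cover g => unitPart g (w.2 + intVec m) * f w :=
    hf.mul_left (hb.comp (contDiff_snd.add contDiff_const))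
  rw [funext h2]
  refine ⟨IsTest.sum fun m _ => ht2 m, ?_⟩
  conv_rhs => rw [funext h1]
  rw [F.ev_pull_sum T fun m _ => ht2 m, F.ev_pull_sum T fun m _ => ht1 m]
  refine Finset.sum_congr rfl fun m _ => ?_
  rw [← F.ev_pull_translate T (ht1 m) (0, -m)]
  congr 2
  funext w
  have e : (w + latt (0, -m)).2 + intVec m = w.2 := by ext i; simp [latt, intVec]
  simp only [e, smul_zero, neg_zero, ech_zero, one_mul]

/-- The translates of the derivative of `unitPart` sum to the derivative of 1, which is zero, so the
cutoff contributes no error terms. -/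
lemma ev_pull_partWave_fderiv {k : ℕ} (T : DistSec g k) (chi : Fin g → ℤ)
    {psi : (Fin g → ℝ) → ℂ} (h : IsTest psi) (v : Fin g → ℝ) :
    ev T (F.pull k fun w => psi w.1 * (fderiv ℝ (unitPart g) w.2 v * ech (-chi) w.2)) = 0 := by
  have ht := h.tensor ((isTest_unitPart.fderiv_apply v).mul_right (contDiff_ech (-chi)))
  rw [← (F.ev_pull_periodize T ht).2]
  have e (w : Cover g) : ∑ᶠ m : Fin g → ℤ, psi w.1 * (fderiv ℝ (unitPart g) (w.2 + intVec m) v *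
      ech (-chi) (w.2 + intVec m)) = 0 := by
    have e1 (m : Fin g → ℤ) : psi w.1 * (fderiv ℝ (unitPart g) (w.2 + intVec m) v *
        ech (-chi) (w.2 + intVec m)) =
        (psi w.1 * ech (-chi) w.2) * fderiv ℝ (unitPart g) (w.2 + intVec m) v := by
      rw [ech_add_intVec]
      ring
    simp only [e1]
    rw [← mul_finsum', finsum_fderiv_unitPart, mul_zero]
    have := (cubeTiling (Fin g)).finite_translates isTest_unitPart.2 (isCompact_singleton (x := w.2))
    refine this.subset fun m hm => ⟨w.2, rfl, ?_⟩
    exact tsupport_fderiv_apply_subset _ v (subset_tsupport _ hm)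
  simp only [e, mul_zero]
  have e2 : F.pull k (fun _ => (0 : ℂ)) = fun _ => 0 := by funext u; simp [pull]
  rw [e2, ev_zero]

lemma lev_pos {k : ℕ} (hk : 0 < k) : 0 < F.lev k := Nat.mul_pos hk F.kap_pos

/-- Dividing by the Gaussian conjugates the covariant derivative along the graph of -Z, on the χ-th
Fourier mode, into the plain derivative in q. Only terms with a derivative of the cutoff are left
over, and `ev_pull_partWave_fderiv` removes them. -/
lemma cderiv_partWave {K : ℕ} (hK : 0 < K) {Z : Matrix (Fin g) (Fin g) ℂ} (hs : Z.IsSymm) (chi : Fin g → ℤ)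
    {phi : (Fin g → ℝ) → ℂ} (h : IsTest phi) (v : Fin g → ℝ) (w : Cover g) :
    cderiv (toC v, -(Z *ᵥ toC v)) (partWave chi fun q => phi q * (gaussian K Z chi q)⁻¹) w -
      2 * Real.pi * I * K * (toC w.1 ⬝ᵥ (-(Z *ᵥ toC v))) *
        partWave chi (fun q => phi q * (gaussian K Z chi q)⁻¹) w =
    partWave chi (fun q => fderiv ℝ phi q v * (gaussian K Z chi q)⁻¹) w +
      (phi w.1 * (gaussian K Z chi w.1)⁻¹) *
        (fderiv ℝ (unitPart g) w.2 (reT (toC v, -(Z *ᵥ toC v))).2 * ech (-chi) w.2) +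
      I * ((phi w.1 * (gaussian K Z chi w.1)⁻¹) *
        (fderiv ℝ (unitPart g) w.2 (imT (toC v, -(Z *ᵥ toC v))).2 * ech (-chi) w.2)) := by
  have hE := contDiff_gaussian K Z chi
  have hEi := hE.inv (gaussian_ne_zero K Z chi)
  have hd1 : Differentiable ℝ fun q => phi q * (gaussian K Z chi q)⁻¹ :=
    (h.1.mul hEi).differentiable (by simp)
  have hd2 : Differentiable ℝ fun p => unitPart g p * ech (-chi) p :=
    (isTest_unitPart.1.mul (contDiff_ech _)).differentiable (by simp)
  have e1 : (reT (toC v, -(Z *ᵥ toC v))).1 = v := by ext i; simp [reT, toC]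
  have e2 : (imT (toC v, -(Z *ᵥ toC v))).1 = 0 := by ext i; simp [imT, toC]
  have hq : fderiv ℝ (fun q => phi q * (gaussian K Z chi q)⁻¹) w.1 v =
      fderiv ℝ phi w.1 v * (gaussian K Z chi w.1)⁻¹ - 2 * Real.pi * I * K *
      (toC (w.1 + (K : ℝ)⁻¹ • intVec chi) ⬝ᵥ Z *ᵥ toC v) * (phi w.1 * (gaussian K Z chi w.1)⁻¹) := by
    have e3 : phi = fun q => phi q * (gaussian K Z chi q)⁻¹ * gaussian K Z chi q := by
      funext q
      rw [inv_mul_cancel_right₀ (gaussian_ne_zero K Z chi q)]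
    have h3 := congrArg (fun L => L v) (fderiv_fun_mul (hd1 w.1) (hE.differentiable (by simp) w.1))
    simp only [← e3, _root_.add_apply, _root_.smul_apply, smul_eq_mul, fderiv_gaussian hs] at h3
    have h0 := gaussian_ne_zero K Z chi w.1
    rw [h3]
    field_simp
    ring
  have hp (x : Fin g → ℝ) : fderiv ℝ (fun p => unitPart g p * ech (-chi) p) w.2 x =
      fderiv ℝ (unitPart g) w.2 x * ech (-chi) w.2 - 2 * Real.pi * I *
        (∑ i, (chi i : ℂ) * x i) * (unitPart g w.2 * ech (-chi) w.2) := by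
    rw [fderiv_fun_mul (isTest_unitPart.1.differentiable (by simp) w.2)
      ((contDiff_ech _).differentiable (by simp) w.2)]
    simp only [_root_.add_apply, _root_.smul_apply, smul_eq_mul, hasFDerivAt_ech]
    have : ∑ i, (((-chi) i : ℤ) : ℂ) * (x i : ℂ) = -∑ i, (chi i : ℂ) * x i := by
      rw [← Finset.sum_neg_distrib]
      exact Finset.sum_congr rfl fun i _ => by simp
    rw [this]
    ring
  have hz : ∑ i, (chi i : ℂ) * ((reT (toC v, -(Z *ᵥ toC v))).2 i : ℂ) +
      I * ∑ i, (chi i : ℂ) * ((imT (toC v, -(Z *ᵥ toC v))).2 i : ℂ) =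
      -(toC (intVec chi) ⬝ᵥ Z *ᵥ toC v) := by
    rw [Finset.mul_sum, ← Finset.sum_add_distrib, dotProduct, ← Finset.sum_neg_distrib]
    refine Finset.sum_congr rfl fun i _ => ?_
    have := re_add_im ((Z *ᵥ toC v) i)
    simp only [reT, imT, Pi.neg_apply, neg_re, neg_im, ofReal_neg, toC, intVec, ofReal_intCast]
    linear_combination (-(chi i : ℂ)) * this
  have hx : (K : ℂ) * (toC (w.1 + (K : ℝ)⁻¹ • intVec chi) ⬝ᵥ Z *ᵥ toC v) =
      K * (toC w.1 ⬝ᵥ Z *ᵥ toC v) + toC (intVec chi) ⬝ᵥ Z *ᵥ toC v := by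
    have : (K : ℂ) ≠ 0 := by exact_mod_cast hK.ne'
    rw [toC_add, toC_smul, add_dotProduct, smul_dotProduct, smul_eq_mul, mul_add, ← mul_assoc]
    push_cast
    rw [mul_inv_cancel₀ this, one_mul]
  have hf1 (u : Cover g) : fderiv ℝ (partWave chi fun q => phi q * (gaussian K Z chi q)⁻¹) w u = _ :=
    fderiv_tensor hd1 hd2 w u
  simp only [cderiv]
  rw [hf1, hf1]
  simp only [partWave]
  rw [e1, e2, hq, hp, hp, map_zero, dotProduct_neg]
  linear_combination (-(2 * Real.pi * I) * (phi w.1 * (gaussian K Z chi w.1)⁻¹) *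
    (unitPart g w.2 * ech (-chi) w.2)) * hz + (-(2 * Real.pi * I) * (phi w.1 * (gaussian K Z chi w.1)⁻¹) *
    (unitPart g w.2 * ech (-chi) w.2)) * hx

end Frame

lemma integral_unitPart : ∫ p, unitPart g p = 1 := by
  rw [← (cubeTiling (Fin g)).integral_finsum volume isTest_unitPart.continuous isTest_unitPart.2]
  have h : ∀ p, ∑ᶠ m, unitPart g (p + (cubeTiling (Fin g)).e m) = 1 := finsum_unitPart
  simp only [h, setIntegral_const]
  have : volume.real (cubeTiling (Fin g)).D = 1 := by
    have h1 : (cubeTiling (Fin g)).D = Set.pi univ fun _ : Fin g => Ioc (0 : ℝ) 1 := by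
      ext x
      simp [cubeTiling]
    rw [h1]
    simp [Measure.real, volume_pi_pi]
  simp [this]

namespace Frame

variable {t t' : Matrix (Fin g) (Fin g) ℂ} (F : Frame t t')

lemma ev_pull_add {k : ℕ} (T : DistSec g k) {f f' : Cover g → ℂ} (hf : IsTest f) (hf' : IsTest f') :
    ev T (F.pull k fun w => f w + f' w) = ev T (F.pull k f) + ev T (F.pull k f') := by
  rw [← ev_add T (F.isTest_pull k hf) (F.isTest_pull k hf')]
  congr 1
  funext u
  simp only [pull]
  ring

lemma ev_pull_const_mul {k : ℕ} (T : DistSec g k) {f : Cover g → ℂ} (hf : IsTest f) (c : ℂ) :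
    ev T (F.pull k fun w => c * f w) = c * ev T (F.pull k f) := by
  rw [← ev_const_mul T (F.isTest_pull k hf)]
  congr 1
  funext u
  simp only [pull]
  ring

/-- The coefficient of the expansion of a parallel distributional section. -/
def coeff {k : ℕ} (T : DistSec g k) (Z : Matrix (Fin g) (Fin g) ℂ) (chi : Fin g → ℤ) : ℂ :=
  ev T (F.pull k (partWave chi fun q => unitPart g q * (gaussian (F.lev k) Z chi q)⁻¹))

section

variable {F} {k : ℕ} {T : DistSec g k} {Z : Matrix (Fin g) (Fin g) ℂ}

/-- For fixed χ the functional φ ↦ T(φ/Gaussian in the χ-th mode) annihilates derivatives, so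
`annihilatorTrivial_pi` makes it a multiple of the integral. Testing on `unitPart`, which has
integral 1, identifies the multiple as `coeff`. -/
lemma ev_pull_partWave (hk : 0 < k) (hs : Z.IsSymm)
    (hT : ∀ v : Fin g → ℝ, IsParallel T (F.graphVec Z (toC v))) (chi : Fin g → ℤ)
    {psi : (Fin g → ℝ) → ℂ} (h : IsTest psi) :
    ev T (F.pull k (partWave chi psi)) =
      F.coeff T Z chi * ∫ q, psi q * gaussian (F.lev k) Z chi q := by
  have hE := contDiff_gaussian (F.lev k) Z chi
  have hEi : ContDiff ℝ ∞ fun q => (gaussian (F.lev k) Z chi q)⁻¹ :=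
    hE.inv (gaussian_ne_zero (F.lev k) Z chi)
  have ht {phi : (Fin g → ℝ) → ℂ} (hp : IsTest phi) := isTest_partWave chi (hp.mul_right hEi)
  obtain ⟨c, hc⟩ := annihilatorTrivial_pi g
    (fun phi => ev T (F.pull k (partWave chi fun q => phi q * (gaussian (F.lev k) Z chi q)⁻¹)))
    (fun f f' hf hf' => by
      rw [← F.ev_pull_add T (ht hf) (ht hf')]
      congr 2
      funext w
      simp only [partWave]
      ring)
    (fun c f hf => by
      rw [← F.ev_pull_const_mul T (ht hf)]
      congr 2
      funext w
      simp only [partWave]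
      ring)
    (fun f v hf => by
      have h1 := F.ev_pull_cderiv (hT v) (ht hf)
      simp only [cderiv_partWave (F.lev_pos hk) hs chi hf v] at h1
      have hb (x : Fin g → ℝ) := (hf.mul_right hEi).tensor
        ((isTest_unitPart.fderiv_apply x).mul_right (contDiff_ech (-chi)))
      rw [F.ev_pull_add T ((ht (hf.fderiv_apply v)).add (hb _)) ((hb _).const_mul I),
        F.ev_pull_add T (ht (hf.fderiv_apply v)) (hb _), F.ev_pull_const_mul T (hb _) I,
        F.ev_pull_partWave_fderiv T chi (hf.mul_right hEi),
        F.ev_pull_partWave_fderiv T chi (hf.mul_right hEi), add_zero, mul_zero, add_zero] at h1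
      exact h1)
  have h1 := hc _ isTest_unitPart
  rw [integral_unitPart, mul_one] at h1
  have h2 := hc _ (h.mul_right hE)
  simp only [mul_inv_cancel_right₀ (gaussian_ne_zero (F.lev k) Z chi _)] at h2
  rw [coeff, h1]
  exact h2

lemma gaussian_add_smul {K : ℕ} (hK : 0 < K) (Z : Matrix (Fin g) (Fin g) ℂ) (chi m : Fin g → ℤ)
    (q : Fin g → ℝ) : gaussian K Z (chi + K • m) q = gaussian K Z chi (q + intVec m) := by
  have h : q + (K : ℝ)⁻¹ • intVec (chi + K • m) = q + intVec m + (K : ℝ)⁻¹ • intVec chi := by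
    have : (K : ℝ) ≠ 0 := by exact_mod_cast hK.ne'
    ext i
    simp [intVec]
    field_simp
    ring
  rw [gaussian, gaussian, h]

/-- Translation by an integer vector m in q shifts χ by K m, and the Gaussian is shifted in the same
way. Hence a parallel section has only finitely many independent coefficients. -/
lemma coeff_periodic (hk : 0 < k) (hs : Z.IsSymm)
    (hT : ∀ v : Fin g → ℝ, IsParallel T (F.graphVec Z (toC v))) (chi m : Fin g → ℤ) :
    F.coeff T Z (chi + F.lev k • m) = F.coeff T Z chi := by
  have hE := contDiff_gaussian (F.lev k) Z chi
  have hEi : ContDiff ℝ ∞ fun q => (gaussian (F.lev k) Z chi q)⁻¹ :=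
    hE.inv (gaussian_ne_zero (F.lev k) Z chi)
  have h1 := isTest_unitPart.mul_right hEi
  have h2 := ev_pull_partWave hk hs hT (chi + F.lev k • m) (h1.comp_add (intVec m))
  have e1 : ∫ q, unitPart g (q + intVec m) * (gaussian (F.lev k) Z chi (q + intVec m))⁻¹ *
      gaussian (F.lev k) Z (chi + F.lev k • m) q = 1 := by
    simp only [gaussian_add_smul (F.lev_pos hk),
      inv_mul_cancel_right₀ (gaussian_ne_zero (F.lev k) Z chi _)]
    rw [integral_add_right_eq_self, integral_unitPart]
  rw [e1, mul_one] at h2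
  rw [← h2, coeff, ← F.ev_pull_translate T (isTest_partWave chi h1) (m, 0)]
  congr 2
  funext w
  have e2 : (w + latt (m, 0)).1 = w.1 + intVec m := by ext i; simp [latt, intVec]
  have e3 : (w + latt (m, 0)).2 = w.2 := by ext i; simp [latt]
  simp only [partWave, e2, e3]
  rw [neg_add, ech_add, ← smul_neg, smul_neg]
  ring

/-- The Fourier expansion of a distributional section that is parallel along the graph of `-Z`. -/
lemma hasSum_coeff (hk : 0 < k) (hs : Z.IsSymm)
    (hT : ∀ v : Fin g → ℝ, IsParallel T (F.graphVec Z (toC v))) {f : Cover g → ℂ} (hf : IsTest f) :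
    HasSum (fun chi => F.coeff T Z chi * ∫ q, halfFourier f chi q * gaussian (F.lev k) Z chi q)
      (ev T (F.pull k f)) := by
  set B : Set (Cover g) := (Prod.fst '' tsupport f) ×ˢ tsupport (unitPart g) with hBdef
  have hB : IsCompact B := (hf.2.isCompact.image continuous_fst).prod isTest_unitPart.2.isCompact
  have hbB := hB.image F.A.continuous
  obtain ⟨N, C, hTB⟩ := exists_evBound T hbB
  obtain ⟨hper, hperev⟩ := F.ev_pull_periodize T hf
  rw [← hperev]
  simp only [← ev_pull_partWave hk hs hT _ (isTest_halfFourier hf _)]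
  have hsub {h : Cover g → ℂ} (h0 : ∀ w, w ∉ B → h w = 0) : tsupport h ⊆ B :=
    closure_minimal (fun w hw => by by_contra h; exact hw (h0 w h)) hB.isClosed
  have hsupp (chi : Fin g → ℤ) : tsupport (partWave chi (halfFourier f chi)) ⊆ B := by
    refine hsub fun w hw => ?_
    by_contra h
    refine hw ⟨?_, subset_tsupport _ (left_ne_zero_of_mul (right_ne_zero_of_mul h))⟩
    by_contra h1
    exact left_ne_zero_of_mul h (halfFourier_eq_zero h1)
  -- One N is the order of `T`, the second pays for the derivatives of the character e(-χ p), and 2g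
  -- makes the series over χ summable.
  obtain ⟨M, hM⟩ := hf.exists_ckBound (N + (N + 2 * g))
  obtain ⟨Mb, hMb⟩ := (isTest_unitPart (g := g)).exists_ckBound N
  obtain ⟨C1, hC1, h1⟩ := exists_ckBound_mul_chr g N
  obtain ⟨C2, hC2, h2⟩ := F.exists_ckBound_pull k hB N
  obtain ⟨C3, hC3, h3⟩ := exists_ckBound_comp (ContinuousLinearMap.fst ℝ (Fin g → ℝ) (Fin g → ℝ)) N
  obtain ⟨C4, hC4, h4⟩ := exists_ckBound_comp (ContinuousLinearMap.snd ℝ (Fin g → ℝ) (Fin g → ℝ)) N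
  have hech (chi : Fin g → ℤ) (w : Cover g) : ech (-chi) w.2 = chr (0, intVec chi) w := by
    rw [ech, chr, dotR]
    congr 1
    simp only [dotProduct, intVec]
    push_cast
    simp only [Pi.zero_apply, ofReal_zero, mul_zero, Finset.sum_const_zero, zero_add, Finset.mul_sum,
      ← Finset.sum_neg_distrib]
    refine Finset.sum_congr rfl fun i _ => ?_
    simp
    ring
  have hnorm (chi : Fin g → ℤ) : ‖((0, intVec chi) : Cover g)‖ = ‖chi‖ := by
    rw [Prod.norm_mk, norm_zero, max_eq_right (norm_nonneg _)]
    simp only [Pi.norm_def, intVec]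
    congr 2
  have hck (chi : Fin g → ℤ) : CkBound N (C2 * (C1 * (2 ^ N * (C4 * Mb) * (C3 * (M * volume.real (Prod.snd '' tsupport f)))) *
      ((1 + ‖chi‖) ^ (2 * g))⁻¹)) (F.pull k (partWave chi (halfFourier f chi))) := by
    have hH := isTest_halfFourier hf chi
    have a1 := h3 _ _ hH.1 (ckBound_halfFourier_decay hf.2.isCompact chi (N + 2 * g) hf subset_rfl hM)
    have a2 := h4 _ _ isTest_unitPart.1 hMb
    have a3 := a1.mul (B := univ) (hH.1.comp contDiff_fst) (isTest_unitPart.1.comp contDiff_snd)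
      (subset_univ _) (fun n hn u _ => a2 n hn u) a2.nonneg
    have a4 := h1 _ _ (0, intVec chi)
      ((isTest_unitPart.1.comp contDiff_snd).mul (hH.1.comp contDiff_fst)) a3
    have e : (fun u : Cover g => (unitPart g (ContinuousLinearMap.snd ℝ (Fin g → ℝ) (Fin g → ℝ) u) *
        halfFourier f chi (ContinuousLinearMap.fst ℝ (Fin g → ℝ) (Fin g → ℝ) u)) *
        chr (0, intVec chi) u) = partWave chi (halfFourier f chi) := by
      funext w
      simp only [← hech, partWave, ContinuousLinearMap.coe_snd', ContinuousLinearMap.coe_fst']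
      ring
    have a5 : CkBound N _ (partWave chi (halfFourier f chi)) := e ▸ a4
    refine h2 _ _ (isTest_partWave chi hH).1 (hsupp chi) (a5.mono le_rfl (le_of_eq ?_))
    rw [hnorm, pow_add]
    have : (1 + ‖chi‖) ^ N ≠ 0 := by positivity
    field_simp
  refine EvBound.hasSum hbB hTB (fun chi => F.isTest_pull k (isTest_partWave chi
    (isTest_halfFourier hf chi))) (fun chi => F.tsupport_pull (hsupp chi)) (F.isTest_pull k hper)
    (F.tsupport_pull (hsub fun w hw => ?_))
    (((summable_inv_one_add_norm_pow g).mul_left _).mul_left C2) hck fun u => ?_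
  · by_contra h
    refine hw ⟨?_, subset_tsupport _ (left_ne_zero_of_mul h)⟩
    by_contra h1
    refine right_ne_zero_of_mul h (finsum_eq_zero_of_forall_eq_zero fun m => ?_)
    by_contra h2
    exact h1 ⟨_, subset_tsupport _ h2, rfl⟩
  · have := ((hasSum_halfFourier hf (F.A.symm u)).mul_left (unitPart g (F.A.symm u).2)).mul_left
      (phase (F.lev k) (F.A.symm u))
    have e : (fun chi => F.pull k (partWave chi (halfFourier f chi)) u) = fun chi =>
        phase (F.lev k) (F.A.symm u) * (unitPart g (F.A.symm u).2 *
          (halfFourier f chi (F.A.symm u).1 * ech (-chi) (F.A.symm u).2)) := by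
      funext chi
      simp only [pull, partWave]
      ring
    rw [e]
    exact this

end

end Frame

/-! ### Uniform estimates for parallel distributional sections near a real polarization -/

lemma EvBound.mono {j : ℤ} {T : DistSec g j} {B : Set (Cover g)} {N N' : ℕ} {C C' : ℝ}
    (h : EvBound T B N C) (hN : N ≤ N') (hC : C ≤ C') : EvBound T B N' C' := fun f M hf hfB hM =>
  (h f M hf hfB (hM.mono hN le_rfl)).trans (mul_le_mul_of_nonneg_right hC hM.nonneg)

lemma exists_entries_le {U : Set (Matrix (Fin g) (Fin g) ℂ)} (hU : U ∈ 𝓝 0) :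
    ∃ d > 0, ∀ Z : Matrix (Fin g) (Fin g) ℂ, (∀ i j, ‖Z i j‖ ≤ d) → Z ∈ U := by
  obtain ⟨d, hd, h⟩ := (Metric.nhds_basis_closedBall (x := (0 : Fin g → Fin g → ℂ))).mem_iff.1 hU
  refine ⟨d, hd, fun Z hZ => h ?_⟩
  exact (mem_closedBall_zero_iff (E := Fin g → Fin g → ℂ)).2 ((pi_norm_le_iff_of_nonneg hd.le).2
    fun i => (pi_norm_le_iff_of_nonneg hd.le).2 fun j => hZ i j)

lemma integral_fderiv_mul {a f : Cover g → ℂ} (ha : ContDiff ℝ ∞ a) (hf : IsTest f) (v : Cover g) :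
    ∫ u, a u * fderiv ℝ f u v = -∫ u, fderiv ℝ a u v * f u :=
  integral_mul_fderiv_eq_neg_fderiv_mul_of_integrable
    (hf.mul_left ((ha.fderiv_right (m := ∞) (by simp)).clm_apply contDiff_const)).integrable
    ((hf.fderiv_apply v).mul_left ha).integrable (hf.mul_left ha).integrable
    (fun p _ => ha.differentiable (by simp) p) (fun p _ => hf.1.differentiable (by simp) p)

lemma integral_covDerivFun {a f : Cover g → ℂ} (ha : ContDiff ℝ ∞ a) (hf : IsTest f) (j : ℤ)
    (xi : CTangent g) :
    ∫ u, a u * covDerivFun (-j) xi f u = -∫ u, covDerivFun j xi a u * f u := by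
  have hom (v : Cover g) := contDiff_omega_left' v
  have hW : ContDiff ℝ ∞ fun u : Cover g => (omega u (reT xi) : ℂ) + I * omega u (imT xi) :=
    (hom _).add (contDiff_const.mul (hom _))
  have hi1 (v) : Integrable fun u => a u * fderiv ℝ f u v := ((hf.fderiv_apply v).mul_left ha).integrable
  have hi2 (v) : Integrable fun u => fderiv ℝ a u v * f u :=
    (hf.mul_left ((ha.fderiv_right (m := ∞) (by simp)).clm_apply contDiff_const)).integrable
  have hi3 : Integrable fun u : Cover g =>
      ((omega u (reT xi) : ℂ) + I * omega u (imT xi)) * (a u * f u) :=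
    ((hf.mul_left ha).mul_left hW).integrable
  simp only [covDerivFun_eq]
  have e1 (u) : a u * (fderiv ℝ f u (reT xi) + I * fderiv ℝ f u (imT xi) - ((-j : ℤ) : ℂ) * Real.pi * I *
      f u * ((omega u (reT xi) : ℂ) + I * omega u (imT xi))) =
      a u * fderiv ℝ f u (reT xi) + I * (a u * fderiv ℝ f u (imT xi)) + j * Real.pi * I *
        (((omega u (reT xi) : ℂ) + I * omega u (imT xi)) * (a u * f u)) := by push_cast; ring
  have e2 (u) : (fderiv ℝ a u (reT xi) + I * fderiv ℝ a u (imT xi) - (j : ℂ) * Real.pi * I *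
      a u * ((omega u (reT xi) : ℂ) + I * omega u (imT xi))) * f u =
      fderiv ℝ a u (reT xi) * f u + I * (fderiv ℝ a u (imT xi) * f u) - j * Real.pi * I *
        (((omega u (reT xi) : ℂ) + I * omega u (imT xi)) * (a u * f u)) := by ring
  have hA1 : Integrable fun u => a u * fderiv ℝ f u (reT xi) + I * (a u * fderiv ℝ f u (imT xi)) :=
    (hi1 _).add ((hi1 _).const_mul I)
  have hA2 : Integrable fun u => fderiv ℝ a u (reT xi) * f u + I * (fderiv ℝ a u (imT xi) * f u) :=
    (hi2 _).add ((hi2 _).const_mul I)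
  simp only [e1, e2]
  rw [integral_add hA1 (hi3.const_mul _), integral_add (hi1 _) ((hi1 _).const_mul I),
    integral_sub hA2 (hi3.const_mul _),
    integral_add (hi2 _) ((hi2 _).const_mul I)]
  simp only [integral_const_mul, integral_fderiv_mul ha hf]
  ring

/-- Every section is the periodization of a test function, and covariant derivatives commute with
periodization. -/
lemma isParallel_of_ev {j : ℤ} {T : DistSec g j} {xi : CTangent g}
    (h : ∀ f, IsTest f → ev T (covDerivFun (-j) xi f) = 0) : IsParallel T xi := by
  intro phi
  obtain ⟨r, hr, hr1⟩ := exists_partition g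
  have hp := periodizeFun_mul_sec phi.2 hr1
  have hf : IsTest fun u => r u * phi.1 u := hr.mul_right phi.2.1
  have h1 := h _ hf
  rw [ev_eq T (hf.covDerivFun (-j) xi)] at h1
  rw [← h1]
  congr 1
  refine Subtype.ext ?_
  change covDerivFun (-j) xi phi.1 = periodizeFun (-j) (covDerivFun (-j) xi fun u => r u * phi.1 u)
  rw [← covDerivFun_periodizeFun (-j) xi hf, hp]

lemma isParallel_smoothDist {j : ℤ} {s : Sec g j} {xi : CTangent g} (h : covDeriv j xi s = 0) :
    IsParallel (smoothDist s) xi := by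
  refine isParallel_of_ev fun f hf => ?_
  rw [ev_smoothDist s (hf.covDerivFun (-j) xi), integral_covDerivFun s.2.1 hf]
  have h1 : covDerivFun j xi s.1 = 0 := congrArg Subtype.val h
  simp [h1]

lemma covDerivFun_conj {j : ℤ} {xi : CTangent g} {f : Cover g → ℂ} (hf : Differentiable ℝ f)
    (u : Cover g) : covDerivFun (-j) (CTangent.conj xi) (fun u => conj (f u)) u =
      conj (covDerivFun j xi f u) := by
  have e1 : reT (CTangent.conj xi) = reT xi := by ext <;> simp [reT, CTangent.conj]
  have e2 : imT (CTangent.conj xi) = -imT xi := by ext <;> simp [imT, CTangent.conj]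
  have e3 (v) : fderiv ℝ (fun u => conj (f u)) u v = conj (fderiv ℝ f u v) := by
    have := (conjCLE : ℂ →L[ℝ] ℂ).hasFDerivAt.comp u (hf u).hasFDerivAt
    have h : HasFDerivAt (fun u => conj (f u)) _ u := this
    rw [h.fderiv]
    simp
  have e4 : omega u (-imT xi) = -omega u (imT xi) := by
    rw [omega, omega, ← Finset.sum_neg_distrib]
    exact Finset.sum_congr rfl fun i _ => by simp; ring
  rw [covDerivFun_eq, covDerivFun_eq, e1, e2, e3, e3, e4]
  simp

lemma IsParallel.distConj {j : ℤ} {T : DistSec g j} {xi : CTangent g} (h : IsParallel T xi) :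
    IsParallel (distConj T) (CTangent.conj xi) := by
  refine isParallel_of_ev fun f hf => ?_
  rw [ev_distConj T (hf.covDerivFun _ _)]
  have e : (fun u => conj (covDerivFun (-(-j)) (CTangent.conj xi) f u)) =
      covDerivFun (-j) xi fun u => conj (f u) := by
    funext u
    have := covDerivFun_conj (j := -(-j)) (xi := CTangent.conj xi)
      (hf.1.differentiable (by simp)) u
    rw [CTangent.conj_conj] at this
    rw [← this, neg_neg]
  rw [e, h.ev_covDerivFun hf.conj, map_zero]

lemma EvBound.distConj {j : ℤ} {T : DistSec g j} {B : Set (Cover g)} {N : ℕ} {C : ℝ}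
    (h : EvBound T B N C) : EvBound (distConj T) B N C := by
  intro f M hf hfB hM
  rw [ev_distConj T hf, RCLike.norm_conj]
  refine h _ M hf.conj ?_ fun n hn u => ?_
  · have : tsupport (fun u => conj (f u)) ⊆ tsupport f := closure_mono fun u hu hu0 => hu (by simp [hu0])
    exact this.trans hfB
  · exact (conjLIE.norm_iteratedFDeriv_comp_left f u n).trans_le (hM n hn u)

namespace Frame

variable {t t' : Matrix (Fin g) (Fin g) ℂ} (F : Frame t t')

/-- `T` is parallel along the graph of `-Z`, where `Z` is symmetric with `Im Z ≥ 0`. -/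
structure GraphParallel {k : ℕ} (T : DistSec g k) (Z : Matrix (Fin g) (Fin g) ℂ) : Prop where
  isSymm : Z.IsSymm
  im_nonneg : ∀ v : Fin g → ℝ, 0 ≤ (quad Z v).im
  parallel : ∀ v : Fin g → ℝ, IsParallel T (F.graphVec Z (toC v))

lemma continuous_integral_gaussian (K : ℕ) (chi : Fin g → ℤ) :
    Continuous fun Z => ∫ q, unitPart g q * gaussian K Z chi q := by
  have : LocallyCompactSpace (Matrix (Fin g) (Fin g) ℂ) :=
    inferInstanceAs (LocallyCompactSpace (Fin g → Fin g → ℂ))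
  have : FirstCountableTopology (Matrix (Fin g) (Fin g) ℂ) :=
    inferInstanceAs (FirstCountableTopology (Fin g → Fin g → ℂ))
  have h1 (Z : Matrix (Fin g) (Fin g) ℂ) : ∫ q, unitPart g q * gaussian K Z chi q =
      ∫ q in tsupport (unitPart g), unitPart g q * gaussian K Z chi q :=
    (setIntegral_eq_integral_of_forall_compl_eq_zero fun q hq => by
      rw [image_eq_zero_of_notMem_tsupport hq, zero_mul]).symm
  simp only [h1]
  refine continuous_parametric_integral_of_continuous
    (f := fun Z q => unitPart g q * gaussian K Z chi q) ?_ isTest_unitPart.2.isCompact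
  have h2 : Continuous fun p : Matrix (Fin g) (Fin g) ℂ × (Fin g → ℝ) =>
      quad p.1 (p.2 + (K : ℝ)⁻¹ • intVec chi) :=
    continuous_quad.comp (continuous_fst.prodMk (continuous_snd.add continuous_const))
  exact (isTest_unitPart.continuous.comp continuous_snd).mul
    (continuous_exp.comp (continuous_const.mul h2))

lemma gaussian_zero (K : ℕ) (chi : Fin g → ℤ) (q : Fin g → ℝ) : gaussian K 0 chi q = 1 := by
  simp [gaussian, quad]

variable {F} in
-- Reduce χ to its residue modulo the level. For a residue the value on `partWave` is the
-- coefficient times an integral of absolute value at least 1/2.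
lemma GraphParallel.norm_coeff_le {k : ℕ} (hk : 0 < k) {T : DistSec g k}
    {Z : Matrix (Fin g) (Fin g) ℂ} (h : F.GraphParallel T Z) {C : ℝ}
    (h1 : ∀ a : Fin g → ℤ, a ∈ Icc 0 (fun _ => (F.lev k : ℤ)) →
      2⁻¹ ≤ ‖∫ q, unitPart g q * gaussian (F.lev k) Z a q‖ ∧
      ‖ev T (F.pull k (partWave a (unitPart g)))‖ ≤ C) (chi : Fin g → ℤ) :
    ‖F.coeff T Z chi‖ ≤ 2 * C := by
  have hK : (0 : ℤ) < F.lev k := by exact_mod_cast F.lev_pos hk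
  set a : Fin g → ℤ := fun i => chi i % F.lev k with ha
  have e : chi = a + F.lev k • fun i => chi i / F.lev k := by
    funext i
    simp [ha, Int.emod_add_mul_ediv]
  have hmem : a ∈ Icc 0 (fun _ : Fin g => (F.lev k : ℤ)) :=
    ⟨fun i => Int.emod_nonneg _ hK.ne', fun i => (Int.emod_lt_of_pos _ hK).le⟩
  rw [e, coeff_periodic hk h.isSymm h.parallel]
  have h2 := congrArg norm (ev_pull_partWave hk h.isSymm h.parallel a isTest_unitPart)
  rw [norm_mul] at h2
  obtain ⟨h3, h4⟩ := h1 a hmem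
  have := norm_nonneg (F.coeff T Z a)
  nlinarith

lemma norm_integral_halfFourier_gaussian_le {K : ℕ} {Z : Matrix (Fin g) (Fin g) ℂ}
    (hZ : ∀ v, 0 ≤ (quad Z v).im) {B : Set (Cover g)} (hB : IsCompact B) {f : Cover g → ℂ}
    (hf : IsTest f) (hfB : tsupport f ⊆ B) {M : ℝ} (hM : CkBound (0 + 2 * g) M f)
    (chi : Fin g → ℤ) : ‖∫ q, halfFourier f chi q * gaussian K Z chi q‖ ≤
      M * volume.real (Prod.snd '' B) * ((1 + ‖chi‖) ^ (2 * g))⁻¹ * volume.real (Prod.fst '' B) := by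
  rw [← setIntegral_eq_integral_of_forall_compl_eq_zero (s := Prod.fst '' B)]
  · refine norm_setIntegral_le_of_norm_le_const
      (hB.image continuous_fst).measure_lt_top fun q _ => ?_
    rw [norm_mul]
    have h2 := (ckBound_halfFourier_decay hB chi (2 * g) hf hfB hM).norm_le q
    have h3 := norm_gaussian_le hZ (K := K) chi q
    calc _ ≤ _ * 1 := mul_le_mul h2 h3 (norm_nonneg _) ((norm_nonneg _).trans h2)
      _ = _ := mul_one _
  · intro q hq
    rw [halfFourier_eq_zero fun h => hq (image_mono hfB h), zero_mul]

variable {F} in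
-- Im Z ≥ 0 bounds the Gaussians by 1, so the expansion is dominated by the decay of the half
-- Fourier transforms. The order 2g and the geometric constant do not depend on `T` or `Z`.
lemma GraphParallel.norm_ev_pull_le {k : ℕ} (hk : 0 < k) {T : DistSec g k}
    {Z : Matrix (Fin g) (Fin g) ℂ} (h : F.GraphParallel T Z) {C : ℝ}
    (hc : ∀ chi, ‖F.coeff T Z chi‖ ≤ C) {B : Set (Cover g)} (hB : IsCompact B)
    {f : Cover g → ℂ} (hf : IsTest f) (hfB : tsupport f ⊆ B) {M : ℝ} (hM : CkBound (0 + 2 * g) M f) :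
    ‖ev T (F.pull k f)‖ ≤ C * (volume.real (Prod.snd '' B) * volume.real (Prod.fst '' B) *
      ∑' chi : Fin g → ℤ, ((1 + ‖chi‖) ^ (2 * g))⁻¹) * M := by
  have hS := summable_inv_one_add_norm_pow g
  have hC : 0 ≤ C := (norm_nonneg _).trans (hc 0)
  have hb (chi : Fin g → ℤ) : ‖F.coeff T Z chi * ∫ q, halfFourier f chi q * gaussian (F.lev k) Z chi q‖ ≤
      C * (volume.real (Prod.snd '' B) * volume.real (Prod.fst '' B)) * M *
        ((1 + ‖chi‖) ^ (2 * g))⁻¹ := by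
    have h1 := norm_integral_halfFourier_gaussian_le (K := F.lev k) h.im_nonneg hB hf hfB hM chi
    rw [norm_mul]
    refine (mul_le_mul (hc chi) h1 (norm_nonneg _) hC).trans (le_of_eq ?_)
    ring
  have h1 := hasSum_coeff hk h.isSymm h.parallel hf
  rw [← h1.tsum_eq]
  refine (tsum_of_norm_bounded ((hS.mul_left _).hasSum) hb).trans (le_of_eq ?_)
  rw [tsum_mul_left]
  ring

/-- A weak neighbourhood controls finitely many test values. By periodicity these bound all
coefficients, and the coefficients bound the section on every test function supported in `B`. This
replaces a uniform boundedness principle and works for arbitrary filters. -/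
lemma exists_uniform_evBound {k : ℕ} (hk : 0 < k) (S : DistSec g k) {B : Set (Cover g)}
    (hB : IsCompact B) : ∃ N C, ∃ d > 0, ∀ᶠ T in 𝓝 S, ∀ Z : Matrix (Fin g) (Fin g) ℂ,
      (∀ i j, ‖Z i j‖ ≤ d) → F.GraphParallel T Z → EvBound T B N C := by
  have hfin : (Icc (0 : Fin g → ℤ) (fun _ => (F.lev k : ℤ))).Finite := Set.finite_Icc _ _
  -- At Z = 0 the Gaussian is 1 and the integral equals 1, so it stays above 1/2 for small Z.
  have h1 : ∀ᶠ Z in 𝓝 (0 : Matrix (Fin g) (Fin g) ℂ),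
      ∀ a ∈ Icc (0 : Fin g → ℤ) (fun _ => (F.lev k : ℤ)),
        2⁻¹ ≤ ‖∫ q, unitPart g q * gaussian (F.lev k) Z a q‖ := by
    rw [eventually_all_finite hfin]
    intro a _
    have h := (continuous_integral_gaussian (F.lev k) a).norm.tendsto 0
    simp only [gaussian_zero, mul_one, integral_unitPart, norm_one] at h
    exact (h.eventually (lt_mem_nhds (by norm_num : (2⁻¹ : ℝ) < 1))).mono fun Z hZ => hZ.le
  obtain ⟨d, hd, hdU⟩ := exists_entries_le h1
  have h2 : ∃ C, ∀ᶠ T in 𝓝 S, ∀ a ∈ Icc (0 : Fin g → ℤ) (fun _ => (F.lev k : ℤ)),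
      ‖ev T (F.pull k (partWave a (unitPart g)))‖ ≤ C := by
    refine ⟨∑ a ∈ hfin.toFinset, (‖ev S (F.pull k (partWave a (unitPart g)))‖ + 1), ?_⟩
    rw [eventually_all_finite hfin]
    intro a ha
    have h := (continuous_ev (F.pull k (partWave a (unitPart g)))).norm.tendsto S
    refine (h.eventually (gt_mem_nhds (lt_add_one _))).mono fun T hT => hT.le.trans ?_
    exact Finset.single_le_sum (f := fun a => ‖ev S (F.pull k (partWave a (unitPart g)))‖ + 1)
      (fun a _ => by positivity) (hfin.mem_toFinset.2 ha)
  obtain ⟨C, hC⟩ := h2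
  have hB' := hB.image F.A.symm.continuous
  obtain ⟨c, hc, hcu⟩ := F.exists_ckBound_unpull k hB (0 + 2 * g)
  refine ⟨0 + 2 * g, 2 * C * (volume.real (Prod.snd '' (F.A.symm '' B)) *
    volume.real (Prod.fst '' (F.A.symm '' B)) * ∑' chi : Fin g → ℤ, ((1 + ‖chi‖) ^ (2 * g))⁻¹) * c,
    d, hd, ?_⟩
  filter_upwards [hC] with T hT Z hZ hG f M hf hfB hM
  have h3 := hG.norm_coeff_le hk (fun a ha => ⟨hdU Z hZ a ha, hT a ha⟩)
  have h4 := hG.norm_ev_pull_le hk h3 hB' (F.isTest_unpull k hf) (F.tsupport_unpull hfB)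
    (hcu f M hf.1 hfB hM)
  rw [pull_unpull] at h4
  refine h4.trans (le_of_eq ?_)
  ring

end Frame

/-! ### Detection of covectors by nearly parallel directions, and uniform transversality. -/

lemma exists_norm_eq_apply {ι E : Type*} [Fintype ι] [Nonempty ι] [SeminormedAddCommGroup E]
    (v : ι → E) : ∃ j, ‖v‖ = ‖v j‖ := by
  obtain ⟨j, -, hj⟩ := Finset.exists_max_image Finset.univ (fun j => ‖v j‖) Finset.univ_nonempty
  refine ⟨j, le_antisymm ?_ (norm_le_pi_norm v j)⟩
  exact (pi_norm_le_iff_of_nonneg (norm_nonneg _)).2 fun i => hj i (Finset.mem_univ _)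

lemma reT_toCTangent (u : Cover g) : reT (toCTangent u) = u := by ext <;> simp [reT, toCTangent]

lemma imT_toCTangent (u : Cover g) : imT (toCTangent u) = 0 := by ext <;> simp [imT, toCTangent]

lemma dotC_toCTangent (eta u : Cover g) : dotC eta (toCTangent u) = dotR u eta := by
  rw [dotC, reT_toCTangent, imT_toCTangent]
  simp [dotR]

lemma dotC_sub (eta : Cover g) (xi xi' : CTangent g) :
    dotC eta (xi - xi') = dotC eta xi - dotC eta xi' := by
  have e1 : reT (xi - xi') = reT xi - reT xi' := by ext <;> simp [reT]
  have e2 : imT (xi - xi') = imT xi - imT xi' := by ext <;> simp [imT]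
  have e (u v : Cover g) : dotR (u - v) eta = dotR u eta - dotR v eta := by
    simp only [dotR, Prod.fst_sub, Prod.snd_sub, sub_dotProduct]
    ring
  simp only [dotC, e1, e2, e]
  push_cast
  ring

lemma norm_dotC_le (eta : Cover g) (xi : CTangent g) : ‖dotC eta xi‖ ≤ 4 * g * ‖xi‖ * ‖eta‖ := by
  have h (u : Cover g) (hu : ‖u‖ ≤ ‖xi‖) : ‖((dotR u eta : ℝ) : ℂ)‖ ≤ 2 * g * ‖xi‖ * ‖eta‖ := by
    rw [norm_real, Real.norm_eq_abs]
    exact (abs_dotR_le u eta).trans (by gcongr)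
  refine (norm_add_le _ _).trans ?_
  rw [norm_mul, norm_I, one_mul]
  linarith [h _ (norm_reT_le xi), h _ (norm_imT_le xi)]

lemma norm_conj_CTangent (xi : CTangent g) : ‖CTangent.conj xi‖ = ‖xi‖ := by
  simp only [Prod.norm_def, CTangent.conj, Pi.norm_def, nnnorm, RCLike.norm_conj]

lemma conj_sub_CTangent (xi eta : CTangent g) :
    CTangent.conj (xi - eta) = CTangent.conj xi - CTangent.conj eta := by
  ext <;> simp [CTangent.conj]

/-- Stability of detection: half of the lower bound survives when a real direction is perturbed to a
nearby complex one. -/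
lemma dotC_lower {u : Cover g} {xi : CTangent g} {r c : ℝ} (h : ‖xi - toCTangent u‖ ≤ r)
    (hr : 4 * g * r ≤ c) {eta : Cover g} (hu : 2 * c * ‖eta‖ ≤ |dotR u eta|) :
    c * ‖eta‖ ≤ ‖dotC eta xi‖ := by
  have h1 := norm_dotC_le eta (xi - toCTangent u)
  rw [dotC_sub, dotC_toCTangent] at h1
  have h2 : ‖((dotR u eta : ℝ) : ℂ)‖ = |dotR u eta| := by rw [norm_real, Real.norm_eq_abs]
  have h3 := norm_sub_norm_le ((dotR u eta : ℝ) : ℂ) (dotC eta xi)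
  rw [norm_sub_rev] at h3
  have h4 : 4 * g * ‖xi - toCTangent u‖ * ‖eta‖ ≤ c * ‖eta‖ := by
    refine mul_le_mul_of_nonneg_right (le_trans ?_ hr) (norm_nonneg _)
    gcongr
  linarith

namespace Frame

variable {t t' : Matrix (Fin g) (Fin g) ℂ} (F : Frame t t')

/-- The images of the coordinate vectors span ℝ²ᵍ, so pairing with all of them is injective and
therefore bounded below. Some single coordinate attains the norm. -/
lemma exists_detect [Nonempty (Fin g)] : ∃ c > 0, ∀ eta : Cover g, ∃ i,
    2 * c * ‖eta‖ ≤ |dotR (F.A (Pi.single i 1, 0)) eta| ∨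
    2 * c * ‖eta‖ ≤ |dotR (F.swap.A (Pi.single i 1, 0)) eta| := by
  let L : Cover g →ₗ[ℝ] Cover g :=
    { toFun := fun eta => (fun i => dotR eta (F.A (Pi.single i 1, 0)),
        fun i => dotR eta (F.swap.A (Pi.single i 1, 0)))
      map_add' := fun a b => by ext <;> simp [dotR_add_left]
      map_smul' := fun a b => by ext <;> simp [dotR_smul_left] }
  have hL : LinearMap.ker L = ⊥ := by
    refine (Submodule.eq_bot_iff _).2 fun eta h => ?_
    have h1 (i) : dotR eta (F.A (Pi.single i 1, 0)) = 0 := congrFun (congrArg Prod.fst h) i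
    have h2 (i) : dotR eta (F.swap.A (Pi.single i 1, 0)) = 0 := congrFun (congrArg Prod.snd h) i
    have h3 : ((dotCLM eta).comp (F.A : Cover g →L[ℝ] Cover g) : Cover g →ₗ[ℝ] ℝ) = 0 := by
      refine LinearMap.prod_ext (LinearMap.pi_ext' fun i => ?_) (LinearMap.pi_ext' fun i => ?_)
      · ext
        simpa [dotCLM, dotR_comm] using h1 i
      · ext
        have h4 := h2 i
        rw [swap_apply, show ((((Pi.single i 1, 0) : Cover g).2,
          -((Pi.single i 1, 0) : Cover g).1) : Cover g) = -(0, Pi.single i 1) by ext <;> simp,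
          map_neg, dotR_comm] at h4
        have h5 : dotR (-F.A (0, Pi.single i 1)) eta = -dotR (F.A (0, Pi.single i 1)) eta := by
          simp [dotR]
          ring
        rw [h5, neg_eq_zero] at h4
        simpa [dotCLM] using h4
    have h4 : dotR eta eta = 0 := by
      have := LinearMap.congr_fun h3 (F.A.symm eta)
      simpa [dotCLM] using this
    have h5 : eta.1 ⬝ᵥ eta.1 + eta.2 ⬝ᵥ eta.2 = 0 := h4
    have n1 : 0 ≤ eta.1 ⬝ᵥ eta.1 := Finset.sum_nonneg fun i _ => mul_self_nonneg _
    have n2 : 0 ≤ eta.2 ⬝ᵥ eta.2 := Finset.sum_nonneg fun i _ => mul_self_nonneg _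
    exact Prod.ext (dotProduct_self_eq_zero.1 (by linarith)) (dotProduct_self_eq_zero.1 (by linarith))
  obtain ⟨K, hK, hKL⟩ := L.exists_antilipschitzWith hL
  have hK' : (0 : ℝ) < K := hK
  -- Chosen so that 2c is the reciprocal of the antilipschitz constant.
  refine ⟨(2 * K)⁻¹, by positivity, fun eta => ?_⟩
  have h1 : ‖eta‖ ≤ K * ‖L eta‖ := by simpa using hKL.le_mul_dist eta 0
  have h2 : 2 * (2 * (K : ℝ))⁻¹ * ‖eta‖ ≤ ‖L eta‖ := by
    rw [mul_inv, ← mul_assoc, mul_inv_cancel₀ two_ne_zero, one_mul, inv_mul_le_iff₀ hK']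
    exact h1
  rcases le_total ‖(L eta).1‖ ‖(L eta).2‖ with h | h
  · obtain ⟨i, hi⟩ := exists_norm_eq_apply (L eta).2
    rw [Prod.norm_def (L eta), max_eq_right h, hi, Real.norm_eq_abs] at h2
    exact ⟨i, Or.inr (by rw [dotR_comm]; exact h2)⟩
  · obtain ⟨i, hi⟩ := exists_norm_eq_apply (L eta).1
    rw [Prod.norm_def (L eta), max_eq_left h, hi, Real.norm_eq_abs] at h2
    exact ⟨i, Or.inl (by rw [dotR_comm]; exact h2)⟩

lemma graphVec_zero (v : Fin g → ℝ) : F.graphVec 0 (toC v) = toCTangent (F.A (v, 0)) := by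
  rw [graphVec, ← AC_toCTangent]
  congr 1
  ext <;> simp [toCTangent, toC]

lemma exists_graphVec_near {r : ℝ} (hr : 0 < r) : ∃ d > 0, ∀ Z : Matrix (Fin g) (Fin g) ℂ,
    (∀ i j, ‖Z i j‖ ≤ d) → ∀ i, ‖F.graphVec Z (toC (Pi.single i 1)) -
      toCTangent (F.A (Pi.single i 1, 0))‖ ≤ r := by
  refine exists_entries_le (U := {Z | ∀ i, ‖F.graphVec Z (toC (Pi.single i 1)) -
      toCTangent (F.A (Pi.single i 1, 0))‖ ≤ r}) ?_
  change ∀ᶠ Z in 𝓝 (0 : Matrix (Fin g) (Fin g) ℂ), ∀ i, ‖F.graphVec Z (toC (Pi.single i 1)) -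
      toCTangent (F.A (Pi.single i 1, 0))‖ ≤ r
  rw [eventually_all]
  intro i
  have h := ((F.continuous_graphVec (toC (Pi.single i 1))).sub
    (continuous_const (y := toCTangent (F.A (Pi.single i 1, 0))))).norm.tendsto 0
  simp only [Pi.sub_apply, graphVec_zero, sub_self, norm_zero] at h
  exact (h.eventually (gt_mem_nhds hr)).mono fun Z hZ => hZ.le

/-- The uniform continuity bounds of both sections are combined with the stability of detection
under small changes of the polarizations. The second section is treated in the swapped frame;
conjugating it conjugates its parallel directions and leaves their real limits unchanged. -/
lemma eventually_transverse [Nonempty (Fin g)] {k : ℕ} (hk : 0 < k) (S S' : DistSec g k)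
    {B : Set (Cover g)} (hB : IsCompact B) :
    ∃ N C R c, 0 < c ∧ ∃ d > 0, ∀ᶠ p in 𝓝 (S, S'), ∀ Z Z' : Matrix (Fin g) (Fin g) ℂ,
      (∀ i j, ‖Z i j‖ ≤ d) → (∀ i j, ‖Z' i j‖ ≤ d) → F.GraphParallel p.1 Z →
      F.swap.GraphParallel p.2 Z' → Transverse p.1 (distConj p.2) B N C R c := by
  obtain ⟨c, hc, hdet⟩ := F.exists_detect
  obtain ⟨N1, C1, d1, hd1, h1⟩ := F.exists_uniform_evBound hk S hB
  obtain ⟨N2, C2, d2, hd2, h2⟩ := F.swap.exists_uniform_evBound hk S' hB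
  -- Small enough for `dotC_lower`, which needs 4 g r ≤ c.
  set r : ℝ := c / (4 * g + 1) with hrdef
  have hr : 0 < r := by positivity
  have hr' : 4 * g * r ≤ c := by
    rw [hrdef, mul_div_assoc', div_le_iff₀ (by positivity)]
    nlinarith
  obtain ⟨d3, hd3, h3⟩ := F.exists_graphVec_near hr
  obtain ⟨d4, hd4, h4⟩ := F.swap.exists_graphVec_near hr
  set R : ℝ := ∑ i : Fin g, (‖toCTangent (F.A (Pi.single i 1, 0))‖ +
    ‖toCTangent (F.swap.A (Pi.single i 1, 0))‖) + r
  have hR1 (i : Fin g) : ‖toCTangent (F.A (Pi.single i 1, 0))‖ +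
      ‖toCTangent (F.swap.A (Pi.single i 1, 0))‖ + r ≤ R :=
    add_le_add_left (Finset.single_le_sum (f := fun i => ‖toCTangent (F.A (Pi.single i 1, 0))‖ +
      ‖toCTangent (F.swap.A (Pi.single i 1, 0))‖) (fun i _ => by positivity) (Finset.mem_univ i)) _
  have hRx {x y : CTangent g} (h : ‖x - y‖ ≤ r) : ‖x‖ ≤ ‖y‖ + r := by
    have := norm_add_le (x - y) y
    rw [sub_add_cancel] at this
    linarith
  refine ⟨max N1 N2, max C1 C2, R, c, hc, min (min d1 d2) (min d3 d4), by positivity, ?_⟩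
  filter_upwards [continuous_fst.continuousAt.eventually h1,
    continuous_snd.continuousAt.eventually h2] with p hp1 hp2 Z Z' hZ hZ' hG hG'
  refine ⟨(hp1 Z (fun i j => (hZ i j).trans (by simp)) hG).mono (le_max_left _ _) (le_max_left _ _),
    ((hp2 Z' (fun i j => (hZ' i j).trans (by simp)) hG').mono (le_max_right _ _)
      (le_max_right _ _)).distConj, fun eta => ?_⟩
  obtain ⟨i, hi | hi⟩ := hdet eta
  · have hn := h3 Z (fun i j => (hZ i j).trans (by simp)) i
    refine Or.inl ⟨_, ?_, hG.parallel (Pi.single i 1), dotC_lower hn hr' hi⟩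
    have := hR1 i
    have := norm_nonneg (toCTangent (F.swap.A (Pi.single i 1, 0)))
    linarith [hRx hn]
  · have hn := h4 Z' (fun i j => (hZ' i j).trans (by simp)) i
    rw [← norm_conj_CTangent, conj_sub_CTangent, conj_toCTangent] at hn
    refine Or.inr ⟨_, ?_, (hG'.parallel (Pi.single i 1)).distConj, dotC_lower hn hr' hi⟩
    have := hR1 i
    have := norm_nonneg (toCTangent (F.A (Pi.single i 1, 0)))
    linarith [hRx hn]

/-- Smooth parallel sections over points near `τ` are parallel along graphs of small matrices. -/
lemma eventually_graphParallel (k : ℕ) {d : ℝ} (hd : 0 < d) :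
    ∀ᶠ tau in 𝓝 t, tau ∈ siegelDisc g → ∀ s ∈ smoothQuantumSpace k tau,
      ∃ Z : Matrix (Fin g) (Fin g) ℂ, (∀ i j, ‖Z i j‖ ≤ d) ∧ F.GraphParallel (smoothDist s) Z := by
  filter_upwards [F.eventually_exists_graph hd] with tau htau hmem s hs
  obtain ⟨Z, hs1, hZ, him, hpar⟩ := htau hmem
  refine ⟨Z, hZ, hs1, him, fun v => isParallel_smoothDist ?_⟩
  have := hs _ (hpar (toC v))
  rwa [CTangent.conj_conj] at this

/-! ### Invariance of boundary sections along the leaves. -/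

lemma graphParallel_zero {k : ℕ} {S : DistSec g k} (hS : S ∈ weakQuantumSpace k t) :
    F.GraphParallel S 0 := by
  refine ⟨Matrix.isSymm_zero, fun v => by simp [quad], fun v phi => ?_⟩
  have h := hS _ (F.AC_mem_pol (toC v)) phi
  have e : CTangent.conj (F.AC (toC v, 0)) = F.graphVec 0 (toC v) := by
    have e1 : (toC v, (0 : Fin g → ℂ)) = toCTangent (v, 0) := by ext <;> simp [toC, toCTangent]
    rw [graphVec_zero, e1, AC_toCTangent, conj_toCTangent]
  rwa [e] at h

variable {F} in
-- At Z = 0 the Gaussians are 1, and each term of the expansion integrates over q, so it is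
-- invariant under every real translation in q.
lemma GraphParallel.ev_pull_translate {k : ℕ} (hk : 0 < k) {S : DistSec g k}
    (h : F.GraphParallel S 0) {f : Cover g → ℂ} (hf : IsTest f) (v : Fin g → ℝ) :
    ev S (F.pull k fun w => f (w + (v, 0))) = ev S (F.pull k f) := by
  refine (hasSum_coeff hk h.isSymm h.parallel (hf.comp_add (v, 0))).unique ?_
  convert! hasSum_coeff hk h.isSymm h.parallel hf using 2 with chi
  congr 1
  simp only [gaussian_zero, mul_one]
  rw [← integral_add_right_eq_self (halfFourier f chi) v]
  simp [halfFourier]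

variable {F} in
-- A lattice vector tangent to the leaves translates `S` in two ways: by invariance along the leaf
-- and by quasi-periodicity. Their quotient is the holonomy around the corresponding loop, so the
-- holonomy defect annihilates `S`.
lemma GraphParallel.ev_mul_eq_zero {k : ℕ} (hk : 0 < k) {S : DistSec g k}
    (h : F.GraphParallel S 0) {l : Lattice g} {v : Fin g → ℝ} (hl : F.A (v, 0) = latt l)
    {f : Cover g → ℂ} (hf : IsTest f) :
    ev S (fun u => (exp (2 * Real.pi * I * k * omega u (latt l)) -
      (-1) ^ ((k : ℤ) * ∑ i, l.1 i * l.2 i)) * f u) = 0 := by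
  have hc : ContDiff ℝ ∞ fun u : Cover g => exp (Real.pi * I * k * omega u (latt l)) :=
    (contDiff_const.mul (contDiff_omega_left' (latt l))).cexp
  set a : ℂ := (-1) ^ ((k : ℤ) * ∑ i, l.1 i * l.2 i) with ha
  -- The exponential cancels the one in the multiplier, so the quasi-periodic translate of `f2` is
  -- only a sign times `f`, and the whole dependence on u appears on the invariance side.
  set f1 : Cover g → ℂ := fun u => exp (Real.pi * I * k * omega u (latt l)) * f u with hf1d
  have hf1 : IsTest f1 := hf.mul_left hc
  set f2 : Cover g → ℂ := fun u => f1 (u - latt l) with hf2d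
  have hf2 : IsTest f2 := by simpa only [hf2d, sub_eq_add_neg] using hf1.comp_add (-latt l)
  have h1 := h.ev_pull_translate hk (F.isTest_unpull k hf2) v
  rw [pull_unpull, ← ev_translate S hf2 l] at h1
  have e1 (u : Cover g) : F.pull k (fun w => F.unpull k f2 (w + (v, 0))) u =
      exp (2 * Real.pi * I * k * omega u (latt l)) * f u := by
    obtain ⟨w, rfl⟩ := F.A.surjective u
    rw [pull_A, unpull, map_add, hl]
    have e2 : f2 (F.A w + latt l) = f1 (F.A w) := by simp [hf2d]
    rw [e2, ← mul_assoc, hf1d, ← mul_assoc]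
    congr 1
    rw [phase, phase, ← exp_neg, ← exp_add, ← exp_add]
    congr 1
    have e3 : omega (F.A w) (latt l) = F.kap * (w.2 ⬝ᵥ v) := by
      rw [← hl, F.omega_A]
      simp [omega, dotProduct]
    have e4 : (w + (v, 0)).1 ⬝ᵥ (w + (v, 0)).2 = w.1 ⬝ᵥ w.2 + w.2 ⬝ᵥ v := by
      simp [add_dotProduct, dotProduct_comm v]
    rw [e3, e4, lev]
    push_cast
    ring
  have e5 (u : Cover g) : mult k l u * f2 (u + latt l) = a * f u := by
    have e2 : f2 (u + latt l) = f1 u := by simp [hf2d]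
    rw [e2, hf1d, mult, ← ha]
    simp only
    rw [← mul_assoc, mul_assoc a, ← exp_add]
    have : -(Real.pi * I * ((k : ℤ) : ℂ) * (omega u (latt l) : ℂ)) +
      Real.pi * I * k * (omega u (latt l) : ℂ) = 0 := by push_cast; ring
    rw [this, exp_zero, mul_one]
  have hc2 : ContDiff ℝ ∞ fun u : Cover g => exp (2 * Real.pi * I * k * omega u (latt l)) :=
    (contDiff_const.mul (contDiff_omega_left' (latt l))).cexp
  simp only [sub_mul]
  rw [ev_sub S (hf.mul_left hc2) (hf.const_mul a), sub_eq_zero]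
  rw [funext e1, funext e5] at h1
  exact h1

end Frame

/-! ### The action of the lattice on the coefficients -/

/-- `exp (2π i ⟨χ, b⟩)` is additive in `b`. -/
lemma ech_add_right (chi : Fin g → ℤ) (p b : Fin g → ℝ) : ech chi (p + b) = ech chi p * ech chi b := by
  rw [ech, ech, ech, ← exp_add, ← mul_add, ← Finset.sum_add_distrib]
  congr 2
  exact Finset.sum_congr rfl fun i _ => by push_cast [Pi.add_apply]; ring

namespace Frame

variable {t t' : Matrix (Fin g) (Fin g) ℂ} (F : Frame t t')

/-- Up to sign, κ times the j-th first coordinate is ω of the lattice vector with the image of the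
j-th p-vector. That image is a lattice vector, so the value is an integer. -/
lemma exists_shift (m : Lattice g) :
    ∃ n : Fin g → ℤ, intVec n = (F.kap : ℝ) • (F.A.symm (latt m)).1 := by
  have h (j : Fin g) : ∃ n : ℤ, (n : ℝ) = F.kap * (F.A.symm (latt m)).1 j := by
    obtain ⟨m', hm'⟩ := F.latt_A (0, Pi.single j 1)
    refine ⟨-omegaZ m (m' + m'), ?_⟩
    have h1 := omega_latt m (m' + m')
    rw [← hm', ← F.A.apply_symm_apply (latt m), F.omega_A] at h1
    have h2 : omega (F.A.symm (latt m)) (latt (0, Pi.single j 1)) = -(F.A.symm (latt m)).1 j := by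
      simp only [omega, latt]
      rw [Finset.sum_eq_single j]
      · simp
      · intro i _ hi
        simp [hi]
      · simp
    rw [h2] at h1
    push_cast
    linarith
  choose n hn using h
  exact ⟨n, funext fun j => by simp [intVec, hn j]⟩

/-- `K a`, where `a` is the first component of the lattice vector in the frame. -/
def shift (k : ℕ) (m : Lattice g) : Fin g → ℤ := k • Classical.choose (F.exists_shift m)

lemma intVec_shift (k : ℕ) (m : Lattice g) :
    intVec (F.shift k m) = (F.lev k : ℝ) • (F.A.symm (latt m)).1 := by
  have h := Classical.choose_spec (F.exists_shift m)
  have h1 : intVec (F.shift k m) = (k : ℝ) • intVec (Classical.choose (F.exists_shift m)) := by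
    ext i
    simp [intVec, shift]
  rw [h1, h, smul_smul, lev]
  push_cast
  rfl

/-- The constant in the multiplier of a lattice vector in the frame. -/
def shiftConst (k : ℕ) (m : Lattice g) : ℂ :=
  (-1) ^ ((k : ℤ) * ∑ i, m.1 i * m.2 i) * phase (F.lev k) (F.A.symm (latt m))

lemma mult_mul_phase (k : ℕ) (m : Lattice g) (w : Cover g) :
    mult k m (F.A w) * phase (F.lev k) (w + F.A.symm (latt m)) =
      phase (F.lev k) w * (F.shiftConst k m * ech (-(F.shift k m)) w.2) := by
  set v := F.A.symm (latt m) with hv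
  have hl : latt m = F.A v := by simp [hv]
  have e1 : ech (-(F.shift k m)) w.2 = exp (-(2 * Real.pi * I * F.lev k * ((v.1 ⬝ᵥ w.2 : ℝ) : ℂ))) := by
    rw [ech]
    congr 1
    have h1 (i : Fin g) : (((-(F.shift k m)) i : ℤ) : ℂ) = -((F.lev k : ℝ) * v.1 i : ℝ) := by
      have := congrFun (F.intVec_shift k m) i
      rw [← hv, Pi.smul_apply, smul_eq_mul] at this
      rw [← this]
      simp [intVec]
    simp only [h1, dotProduct, ofReal_sum, Finset.mul_sum, ← Finset.sum_neg_distrib]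
    refine Finset.sum_congr rfl fun i _ => ?_
    push_cast
    ring
  have e2 : omega (F.A w) (latt m) = F.kap * (v.1 ⬝ᵥ w.2 - w.1 ⬝ᵥ v.2) := by
    rw [hl, F.omega_A]
    congr 1
    simp only [omega, dotProduct, ← Finset.sum_sub_distrib]
    exact Finset.sum_congr rfl fun i _ => by ring
  have e3 : (w + v).1 ⬝ᵥ (w + v).2 = w.1 ⬝ᵥ w.2 + v.1 ⬝ᵥ w.2 + (w.1 ⬝ᵥ v.2 + v.1 ⬝ᵥ v.2) := by
    simp only [Prod.fst_add, Prod.snd_add, add_dotProduct, dotProduct_add]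
  have e4 : exp (-(Real.pi * I * (k : ℤ) * omega (F.A w) (latt m))) * phase (F.lev k) (w + v) =
      phase (F.lev k) w * (phase (F.lev k) v *
        exp (-(2 * Real.pi * I * F.lev k * ((v.1 ⬝ᵥ w.2 : ℝ) : ℂ)))) := by
    simp only [phase, ← exp_add]
    congr 1
    rw [e2, e3, lev]
    push_cast
    ring
  rw [mult, shiftConst, e1, ← hv]
  linear_combination (-1 : ℂ) ^ ((k : ℤ) * ∑ i, m.1 i * m.2 i) * e4

/-- The image of the integer points of the frame is only a sublattice of ℤ²ᵍ. Invariance under the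
full lattice gives further relations between coefficients, without which the theta functions below
would not be sections of Lᵏ. -/
lemma ev_pull_lattice {k : ℕ} (T : DistSec g k) {f : Cover g → ℂ} (hf : IsTest f) (m : Lattice g) :
    ev T (F.pull k fun w => F.shiftConst k m * (ech (-(F.shift k m)) w.2 *
      f (w + F.A.symm (latt m)))) = ev T (F.pull k f) := by
  rw [← ev_translate T (F.isTest_pull k hf) m]
  congr 1
  funext u
  obtain ⟨w, rfl⟩ := F.A.surjective u
  have h : F.A w + latt m = F.A (w + F.A.symm (latt m)) := by rw [map_add]; simp
  rw [pull_A, h, pull_A, ← mul_assoc (mult _ _ _), mult_mul_phase]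
  ring

/-- Only the periodization of the cutoff matters. A general lattice translation moves `unitPart` to
a shifted cutoff, which this lemma permits to move back. -/
lemma ev_pull_partition {k : ℕ} (T : DistSec g k) {b : (Fin g → ℝ) → ℂ} (hb : IsTest b)
    (hb1 : ∀ p, ∑ᶠ m : Fin g → ℤ, b (p + intVec m) = 1) (chi : Fin g → ℤ)
    {psi : (Fin g → ℝ) → ℂ} (h : IsTest psi) :
    ev T (F.pull k fun w => psi w.1 * (b w.2 * ech (-chi) w.2)) =
      ev T (F.pull k (partWave chi psi)) := by
  have key {b : (Fin g → ℝ) → ℂ} (hb : IsTest b)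
      (hb1 : ∀ p, ∑ᶠ m : Fin g → ℤ, b (p + intVec m) = 1) :
      (fun w : Cover g => unitPart g w.2 * ∑ᶠ m : Fin g → ℤ,
        psi w.1 * (b (w.2 + intVec m) * ech (-chi) (w.2 + intVec m))) =
      fun w => unitPart g w.2 * (psi w.1 * ech (-chi) w.2) := by
    funext w
    congr 1
    have e1 (m : Fin g → ℤ) : psi w.1 * (b (w.2 + intVec m) * ech (-chi) (w.2 + intVec m)) =
        (psi w.1 * ech (-chi) w.2) * b (w.2 + intVec m) := by
      rw [ech_add_intVec]
      ring
    simp only [e1]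
    rw [← mul_finsum', hb1, mul_one]
    have := (cubeTiling (Fin g)).finite_translates hb.2 (isCompact_singleton (x := w.2))
    exact this.subset fun m hm => ⟨w.2, rfl, subset_tsupport _ hm⟩
  rw [← (F.ev_pull_periodize T (h.tensor (hb.mul_right (contDiff_ech (-chi))))).2,
    ← (F.ev_pull_periodize T (isTest_partWave chi h)).2]
  simp only [partWave]
  rw [key hb hb1, key isTest_unitPart finsum_unitPart]

variable {F} in
-- Apply `ev_pull_lattice` to a partial wave: translation turns the mode χ into χ + shift,
-- multiplies by a constant, and leaves the integral over q unchanged.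
lemma GraphParallel.coeff_shift {k : ℕ} (hk : 0 < k) {S : DistSec g k} (h : F.GraphParallel S 0)
    (m : Lattice g) (chi : Fin g → ℤ) :
    F.coeff S 0 chi * ech chi (F.A.symm (latt m)).2 =
      F.shiftConst k m * F.coeff S 0 (chi + F.shift k m) := by
  set v := F.A.symm (latt m) with hv
  have h1 (chi : Fin g → ℤ) {psi : (Fin g → ℝ) → ℂ} (hp : IsTest psi) :
      ev S (F.pull k (partWave chi psi)) = F.coeff S 0 chi * ∫ q, psi q := by
    simpa only [gaussian_zero, mul_one] using ev_pull_partWave hk h.isSymm h.parallel chi hp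
  have h2 := F.ev_pull_lattice S (isTest_partWave chi isTest_unitPart) m
  rw [h1 chi isTest_unitPart, integral_unitPart, mul_one] at h2
  have hb : IsTest fun p => unitPart g (p + v.2) := isTest_unitPart.comp_add _
  have hb1 (p) : ∑ᶠ m : Fin g → ℤ, unitPart g (p + intVec m + v.2) = 1 := by
    simp only [add_right_comm p _ v.2]
    exact finsum_unitPart _
  have hpsi : IsTest fun q => unitPart g (q + v.1) := isTest_unitPart.comp_add _
  have h3 := F.ev_pull_partition S hb hb1 (chi + F.shift k m) hpsi
  rw [h1 _ hpsi, integral_add_right_eq_self, integral_unitPart, mul_one] at h3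
  have e (w : Cover g) : F.shiftConst k m * (ech (-(F.shift k m)) w.2 *
      partWave chi (unitPart g) (w + v)) = (F.shiftConst k m * ech (-chi) v.2) *
      (unitPart g (w.1 + v.1) * (unitPart g (w.2 + v.2) * ech (-(chi + F.shift k m)) w.2)) := by
    rw [partWave, Prod.fst_add, Prod.snd_add, ech_add_right, neg_add, ech_add]
    ring
  rw [funext e, F.ev_pull_const_mul S (hpsi.tensor (hb.mul_right (contDiff_ech _))), h3] at h2
  rw [← h2]
  have := ech_neg chi v.2
  linear_combination F.shiftConst k m * F.coeff S 0 (chi + F.shift k m) * this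

end Frame

/-! ### Theta series with periodic coefficients -/

/-- `exp (2π i n x - π ε n² / K)`. -/
def thetaTerm (K : ℕ) (eps : ℝ) (n : ℤ) (x : ℂ) : ℂ :=
  exp (2 * Real.pi * I * n * x - Real.pi * eps * n ^ 2 / K)

/-- The sum of the terms of index in `a + Kℤ`. -/
def thetaPart (K : ℕ) (eps : ℝ) (a : ℤ) (x : ℂ) : ℂ :=
  thetaTerm K eps a x * jacobiTheta₂ (K * x + I * eps * a) (I * eps * K)

lemma im_theta {K : ℕ} (hK : 0 < K) {eps : ℝ} (he : 0 < eps) : 0 < (I * eps * K : ℂ).im := by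
  have : (I * eps * K : ℂ).im = eps * K := by simp
  rw [this]
  positivity

lemma summable_thetaTerm {K : ℕ} (hK : 0 < K) {eps : ℝ} (he : 0 < eps) (x : ℂ) :
    Summable fun n : ℤ => ‖thetaTerm K eps n x‖ := by
  have h1 : 0 < (I * (eps / K : ℝ) : ℂ).im := by
    have : (I * (eps / K : ℝ) : ℂ).im = eps / K := by simp [- ofReal_div]
    rw [this]
    positivity
  have h := ((summable_jacobiTheta₂_term_iff x _).2 h1).norm
  refine h.congr fun n => ?_
  rw [jacobiTheta₂_term, thetaTerm]
  congr 2
  push_cast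
  have := I_mul_I
  linear_combination (Real.pi * n ^ 2 * (eps / K) : ℂ) * this

lemma hasSum_thetaPart {K : ℕ} (hK : 0 < K) {eps : ℝ} (he : 0 < eps) (a : ℤ) (x : ℂ) :
    HasSum (fun n : ℤ => thetaTerm K eps (a + K * n) x) (thetaPart K eps a x) := by
  have h := (hasSum_jacobiTheta₂_term (K * x + I * eps * a) (im_theta hK he)).mul_left
    (thetaTerm K eps a x)
  refine h.congr_fun ?_
  intro n
  rw [jacobiTheta₂_term, thetaTerm, thetaTerm, ← exp_add]
  congr 1
  have : (K : ℂ) ≠ 0 := by exact_mod_cast hK.ne'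
  push_cast
  field_simp
  linear_combination (-(2 * a * K * n * eps) - K ^ 2 * n ^ 2 * eps : ℂ) * I_mul_I

/-- The sum over `χ` of the products of the terms, with coefficients of period `K`. -/
def thetaSum (K : ℕ) (eps : ℝ) (c : (Fin g → ℤ) → ℂ) (z : Fin g → ℂ) : ℂ :=
  ∑ a : Fin g → Fin K, c (fun i => (a i : ℤ)) * ∏ i, thetaPart K eps (a i : ℤ) (z i)

lemma exists_bound_of_periodic {K : ℕ} (hK : 0 < K) {c : (Fin g → ℤ) → ℂ}
    (hc : ∀ chi m, c (chi + K • m) = c chi) : ∃ C, ∀ chi, ‖c chi‖ ≤ C := by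
  have hK' : (0 : ℤ) < K := by exact_mod_cast hK
  have hfin : (Icc (0 : Fin g → ℤ) (fun _ => (K : ℤ))).Finite := Set.finite_Icc _ _
  refine ⟨∑ a ∈ hfin.toFinset, ‖c a‖, fun chi => ?_⟩
  have e : chi = (fun i => chi i % K) + K • fun i => chi i / K := by
    funext i
    simp [Int.emod_add_mul_ediv]
  rw [e, hc]
  refine Finset.single_le_sum (f := fun a => ‖c a‖) (fun a _ => norm_nonneg _)
    (hfin.mem_toFinset.2 ⟨fun i => Int.emod_nonneg _ hK'.ne', fun i =>
      (Int.emod_lt_of_pos _ hK').le⟩)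

/-- Split χ into a residue a and a multiple of K. For fixed a the coefficient is constant and the
sum factors into one-variable theta series, so holomorphy in z follows from that of `jacobiTheta₂`.
-/
lemma hasSum_thetaSum {K : ℕ} (hK : 0 < K) {eps : ℝ} (he : 0 < eps) {c : (Fin g → ℤ) → ℂ}
    (hc : ∀ chi m, c (chi + K • m) = c chi) (z : Fin g → ℂ) :
    (Summable fun chi : Fin g → ℤ => ‖c chi * ∏ i, thetaTerm K eps (chi i) (z i)‖) ∧
      HasSum (fun chi : Fin g → ℤ => c chi * ∏ i, thetaTerm K eps (chi i) (z i))
        (thetaSum K eps c z) := by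
  have : NeZero K := ⟨hK.ne'⟩
  obtain ⟨C, hC⟩ := exists_bound_of_periodic hK hc
  have h1 := (summable_prod_pi (f := fun i n => thetaTerm K eps n (z i))
    fun i => summable_thetaTerm hK he (z i)).1
  have h2 : Summable fun chi : Fin g → ℤ => ‖c chi * ∏ i, thetaTerm K eps (chi i) (z i)‖ := by
    refine (h1.mul_left C).of_nonneg_of_le (fun _ => norm_nonneg _) fun chi => ?_
    rw [norm_mul]
    exact mul_le_mul_of_nonneg_right (hC chi) (norm_nonneg _)
  refine ⟨h2, ?_⟩
  let e : (Fin g → ℤ) ≃ (Fin g → Fin K) × (Fin g → ℤ) :=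
    ((Equiv.piCongrRight fun _ => Int.divModEquiv K).trans
      (Equiv.arrowProdEquivProdArrow _ _ _)).trans (Equiv.prodComm _ _)
  have he1 (a : Fin g → Fin K) (m : Fin g → ℤ) :
      e.symm (a, m) = (fun i => (a i : ℤ)) + K • m := by
    funext i
    change (Int.divModEquiv K).symm (m i, a i) = _
    rw [Int.divModEquiv_symm_apply]
    simp
    ring
  have h3 := e.symm.hasSum_iff.2 h2.of_norm.hasSum
  have h4 := h3.prod_fiberwise (g := fun a => c (fun i => (a i : ℤ)) *
    ∏ i, thetaPart K eps (a i : ℤ) (z i)) fun a => by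
      have h5 (i : Fin g) := hasSum_thetaPart hK he (a i : ℤ) (z i)
      have h6 := (summable_prod_pi (f := fun i n => thetaTerm K eps ((a i : ℤ) + K * n) (z i))
        fun i => (h5 i).summable.norm).2.mul_left (c (fun i => (a i : ℤ)))
      simp only [fun i => (h5 i).tsum_eq] at h6
      refine h6.congr_fun fun m => ?_
      simp only [Function.comp_apply, he1, hc]
      congr 1
  have h5 := (hasSum_fintype _).unique h4
  rw [thetaSum, h5]
  exact h2.of_norm.hasSum

lemma differentiable_thetaPart {K : ℕ} (hK : 0 < K) {eps : ℝ} (he : 0 < eps) (a : ℤ) :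
    Differentiable ℂ (thetaPart K eps a) := by
  have h1 : Differentiable ℂ (thetaTerm K eps a) := by
    unfold thetaTerm
    fun_prop
  have h2 : Differentiable ℂ fun x => jacobiTheta₂ x (I * eps * K) := fun x =>
    differentiableAt_jacobiTheta₂_fst x (im_theta hK he)
  exact h1.mul (h2.comp (by fun_prop : Differentiable ℂ fun x : ℂ => K * x + I * eps * a))

lemma differentiable_thetaSum {K : ℕ} (hK : 0 < K) {eps : ℝ} (he : 0 < eps)
    (c : (Fin g → ℤ) → ℂ) : Differentiable ℂ (thetaSum K eps c) := by
  have h (a : ℤ) : ContDiff ℂ 1 (thetaPart K eps a) := (differentiable_thetaPart hK he a).contDiff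
  have h1 : ContDiff ℂ 1 (thetaSum K eps c) := by
    unfold thetaSum
    refine ContDiff.sum fun a _ => contDiff_const.mul (contDiff_prod fun i _ => ?_)
    exact (h _).comp (contDiff_apply ℂ ℂ i)
  exact h1.differentiable one_ne_zero

lemma contDiff_thetaSum {K : ℕ} (hK : 0 < K) {eps : ℝ} (he : 0 < eps)
    (c : (Fin g → ℤ) → ℂ) : ContDiff ℝ ∞ (thetaSum K eps c) := by
  have h (a : ℤ) : ContDiff ℝ ∞ (thetaPart K eps a) :=
    ((differentiable_thetaPart hK he a).contDiff (n := ∞)).restrict_scalars ℝ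
  unfold thetaSum
  refine ContDiff.sum fun a _ => contDiff_const.mul (contDiff_prod fun i _ => ?_)
  exact (h _).comp (contDiff_apply ℝ ℂ i)

/-- The theta function `exp (-π K ε |q|²) ∑ c_χ ∏ exp (2π i χ (p + i ε q) - π ε χ² / K)`. -/
def thetaFn (K : ℕ) (eps : ℝ) (c : (Fin g → ℤ) → ℂ) (w : Cover g) : ℂ :=
  exp (-(Real.pi * K * eps * ((w.1 ⬝ᵥ w.1 : ℝ) : ℂ))) *
    thetaSum K eps c (toC w.2 + (I * eps) • toC w.1)

lemma gaussian_mul_ech {K : ℕ} (hK : 0 < K) (eps : ℝ) (chi : Fin g → ℤ) (w : Cover g) :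
    gaussian K ((I * eps) • 1) chi w.1 * ech chi w.2 =
      exp (-(Real.pi * K * eps * ((w.1 ⬝ᵥ w.1 : ℝ) : ℂ))) *
        ∏ i, thetaTerm K eps (chi i) ((toC w.2 + (I * eps) • toC w.1) i) := by
  have hK' : (K : ℂ) ≠ 0 := by exact_mod_cast hK.ne'
  simp only [gaussian, ech, thetaTerm, ← exp_sum, ← exp_add]
  congr 1
  simp only [quad, smul_mulVec, one_mulVec, dotProduct, Pi.smul_apply, smul_eq_mul, Pi.add_apply, toC,
    ofReal_sum, Finset.mul_sum, ← Finset.sum_add_distrib, ← Finset.sum_neg_distrib]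
  refine Finset.sum_congr rfl fun i _ => ?_
  simp only [intVec]
  push_cast
  field_simp
  linear_combination ((K : ℂ) ^ 2 * w.1 i ^ 2 * eps + chi i ^ 2 * eps) * I_mul_I

/-! ### Theta functions on the cover -/

lemma gaussian_scalar_zero (K : ℕ) (eps : ℝ) (q : Fin g → ℝ) :
    gaussian K ((I * eps) • 1) 0 q = exp (-(Real.pi * K * eps * ((q ⬝ᵥ q : ℝ) : ℂ))) := by
  rw [gaussian]
  congr 1
  have h : q + (K : ℝ)⁻¹ • intVec 0 = q := by
    ext i
    simp [intVec]
  rw [h, quad, smul_mulVec, one_mulVec, dotProduct_smul, smul_eq_mul]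
  have h2 : toC q ⬝ᵥ toC q = ((q ⬝ᵥ q : ℝ) : ℂ) := by simp [dotProduct, toC]
  rw [h2]
  linear_combination (Real.pi * K * eps * ((q ⬝ᵥ q : ℝ) : ℂ)) * I_mul_I

/-- The linear map `(q, p) ↦ p + i ε q`. -/
def thetaArg (g : ℕ) (eps : ℝ) : Cover g →L[ℝ] (Fin g → ℂ) :=
  LinearMap.toContinuousLinearMap
    { toFun := fun w => toC w.2 + (I * eps) • toC w.1
      map_add' := fun u w => by
        ext i
        simp [toC]
        ring
      map_smul' := fun r w => by
        ext i
        simp [toC]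
        ring }

lemma thetaArg_apply (eps : ℝ) (w : Cover g) : thetaArg g eps w = toC w.2 + (I * eps) • toC w.1 := rfl

lemma thetaFn_eq (K : ℕ) (eps : ℝ) (c : (Fin g → ℤ) → ℂ) (w : Cover g) :
    thetaFn K eps c w = gaussian K ((I * eps) • 1) 0 w.1 * thetaSum K eps c (thetaArg g eps w) := by
  rw [gaussian_scalar_zero, thetaFn, thetaArg_apply]

lemma hasSum_thetaFn {K : ℕ} (hK : 0 < K) {eps : ℝ} (he : 0 < eps) {c : (Fin g → ℤ) → ℂ}
    (hc : ∀ chi m, c (chi + K • m) = c chi) (w : Cover g) :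
    HasSum (fun chi : Fin g → ℤ => c chi * (gaussian K ((I * eps) • 1) chi w.1 * ech chi w.2))
      (thetaFn K eps c w) := by
  refine ((hasSum_thetaSum hK he hc (toC w.2 + (I * eps) • toC w.1)).2.mul_left
    (exp (-(Real.pi * K * eps * ((w.1 ⬝ᵥ w.1 : ℝ) : ℂ))))).congr_fun fun chi => ?_
  rw [gaussian_mul_ech hK]
  ring

lemma contDiff_thetaFn {K : ℕ} (hK : 0 < K) {eps : ℝ} (he : 0 < eps) (c : (Fin g → ℤ) → ℂ) :
    ContDiff ℝ ∞ (thetaFn K eps c) := by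
  have h := ((contDiff_gaussian K ((I * eps) • 1) 0).comp (contDiff_fst (F := Fin g → ℝ))).mul
    ((contDiff_thetaSum hK he c).comp (thetaArg g eps).contDiff)
  exact (funext fun w => thetaFn_eq K eps c w) ▸ h

lemma isSymm_scalar (z : ℂ) : (z • (1 : Matrix (Fin g) (Fin g) ℂ)).IsSymm := by
  rw [IsSymm, transpose_smul, transpose_one]

/-- The direction (a, -iε a) is killed by the complexified argument p + iε q, so the holomorphic
theta sum does not contribute; only the Gaussian prefactor is differentiated. -/
lemma cderiv_thetaFn {K : ℕ} (hK : 0 < K) {eps : ℝ} (he : 0 < eps) (c : (Fin g → ℤ) → ℂ)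
    (a : Fin g → ℂ) (w : Cover g) :
    cderiv (a, -((I * eps) • a)) (thetaFn K eps c) w =
      -(2 * Real.pi * K * eps * (toC w.1 ⬝ᵥ a)) * thetaFn K eps c w := by
  have h1 : HasFDerivAt (fun w : Cover g => gaussian K ((I * eps) • 1) 0 w.1) _ w :=
    ((contDiff_gaussian K ((I * eps) • 1) 0).differentiable (by simp) w.1).hasFDerivAt.comp w
      hasFDerivAt_fst
  have h2 : HasFDerivAt (fun w : Cover g => thetaSum K eps c (thetaArg g eps w)) _ w :=
    ((differentiable_thetaSum hK he c _).hasFDerivAt.restrictScalars ℝ).comp w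
      (thetaArg g eps).hasFDerivAt
  have h3 := h1.fun_mul h2
  rw [← funext fun w => thetaFn_eq K eps c w] at h3
  have e0 : w.1 + (K : ℝ)⁻¹ • intVec (0 : Fin g → ℤ) = w.1 := by
    ext i
    simp [intVec]
  have e1 (v : Fin g → ℝ) : fderiv ℝ (gaussian K ((I * eps) • 1) 0) w.1 v =
      -(2 * Real.pi * K * eps * (toC w.1 ⬝ᵥ toC v)) * gaussian K ((I * eps) • 1) 0 w.1 := by
    rw [fderiv_gaussian (isSymm_scalar _), e0, smul_mulVec, one_mulVec, dotProduct_smul, smul_eq_mul]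
    linear_combination (2 * Real.pi * K * eps * (toC w.1 ⬝ᵥ toC v) *
      gaussian K ((I * eps) • 1) 0 w.1) * I_mul_I
  have e2 (xi : CTangent g) : thetaArg g eps (reT xi) + I • thetaArg g eps (imT xi) =
      xi.2 + (I * eps) • xi.1 := by
    ext i
    have h1 := re_add_im (xi.1 i)
    have h2 := re_add_im (xi.2 i)
    simp only [thetaArg_apply, toC, reT, imT, Pi.add_apply, Pi.smul_apply, smul_eq_mul]
    linear_combination h2 + I * eps * h1
  have e3 : toC (reT (a, -((I * eps) • a))).1 + I • toC (imT (a, -((I * eps) • a))).1 = a := by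
    ext i
    have h1 := re_add_im (a i)
    simp only [toC, reT, imT, Pi.add_apply, Pi.smul_apply, smul_eq_mul]
    linear_combination h1
  have e4 : toC w.1 ⬝ᵥ toC (reT (a, -((I * eps) • a))).1 +
      I * (toC w.1 ⬝ᵥ toC (imT (a, -((I * eps) • a))).1) = toC w.1 ⬝ᵥ a := by
    conv_rhs => rw [← e3]
    rw [dotProduct_add, dotProduct_smul, smul_eq_mul]
  have e5 := congrArg (fderiv ℂ (thetaSum K eps c) (thetaArg g eps w)) (e2 (a, -((I * eps) • a)))
  have e6 : -((I * eps) • a) + (I * eps) • a = 0 := neg_add_cancel _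
  rw [map_add, map_smul, e6, map_zero, smul_eq_mul] at e5
  rw [cderiv, h3.fderiv, thetaFn_eq]
  simp only [_root_.add_apply, _root_.smul_apply, ContinuousLinearMap.comp_apply, smul_eq_mul,
    ContinuousLinearMap.coe_fst', ContinuousLinearMap.coe_restrictScalars', e1]
  linear_combination gaussian K ((I * eps) • 1) 0 w.1 * e5 +
    (-(2 * Real.pi * K * eps) * gaussian K ((I * eps) • 1) 0 w.1 *
      thetaSum K eps c (thetaArg g eps w)) * e4

lemma cderiv_conj {f : Cover g → ℂ} (hf : Differentiable ℝ f) (xi : CTangent g) (w : Cover g) :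
    cderiv (CTangent.conj xi) (fun w => conj (f w)) w = conj (cderiv xi f w) := by
  have e1 : reT (CTangent.conj xi) = reT xi := by ext <;> simp [reT, CTangent.conj]
  have e2 : imT (CTangent.conj xi) = -imT xi := by ext <;> simp [imT, CTangent.conj]
  have e3 (v) : fderiv ℝ (fun u => conj (f u)) w v = conj (fderiv ℝ f w v) := by
    have := (conjCLE : ℂ →L[ℝ] ℂ).hasFDerivAt.comp w (hf w).hasFDerivAt
    have h : HasFDerivAt (fun u => conj (f u)) _ w := this
    rw [h.fderiv]
    simp
  rw [cderiv, cderiv, e1, e2, e3, e3]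
  simp

lemma norm_gaussian_scalar {K : ℕ} {eps : ℝ} (chi : Fin g → ℤ) (q : Fin g → ℝ) :
    ((‖gaussian K ((I * eps) • 1) chi q‖ : ℝ) : ℂ) = gaussian K ((I * eps) • 1) chi q := by
  have h : gaussian K ((I * eps) • 1) chi q = ((Real.exp (-(Real.pi * K * eps *
      ((q + (K : ℝ)⁻¹ • intVec chi) ⬝ᵥ (q + (K : ℝ)⁻¹ • intVec chi)))) : ℝ) : ℂ) := by
    have h1 := gaussian_scalar_zero K eps (q + (K : ℝ)⁻¹ • intVec chi)
    rw [gaussian] at h1 ⊢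
    have e0 : q + (K : ℝ)⁻¹ • intVec chi + (K : ℝ)⁻¹ • intVec (0 : Fin g → ℤ) =
        q + (K : ℝ)⁻¹ • intVec chi := by
      ext i
      simp [intVec]
    rw [e0] at h1
    rw [h1]
    push_cast
    rfl
  rw [h, norm_real, Real.norm_of_nonneg (Real.exp_pos _).le]

lemma im_quad_scalar {eps : ℝ} (he : 0 ≤ eps) (v : Fin g → ℝ) : 0 ≤ (quad ((I * eps) • 1) v).im := by
  have h2 : toC v ⬝ᵥ toC v = ((v ⬝ᵥ v : ℝ) : ℂ) := by simp [dotProduct, toC]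
  rw [quad, smul_mulVec, one_mulVec, dotProduct_smul, smul_eq_mul, h2]
  have h3 : (I * eps * ((v ⬝ᵥ v : ℝ) : ℂ) : ℂ).im = eps * (v ⬝ᵥ v) := by simp
  rw [h3]
  exact mul_nonneg he (Finset.sum_nonneg fun i _ => mul_self_nonneg _)

/-- Termwise integration of a theta function against a test function. -/
lemma hasSum_integral_thetaFn {K : ℕ} (hK : 0 < K) {eps : ℝ} (he : 0 < eps) {c : (Fin g → ℤ) → ℂ}
    (hc : ∀ chi m, c (chi + K • m) = c chi) {f : Cover g → ℂ} (hf : IsTest f) :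
    HasSum (fun chi => c chi * ∫ q, halfFourier f chi q * gaussian K ((I * eps) • 1) chi q)
      (∫ w, f w * thetaFn K eps c w) := by
  have hcg (chi : Fin g → ℤ) : ContDiff ℝ ∞ fun w : Cover g =>
      c chi * (gaussian K ((I * eps) • 1) chi w.1 * ech chi w.2) :=
    contDiff_const.mul (((contDiff_gaussian _ _ _).comp contDiff_fst).mul
      ((contDiff_ech chi).comp contDiff_snd))
  have hF (chi : Fin g → ℤ) : ∫ w : Cover g, f w *
      (c chi * (gaussian K ((I * eps) • 1) chi w.1 * ech chi w.2)) =
      c chi * ∫ q, halfFourier f chi q * gaussian K ((I * eps) • 1) chi q := by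
    have hi : Integrable (fun w : Cover g => f w *
        (c chi * (gaussian K ((I * eps) • 1) chi w.1 * ech chi w.2))) volume :=
      (hf.mul_right (hcg chi)).integrable
    rw [Measure.volume_eq_prod] at hi ⊢
    rw [integral_prod _ hi, ← integral_const_mul]
    congr 1
    funext q
    rw [halfFourier, ← integral_mul_const, ← integral_const_mul]
    congr 1
    funext p
    ring
  simp only [← hF]
  have hnc (chi m : Fin g → ℤ) : ((‖c (chi + K • m)‖ : ℝ) : ℂ) = ((‖c chi‖ : ℝ) : ℂ) := by rw [hc]
  -- For Z = iε the Gaussians are positive, so the majorant is itself a theta series, with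
  -- coefficients |c_χ| and p = 0. Its sum is therefore continuous in w.
  have hbd (w : Cover g) : HasSum (fun chi => ‖f w‖ * (‖c chi‖ * ‖gaussian K ((I * eps) • 1) chi w.1‖))
      (‖f w‖ * (thetaFn K eps (fun chi => ((‖c chi‖ : ℝ) : ℂ)) (w.1, 0)).re) := by
    refine HasSum.mul_left _ ?_
    have h := hasSum_re (hasSum_thetaFn hK he
      (c := fun chi => ((‖c chi‖ : ℝ) : ℂ)) hnc (w.1, 0))
    refine h.congr_fun fun chi => ?_
    have e : ech chi (0 : Fin g → ℝ) = 1 := by simp [ech]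
    simp only [e, mul_one]
    rw [← norm_gaussian_scalar, ← ofReal_mul, ofReal_re, norm_real, norm_norm]
  refine hasSum_integral_of_dominated_convergence
    (fun chi w => ‖f w‖ * (‖c chi‖ * ‖gaussian K ((I * eps) • 1) chi w.1‖))
    (fun chi => (hf.mul_right (hcg chi)).integrable.aestronglyMeasurable)
    (fun chi => ae_of_all _ fun w => le_of_eq ?_) (ae_of_all _ fun w => (hbd w).summable) ?_
    (ae_of_all _ fun w => (hasSum_thetaFn hK he hc w).mul_left (f w))
  · rw [norm_mul, norm_mul, norm_mul, norm_ech, mul_one]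
  · simp only [fun w => (hbd w).tsum_eq]
    have h1 : Continuous fun w : Cover g =>
        ‖f w‖ * (thetaFn K eps (fun chi => ((‖c chi‖ : ℝ) : ℂ)) (w.1, 0)).re :=
      hf.continuous.norm.mul (continuous_re.comp ((contDiff_thetaFn hK he _).continuous.comp
        (continuous_fst.prodMk continuous_const)))
    exact h1.integrable_of_hasCompactSupport (hf.2.norm.mul_right)

/-- Convergence of the integrals of theta functions as the Gaussian factor degenerates. -/
lemma tendsto_integral_thetaFn {K : ℕ} (hK : 0 < K) {c : (Fin g → ℤ) → ℂ}
    (hc : ∀ chi m, c (chi + K • m) = c chi) {f : Cover g → ℂ} (hf : IsTest f) :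
    Tendsto (fun eps : ℝ => ∫ w, f w * thetaFn K eps c w) (𝓝[>] 0)
      (𝓝 (∑' chi, c chi * ∫ q, halfFourier f chi q)) := by
  obtain ⟨C, hC⟩ := exists_bound_of_periodic hK hc
  obtain ⟨M, hM⟩ := hf.exists_ckBound (0 + 2 * g)
  have hC0 : 0 ≤ C := (norm_nonneg _).trans (hC 0)
  have hS := summable_inv_one_add_norm_pow g
  -- Two dominated limits are nested: over χ, by the decay of the half Fourier transforms, and for
  -- each χ over q, by the bound 1 on the Gaussian.
  have h := tendsto_tsum_of_dominated_convergence (𝓕 := 𝓝[>] (0 : ℝ))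
    (f := fun eps chi => c chi * ∫ q, halfFourier f chi q * gaussian K ((I * eps) • 1) chi q)
    (g := fun chi => c chi * ∫ q, halfFourier f chi q)
    (bound := fun chi => C * (M * volume.real (Prod.snd '' tsupport f) * volume.real (Prod.fst '' tsupport f)) *
      ((1 + ‖chi‖) ^ (2 * g))⁻¹) (hS.mul_left _) (fun chi => ?_) ?_
  · refine h.congr' ?_
    filter_upwards [self_mem_nhdsWithin] with eps he
    exact (hasSum_integral_thetaFn hK he hc hf).tsum_eq
  · refine Tendsto.const_mul _ ?_
    refine tendsto_integral_filter_of_dominated_convergence (fun q => ‖halfFourier f chi q‖)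
      (Eventually.of_forall fun eps => ((isTest_halfFourier hf chi).mul_right
        (contDiff_gaussian _ _ _)).integrable.aestronglyMeasurable) ?_
      (isTest_halfFourier hf chi).integrable.norm (ae_of_all _ fun q => ?_)
    · filter_upwards [self_mem_nhdsWithin] with eps he
      refine ae_of_all _ fun q => ?_
      rw [norm_mul]
      exact mul_le_of_le_one_right (norm_nonneg _) (norm_gaussian_le (im_quad_scalar (le_of_lt he)) chi q)
    · have h1 : Continuous fun eps : ℝ => halfFourier f chi q * gaussian K ((I * eps) • 1) chi q := by
        have h2 (eps : ℝ) : quad ((I * eps) • 1) (q + (K : ℝ)⁻¹ • intVec chi) =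
            I * eps * (toC (q + (K : ℝ)⁻¹ • intVec chi) ⬝ᵥ toC (q + (K : ℝ)⁻¹ • intVec chi)) := by
          rw [quad, smul_mulVec, one_mulVec, dotProduct_smul, smul_eq_mul]
        simp only [gaussian, h2]
        fun_prop
      have h3 := (h1.tendsto 0).mono_left (nhdsWithin_le_nhds (s := Ioi (0 : ℝ)))
      simpa [Frame.gaussian_zero] using h3
  · filter_upwards [self_mem_nhdsWithin] with eps he chi
    have h1 := Frame.norm_integral_halfFourier_gaussian_le (K := K) (im_quad_scalar (le_of_lt he))
      hf.2.isCompact hf subset_rfl hM chi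
    rw [norm_mul]
    refine (mul_le_mul (hC chi) h1 (norm_nonneg _) hC0).trans (le_of_eq ?_)
    ring

namespace Frame

variable {t t' : Matrix (Fin g) (Fin g) ℂ} (F : Frame t t')

/-! ### Approximation by sections over the open disc -/

variable {F} in
-- Translation by a lattice vector moves the centres of the Gaussians by `shift`; reindexing χ
-- accordingly and applying `coeff_shift` produces the factor.
lemma GraphParallel.thetaFn_shift {k : ℕ} (hk : 0 < k) {S : DistSec g k} (h : F.GraphParallel S 0)
    {eps : ℝ} (he : 0 < eps) (m : Lattice g) (w : Cover g) :
    thetaFn (F.lev k) eps (F.coeff S 0) (w + F.A.symm (latt m)) =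
      F.shiftConst k m * ech (-(F.shift k m)) w.2 * thetaFn (F.lev k) eps (F.coeff S 0) w := by
  have hK := F.lev_pos hk
  have hK' : (F.lev k : ℝ) ≠ 0 := by exact_mod_cast hK.ne'
  have hc := coeff_periodic hk h.isSymm h.parallel
  have h1 := hasSum_thetaFn hK he hc (w + F.A.symm (latt m))
  have h2 := ((Equiv.addRight (F.shift k m)).hasSum_iff.2 (hasSum_thetaFn hK he hc w)).mul_left
    (F.shiftConst k m * ech (-(F.shift k m)) w.2)
  refine h1.unique (h2.congr_fun fun chi => ?_)
  have e1 : gaussian (F.lev k) ((I * eps) • 1) chi (w.1 + (F.A.symm (latt m)).1) =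
      gaussian (F.lev k) ((I * eps) • 1) (chi + F.shift k m) w.1 := by
    rw [gaussian, gaussian]
    congr 3
    have e2 : intVec (chi + F.shift k m) = intVec chi + (F.lev k : ℝ) • (F.A.symm (latt m)).1 := by
      rw [← intVec_shift]
      ext i
      simp [intVec]
    rw [e2, smul_add, smul_smul, inv_mul_cancel₀ hK', one_smul]
    abel
  have e3 := h.coeff_shift hk m chi
  have e4 := ech_neg (F.shift k m) w.2
  simp only [Function.comp_apply, Equiv.coe_addRight, Prod.fst_add, Prod.snd_add, e1, ech_add_right,
    ech_add]
  linear_combination gaussian (F.lev k) ((I * eps) • 1) (chi + F.shift k m) w.1 * ech chi w.2 * e3 -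
    F.shiftConst k m * F.coeff S 0 (chi + F.shift k m) * ech chi w.2 *
      gaussian (F.lev k) ((I * eps) • 1) (chi + F.shift k m) w.1 * e4

lemma norm_phase (K : ℕ) (w : Cover g) : ‖phase K w‖ = 1 := by
  rw [phase, norm_exp]
  simp

lemma conj_phase_inv (K : ℕ) (w : Cover g) : conj (phase K w)⁻¹ = phase K w := by
  have h := conj_mul' (phase K w)
  rw [norm_phase] at h
  rw [map_inv₀]
  refine inv_eq_of_mul_eq_one_right ?_
  simpa using h

/-- The Jacobian of the frame. -/
def jac : ℝ := |(F.A : Cover g →L[ℝ] Cover g).det|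

lemma jac_pos : 0 < F.jac := abs_pos.2 (F.A.toLinearEquiv.isUnit_det').ne_zero

lemma integral_comp_frame (f : Cover g → ℂ) : ∫ u, f u = F.jac * ∫ w, f (F.A w) := by
  have h := integral_image_eq_integral_abs_det_fderiv_smul volume MeasurableSet.univ
    (fun w _ => F.A.hasFDerivAt.hasFDerivWithinAt) F.A.injective.injOn f
  rw [image_univ, F.A.surjective.range_eq, setIntegral_univ, setIntegral_univ] at h
  rw [h, jac, ← integral_const_mul]
  simp

/-- The theta function as a function on the cover, in the trivialization of the line bundle. -/
def approxFun (k : ℕ) (S : DistSec g k) (eps : ℝ) (u : Cover g) : ℂ :=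
  (F.jac : ℂ)⁻¹ * ((phase (F.lev k) (F.A.symm u))⁻¹ *
    thetaFn (F.lev k) eps (F.coeff S 0) (F.A.symm u))

variable {F} in
lemma GraphParallel.approxFun_mem {k : ℕ} (hk : 0 < k) {S : DistSec g k} (h : F.GraphParallel S 0)
    {eps : ℝ} (he : 0 < eps) : F.approxFun k S eps ∈ Sec g k := by
  refine ⟨?_, fun l u => ?_⟩
  · exact contDiff_const.mul (((contDiff_inv_phase (F.lev k)).mul
      (contDiff_thetaFn (F.lev_pos hk) he _)).comp F.A.symm.contDiff)
  · obtain ⟨w, rfl⟩ := F.A.surjective u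
    have e := F.mult_mul_phase k l w
    have h1 : (phase (F.lev k) (w + F.A.symm (latt l)))⁻¹ *
        (F.shiftConst k l * ech (-(F.shift k l)) w.2) =
        mult k l (F.A w) * (phase (F.lev k) w)⁻¹ := by
      have := phase_ne_zero (F.lev k) w
      have := phase_ne_zero (F.lev k) (w + F.A.symm (latt l))
      field_simp
      linear_combination -e
    rw [approxFun, approxFun, map_add, F.A.symm_apply_apply, h.thetaFn_shift hk he]
    linear_combination (F.jac : ℂ)⁻¹ * thetaFn (F.lev k) eps (F.coeff S 0) w * h1

lemma graphVec_scalar (eps : ℝ) (a : Fin g → ℂ) :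
    F.graphVec ((I * eps) • 1) a = F.AC (a, -((I * eps) • a)) := by
  rw [graphVec, smul_mulVec, one_mulVec]

lemma im_scalar_pos {eps : ℝ} (he : 0 < eps) (w : Fin g → ℂ) (hw : w ≠ 0) :
    0 < (star w ⬝ᵥ (((I * eps) • (1 : Matrix (Fin g) (Fin g) ℂ)) *ᵥ w)).im := by
  rw [smul_mulVec, one_mulVec, dotProduct_smul, smul_eq_mul]
  have h := dotProduct_star_self_pos_iff.2 hw
  have h1 := (Complex.lt_def.1 h)
  have h2 : (I * eps * (star w ⬝ᵥ w) : ℂ).im = eps * (star w ⬝ᵥ w).re := by simp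
  rw [h2]
  exact mul_pos he (by simpa using h1.1)

/-- The function is conjugated because `covDerivFun_pull` concerns the connection of L⁻ᵏ. There the
connection term cancels the derivative computed in `cderiv_thetaFn`. -/
lemma approxFun_covDerivFun {k : ℕ} (hk : 0 < k) (S : DistSec g k) {eps : ℝ} (he : 0 < eps)
    (a : Fin g → ℂ) :
    covDerivFun k (F.graphVec ((I * eps) • 1) a) (F.approxFun k S eps) = 0 := by
  set th := thetaFn (F.lev k) eps (F.coeff S 0) with hth
  have hK := F.lev_pos hk
  have hd : Differentiable ℝ th := (contDiff_thetaFn hK he _).differentiable (by simp)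
  have hdc : Differentiable ℝ fun w => conj (th w) :=
    (conjCLE.contDiff.comp (contDiff_thetaFn hK he _)).differentiable (n := ∞) (by simp)
  have hda : Differentiable ℝ (F.approxFun k S eps) :=
    (contDiff_const.mul (((contDiff_inv_phase (F.lev k)).mul
      (contDiff_thetaFn hK he _)).comp F.A.symm.contDiff)).differentiable (n := ∞) (by simp)
  have e1 : (fun u => conj (F.approxFun k S eps u)) =
      F.pull k fun w => (F.jac : ℂ)⁻¹ * conj (th w) := by
    funext u
    rw [approxFun, pull, map_mul, map_mul, conj_phase_inv, map_inv₀, conj_ofReal]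
    ring
  have e2 : CTangent.conj (F.graphVec ((I * eps) • 1) a) =
      F.AC (CTangent.conj (a, -((I * eps) • a))) := by rw [graphVec_scalar, conj_AC]
  funext u
  obtain ⟨w, rfl⟩ := F.A.surjective u
  have h1 := covDerivFun_conj (j := k) (xi := F.graphVec ((I * eps) • 1) a) hda (F.A w)
  rw [e1, e2, F.covDerivFun_pull k (hdc.const_mul _), pull_A] at h1
  have h2 : cderiv (CTangent.conj (a, -((I * eps) • a))) (fun w => (F.jac : ℂ)⁻¹ * conj (th w)) w =
      (F.jac : ℂ)⁻¹ * conj (-(2 * Real.pi * F.lev k * eps * (toC w.1 ⬝ᵥ a)) * th w) := by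
    rw [← cderiv_thetaFn hK he, ← cderiv_conj hd, cderiv, cderiv, fderiv_const_mul (hdc w)]
    simp only [_root_.smul_apply, smul_eq_mul]
    ring
  have h3 : toC w.1 ⬝ᵥ (CTangent.conj (a, -((I * eps) • a))).2 =
      I * eps * conj (toC w.1 ⬝ᵥ a) := by
    simp only [dotProduct, CTangent.conj, map_sum, Finset.mul_sum]
    refine Finset.sum_congr rfl fun i _ => ?_
    simp [toC]
    ring
  rw [h2, h3] at h1
  have h4 : conj (covDerivFun k (F.graphVec ((I * eps) • 1) a) (F.approxFun k S eps) (F.A w)) = 0 := by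
    rw [← h1]
    simp only [map_mul, map_neg, conj_ofReal, map_natCast, map_ofNat]
    linear_combination (-(phase (F.lev k) w * 2 * Real.pi * F.lev k * eps * (F.jac : ℂ)⁻¹ *
      conj (toC w.1 ⬝ᵥ a) * conj (th w))) * I_mul_I
  simpa using h4

lemma ev_approx {k : ℕ} {S : DistSec g k} {eps : ℝ} (hm : F.approxFun k S eps ∈ Sec g k)
    {f : Cover g → ℂ} (hf : IsTest f) :
    ev (smoothDist ⟨_, hm⟩) (F.pull k f) =
      ∫ w, f w * thetaFn (F.lev k) eps (F.coeff S 0) w := by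
  rw [ev_smoothDist _ (F.isTest_pull k hf), F.integral_comp_frame, ← integral_const_mul]
  congr 1
  funext w
  have h1 := phase_ne_zero (F.lev k) w
  have h2 : (F.jac : ℂ) ≠ 0 := by exact_mod_cast F.jac_pos.ne'
  rw [pull_A]
  simp only [approxFun, ContinuousLinearEquiv.symm_apply_apply]
  field_simp

/-- The sections over the open disc that approximate a parallel distribution. -/
def approx {k : ℕ} (hk : 0 < k) {S : DistSec g k} (h : F.GraphParallel S 0) (eps : Ioi (0 : ℝ)) :
    Sec g k := ⟨F.approxFun k S eps, h.approxFun_mem hk eps.2⟩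

lemma approx_mem {k : ℕ} (hk : 0 < k) {S : DistSec g k} (h : F.GraphParallel S 0)
    (eps : Ioi (0 : ℝ)) :
    F.approx hk h eps ∈ smoothQuantumSpace k (F.discPoint ((I * (eps : ℝ)) • 1)) := by
  intro xi hxi
  obtain ⟨a, ha⟩ := F.exists_graphVec_of_discPoint (F.det_alphaMatrix (im_scalar_pos eps.2))
    (xi := CTangent.conj xi) (by rwa [CTangent.conj_conj])
  rw [← ha]
  exact Subtype.ext (F.approxFun_covDerivFun hk S eps.2 a)

/-- As ε tends to 0 the integral against the theta function tends to the series with all Gaussians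
equal to 1, and that is the expansion of `S` itself. -/
lemma tendsto_approx {k : ℕ} (hk : 0 < k) {S : DistSec g k} (h : F.GraphParallel S 0) :
    Tendsto (fun eps => smoothDist (F.approx hk h eps)) (comap Subtype.val (𝓝[>] 0)) (𝓝 S) := by
  rw [nhds_induced, tendsto_comap_iff, tendsto_pi_nhds]
  intro phi
  obtain ⟨r, hr, h1⟩ := exists_partition g
  have hf : IsTest fun u => r u * phi.1 u := hr.mul_right phi.2.1
  have hu := F.isTest_unpull k hf
  have key (T : DistSec g k) : T phi = ev T (F.pull k (F.unpull k fun u => r u * phi.1 u)) := by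
    rw [pull_unpull]
    exact apply_eq_ev T hr h1 phi
  have h2 := hasSum_coeff hk h.isSymm h.parallel hu
  simp only [gaussian_zero, mul_one] at h2
  have h3 := tendsto_integral_thetaFn (F.lev_pos hk) (coeff_periodic hk h.isSymm h.parallel) hu
  rw [h2.tsum_eq, ← key] at h3
  have h4 := h3.comp (tendsto_comap (f := (Subtype.val : Ioi (0 : ℝ) → ℝ)))
  refine h4.congr fun eps => ?_
  rw [Function.comp_apply, Function.comp_apply, key (smoothDist _)]
  exact (F.ev_approx (F.approx hk h eps).2 hu).symm

lemma tendsto_scalar : Tendsto (fun eps : Ioi (0 : ℝ) => F.discPoint ((I * (eps : ℝ)) • 1))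
    (comap Subtype.val (𝓝[>] 0)) (𝓝 t) := by
  refine F.tendsto_discPoint.comp ?_
  have h1 : Continuous fun eps : ℝ => ((I * eps) • 1 : Matrix (Fin g) (Fin g) ℂ) := by fun_prop
  have h2 := (h1.tendsto 0).mono_left (nhdsWithin_le_nhds (s := Ioi (0 : ℝ)))
  simp only [ofReal_zero, mul_zero, zero_smul] at h2
  exact h2.comp tendsto_comap

end Frame

/-- Theta functions at the disc points with Z = iε, in the frame and in the swapped frame, approach
the given pair in base points and sections at once. Without them the extension by continuity would
be vacuous. -/
lemma neBot_bksFilter {t t' : Matrix (Fin g) (Fin g) ℂ} (F : Frame t t') {k : ℕ} (hk : 0 < k)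
    {S S' : DistSec g k} (h : F.GraphParallel S 0) (h' : F.swap.GraphParallel S' 0) :
    (bksFilter k t t' S S').NeBot := by
  have hb : (comap (Subtype.val : Ioi (0 : ℝ) → ℝ) (𝓝[>] 0)).NeBot := by
    refine comap_neBot fun s hs => ?_
    obtain ⟨r, hr, hr0⟩ := Filter.nonempty_of_mem (inter_mem hs self_mem_nhdsWithin)
    exact ⟨⟨r, hr0⟩, hr⟩
  let P (eps : Ioi (0 : ℝ)) : InteriorPair g k :=
    { t := F.discPoint ((I * (eps : ℝ)) • 1)
      t' := F.swap.discPoint ((I * (eps : ℝ)) • 1)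
      s := F.approx hk h eps
      s' := F.swap.approx hk h' eps
      t_mem := F.discPoint_mem (isSymm_scalar _) (Frame.im_scalar_pos eps.2)
      t'_mem := F.swap.discPoint_mem (isSymm_scalar _) (Frame.im_scalar_pos eps.2)
      s_mem := F.approx_mem hk h eps
      s'_mem := F.swap.approx_mem hk h' eps }
  have hP : Tendsto P (comap Subtype.val (𝓝[>] 0)) (bksFilter k t t' S S') :=
    tendsto_comap_iff.2 (F.tendsto_scalar.prodMk_nhds (F.swap.tendsto_scalar.prodMk_nhds
      ((F.tendsto_approx hk h).prodMk_nhds (F.swap.tendsto_approx hk h'))))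
  exact hP.neBot

/-! ### Wave front sets of parallel distributions -/

lemma dotC_smul (r : ℝ) (eta : Cover g) (xi : CTangent g) : dotC (r • eta) xi = r * dotC eta xi := by
  simp only [dotC, dotR_comm _ (r • eta), dotR_smul_left, dotR_comm eta]
  push_cast
  ring

lemma continuous_dotC (xi : CTangent g) : Continuous fun eta : Cover g => dotC eta xi := by
  have h (u : Cover g) : Continuous fun eta : Cover g => ((dotR u eta : ℝ) : ℂ) := by
    simp only [dotR_comm u]
    exact continuous_ofReal.comp (dotCLM u).continuous
  exact (h _).add (continuous_const.mul (h _))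

lemma exists_bump (u : Cover g) : ∃ f : TestFn g, f.1 =ᶠ[𝓝 u] 1 := by
  obtain ⟨b, hb, -, hb1⟩ := exists_isTest_one (isCompact_closedBall u 1)
  refine ⟨⟨_, hb⟩, ?_⟩
  filter_upwards [Metric.closedBall_mem_nhds u one_pos] with v hv
  simp [hb1 v hv]

/-- The pairing with `xi` stays away from zero near `eta` and scales linearly along rays, so
`exists_decay` gives rapid decrease in a conic neighbourhood. -/
lemma IsParallel.notMem_waveFrontSet {j : ℤ} {T : DistSec g j} {xi : CTangent g}
    (h : IsParallel T xi) {eta : Cover g} (hne : dotC eta xi ≠ 0) (u : Cover g) :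
    (u, eta) ∉ waveFrontSet T := by
  rintro ⟨-, hn⟩
  obtain ⟨f, hf1⟩ := exists_bump u
  have hf : IsTest f.1 := f.2
  have hB : IsCompact (tsupport f.1) := hf.2
  refine hn ⟨f, by simp [hf1.eq_of_nhds], ?_⟩
  obtain ⟨N, C, hT⟩ := exists_evBound T hB
  set a : ℝ := ‖dotC eta xi‖ / 2 with ha
  have ha0 : 0 < a := half_pos (norm_pos_iff.2 hne)
  refine ⟨{z | ‖z‖ < ‖eta‖ + 1} ∩ {z | a < ‖dotC z xi‖}, inter_mem ?_ ?_, fun m => ?_⟩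
  · exact (continuous_norm.tendsto eta).eventually (gt_mem_nhds (lt_add_one _))
  · exact ((continuous_dotC xi).norm.tendsto eta).eventually
      (lt_mem_nhds (half_lt_self (norm_pos_iff.2 hne)))
  -- The extra N integrations by parts compensate the growth (1 + ‖η‖)^N of the estimate.
  · obtain ⟨D, hD, hdec⟩ := exists_decay j hB N C ‖xi‖ (m + N)
    obtain ⟨M, hM⟩ := hf.exists_ckBound (N + (m + N))
    refine ⟨D * M * (2 + ‖eta‖) ^ N / a ^ (m + N), fun z hz r hr => ?_⟩
    have hr0 : 0 < r := one_pos.trans_le hr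
    have hM0 := hM.nonneg
    have h1 := hdec T xi f.1 M (r • z) hT le_rfl h hf subset_rfl hM
    rw [← distFourier_eq] at h1
    have h2 : r * a ≤ ‖dotC (r • z) xi‖ := by
      rw [dotC_smul, norm_mul, norm_real, Real.norm_of_nonneg hr0.le]
      exact mul_le_mul_of_nonneg_left hz.2.le hr0.le
    have h3 : 1 + ‖r • z‖ ≤ r * (2 + ‖eta‖) := by
      rw [norm_smul, Real.norm_of_nonneg hr0.le]
      nlinarith [show ‖z‖ < ‖eta‖ + 1 from hz.1]
    have h4 : (r * a) ^ (m + N) * ‖distFourier T f (r • z)‖ ≤ D * M * (r * (2 + ‖eta‖)) ^ N := by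
      refine le_trans ?_ (h1.trans ?_)
      · exact mul_le_mul_of_nonneg_right (pow_le_pow_left₀ (mul_pos hr0 ha0).le h2 _) (norm_nonneg _)
      · exact mul_le_mul_of_nonneg_left (pow_le_pow_left₀ (by positivity) h3 _) (mul_nonneg hD hM0)
    rw [le_div_iff₀ (pow_pos ha0 _)]
    refine le_of_mul_le_mul_left ?_ (pow_pos hr0 N)
    calc r ^ N * (r ^ m * ‖distFourier T f (r • z)‖ * a ^ (m + N))
        = (r * a) ^ (m + N) * ‖distFourier T f (r • z)‖ := by rw [mul_pow, pow_add r]; ring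
      _ ≤ _ := h4
      _ = r ^ N * (D * M * (2 + ‖eta‖) ^ N) := by rw [mul_pow]; ring

/-! ### Bohr–Sommerfeld leaves -/

/-- Leaves are isotropic, so along a path γ in the leaf of u the transport equation integrates
explicitly: ζ exp(k π i ω(γ, u)) is constant. The holonomy around λ then depends only on ω(u, λ). -/
lemma proj_mem_bohrSommerfeld {k : ℕ} {t : Matrix (Fin g) (Fin g) ℂ} (hs : t.IsSymm) {u : Cover g}
    (h : ∀ l : Lattice g, latt l ∈ realPart t →
      exp (2 * Real.pi * I * k * omega u (latt l)) = (-1) ^ ((k : ℤ) * ∑ i, l.1 i * l.2 i)) :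
    proj u ∈ bohrSommerfeld k t := by
  refine ⟨u, fun gam zeta l hgam hleaf hl hz => ?_, u, ?_, rfl⟩
  · have hV (r : ℝ) : gam r - u ∈ realPart t := hleaf r
    have hlV : latt l ∈ realPart t := by
      have : latt l = gam 1 - u - (gam 0 - u) := by rw [hl]; abel
      rw [this]
      exact sub_mem (hV 1) (hV 0)
    have hg (r : ℝ) : HasDerivAt gam (deriv gam r) r :=
      (hgam.differentiable (by simp) r).hasDerivAt
    have hom (v : Cover g) (r : ℝ) : HasDerivAt (fun r => omega (gam r) v) (omega (deriv gam r) v) r :=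
      (omegaCLM v).hasFDerivAt.comp_hasDerivAt r (hg r)
    -- Isotropy makes ω(γ(s), γ(r) - u) independent of s; its derivative vanishes, which allows γ to
    -- be replaced by u.
    have h0 (r : ℝ) : omega (gam r) (deriv gam r) = -omega (deriv gam r) u := by
      have h1 := hom (gam r - u) r
      have h2 : (fun s => omega (gam s) (gam r - u)) = fun _ => omega u (gam r - u) := by
        funext s
        have h3 := omega_of_mem_realPart hs (hV s) (hV r)
        have h4 := omega_add_left (gam s - u) u (gam r - u)
        rw [sub_add_cancel, h3, zero_add] at h4
        exact h4
      rw [h2] at h1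
      have h3 := h1.unique (hasDerivAt_const r _)
      have h4 := omega_add_right (deriv gam r) (gam r - u) u
      rw [sub_add_cancel, h3, zero_add] at h4
      rw [omega_antisymm, h4]
    have h5 (r : ℝ) : HasDerivAt (fun r => zeta r *
        exp (k * Real.pi * I * ((omega (gam r) u : ℝ) : ℂ))) 0 r := by
      have h6 := (hz r).fun_mul (((hom u r).ofReal_comp.const_mul (k * Real.pi * I : ℂ)).cexp)
      refine h6.congr_deriv ?_
      rw [h0]
      push_cast
      ring
    have h6 := is_const_of_deriv_eq_zero (fun r => (h5 r).differentiableAt) (fun r => (h5 r).deriv) 1 0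
    have h7 : omega (gam 1) u = omega (gam 0) u - omega u (latt l) := by
      rw [hl, omega_add_left, omega_antisymm (latt l)]
      ring
    have h8 : omega (gam 0) (latt l) = omega u (latt l) := by
      have h9 := omega_add_left (gam 0 - u) u (latt l)
      rwa [sub_add_cancel, omega_of_mem_realPart hs (hV 0) hlV, zero_add] at h9
    rw [mult, h8, ← h l hlV, ← exp_add]
    simp only [h7] at h6
    have h9 : exp (k * Real.pi * I * ((omega (gam 0) u - omega u (latt l) : ℝ) : ℂ)) =
        exp (k * Real.pi * I * ((omega (gam 0) u : ℝ) : ℂ)) *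
          exp (-(k * Real.pi * I * ((omega u (latt l) : ℝ) : ℂ))) := by
      rw [← exp_add]
      congr 1
      push_cast
      ring
    have h10 : exp (2 * Real.pi * I * k * omega u (latt l) + -(Real.pi * I * (k : ℤ) * omega u (latt l))) =
        exp (k * Real.pi * I * ((omega u (latt l) : ℝ) : ℂ)) := by
      congr 1
      push_cast
      ring
    have h11 : exp (k * Real.pi * I * ((omega u (latt l) : ℝ) : ℂ)) *
        exp (-(k * Real.pi * I * ((omega u (latt l) : ℝ) : ℂ))) = 1 := by
      rw [← exp_add, add_neg_cancel, exp_zero]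
    rw [h10]
    rw [h9] at h6
    have h12 := exp_ne_zero (k * Real.pi * I * ((omega (gam 0) u : ℝ) : ℂ))
    refine mul_right_cancel₀ h12 ?_
    linear_combination exp (k * Real.pi * I * ((omega u (latt l) : ℝ) : ℂ)) * h6 -
      zeta 1 * exp (k * Real.pi * I * ((omega (gam 0) u : ℝ) : ℂ)) * h11
  · change toCTangent (u - u) ∈ pol t
    rw [sub_self, toCTangent_zero]
    exact zero_mem _

lemma isOpenMap_proj : IsOpenMap (proj : Cover g → Torus g) := by
  have h : IsOpenMap fun x : Fin g → ℝ => fun i => (x i : UnitAddCircle) :=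
    IsOpenMap.piMap (fun _ => QuotientAddGroup.isOpenMap_coe) (by
      exact (Set.finite_univ.subset (subset_univ _)))
  exact h.prodMap h

/-- Off the Bohr–Sommerfeld set some holonomy defect `H` is nonzero near the point. `H` is
lattice-periodic, so a test section φ supported nearby is H times φ/H, on which `w` vanishes. -/
lemma distSupport_subset_bohrSommerfeld {k : ℕ} {t : Matrix (Fin g) (Fin g) ℂ} (hs : t.IsSymm)
    {w : DistSec g 0} (hw : ∀ l : Lattice g, latt l ∈ realPart t → ∀ f : Cover g → ℂ, IsTest f →
      ev w (fun u => (exp (2 * Real.pi * I * k * omega u (latt l)) -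
        (-1) ^ ((k : ℤ) * ∑ i, l.1 i * l.2 i)) * f u) = 0) :
    distSupport w ⊆ bohrSommerfeld k t := by
  intro p hp
  obtain ⟨u, rfl⟩ : ∃ u, proj u = p := by
    choose x hx using fun i => QuotientAddGroup.mk_surjective (p.1 i)
    choose y hy using fun i => QuotientAddGroup.mk_surjective (p.2 i)
    exact ⟨(x, y), Prod.ext (funext hx) (funext hy)⟩
  by_contra hu
  obtain ⟨l, hl, hne⟩ : ∃ l : Lattice g, latt l ∈ realPart t ∧
      exp (2 * Real.pi * I * k * omega u (latt l)) ≠ (-1) ^ ((k : ℤ) * ∑ i, l.1 i * l.2 i) := by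
    by_contra! h
    exact hu (proj_mem_bohrSommerfeld hs h)
  set H : Cover g → ℂ := fun u => exp (2 * Real.pi * I * k * omega u (latt l)) -
    (-1) ^ ((k : ℤ) * ∑ i, l.1 i * l.2 i) with hH
  have hHs : ContDiff ℝ ∞ H := (contDiff_const.mul (contDiff_omega_left' (latt l))).cexp.sub contDiff_const
  have hHp (v : Cover g) (m : Lattice g) : H (v + latt m) = H v := by
    simp only [hH]
    congr 1
    rw [omega_add_left, omega_latt, exp_eq_exp_iff_exists_int]
    refine ⟨k * omegaZ m l, ?_⟩
    push_cast
    ring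
  have hu0 : 0 < ‖H u‖ := norm_pos_iff.2 (sub_ne_zero.2 hne)
  have hO : proj '' {v | ‖H u‖ / 2 < ‖H v‖} ∈ 𝓝 (proj u) :=
    (isOpenMap_proj _ (isOpen_lt continuous_const hHs.continuous.norm)).mem_nhds
      ⟨u, half_lt_self hu0, rfl⟩
  obtain ⟨phi, hphi, hwphi⟩ := hp _ hO
  have hphi' (v) (hv : phi.1 v ≠ 0) : ‖H u‖ / 2 < ‖H v‖ := by
    obtain ⟨x, hx, hxv⟩ := hphi v hv
    obtain ⟨m, rfl⟩ := proj_eq_iff.1 hxv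
    rwa [hHp]
  -- At zeros of `H` the quotient is identically 0 nearby, because `phi` is supported where |H| is
  -- bounded below.
  have hpsi : ContDiff ℝ ∞ fun v => phi.1 v / H v := by
    refine contDiff_iff_contDiffAt.2 fun v => ?_
    by_cases hv : H v = 0
    · have : (fun v => phi.1 v / H v) =ᶠ[𝓝 v] fun _ => 0 := by
        have h1 : ∀ᶠ x in 𝓝 v, ‖H x‖ < ‖H u‖ / 2 :=
          (hHs.continuous.norm.tendsto v).eventually (gt_mem_nhds (by rw [hv, norm_zero]; exact half_pos hu0))
        filter_upwards [h1] with x hx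
        have : phi.1 x = 0 := by
          by_contra h
          exact (hphi' x h).not_gt hx
        rw [this, zero_div]
      exact contDiffAt_const.congr_of_eventuallyEq this
    · simp only [div_eq_mul_inv]
      exact phi.2.1.contDiffAt.mul (hHs.contDiffAt.inv hv)
  obtain ⟨r, hr, hr1⟩ := exists_partition g
  have h2 := hw l hl (fun v => r v * (phi.1 v / H v)) (hr.mul_right hpsi)
  refine hwphi ?_
  rw [apply_eq_ev w hr hr1 phi, ← h2]
  congr 1
  funext v
  by_cases hv : phi.1 v = 0
  · simp [hv]
  · have : H v ≠ 0 := fun h => by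
      have := hphi' v hv
      rw [h, norm_zero] at this
      linarith
    change _ = H v * _
    field_simp

/-! ### The product as a limit of products over the open disc -/

/-- The function `s s̄'` on the torus. -/
def prodSec {k : ℕ} (s s' : Sec g k) : Sec g 0 :=
  ⟨fun u => s.1 u * conj (s'.1 u), s.2.1.mul (conjCLE.contDiff.comp s'.2.1), fun l u => by
    have h1 : mult (k : ℤ) l u * mult (-(k : ℤ)) l u = 1 := by
      rw [← mult_inv, mul_inv_cancel₀ (mult_ne_zero _ l u)]
    simp only [s.2.2 l u, s'.2.2 l u, map_mul, conj_mult, mult_zero]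
    linear_combination s.1 u * conj (s'.1 u) * h1⟩

lemma continuous_distConj {j : ℤ} : Continuous (distConj : DistSec g j → DistSec g (-j)) :=
  continuous_induced_rng.2 (continuous_pi fun _ => continuous_conj.comp
    ((continuous_apply _).comp continuous_induced_dom))

lemma pairing_smoothDist {k : ℕ} (s s' : Sec g k) {f f' : Cover g → ℂ} (hf : IsTest f)
    (hf' : IsTest f') : pairing (smoothDist s) (distConj (smoothDist s')) f f' =
      ev (smoothDist (prodSec s s')) fun u => f u * f' u := by
  rw [pairing_eq_integral s (b := fun u => conj (s'.1 u)) (conjCLE.contDiff.comp s'.2.1)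
    (fun h hh => ?_) hf hf', ev_smoothDist _ (hf.mul_right hf'.1)]
  · congr 1
    funext u
    simp only [prodSec]
    ring
  · rw [ev_distConj _ hh, ev_smoothDist _ hh.conj, ← integral_conj]
    congr 1
    funext u
    simp

section

variable {t t' : Matrix (Fin g) (Fin g) ℂ} {k : ℕ} {S S' : DistSec g k}

lemma tendsto_bks_left : Tendsto (fun p : InteriorPair g k => smoothDist p.s)
    (bksFilter k t t' S S') (𝓝 S) :=
  ((continuous_fst.comp (continuous_snd.comp continuous_snd)).tendsto (t, t', S, S')).comp
    tendsto_comap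

lemma tendsto_bks_right : Tendsto (fun p : InteriorPair g k => smoothDist p.s')
    (bksFilter k t t' S S') (𝓝 S') :=
  ((continuous_snd.comp (continuous_snd.comp continuous_snd)).tendsto (t, t', S, S')).comp
    tendsto_comap

lemma tendsto_bks_base : Tendsto (fun p : InteriorPair g k => (p.t, p.t'))
    (bksFilter k t t' S S') (𝓝[siegelDisc g ×ˢ siegelDisc g] (t, t')) := by
  refine tendsto_nhdsWithin_iff.2 ⟨?_, Eventually.of_forall fun p => ⟨p.t_mem, p.t'_mem⟩⟩
  exact ((continuous_fst.prodMk (continuous_fst.comp continuous_snd)).tendsto (t, t', S, S')).comp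
    tendsto_comap

/-- The boundary pair satisfies the same estimates as its interior neighbours, being the case Z = Z'
= 0. -/
lemma eventually_transverse_bks [Nonempty (Fin g)] (F : Frame t t') (hk : 0 < k)
    (h : F.GraphParallel S 0) (h' : F.swap.GraphParallel S' 0)
    {B : Set (Cover g)} (hB : IsCompact B) : ∃ N C R c, 0 < c ∧
    Transverse S (distConj S') B N C R c ∧ ∀ᶠ p in bksFilter k t t' S S',
      Transverse (smoothDist p.s) (distConj (smoothDist p.s')) B N C R c := by
  obtain ⟨N, C, R, c, hc, d, hd, hT⟩ := F.eventually_transverse hk S S' hB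
  refine ⟨N, C, R, c, hc, hT.self_of_nhds 0 0 (by simp [hd.le]) (by simp [hd.le]) h h', ?_⟩
  have hb := (tendsto_bks_base (t := t) (t' := t') (S := S) (S' := S')).mono_right nhdsWithin_le_nhds
  have h1 := ((continuous_fst.tendsto (t, t')).comp hb).eventually (F.eventually_graphParallel k hd)
  have h2 := ((continuous_snd.tendsto (t, t')).comp hb).eventually
    (F.swap.eventually_graphParallel k hd)
  filter_upwards [h1, h2, (tendsto_bks_left.prodMk_nhds tendsto_bks_right).eventually hT]
    with p hp hp' hpT
  obtain ⟨Z, hZ, hpZ⟩ := hp p.t_mem p.s p.s_mem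
  obtain ⟨Z', hZ', hpZ'⟩ := hp' p.t'_mem p.s' p.s'_mem
  exact hpT Z Z' hZ hZ' hpZ hpZ'

lemma ckBound_of_sec_zero {K : ℕ} {M : ℝ} {phi : Cover g → ℂ} (hphi : phi ∈ Sec g (-0))
    (hM : ∀ n ≤ K, ∀ u ∈ Icc (0 : Cover g) 1, ‖iteratedFDeriv ℝ n phi u‖ ≤ M) : CkBound K M phi := by
  intro n hn u
  obtain ⟨l, hl, -⟩ := (coverTiling g).existsUnique u
  have h1 : (fun z => phi (z + latt (-l))) = phi := by
    funext z
    rw [hphi.2, neg_zero, mult_zero, one_mul]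
  have h2 := hM n hn _ ((coverTiling g).subset hl)
  have h3 : u - (coverTiling g).e l = u + latt (-l) := by
    rw [← coverTiling_e, map_neg, sub_eq_add_neg]
  rw [h3, ← iteratedFDeriv_comp_add_right, h1] at h2
  exact h2

/-- The pairings of localized sections converge. -/
lemma tendsto_ev_prodSec [Nonempty (Fin g)] (F : Frame t t') (hk : 0 < k)
    (h : F.GraphParallel S 0) (h' : F.swap.GraphParallel S' 0)
    {f f' : Cover g → ℂ} (hf : IsTest f) (hf' : IsTest f') :
    Tendsto (fun p : InteriorPair g k => ev (smoothDist (prodSec p.s p.s')) fun u => f u * f' u)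
      (bksFilter k t t' S S') (𝓝 (pairing S (distConj S') f f')) := by
  have := neBot_bksFilter F hk h h'
  obtain ⟨N, C, R, c, hc, -, hT⟩ := eventually_transverse_bks F hk h h'
    (hf.2.isCompact.union hf'.2.isCompact)
  refine (tendsto_pairing tendsto_bks_left
    ((continuous_distConj.tendsto S').comp tendsto_bks_right) (hf.2.isCompact.union hf'.2.isCompact)
    hc hT hf subset_union_left hf' subset_union_right).congr fun p => ?_
  exact pairing_smoothDist p.s p.s' hf hf'

/-- Define w(φ) as the Fourier pairing with test functions r φ and b', where r is a lattice
partition of unity and b' = 1 on its support. Linearity, and the formula for arbitrary f and f', are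
inherited from the smooth products by uniqueness of limits; continuity comes from
`exists_norm_pairing_le`. -/
lemma exists_product [Nonempty (Fin g)] (F : Frame t t') (hk : 0 < k)
    (h : F.GraphParallel S 0) (h' : F.swap.GraphParallel S' 0) : ∃ w : DistSec g 0,
    Tendsto (fun p : InteriorPair g k => smoothDist (prodSec p.s p.s')) (bksFilter k t t' S S') (𝓝 w) ∧
    ∀ f f' : Cover g → ℂ, IsTest f → IsTest f' →
      ev w (fun u => f u * f' u) = pairing S (distConj S') f f' := by
  have := neBot_bksFilter F hk h h'
  obtain ⟨r, hr, hr1⟩ := exists_partition g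
  obtain ⟨b, hb, -, hb1⟩ := exists_isTest_one hr.2.isCompact
  set b' : Cover g → ℂ := fun u => (b u : ℂ) with hb'
  have hrb (phi : Cover g → ℂ) : (fun u => r u * phi u * b' u) = fun u => r u * phi u := by
    funext u
    by_cases hu : u ∈ tsupport r
    · simp [hb', hb1 u hu]
    · simp [image_eq_zero_of_notMem_tsupport hu]
  have hlim (phi : Sec g (-0)) : Tendsto (fun p : InteriorPair g k => smoothDist (prodSec p.s p.s') phi)
      (bksFilter k t t' S S') (𝓝 (pairing S (distConj S') (fun u => r u * phi.1 u) b')) := by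
    refine (tendsto_ev_prodSec F hk h h' (hr.mul_right phi.2.1) hb).congr fun p => ?_
    rw [apply_eq_ev _ hr hr1 phi, ← hrb phi.1]
  obtain ⟨N, C, R, c, hc, hTS, -⟩ := eventually_transverse_bks F hk h h'
    (hr.2.isCompact.union hb.2.isCompact)
  obtain ⟨K, D, hD, hbound⟩ := exists_norm_pairing_le (k : ℤ) (-(k : ℤ))
    (hr.2.isCompact.union hb.2.isCompact) N C R hc
  obtain ⟨Mb, hMb⟩ := hb.exists_ckBound K
  obtain ⟨E, hE, hrE⟩ : ∃ E : ℝ, 0 ≤ E ∧ ∀ (phi : Sec g (-0)) (M : ℝ),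
      (∀ n ≤ K, ∀ u ∈ Icc (0 : Cover g) 1, ‖iteratedFDeriv ℝ n (phi : Cover g → ℂ) u‖ ≤ M) →
      CkBound K (E * M) fun u => r u * phi.1 u := by
    obtain ⟨Mr, hMr⟩ := hr.exists_ckBound K
    have := hMr.nonneg
    refine ⟨2 ^ K * Mr, by positivity, fun phi M hM => ?_⟩
    have h1 := ckBound_of_sec_zero phi.2 hM
    have h2 := hMr.mul (B := univ) hr.1 phi.2.1 (subset_univ _) (fun n hn u _ => h1 n hn u) h1.nonneg
    have e : (fun u => phi.1 u * r u) = fun u => r u * phi.1 u := funext fun u => mul_comm _ _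
    rw [e] at h2
    exact h2.mono le_rfl (le_of_eq (by ring))
  let w : DistSec g 0 :=
    ⟨{ toFun := fun phi => pairing S (distConj S') (fun u => r u * phi.1 u) b'
       map_add' := fun phi psi => by
         refine tendsto_nhds_unique (hlim (phi + psi)) ?_
         simp only [map_add]
         exact (hlim phi).add (hlim psi)
       map_smul' := fun a phi => by
         refine tendsto_nhds_unique (hlim (a • phi)) ?_
         simp only [map_smul]
         exact (hlim phi).const_smul a },
      K, D * E * Mb, fun phi M hM => by
        have h1 := hbound S (distConj S') _ b' _ Mb hTS (hr.mul_right phi.2.1)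
          ((tsupport_mul_subset_left (f := r) (g := phi.1)).trans subset_union_left) (hrE phi M hM)
          hb subset_union_right hMb
        exact h1.trans (le_of_eq (by ring))⟩
  have hw : Tendsto (fun p : InteriorPair g k => smoothDist (prodSec p.s p.s'))
      (bksFilter k t t' S S') (𝓝 w) := by
    rw [nhds_induced, tendsto_comap_iff, tendsto_pi_nhds]
    exact hlim
  exact ⟨w, hw, fun f f' hf hf' => tendsto_nhds_unique
    (((continuous_ev _).tendsto w).comp hw) (tendsto_ev_prodSec F hk h h' hf hf')⟩

/-- Transversality at ξ removes (u, ξ) from the first wave front set or (u, -ξ) from the second. The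
convolution at ξ is the pairing with the second cutoff modulated by ξ, to which the hypothesis on
`w` applies. -/
lemma isProduct_of_ev [Nonempty (Fin g)] (F : Frame t t') (hk : 0 < k)
    (h : F.GraphParallel S 0) (h' : F.swap.GraphParallel S' 0)
    {w : DistSec g 0} (hw : ∀ f f' : Cover g → ℂ, IsTest f → IsTest f' →
      ev w (fun u => f u * f' u) = pairing S (distConj S') f f') :
    IsProduct S (distConj S') w := by
  refine ⟨fun u xi h1 h2 => ?_, fun u => ?_⟩
  · obtain ⟨N, C, R, c, hc, hT, -⟩ := eventually_transverse_bks F hk h h' (isCompact_singleton (x := u))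
    have hxi : 0 < c * ‖xi‖ := mul_pos hc (norm_pos_iff.2 h1.1)
    obtain ⟨z, -, hz, hz'⟩ | ⟨z, -, hz, hz'⟩ := hT.detect xi
    · exact hz.notMem_waveFrontSet (norm_pos_iff.1 (hxi.trans_le hz')) u h1
    · refine hz.notMem_waveFrontSet (eta := -xi) ?_ u h2
      rw [dotC_neg]
      exact neg_ne_zero.2 (norm_pos_iff.1 (hxi.trans_le hz'))
  · obtain ⟨f, hf1⟩ := exists_bump u
    have hf : IsTest f.1 := f.2
    refine ⟨f, hf1, fun xi => ?_⟩
    obtain ⟨N, C, R, c, hc, hT, -⟩ := eventually_transverse_bks F hk h h' hf.2.isCompact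
    have e : (fun eta => distFourier S f eta * distFourier (distConj S') f (xi - eta)) = fun eta =>
        ev S (fun u => f.1 u * chr eta u) *
          ev (distConj S') (fun u => f.1 u * chr xi u * chr (-eta) u) := by
      funext eta
      rw [distFourier_eq, distFourier_eq]
      congr 2
      funext u
      rw [sub_eq_add_neg, chr_add, mul_assoc]
    rw [e]
    refine ⟨hT.integrable hf.2.isCompact hc hf subset_rfl (hf.mul_chr xi)
      (tsupport_mul_subset_left (f := f.1) (g := chr xi)), ?_⟩
    rw [distFourier_eq]
    refine Eq.trans ?_ (hw f.1 _ hf (hf.mul_chr xi))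
    congr 1
    funext u
    simp only [testSq, mul_assoc]

lemma Frame.exists_apply_eq_latt (F : Frame t t') {l : Lattice g} (hl : latt l ∈ realPart t)
    (hdis : Disjoint (realPart t) (realPart t')) : ∃ v, F.A (v, 0) = latt l := by
  set u := F.A.symm (latt l) with hu
  have h1 : F.A (u.1, 0) + F.A (0, u.2) = latt l := by
    rw [← map_add, Prod.mk_add_mk, add_zero, zero_add]
    simp [hu]
  have h2 : F.A (0, u.2) = 0 := by
    refine Submodule.disjoint_def.1 hdis _ ?_ (F.mem_right _ rfl)
    rw [← eq_sub_iff_add_eq'] at h1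
    rw [h1]
    exact sub_mem hl (F.mem_left _ rfl)
  exact ⟨u.1, by rw [← h1, h2, add_zero]⟩

lemma contDiff_holonomyFactor (k : ℕ) (l : Lattice g) : ContDiff ℝ ∞ fun u : Cover g =>
    exp (2 * Real.pi * I * k * omega u (latt l)) - (-1) ^ ((k : ℤ) * ∑ i, l.1 i * l.2 i) :=
  (contDiff_const.mul (contDiff_omega_left' (latt l))).cexp.sub contDiff_const

/-- In the Fourier pairing the holonomy factor can be attached to `S`, which it annihilates at every
frequency, so the integrand is identically zero. -/
lemma ev_holonomyFactor_left (F : Frame t t') (hk : 0 < k) (h : F.GraphParallel S 0)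
    (hdis : Disjoint (realPart t) (realPart t')) {w : DistSec g 0}
    (hw : ∀ f f' : Cover g → ℂ, IsTest f → IsTest f' →
      ev w (fun u => f u * f' u) = pairing S (distConj S') f f') {l : Lattice g}
    (hl : latt l ∈ realPart t) {f : Cover g → ℂ} (hf : IsTest f) :
    ev w (fun u => (exp (2 * Real.pi * I * k * omega u (latt l)) -
        (-1) ^ ((k : ℤ) * ∑ i, l.1 i * l.2 i)) * f u) = 0 := by
  obtain ⟨b, hb, -, hb1⟩ := exists_isTest_one hf.2.isCompact
  obtain ⟨v, hv⟩ := F.exists_apply_eq_latt hl hdis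
  have e := hw _ _ (hf.mul_left (contDiff_holonomyFactor k l)) hb
  have e1 : (fun u => (exp (2 * Real.pi * I * k * omega u (latt l)) -
      (-1) ^ ((k : ℤ) * ∑ i, l.1 i * l.2 i)) * f u * (b u : ℂ)) = fun u =>
      (exp (2 * Real.pi * I * k * omega u (latt l)) -
        (-1) ^ ((k : ℤ) * ∑ i, l.1 i * l.2 i)) * f u := by
    funext u
    by_cases hu : u ∈ tsupport f
    · simp [hb1 u hu]
    · simp [image_eq_zero_of_notMem_tsupport hu]
  rw [e1] at e
  rw [e, pairing]
  refine integral_eq_zero_of_ae (ae_of_all _ fun eta => ?_)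
  have h1 := h.ev_mul_eq_zero hk hv (hf.mul_chr eta)
  simp only [mul_assoc] at h1 ⊢
  simp [h1]

lemma ev_holonomyFactor_right (F : Frame t t') (hk : 0 < k)
    (h' : F.swap.GraphParallel S' 0) (hdis : Disjoint (realPart t) (realPart t')) {w : DistSec g 0}
    (hw : ∀ f f' : Cover g → ℂ, IsTest f → IsTest f' →
      ev w (fun u => f u * f' u) = pairing S (distConj S') f f') {l : Lattice g}
    (hl : latt l ∈ realPart t') {f : Cover g → ℂ} (hf : IsTest f) :
    ev w (fun u => (exp (2 * Real.pi * I * k * omega u (latt l)) -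
        (-1) ^ ((k : ℤ) * ∑ i, l.1 i * l.2 i)) * f u) = 0 := by
  obtain ⟨b, hb, -, hb1⟩ := exists_isTest_one hf.2.isCompact
  -- Here the factor falls on the conjugate of `S'`. Conjugation inverts the exponential, so the
  -- annihilation is applied to `-l`.
  have hl' : latt (-l) = -latt l := by ext <;> simp [latt]
  obtain ⟨v, hv⟩ := F.swap.exists_apply_eq_latt (l := -l)
    (by rw [hl']; exact neg_mem hl) hdis.symm
  have e := hw _ _ hb (hf.mul_left (contDiff_holonomyFactor k l))
  have e1 : (fun u => (b u : ℂ) * ((exp (2 * Real.pi * I * k * omega u (latt l)) -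
      (-1) ^ ((k : ℤ) * ∑ i, l.1 i * l.2 i)) * f u)) = fun u =>
      (exp (2 * Real.pi * I * k * omega u (latt l)) -
        (-1) ^ ((k : ℤ) * ∑ i, l.1 i * l.2 i)) * f u := by
    funext u
    by_cases hu : u ∈ tsupport f
    · simp [hb1 u hu]
    · simp [image_eq_zero_of_notMem_tsupport hu]
  rw [e1] at e
  rw [e, pairing]
  refine integral_eq_zero_of_ae (ae_of_all _ fun eta => ?_)
  have h1 := h'.ev_mul_eq_zero hk hv (hf.mul_chr (-eta)).conj
  have e2 : (fun u => conj ((exp (2 * Real.pi * I * k * omega u (latt l)) -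
      (-1) ^ ((k : ℤ) * ∑ i, l.1 i * l.2 i)) * f u * chr (-eta) u)) = fun u =>
      (exp (2 * Real.pi * I * k * omega u (latt (-l))) -
        (-1) ^ ((k : ℤ) * ∑ i, (-l).1 i * (-l).2 i)) * conj (f u * chr (-eta) u) := by
    funext u
    have h2 : omega u (latt (-l)) = -omega u (latt l) := by
      rw [hl', ← neg_one_smul ℝ, omega_smul_right, neg_one_mul]
    have h3 : ∑ i, (-l).1 i * (-l).2 i = ∑ i, l.1 i * l.2 i := by simp
    rw [mul_assoc, map_mul, h2, h3, map_sub, ← exp_conj, map_zpow₀]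
    simp
    exact Or.inl (by rw [map_ofNat])
  have h4 := ev_distConj S' ((hf.mul_left (contDiff_holonomyFactor k l)).mul_chr (-eta))
  simp only [e2, h1, map_zero] at h4
  simp only [h4, mul_zero, Pi.zero_apply]

end

end TorusQuantization

end

/-! ### The proposition. -/

theorem mainTheorem7 (g k : ℕ) (hg : 0 < g) (hk : 0 < k)
    (t t' : Matrix (Fin g) (Fin g) ℂ)
    (ht : t ∈ closedSiegelDisc g) (ht' : t' ∈ closedSiegelDisc g)
    (hred : IsReducible t) (hred' : IsReducible t') (htrans : IsTransverse t t')
    (s s' : DistSec g k) (hs : s ∈ weakQuantumSpace k t) (hs' : s' ∈ weakQuantumSpace k t') :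
    ∃ (w : DistSec g 0) (h : ℂ),
      IsProduct s (distConj s') w ∧
      distSupport w ⊆ bohrSommerfeld k t ∩ bohrSommerfeld k t' ∧
      HasHalfFormPairing k t t' h ∧
      HasBKSPairing k t t' s s' (h * w (oneSec g)) := by
  have : Nonempty (Fin g) := ⟨⟨0, hg⟩⟩
  obtain ⟨F⟩ := Frame.exists t t' ht.1 ht'.1 hred hred' htrans
  have hS := F.graphParallel_zero hs
  have hS' := F.swap.graphParallel_zero hs'
  have hdis := (isCompl_realPart hred.1 hred'.1 htrans).disjoint
  obtain ⟨w, hw, hpair⟩ := exists_product F hk hS hS'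
  obtain ⟨h, hh⟩ := exists_hasHalfFormPairing hk ht ht' hred.1 htrans
  refine ⟨w, h, isProduct_of_ev F hk hS hS' hpair, subset_inter ?_ ?_, hh,
    neBot_bksFilter F hk hS hS', ?_⟩
  · exact distSupport_subset_bohrSommerfeld ht.1 fun l hl f hf =>
      ev_holonomyFactor_left F hk hS hdis hpair hl hf
  · exact distSupport_subset_bohrSommerfeld ht'.1 fun l hl f hf =>
      ev_holonomyFactor_right F hk hS' hdis hpair hl hf
  · have h1 : Tendsto (fun T : DistSec g 0 => T (oneSec g)) (𝓝 w) (𝓝 (w (oneSec g))) :=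
      ((continuous_apply (oneSec g)).comp continuous_induced_dom).tendsto w
    -- Both factors converge along the same filter, and at an interior pair the smooth product
    -- evaluated at 1 is the hermitian product.
    have h2 := (h1.comp hw).mul (hh.2.comp tendsto_bks_base)
    rw [mul_comm h]
    refine h2.congr fun p => ?_
    simp [InteriorPair.pairing, sectionInner, smoothDist, prodSec, oneSec]
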